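/- Let $\beta\ge 2$ be an even integer. **Setting.** Let $f_N(u)=f(u)+\frac1N h(u)$, $N=1,2,\dots$ (the case $h=0$, $f_N=f$, is included; any further parameter $x$ is fixed and suppressed). Assume that $e^{f}$ and $e^{h}$, hence $e^{Nf_N}$, are analytic in the complex plane except possibly at the points of a finite set $P$ (e.g. one pole or none), and put $$R_{N,\beta}=\int_{-\infty}^{\infty}\!du_1\cdots\int_{-\infty}^{\infty}\!du_\beta\ \prod_{i=1}^{\beta}e^{Nf_N(u_i)}\prod_{1\le j<k\le\beta}|u_j-u_k|^{4/\beta},$$ where the integral is assumed to converge absolutely for at least one $N\ge1$. Let $u_\pm\in\mathbb C$, $\Re u_-<\Re u_+$, be two points at which $f$ and $h$ are analytic and which are simple saddle points of $f$: $$f'(u_\pm)=0,\qquad f''(u_\pm)=R\,e^{\mathrm i\phi_\pm},\qquad R>0,$$ with the same $R$ for both, and let $\theta_\pm\in(-\pi,\pi]$, $\theta_\pm\equiv(\pi-\phi_\pm)/2 \pmod \pi$, be angles of steepest descent. Assume that the real line can be deformed into a descent contour through both saddle points; that is, there is a $C^1$ curve $\gamma:\mathbb R\to\mathbb C\setminus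 P$ such that 1. $\gamma(t)=t$ for $|t|$ large, and there is $c<\Re f(u_+)$ with $\Re f(t)\le c$ for all real $t$ with $|t|$ large; 2. $\gamma(t)-\gamma(s)\notin(-\infty,0]$ for all $s<t$; 3. each $p\in P$ is either a removable singularity of $e^{Nf_N}$ for all large $N$, or satisfies $p\ne(1-s)t+s\gamma(t)$ for all $s\in[0,1]$, $t\in\mathbb R$; 4. $\Re f(u_-)=\Re f(u_+)$, and there are $t_-<t_+$ with $\gamma(t_\pm)=u_\pm$, such that $\gamma'(t_\pm)$ is a positive multiple of $e^{\mathrm i\theta_\pm}$ and does not lie in $(-\infty,0]$, and $\Re f(\gamma(t))<\Re f(u_\pm)$ for all $t\neq t_\pm$. **Claim 1.** Write $f_\pm=f_N(u_\pm)$. Then the integral $R_{N,\beta}$ converges absolutely for all large $N$ and, as $N\to\infty$, $$R_{N,\beta}=\binom{\beta}{\beta/2}(\Gamma_{\beta/2,\beta})^2(u_+-u_-)^\beta\left(\frac{2}{NR}\right)^{\beta-1}e^{\beta N(f_++f_-)/2}\,e^{\mathrm i(\beta-1)(\theta_++\theta_-)}\left[r_{N,\beta}+O\!\left(\frac1N\right)\right],$$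 where (principal powers) $$r_{N,\beta}=1+2\sum_{k=1}^{\lfloor\sqrt{\beta/2}\rfloor}\left(\prod_{j=1}^{k}\frac{\Gamma(1+2j/\beta)}{\Gamma(1+2(j-k)/\beta)}\right)\frac{e^{2\mathrm i k^2(\theta_++\theta_-)/\beta}}{(u_+-u_-)^{4k^2/\beta}(NR)^{2k^2/\beta}}\cos\Big(-\mathrm i kN(f_+-f_-)+k(\theta_+-\theta_-)(3-2/\beta)\Big).$$ **Claim 2.** For every integer $n\ge0$ the following integral converges absolutely, and $$\Gamma_{n,\beta}:=\int_{-\infty}^{\infty}\!du_1\cdots\int_{-\infty}^{\infty}\!du_n\ \prod_{i=1}^n e^{-u_i^2}\prod_{1\le j<k\le n}|u_j-u_k|^{4/\beta}=\frac{\pi^{n/2}}{2^{n(n-1)/\beta}}\prod_{j=2}^{n}\frac{\Gamma(1+2j/\beta)}{\Gamma(1+2/\beta)}.$$ -/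

import Mathlib

open Filter Asymptotics MeasureTheory

noncomputable section

/-- `∏_{j < k} |u_j - u_k| ^ κ`. -/
def absVandermondePow {n : ℕ} (κ : ℝ) (u : Fin n → ℝ) : ℝ :=
  ∏ j : Fin n, ∏ k ∈ Finset.Ioi j, |u j - u k| ^ κ

/-- The exponent function `f_N(u) = f(u) + h(u) / N`. -/
def phaseN (f h : ℂ → ℂ) (N : ℕ) (u : ℂ) : ℂ := f u + h u / (N : ℂ)

/-- The integrand `∏_i exp (N f_N(u_i)) ∏_{j < k} |u_j - u_k| ^ (4 / β)` of `R_{N,β}`. -/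
def RIntegrand (f h : ℂ → ℂ) (N β : ℕ) (u : Fin β → ℝ) : ℂ :=
  (∏ i : Fin β, Complex.exp ((N : ℂ) * phaseN f h N (u i : ℂ))) *
    (absVandermondePow (4 / (β : ℝ)) u : ℂ)

/-- The `β`-fold integral `R_{N,β}` over the real line. -/
def RIntegral (f h : ℂ → ℂ) (N β : ℕ) : ℂ :=
  ∫ u : Fin β → ℝ, RIntegrand f h N β u

/-- The integrand of `Γ_{n,β}`. -/
def mehtaIntegrand (n β : ℕ) (u : Fin n → ℝ) : ℝ :=
  (∏ i : Fin n, Real.exp (-(u i) ^ 2)) * absVandermondePow (4 / (β : ℝ)) u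

/-- The Mehta type integral `Γ_{n,β}`. -/
def mehtaIntegral (n β : ℕ) : ℝ := ∫ u : Fin n → ℝ, mehtaIntegrand n β u

/-- `u₀` is a simple saddle point of `f`, at which `f'' = R e^{iφ}`, and `θ` is an angle of
steepest descent there. -/
structure IsSimpleSaddle (f : ℂ → ℂ) (u₀ : ℂ) (R φ θ : ℝ) : Prop where
  analyticAt : AnalyticAt ℂ f u₀
  deriv_eq_zero : deriv f u₀ = 0
  pos : 0 < R
  deriv2_eq : iteratedDeriv 2 f u₀ = (R : ℂ) * Complex.exp (Complex.I * (φ : ℂ))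
  angle_eq : ∃ m : ℤ, θ = (Real.pi - φ) / 2 + (m : ℝ) * Real.pi
  angle_mem : θ ∈ Set.Ioc (-Real.pi) Real.pi

/-- `exp (N f_N)` is analytic in the finite plane for all `N ≥ 1`, except possibly at the points
of the finite set `P`. -/
structure IsAnalyticOff (f h : ℂ → ℂ) (P : Set ℂ) : Prop where
  finite : P.Finite
  exp_f : ∀ u ∉ P, AnalyticAt ℂ (fun z => Complex.exp (f z)) u
  exp_h : ∀ u ∉ P, AnalyticAt ℂ (fun z => Complex.exp (h z)) u

/-- `γ` is a `C¹` contour from `-∞` to `∞` that passes first through the saddle point `um` and then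
through the saddle point `up`, in the directions `θm` and `θp`, such that `Re f` is
maximal on the contour exactly at these two points, and such that the ordered real line
can be deformed into `γ`. -/
structure IsDescentContour (f h : ℂ → ℂ) (P : Set ℂ) (um up : ℂ) (θm θp : ℝ) (γ : ℝ → ℂ) :
    Prop where
  contDiff : ContDiff ℝ 1 γ
  /-- Outside a compact set, the contour is the real line, and there `Re f` stays away from its
  value at the saddle points. -/
  at_infinity : ∃ c < (f up).re, ∀ᶠ t in cocompact ℝ, γ t = (t : ℂ) ∧ (f (t : ℂ)).re ≤ c
  /-- The principal powers `(u_j - u_k) ^ (4 / β)` are continuous for ordered points on `γ`; in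
  particular `γ` is simple. -/
  sub_mem : ∀ s t : ℝ, s < t → γ t - γ s ∈ Complex.slitPlane
  avoids : ∀ t : ℝ, γ t ∉ P
  /-- No singular point that persists for large `N` is met in the linear deformation of the real
  line into `γ`. -/
  deformation : ∀ p ∈ P,
    (∀ᶠ N : ℕ in atTop,
      (fun z => Complex.exp ((N : ℂ) * phaseN f h N z)) =O[nhdsWithin p {p}ᶜ]
        (fun _ => (1 : ℝ))) ∨
    (∀ s ∈ Set.Icc (0 : ℝ) 1, ∀ t : ℝ, (1 - (s : ℂ)) * (t : ℂ) + (s : ℂ) * γ t ≠ p)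
  same_height : (f um).re = (f up).re
  /-- The two saddle points are passed in this order and in the directions of the angles, and they
  are the only maxima of `Re f` on the contour. -/
  passes : ∃ tm tp : ℝ, tm < tp ∧ γ tm = um ∧ γ tp = up ∧
    deriv γ tm ∈ Complex.slitPlane ∧ deriv γ tp ∈ Complex.slitPlane ∧
    (∃ c : ℝ, 0 < c ∧ deriv γ tm = (c : ℂ) * Complex.exp (Complex.I * (θm : ℂ))) ∧
    (∃ c : ℝ, 0 < c ∧ deriv γ tp = (c : ℂ) * Complex.exp (Complex.I * (θp : ℂ))) ∧
    ∀ t : ℝ, t ≠ tm → t ≠ tp → (f (γ t)).re < (f up).re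

/-- The prefactor `C(β, β/2) Γ_{β/2,β}² (u₊ - u₋)^β (2 / (N R))^(β-1) e^{βN(f₊+f₋)/2}
e^{i(β-1)(θ₊+θ₋)}`, where `fm` and `fp` are the values of the exponent function at the
saddle points. -/
def bulkPrefactor (β N : ℕ) (R : ℝ) (um up fm fp : ℂ) (θm θp : ℝ) : ℂ :=
  (β.choose (β / 2) : ℂ) * (mehtaIntegral (β / 2) β : ℂ) ^ 2 * (up - um) ^ β *
    (2 / ((N : ℂ) * (R : ℂ))) ^ (β - 1) *
    Complex.exp ((β : ℂ) * (N : ℂ) * (fp + fm) / 2) *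
    Complex.exp (Complex.I * ((β : ℂ) - 1) * ((θp : ℂ) + (θm : ℂ)))

/-- The truncated sum `r_{N,β}` of combinatorial oscillatory terms. -/
def oscillatoryFactor (β N : ℕ) (R : ℝ) (um up fm fp : ℂ) (θm θp : ℝ) : ℂ :=
  1 + 2 * ∑ k ∈ Finset.Icc 1 ⌊Real.sqrt ((β : ℝ) / 2)⌋₊,
    ((∏ j ∈ Finset.Icc 1 k,
        Real.Gamma (1 + 2 * (j : ℝ) / (β : ℝ)) /
          Real.Gamma (1 + 2 * ((j : ℝ) - (k : ℝ)) / (β : ℝ)) : ℝ) : ℂ) *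
      (Complex.exp (Complex.I * (2 * (k : ℂ) ^ 2 * ((θp : ℂ) + (θm : ℂ)) / (β : ℂ))) /
        ((up - um) ^ (4 * (k : ℂ) ^ 2 / (β : ℂ)) *
          ((((N : ℝ) * R) ^ (2 * (k : ℝ) ^ 2 / (β : ℝ)) : ℝ) : ℂ))) *
      Complex.cos (-Complex.I * (k : ℂ) * (N : ℂ) * (fp - fm) +
        (k : ℂ) * ((θp : ℂ) - (θm : ℂ)) * (3 - 2 / (β : ℂ)))

end

/-! The closed form of `Γ_{n,β}` is obtained from the Laguerre integrals `L_n(a)`, with weight `x^a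
e^{-x}` on the half line and interaction `|u_j - u_k|^{2g}`, `g = 2/β`. Integration by parts and
antisymmetrization (Aomoto's method) give `L_n(a+1) = ∏_{m<n} (a+1+gm) · L_n(a)`
(`lagIntegral_add_one`). At `a = 0` an integration by parts in one variable leaves a boundary term,
which says `L_{n+1}(0) = L_n(2g)` (`lagIntegral_zero_succ`). Hence `L_{n+1}(N)` and `L_n(N+2g)`
differ by explicit Gamma factors. For large `N` both integrals, recentred at the peak of the weight,
become Gaussian, and the relation turns into a recursion in `n` (`gaussVandIntegral_succ`).

For the asymptotics, write `β = 2e` and `κ = 4/β`. On the real line `|u_j - u_k|^κ` is the principal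
power of the difference of the two points, taken in the order of their parameters. This form
continues along the homotopy `t + s(γ(t) - t)`, since ordered differences stay in the slit plane.
The `s`-derivative of the integrand is a divergence whose flux is continuous across the diagonals
and vanishes far out, so the integral does not change (`IsDeformation.integral_eq_contour`). A shift
`ε > 0` in the base of the power keeps everything differentiable off the diagonals and is removed at
the end.

The contour is then modified to be exactly straight near both saddles (`exists_straighten`,
`IsDescentContour.exists_straightContour`). Points near the same saddle then interact through an
exact real power times a phase. Up to an exponentially small part, the integral is a sum over the
subsets `S` of the variables that lie near `u₊`. In the scale `σ = (2/(NR))^{1/2}` the summand for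
`S` is a constant times a Gaussian integral that splits into two Mehta integrals, with a correction
that is odd at order `σ` and so integrates to zero; the relative error is `O(σ²) = O(1/N)`
(`exists_local_asymptotics`, `exists_contour_asymptotics`).

With `|S| = e + k`, the constant is `e^{k² G + k X}` times a factor independent of `k`, where `e^{k²
G}` has size `N^{-k²/e}` up to constants (`exp_logAmplitude`). The subsets of sizes `e + k` and `e -
k` combine into a cosine, and binomials and Mehta integrals into the quotient of Gamma functions
(`choose_mul_mehtaIntegral_eq`). Terms with `k² ≥ e` are `O(1/N)`, which permits the truncation of
the sum (`exists_expansion`).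

Two points concern the hypotheses. Removable singularities are filled in, which changes the real
integrand only on a null set. Convergence for one `N₀` is passed through Fubini to a one-dimensional
weighted integral, which then converges for all larger `N`, because `Re f` is bounded above near
infinity. -/

/-- The product of `F j k` over all pairs of indices `j < k`. -/
def pairProd {d : ℕ} {A : Type*} [CommMonoid A] (F : Fin d → Fin d → A) : A :=
  ∏ j : Fin d, ∏ k ∈ Finset.Ioi j, F j k

/-! ### Products over pairs of indices and their logarithmic derivatives. -/

section PairProd

variable {d : ℕ}

theorem pairProd_congr {A : Type*} [CommMonoid A] {F G : Fin d → Fin d → A}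
    (h : ∀ j k, j < k → F j k = G j k) : pairProd F = pairProd G :=
  Finset.prod_congr rfl fun j _ => Finset.prod_congr rfl fun k hk => h j k (Finset.mem_Ioi.1 hk)

theorem pairProd_mul {A : Type*} [CommMonoid A] (F G : Fin d → Fin d → A) :
    pairProd (fun j k => F j k * G j k) = pairProd F * pairProd G := by
  simp [pairProd, Finset.prod_mul_distrib]

theorem pairProd_mul_swap {A : Type*} [CommMonoid A] (F : Fin d → Fin d → A) :
    pairProd (fun j k => F k j * F j k) = ∏ j, ∏ k ∈ ({j}ᶜ : Finset (Fin d)), F k j :=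
  Finset.prod_prod_Ioi_mul_eq_prod_prod_off_diag F

theorem map_pairProd {A B G : Type*} [CommMonoid A] [CommMonoid B] [FunLike G A B]
    [MonoidHomClass G A B] (g : G) (F : Fin d → Fin d → A) :
    g (pairProd F) = pairProd fun j k => g (F j k) := by
  simp [pairProd, map_prod]

theorem pairProd_mul_eq_prod_pow (p : Fin d → ℝ) :
    pairProd (fun j k => p j * p k) = ∏ j, p j ^ (d - 1) := by
  have h := pairProd_mul_swap (fun _ k : Fin d => p k)
  rw [h]
  refine Finset.prod_congr rfl fun j _ => ?_
  simp [Finset.card_compl]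

/-- Each index lies in `d - 1` pairs. A pairwise bound of product form thus becomes a product of
one-variable bounds, which is how the multiple integrals below are dominated. -/
theorem norm_pairProd_le {A : Type*} [NormedField A] {F : Fin d → Fin d → A} {p : Fin d → ℝ}
    (h : ∀ j k, j < k → ‖F j k‖ ≤ p j * p k) : ‖pairProd F‖ ≤ ∏ j, p j ^ (d - 1) := by
  rw [← pairProd_mul_eq_prod_pow, pairProd, norm_prod]
  refine Finset.prod_le_prod (fun j _ => norm_nonneg _) fun j _ => ?_
  rw [norm_prod]
  exact Finset.prod_le_prod (fun k _ => norm_nonneg _) fun k hk => h j k (Finset.mem_Ioi.1 hk)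

/-- Derivatives are given as value times a factor `l i`, so the product rule needs no division and
also holds where some factor vanishes. -/
theorem hasDerivAt_prod_of_logDeriv {ι 𝔸 : Type*} [NormedCommRing 𝔸] [NormedAlgebra ℝ 𝔸]
    (s : Finset ι) {f : ι → ℝ → 𝔸} {l : ι → 𝔸} {x : ℝ}
    (h : ∀ i ∈ s, HasDerivAt (f i) (f i x * l i) x) :
    HasDerivAt (fun y => ∏ i ∈ s, f i y) ((∏ i ∈ s, f i x) * ∑ i ∈ s, l i) x := by
  classical
  convert HasDerivAt.fun_finsetProd h using 1
  rw [Finset.mul_sum]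
  refine Finset.sum_congr rfl fun i hi => ?_
  rw [← Finset.prod_erase_mul _ _ hi, smul_eq_mul, mul_assoc]

theorem hasDerivAt_pairProd {𝔸 : Type*} [NormedCommRing 𝔸] [NormedAlgebra ℝ 𝔸]
    {F : Fin d → Fin d → ℝ → 𝔸} {l : Fin d → Fin d → 𝔸} {x : ℝ}
    (h : ∀ j k, j < k → HasDerivAt (F j k) (F j k x * l j k) x) :
    HasDerivAt (fun y => pairProd fun j k => F j k y)
      ((pairProd fun j k => F j k x) * ∑ j, ∑ k ∈ Finset.Ioi j, l j k) x :=
  hasDerivAt_prod_of_logDeriv _ fun j _ =>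
    hasDerivAt_prod_of_logDeriv _ fun k hk => h j k (Finset.mem_Ioi.1 hk)

/-- Symmetry of `ω` allows the moving variable to be placed in the first slot of every pair that
contains it. The lemma serves both the regularized Vandermonde product and the contour kernel. -/
theorem hasDerivAt_pairProd_update {𝔸 : Type*} [NormedCommRing 𝔸] [NormedAlgebra ℝ 𝔸]
    {ω : ℝ → ℝ → 𝔸} (hsymm : ∀ a b, ω a b = ω b a) (t : Fin d → ℝ) (i : Fin d) {q : Fin d → 𝔸}
    (h : ∀ k, k ≠ i → HasDerivAt (fun x => ω x (t k)) (ω (t i) (t k) * q k) (t i)) :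
    HasDerivAt (fun x => pairProd fun j k =>
        ω (Function.update t i x j) (Function.update t i x k))
      ((pairProd fun j k => ω (t j) (t k)) * ∑ k ∈ ({i}ᶜ : Finset (Fin d)), q k) (t i) := by
  -- Whichever member of the pair equals `i`, exactly one of `r k j`, `r j k` carries its
  -- logarithmic derivative; for pairs without `i` both are zero.
  set r : Fin d → Fin d → 𝔸 := fun k j => if k = i then q j else 0 with hr
  have hF := hasDerivAt_pairProd (x := t i)
    (F := fun j k x => ω (Function.update t i x j) (Function.update t i x k))
    (l := fun j k => r k j + r j k) ?_
  · convert! hF using 1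
    congr 1
    · simp
    · rw [Finset.sum_sum_Ioi_add_eq_sum_sum_off_diag]
      simp only [hr]
      have : ∀ j : Fin d, ∑ k ∈ ({j}ᶜ : Finset (Fin d)), (if k = i then q j else 0)
          = if j = i then 0 else q j := by
        intro j
        rw [Finset.sum_ite_eq']
        by_cases hj : j = i
        · simp [hj]
        · rw [if_pos (by simpa using Ne.symm hj), if_neg hj]
      rw [Finset.sum_congr rfl fun j _ => this j]
      have h2 : ({i}ᶜ : Finset (Fin d)) = Finset.univ.filter fun j => ¬ j = i := by
        ext; simp
      rw [h2, Finset.sum_filter]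
      refine Finset.sum_congr rfl fun j _ => ?_
      by_cases hj : j = i <;> simp [hj]
  · intro j k hjk
    by_cases hj : j = i
    · subst hj
      have hk : k ≠ j := hjk.ne'
      simp only [Function.update_self, Function.update_of_ne hk, hr, if_neg hk, zero_add, if_true]
      exact h k hk
    · by_cases hk : k = i
      · subst hk
        simp only [Function.update_self, Function.update_of_ne hj, hr, if_neg hj, add_zero,
          if_true]
        simp_rw [hsymm (t j)]
        exact h j hj
      · simp only [Function.update_of_ne hj, Function.update_of_ne hk, hr, if_neg hj, if_neg hk,
          add_zero, mul_zero]
        exact hasDerivAt_const _ _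

/-- Antisymmetry regroups a sum over pairs, weighted by differences of velocities, into a sum over
single particles. This turns the parameter derivative of the contour kernel into a divergence. -/
theorem sum_pair_mul_sub_eq {𝔸 : Type*} [CommRing 𝔸] (q : Fin d → Fin d → 𝔸)
    (hq : ∀ j k, q k j = - q j k) (v : Fin d → 𝔸) :
    ∑ j, ∑ k ∈ Finset.Ioi j, q j k * (v j - v k) =
      ∑ j, v j * ∑ k ∈ ({j}ᶜ : Finset (Fin d)), q j k := by
  have := Finset.sum_sum_Ioi_add_eq_sum_sum_off_diag (fun k j : Fin d => v j * q j k)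
  simp_rw [Finset.mul_sum]
  rw [← this]
  refine Finset.sum_congr rfl fun j _ => Finset.sum_congr rfl fun k _ => ?_
  rw [hq j k]; ring

end PairProd

/-! ### Fubini in one chosen coordinate. -/

section PiIntegral

theorem Integrable.of_norm_le_prod {d : ℕ} {E : Type*} [NormedAddCommGroup E] {μ : Measure ℝ}
    [SigmaFinite μ] {H : (Fin d → ℝ) → E} {φ : Fin d → ℝ → ℝ} (hφ : ∀ i, Integrable (φ i) μ)
    (C : ℝ) (hm : AEStronglyMeasurable H (Measure.pi fun _ => μ))
    (h : ∀ᵐ x ∂(Measure.pi fun _ => μ), ‖H x‖ ≤ C * ∏ i, φ i (x i)) :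
    Integrable H (Measure.pi fun _ => μ) :=
  ((Integrable.fintype_prod hφ).const_mul C).mono' hm h

variable {n : ℕ} {E : Type*} [NormedAddCommGroup E] [NormedSpace ℝ E] {μ : Measure ℝ}
  [SigmaFinite μ]

theorem measurePreserving_insertNth (i : Fin (n + 1)) :
    MeasurePreserving (fun z : ℝ × (Fin n → ℝ) => (i.insertNth z.1 z.2 : Fin (n + 1) → ℝ))
      (μ.prod (Measure.pi fun _ => μ)) (Measure.pi fun _ => μ) :=
  (measurePreserving_piFinSuccAbove (fun _ : Fin (n + 1) => μ) i).symm

theorem integral_pi_eq_insertNth (i : Fin (n + 1)) {F : (Fin (n + 1) → ℝ) → E}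
    (hF : Integrable F (Measure.pi fun _ => μ)) :
    ∫ t, F t ∂(Measure.pi fun _ => μ) =
      ∫ r, (∫ x, F (i.insertNth x r) ∂μ) ∂(Measure.pi fun _ : Fin n => μ) := by
  have hmp := measurePreserving_insertNth (μ := μ) i
  have hemb : MeasurableEmbedding
      (fun z : ℝ × (Fin n → ℝ) => (i.insertNth z.1 z.2 : Fin (n + 1) → ℝ)) :=
    (MeasurableEquiv.piFinSuccAbove (fun _ : Fin (n + 1) => ℝ) i).symm.measurableEmbedding
  have hF' := (hmp.integrable_comp_emb hemb).2 hF
  rw [← hmp.integral_comp hemb]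
  exact integral_prod_symm _ hF'

theorem integral_pi_eq_zero_of_forall_insertNth (i : Fin (n + 1)) {F : (Fin (n + 1) → ℝ) → E}
    (hF : Integrable F (Measure.pi fun _ => μ))
    (h : ∀ r : Fin n → ℝ, ∫ x, F (i.insertNth x r) ∂μ = 0) :
    ∫ t, F t ∂(Measure.pi fun _ => μ) = 0 := by
  rw [integral_pi_eq_insertNth i hF]
  simp [h]

theorem integral_pi_comp_equiv {ι ι' : Type*} [Fintype ι] [Fintype ι'] (e : ι' ≃ ι)
    (F : (ι' → ℝ) → E) :
    ∫ t : ι → ℝ, F (fun j => t (e j)) ∂(Measure.pi fun _ => μ) =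
      ∫ t, F t ∂(Measure.pi fun _ => μ) := by
  have h := (measurePreserving_piCongrLeft (fun _ : ι => μ) e).symm
  exact h.integral_comp
    (MeasurableEquiv.piCongrLeft (fun _ : ι => ℝ) e).symm.measurableEmbedding F

end PiIntegral

/-! ### Exponentially decaying majorants and the fundamental theorem on a half space. -/

/-- The weight `e^{-|x|} (1 + |x|)^M`. -/
noncomputable def expWeight (M : ℕ) (x : ℝ) : ℝ := Real.exp (-|x|) * (1 + |x|) ^ M

section ExpWeight

theorem expWeight_nonneg (M : ℕ) (x : ℝ) : 0 ≤ expWeight M x := by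
  unfold expWeight; positivity

theorem continuous_expWeight (M : ℕ) : Continuous (expWeight M) := by
  unfold expWeight; fun_prop

theorem expWeight_le_inv (M : ℕ) :
    ∃ C : ℝ, 0 ≤ C ∧ ∀ x, expWeight M x ≤ C * (1 + x ^ 2)⁻¹ := by
  refine ⟨(M + 2).factorial * Real.exp 1, by positivity, fun x => ?_⟩
  have h0 : 0 ≤ 1 + |x| := by positivity
  have h := Real.pow_div_factorial_le_exp (1 + |x|) h0 (M + 2)
  rw [div_le_iff₀ (by positivity)] at h
  rw [← div_eq_mul_inv, le_div_iff₀ (by positivity)]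
  have h1 : 1 + x ^ 2 ≤ (1 + |x|) ^ 2 := by nlinarith [abs_nonneg x, sq_abs x]
  calc expWeight M x * (1 + x ^ 2)
      ≤ expWeight M x * (1 + |x|) ^ 2 := mul_le_mul_of_nonneg_left h1 (expWeight_nonneg M x)
    _ = Real.exp (-|x|) * (1 + |x|) ^ (M + 2) := by unfold expWeight; ring
    _ ≤ Real.exp (-|x|) * (Real.exp (1 + |x|) * (M + 2).factorial) := by gcongr
    _ = (M + 2).factorial * Real.exp 1 := by
        rw [Real.exp_add, Real.exp_neg]; field_simp

theorem integrable_expWeight (M : ℕ) : Integrable (expWeight M) := by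
  obtain ⟨C, _, hC⟩ := expWeight_le_inv M
  refine (integrable_inv_one_add_sq.const_mul C).mono'
    (continuous_expWeight M).aestronglyMeasurable (ae_of_all _ fun x => ?_)
  rw [Real.norm_of_nonneg (expWeight_nonneg M x)]
  exact hC x

theorem tendsto_expWeight_atTop (M : ℕ) : Tendsto (expWeight M) atTop (nhds 0) := by
  obtain ⟨C, _, hC⟩ := expWeight_le_inv M
  refine squeeze_zero (expWeight_nonneg M) hC ?_
  have : Tendsto (fun x : ℝ => (1 + x ^ 2)⁻¹) atTop (nhds 0) :=
    tendsto_inv_atTop_zero.comp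
      (tendsto_atTop_add_const_left _ _ (tendsto_pow_atTop two_ne_zero))
  simpa using this.const_mul C

theorem expWeight_mul_pow (M m : ℕ) (x : ℝ) :
    expWeight M x * (1 + |x|) ^ m = expWeight (M + m) x := by
  unfold expWeight; rw [pow_add]; ring

theorem expWeight_mono {M m : ℕ} (h : M ≤ m) (x : ℝ) : expWeight M x ≤ expWeight m x := by
  unfold expWeight
  gcongr
  simp

variable {n : ℕ} {E : Type*} [NormedAddCommGroup E]

theorem integrable_of_le_expWeight {H : (Fin n → ℝ) → E} (hm : AEStronglyMeasurable H) (C : ℝ)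
    (M : ℕ) (h : ∀ u, ‖H u‖ ≤ C * ∏ i, expWeight M (u i)) : Integrable H :=
  Integrable.of_norm_le_prod (φ := fun _ => expWeight M) (fun _ => integrable_expWeight M) C hm
    (ae_of_all _ h)

/-- The fundamental theorem of calculus is applied on `(0, ∞)` in the variable `u i` on every slice.
The majorant makes the slice integrable and kills the contribution of infinity, so only the value at
`0` survives. -/
theorem integral_eq_neg_boundary [NormedSpace ℝ E] [CompleteSpace E] (i : Fin (n + 1))
    {H G : (Fin (n + 1) → ℝ) → E} (hHm : StronglyMeasurable H) {C : ℝ} {M : ℕ}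
    (hH : ∀ u, ‖H u‖ ≤ C * ∏ j, expWeight M (u j)) (hH0 : ∀ u, u i ≤ 0 → H u = 0)
    (hG : ∀ u, 0 < u i → ‖G u‖ ≤ C * ∏ j, expWeight M (u j))
    (hcont : ∀ u, Continuous fun x => G (Function.update u i x))
    (hderiv : ∀ u, 0 < u i → HasDerivAt (fun x => G (Function.update u i x)) (H u) (u i)) :
    ∫ u, H u = - ∫ r : Fin n → ℝ, G (i.insertNth 0 r) := by
  have hHi := integrable_of_le_expWeight hHm.aestronglyMeasurable C M hH
  rw [show (∫ u, H u) = ∫ u, H u ∂(Measure.pi fun _ => volume) from rfl,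
    integral_pi_eq_insertNth i hHi, ← integral_neg]
  refine integral_congr_ae (ae_of_all _ fun r => ?_)
  have hup : ∀ x y : ℝ, Function.update (i.insertNth x r : Fin (n + 1) → ℝ) i y
      = i.insertNth y r := fun x y => Fin.update_insertNth _ _ _ _
  have hprod : ∀ x : ℝ, ∏ j, expWeight M ((i.insertNth x r : Fin (n + 1) → ℝ) j)
      = expWeight M x * ∏ j, expWeight M (r j) := fun x => by
    rw [Fin.prod_univ_succAbove _ i]; simp
  have hmeas : Measurable fun x : ℝ => (i.insertNth x r : Fin (n + 1) → ℝ) := by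
    rw [← funext fun x => hup 0 x]
    exact measurable_update _
  have hsl : Integrable fun x : ℝ => H (i.insertNth x r) := by
    refine ((integrable_expWeight M).const_mul (C * ∏ j, expWeight M (r j))).mono'
      (hHm.comp_measurable hmeas).aestronglyMeasurable (ae_of_all _ fun x => ?_)
    refine (hH _).trans (le_of_eq ?_)
    rw [hprod]; ring
  have hz : ∀ x, x ∉ Set.Ioi (0 : ℝ) → H (i.insertNth x r) = 0 := fun x hx =>
    hH0 _ (by simpa using hx)
  simp only
  rw [← setIntegral_eq_integral_of_forall_compl_eq_zero hz]
  have hc := hcont (i.insertNth 0 r)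
  simp_rw [hup] at hc
  have := integral_Ioi_of_hasDerivAt_of_tendsto (a := 0) (m := (0 : E))
    (f := fun x => G (i.insertNth x r)) (f' := fun x => H (i.insertNth x r))
    hc.continuousWithinAt (fun x hx => ?_) hsl.integrableOn ?_
  · rw [this]; simp
  · have := hderiv (i.insertNth x r) (by simpa using hx)
    simp only [hup, Fin.insertNth_apply_same] at this
    exact this
  · have ht := (tendsto_expWeight_atTop M).const_mul (C * ∏ j, expWeight M (r j))
    rw [mul_zero] at ht
    refine squeeze_zero_norm' ?_ ht
    filter_upwards [eventually_gt_atTop 0] with x hx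
    refine (hG _ (by simpa using hx)).trans (le_of_eq ?_)
    rw [hprod]; ring

end ExpWeight

theorem prod_offDiag_comp_equiv {ι ι' A : Type*} [Fintype ι] [Fintype ι'] [DecidableEq ι]
    [DecidableEq ι'] [CommMonoid A] (e : ι' ≃ ι) (F : ι → ι → A) :
    ∏ j, ∏ k ∈ ({j}ᶜ : Finset ι'), F (e k) (e j) = ∏ j, ∏ k ∈ ({j}ᶜ : Finset ι), F k j := by
  rw [← e.prod_comp]
  refine Finset.prod_congr rfl fun j _ => ?_
  exact Finset.prod_equiv e (by simp) (by simp)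

/-! ### The Vandermonde product, regularized to be smooth on the diagonals. -/

/-- The regularized product `∏_{j < k} ((u_j - u_k)² + ε) ^ g`. -/
noncomputable def regVand (g ε : ℝ) {n : ℕ} (u : Fin n → ℝ) : ℝ :=
  pairProd fun j k => ((u j - u k) ^ 2 + ε) ^ g

section RegVand

variable {g ε : ℝ} {n : ℕ}

theorem regVand_zero (u : Fin n → ℝ) : regVand g 0 u = absVandermondePow (2 * g) u := by
  unfold regVand absVandermondePow pairProd
  refine Finset.prod_congr rfl fun j _ => Finset.prod_congr rfl fun k _ => ?_
  simp only [add_zero]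
  rw [← sq_abs, ← Real.rpow_natCast, ← Real.rpow_mul (abs_nonneg _)]
  norm_num

theorem regVand_nonneg (hε : 0 ≤ ε) (u : Fin n → ℝ) : 0 ≤ regVand g ε u := by
  unfold regVand pairProd; positivity

theorem continuous_regVand (hg : 0 ≤ g) : Continuous fun u : Fin n → ℝ => regVand g ε u := by
  unfold regVand pairProd
  refine continuous_finsetProd _ fun j _ => continuous_finsetProd _ fun k _ => ?_
  exact Continuous.rpow_const (by fun_prop) fun _ => Or.inr hg

theorem continuous_regVand_eps (hg : 0 ≤ g) (u : Fin n → ℝ) :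
    Continuous fun ε => regVand g ε u := by
  unfold regVand pairProd
  refine continuous_finsetProd _ fun j _ => continuous_finsetProd _ fun k _ => ?_
  exact Continuous.rpow_const (by fun_prop) fun _ => Or.inr hg

theorem sq_sub_add_rpow_le (hg : 0 ≤ g) (hε : 0 ≤ ε) (hε1 : ε ≤ 1) (x y : ℝ) :
    ((x - y) ^ 2 + ε) ^ g ≤ (1 + |x|) ^ ⌈2 * g⌉₊ * (1 + |y|) ^ ⌈2 * g⌉₊ := by
  have hx := abs_nonneg x
  have hy := abs_nonneg y
  have hB : 1 ≤ (1 + |x|) * (1 + |y|) := by nlinarith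
  have h1 : (x - y) ^ 2 + ε ≤ ((1 + |x|) * (1 + |y|)) ^ 2 := by
    have h2 : (x - y) ^ 2 ≤ (|x| + |y|) ^ 2 := by
      rw [← sq_abs (x - y)]
      exact pow_le_pow_left₀ (abs_nonneg _) (abs_sub x y) 2
    nlinarith [mul_nonneg hx hy]
  calc ((x - y) ^ 2 + ε) ^ g ≤ (((1 + |x|) * (1 + |y|)) ^ 2) ^ g :=
        Real.rpow_le_rpow (by positivity) h1 hg
    _ = ((1 + |x|) * (1 + |y|)) ^ (2 * g) := by
        rw [← Real.rpow_natCast, ← Real.rpow_mul (by positivity)]; norm_num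
    _ ≤ ((1 + |x|) * (1 + |y|)) ^ ((⌈2 * g⌉₊ : ℕ) : ℝ) :=
        Real.rpow_le_rpow_of_exponent_le hB (Nat.le_ceil _)
    _ = _ := by rw [Real.rpow_natCast, mul_pow]

theorem regVand_le (hg : 0 ≤ g) (hε : 0 ≤ ε) (hε1 : ε ≤ 1) (u : Fin n → ℝ) :
    regVand g ε u ≤ ∏ j, (1 + |u j|) ^ (⌈2 * g⌉₊ * (n - 1)) := by
  refine (le_abs_self _).trans ?_
  rw [← Real.norm_eq_abs]
  simp_rw [pow_mul]
  refine norm_pairProd_le fun j k _ => ?_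
  rw [Real.norm_of_nonneg (by positivity)]
  exact sq_sub_add_rpow_le hg hε hε1 _ _

/-- Giving each of the two orderings of a pair the exponent `g / 2` yields a product over all
ordered pairs, which is visibly symmetric. -/
theorem regVand_comp_perm (hg : 0 ≤ g) (hε : 0 ≤ ε) (σ : Equiv.Perm (Fin n)) (u : Fin n → ℝ) :
    regVand g ε (fun j => u (σ j)) = regVand g ε u := by
  have key : ∀ v : Fin n → ℝ, regVand g ε v =
      ∏ j, ∏ k ∈ ({j}ᶜ : Finset (Fin n)), ((v j - v k) ^ 2 + ε) ^ (g / 2) := fun v => by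
    rw [← pairProd_mul_swap fun k j => ((v j - v k) ^ 2 + ε) ^ (g / 2)]
    refine pairProd_congr fun j k _ => ?_
    rw [← neg_sub (v j), neg_sq, ← Real.rpow_add_of_nonneg (by positivity) (by positivity)
      (by positivity), add_halves]
  rw [key, key]
  exact prod_offDiag_comp_equiv σ fun k j => ((u j - u k) ^ 2 + ε) ^ (g / 2)

theorem hasDerivAt_regVand_update (hε : 0 < ε) (u : Fin n → ℝ) (i : Fin n) :
    HasDerivAt (fun x => regVand g ε (Function.update u i x))
      (regVand g ε u * ∑ l ∈ ({i}ᶜ : Finset (Fin n)),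
        2 * g * ((u i - u l) / ((u i - u l) ^ 2 + ε))) (u i) := by
  refine hasDerivAt_pairProd_update (ω := fun a b => ((a - b) ^ 2 + ε) ^ g) (fun a b => by
    rw [← neg_sub, neg_sq]) u i fun k _ => ?_
  have hp : 0 < (u i - u k) ^ 2 + ε := by positivity
  have h := ((((hasDerivAt_id (u i)).sub_const (u k)).pow 2).add_const ε).rpow_const (p := g)
    (Or.inl hp.ne')
  convert! h using 1
  simp only [id, Pi.pow_apply]
  rw [Real.rpow_sub_one hp.ne']
  field_simp
  norm_num
  ring

end RegVand

/-! ### Laguerre type integrals. -/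

/-- The Laguerre weight `x ^ a e^{-x}` on the positive half line. -/
noncomputable def lagWeight (a x : ℝ) : ℝ := if 0 < x then x ^ a * Real.exp (-x) else 0

section LagWeight

theorem lagWeight_nonneg (a x : ℝ) : 0 ≤ lagWeight a x := by
  unfold lagWeight; split_ifs <;> positivity

theorem measurable_lagWeight (a : ℝ) : Measurable (lagWeight a) := by
  unfold lagWeight
  exact Measurable.ite measurableSet_Ioi (by fun_prop) measurable_const

theorem rpow_mul_exp_le {a x : ℝ} (ha : 0 ≤ a) (hx : 0 ≤ x) :
    x ^ a * Real.exp (-x) ≤ expWeight ⌈a⌉₊ x := by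
  unfold expWeight
  rw [abs_of_nonneg hx, mul_comm]
  gcongr
  calc x ^ a ≤ (1 + x) ^ a := Real.rpow_le_rpow hx (by linarith) ha
    _ ≤ (1 + x) ^ ((⌈a⌉₊ : ℕ) : ℝ) :=
        Real.rpow_le_rpow_of_exponent_le (by linarith) (Nat.le_ceil _)
    _ = _ := Real.rpow_natCast _ _

theorem lagWeight_le {a : ℝ} (ha : 0 ≤ a) (x : ℝ) : lagWeight a x ≤ expWeight ⌈a⌉₊ x := by
  unfold lagWeight
  split_ifs with h
  · exact rpow_mul_exp_le ha h.le
  · exact expWeight_nonneg _ _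

theorem mul_lagWeight (a x : ℝ) : x * lagWeight a x = lagWeight (a + 1) x := by
  unfold lagWeight
  split_ifs with h
  · rw [Real.rpow_add_one h.ne']; ring
  · simp

end LagWeight

/-- The regularized Laguerre type integral, with extra factors `u_j` for `j ∈ K`. -/
noncomputable def lagIntegral (g ε a : ℝ) {n : ℕ} (K : Finset (Fin n)) : ℝ :=
  ∫ u : Fin n → ℝ, (∏ j ∈ K, u j) * (∏ j, lagWeight a (u j)) * regVand g ε u

section LagIntegral

variable {g ε a : ℝ} {n : ℕ}

theorem prod_abs_le_prod_one_add (K : Finset (Fin n)) (u : Fin n → ℝ) :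
    |∏ j ∈ K, u j| ≤ ∏ j, (1 + |u j|) := by
  rw [Finset.abs_prod, ← Finset.prod_ite_mem_eq K fun j => |u j|]
  refine Finset.prod_le_prod (fun j _ => by split_ifs <;> positivity) fun j _ => ?_
  split_ifs <;> linarith [abs_nonneg (u j)]

/-- The weights `w` are left free because integration by parts changes the weight of one variable,
while the boundary term changes it in all variables. -/
theorem lagIntegrand_le (hg : 0 ≤ g) (hε : 0 ≤ ε) (hε1 : ε ≤ 1) {w : Fin n → ℝ} {m : ℕ}
    {u : Fin n → ℝ} (hw : ∀ j, 0 ≤ w j) (hw' : ∀ j, w j ≤ expWeight m (u j))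
    (K : Finset (Fin n)) :
    |(∏ j ∈ K, u j) * (∏ j, w j) * regVand g ε u| ≤
      ∏ j, expWeight (m + (1 + ⌈2 * g⌉₊ * (n - 1))) (u j) := by
  rw [abs_mul, abs_mul, abs_of_nonneg (regVand_nonneg hε u),
    abs_of_nonneg (Finset.prod_nonneg fun j _ => hw j)]
  calc |∏ j ∈ K, u j| * (∏ j, w j) * regVand g ε u
      ≤ (∏ j, (1 + |u j|)) * (∏ j, expWeight m (u j)) *
          ∏ j, (1 + |u j|) ^ (⌈2 * g⌉₊ * (n - 1)) := by
        have h1 : ∏ j, w j ≤ ∏ j, expWeight m (u j) :=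
          Finset.prod_le_prod (fun j _ => hw j) fun j _ => hw' j
        have h2 : 0 ≤ ∏ j, w j := Finset.prod_nonneg fun j _ => hw j
        exact mul_le_mul (mul_le_mul (prod_abs_le_prod_one_add K u) h1 h2 (by positivity))
          (regVand_le hg hε hε1 u) (regVand_nonneg hε u)
          (mul_nonneg (by positivity) (h2.trans h1))
    _ = _ := by
        rw [← Finset.prod_mul_distrib, ← Finset.prod_mul_distrib]
        refine Finset.prod_congr rfl fun j _ => ?_
        rw [← expWeight_mul_pow, pow_add]; ring

theorem measurable_lagIntegrand (hg : 0 ≤ g) (K : Finset (Fin n)) :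
    Measurable fun u : Fin n → ℝ =>
      (∏ j ∈ K, u j) * (∏ j, lagWeight a (u j)) * regVand g ε u := by
  refine ((Finset.measurable_prod _ fun j _ => measurable_pi_apply j).mul
    (Finset.measurable_prod _ fun j _ => (measurable_lagWeight a).comp
      (measurable_pi_apply j))).mul (continuous_regVand hg).measurable

/-- Dominated convergence; restricting `ε` to `(0, 1]` makes the majorant independent of `ε`. -/
theorem tendsto_lagIntegral (hg : 0 ≤ g) (ha : 0 ≤ a) (K : Finset (Fin n)) :
    Tendsto (fun ε => lagIntegral g ε a K) (nhdsWithin 0 (Set.Ioc 0 1))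
      (nhds (lagIntegral g 0 a K)) := by
  refine tendsto_integral_filter_of_dominated_convergence
    (fun u => ∏ j, expWeight (⌈a⌉₊ + (1 + ⌈2 * g⌉₊ * (n - 1))) (u j))
    (Eventually.of_forall fun ε => (measurable_lagIntegrand hg K).aestronglyMeasurable) ?_
    (Integrable.fintype_prod fun _ => integrable_expWeight _) (ae_of_all _ fun u => ?_)
  · filter_upwards [self_mem_nhdsWithin] with ε hε
    exact ae_of_all _ fun u => lagIntegrand_le hg hε.1.le hε.2 (fun j => lagWeight_nonneg _ _)
      (fun j => lagWeight_le ha _) K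
  · exact (((continuous_regVand_eps hg u).const_mul _).tendsto 0).mono_left nhdsWithin_le_nhds

end LagIntegral

/-! ### Integration by parts in the regularized Laguerre integral. -/

section LaguerreIBP

variable {g ε a : ℝ} {n : ℕ}

theorem one_le_prod_of_forall_one_le {ι : Type*} {s : Finset ι} {f : ι → ℝ}
    (h : ∀ i ∈ s, 1 ≤ f i) : 1 ≤ ∏ i ∈ s, f i := by
  simpa using Finset.prod_le_prod (f := fun _ => (1 : ℝ)) (fun _ _ => zero_le_one) h

theorem one_add_abs_le_prod (i : Fin n) (u : Fin n → ℝ) : 1 + |u i| ≤ ∏ j, (1 + |u j|) := by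
  rw [← Finset.mul_prod_erase _ _ (Finset.mem_univ i)]
  refine le_mul_of_one_le_right (by positivity) ?_
  exact one_le_prod_of_forall_one_le fun j _ => by linarith [abs_nonneg (u j)]

theorem integrable_lag_mul (hg : 0 ≤ g) (hε : 0 ≤ ε) (hε1 : ε ≤ 1) (ha : 0 ≤ a)
    {f : (Fin n → ℝ) → ℝ} (hf : Measurable f) {C : ℝ} {p : ℕ}
    (hfC : ∀ u, |f u| ≤ C * ∏ j, (1 + |u j|) ^ p) :
    Integrable fun u => (∏ j, lagWeight a (u j)) * regVand g ε u * f u := by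
  have hm := measurable_lagIntegrand (a := a) (ε := ε) hg (∅ : Finset (Fin n))
  simp only [Finset.prod_empty, one_mul] at hm
  refine integrable_of_le_expWeight (hm.mul hf).aestronglyMeasurable C
    (⌈a⌉₊ + (1 + ⌈2 * g⌉₊ * (n - 1)) + p) fun u => ?_
  have h := lagIntegrand_le hg hε hε1 (fun j => lagWeight_nonneg a (u j))
    (fun j => lagWeight_le ha (u j)) ∅
  simp only [Finset.prod_empty, one_mul] at h
  rw [norm_mul, Real.norm_eq_abs, Real.norm_eq_abs]
  refine (mul_le_mul h (hfC u) (abs_nonneg _)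
    (Finset.prod_nonneg fun _ _ => expWeight_nonneg _ _)).trans (le_of_eq ?_)
  rw [mul_left_comm, ← Finset.prod_mul_distrib]
  simp_rw [expWeight_mul_pow]

theorem abs_div_sq_add_le {x ε : ℝ} (hε : 0 < ε) (hε1 : ε ≤ 1) : |x / (x ^ 2 + ε)| ≤ 1 / ε := by
  rw [abs_div, abs_of_pos (show 0 < x ^ 2 + ε by positivity), div_le_div_iff₀ (by positivity) hε,
    one_mul, ← sq_abs]
  have := abs_nonneg x
  rcases le_total |x| 1 with h | h <;> nlinarith

/-- The logarithmic derivative of `regVand` in the `i`-th variable. -/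
noncomputable def regVandLogDeriv (g ε : ℝ) (i : Fin n) (u : Fin n → ℝ) : ℝ :=
  ∑ l ∈ ({i}ᶜ : Finset (Fin n)), 2 * g * ((u i - u l) / ((u i - u l) ^ 2 + ε))

theorem measurable_regVandLogDeriv (i : Fin n) :
    Measurable (regVandLogDeriv g ε i) := by
  unfold regVandLogDeriv
  fun_prop

theorem abs_regVandLogDeriv_le (hg : 0 ≤ g) (hε : 0 < ε) (hε1 : ε ≤ 1) (i : Fin n)
    (u : Fin n → ℝ) : |regVandLogDeriv g ε i u| ≤ n * (2 * g * (1 / ε)) := by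
  refine (Finset.abs_sum_le_sum_abs _ _).trans ?_
  refine (Finset.sum_le_card_nsmul _ _ (2 * g * (1 / ε)) fun l _ => ?_).trans ?_
  · rw [abs_mul, abs_of_nonneg (by positivity)]
    exact mul_le_mul_of_nonneg_left (abs_div_sq_add_le hε hε1) (by positivity)
  · rw [nsmul_eq_mul]
    refine mul_le_mul_of_nonneg_right ?_ (by positivity)
    exact_mod_cast (Finset.card_le_univ _).trans (by simp)

theorem hasDerivAt_rpow_mul_exp {b x : ℝ} (hx : 0 < x) :
    HasDerivAt (fun x => x ^ b * Real.exp (-x))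
      ((b * x ^ (b - 1) - x ^ b) * Real.exp (-x)) x := by
  have h := (Real.hasDerivAt_rpow_const (x := x) (p := b) (Or.inl hx.ne')).mul
    ((hasDerivAt_id x).neg.exp)
  convert! h using 1
  simp only [Pi.neg_apply, id]
  ring

theorem abs_deriv_rpow_mul_exp_le {b x : ℝ} (hb : b = 0 ∨ 1 ≤ b) (hx : 0 < x) :
    |(b * x ^ (b - 1) - x ^ b) * Real.exp (-x)| ≤ (b + 1) * expWeight ⌈b⌉₊ x := by
  have hb0 : 0 ≤ b := by rcases hb with h | h <;> linarith
  have h1 : x ^ b * Real.exp (-x) ≤ expWeight ⌈b⌉₊ x := rpow_mul_exp_le hb0 hx.le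
  have h2 : b * x ^ (b - 1) * Real.exp (-x) ≤ b * expWeight ⌈b⌉₊ x := by
    rcases hb with h | h
    · simp [h]
    · rw [mul_assoc]
      refine mul_le_mul_of_nonneg_left ?_ hb0
      exact (rpow_mul_exp_le (by linarith) hx.le).trans
        (expWeight_mono (Nat.ceil_mono (by linarith)) x)
  have h3 : 0 ≤ x ^ b * Real.exp (-x) := by positivity
  have h4 : 0 ≤ b * x ^ (b - 1) * Real.exp (-x) := by positivity
  rw [abs_le]
  constructor <;> nlinarith [expWeight_nonneg ⌈b⌉₊ x]

/-- The `u_i`-derivative of `u_i^b e^{-u_i}` times the remaining factors is integrated. Two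
exponents are used: `b = a + 1`, where the boundary factor `0 ^ b` vanishes, and `b = 0`, where it
is `1`. The alternative `b = 0 ∨ 1 ≤ b` keeps the derivative bounded near `0`. -/
theorem integral_laguerre_deriv (hg : 0 ≤ g) (hε : 0 < ε) (hε1 : ε ≤ 1) (ha : 0 ≤ a) {b : ℝ}
    (hb : b = 0 ∨ 1 ≤ b) (i : Fin (n + 1)) (K : Finset (Fin (n + 1))) (hi : i ∉ K) :
    ∫ u : Fin (n + 1) → ℝ, (if 0 < u i then
        (∏ j ∈ K, u j) * (∏ j ∈ ({i}ᶜ : Finset (Fin (n + 1))), lagWeight a (u j)) *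
        (((b * u i ^ (b - 1) - u i ^ b) * Real.exp (-u i) +
          (u i ^ b * Real.exp (-u i)) * regVandLogDeriv g ε i u) * regVand g ε u) else 0) =
      - ∫ r : Fin n → ℝ, (∏ j ∈ K, (i.insertNth 0 r : Fin (n + 1) → ℝ) j) *
        (∏ j ∈ ({i}ᶜ : Finset (Fin (n + 1))),
          lagWeight a ((i.insertNth 0 r : Fin (n + 1) → ℝ) j)) *
        ((0 : ℝ) ^ b * regVand g ε (i.insertNth 0 r : Fin (n + 1) → ℝ)) := by
  have hb0 : 0 ≤ b := by rcases hb with h | h <;> linarith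
  set S := regVandLogDeriv g ε i with hS
  -- Bounds for the derivative of the weight and for the logarithmic derivative of the product. It
  -- blows up as `ε → 0`, which is harmless because `ε` is fixed here.
  set A : ℝ := (b + 1) + (n + 1) * (2 * g * (1 / ε)) with hA
  have hA1 : 1 ≤ A := by
    have : 0 ≤ (n + 1) * (2 * g * (1 / ε)) := by positivity
    linarith
  set m := ⌈a⌉₊ + ⌈b⌉₊ with hm
  have key : ∀ (u : Fin (n + 1) → ℝ) (y : ℝ), |y| ≤ A * expWeight ⌈b⌉₊ (u i) →
      ‖(∏ j ∈ K, u j) * (∏ j ∈ ({i}ᶜ : Finset (Fin (n + 1))), lagWeight a (u j)) *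
        (y * regVand g ε u)‖ ≤
        A * ∏ j, expWeight (m + (1 + ⌈2 * g⌉₊ * (n + 1 - 1))) (u j) := by
    intro u y hy
    have h := lagIntegrand_le (w := fun j => if j = i then expWeight ⌈b⌉₊ (u i) else
      lagWeight a (u j)) (m := m) (u := u) hg hε.le hε1 ?_ ?_ K
    · refine le_trans ?_ (mul_le_mul_of_nonneg_left h (by linarith))
      have hpr : ∏ j, (if j = i then expWeight ⌈b⌉₊ (u i) else lagWeight a (u j)) =
          expWeight ⌈b⌉₊ (u i) *
            ∏ j ∈ ({i}ᶜ : Finset (Fin (n + 1))), lagWeight a (u j) := by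
        rw [← Finset.prod_mul_prod_compl {i}]
        simp only [Finset.prod_singleton, if_true]
        congr 1
        refine Finset.prod_congr rfl fun j hj => ?_
        rw [if_neg (by simpa using hj)]
      rw [hpr]
      simp only [Real.norm_eq_abs, abs_mul, abs_of_nonneg (expWeight_nonneg ⌈b⌉₊ (u i))]
      rw [show |∏ j ∈ K, u j| * |∏ j ∈ ({i}ᶜ : Finset (Fin (n + 1))), lagWeight a (u j)| *
        (|y| * |regVand g ε u|) = |y| * (|∏ j ∈ K, u j| *
          |∏ j ∈ ({i}ᶜ : Finset (Fin (n + 1))), lagWeight a (u j)| * |regVand g ε u|) by ring,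
        show A * (|∏ j ∈ K, u j| * (expWeight ⌈b⌉₊ (u i) *
          |∏ j ∈ ({i}ᶜ : Finset (Fin (n + 1))), lagWeight a (u j)|) * |regVand g ε u|) =
          A * expWeight ⌈b⌉₊ (u i) * (|∏ j ∈ K, u j| *
          |∏ j ∈ ({i}ᶜ : Finset (Fin (n + 1))), lagWeight a (u j)| * |regVand g ε u|) by ring]
      exact mul_le_mul_of_nonneg_right hy (by positivity)
    · intro j
      split_ifs
      · exact expWeight_nonneg _ _
      · exact lagWeight_nonneg _ _
    · intro j
      split_ifs with h
      · subst h; exact expWeight_mono (by omega) _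
      · exact (lagWeight_le ha _).trans (expWeight_mono (by omega) _)
  have hφ : ∀ x : ℝ, 0 < x → |x ^ b * Real.exp (-x)| ≤ expWeight ⌈b⌉₊ x := fun x hx => by
    rw [abs_of_nonneg (by positivity)]
    exact rpow_mul_exp_le hb0 hx.le
  have hcK : ∀ (u : Fin (n + 1) → ℝ) (x : ℝ),
      ∏ j ∈ K, Function.update u i x j = ∏ j ∈ K, u j := fun u x =>
    Finset.prod_congr rfl fun j hj =>
      Function.update_of_ne (ne_of_mem_of_not_mem hj hi) _ _
  have hcW : ∀ (u : Fin (n + 1) → ℝ) (x : ℝ),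
      ∏ j ∈ ({i}ᶜ : Finset (Fin (n + 1))), lagWeight a (Function.update u i x j) =
      ∏ j ∈ ({i}ᶜ : Finset (Fin (n + 1))), lagWeight a (u j) := fun u x =>
    Finset.prod_congr rfl fun j hj => by
      rw [Function.update_of_ne (by simpa using hj)]
  have hmain := integral_eq_neg_boundary i
    (H := fun u => if 0 < u i then
        (∏ j ∈ K, u j) * (∏ j ∈ ({i}ᶜ : Finset (Fin (n + 1))), lagWeight a (u j)) *
        (((b * u i ^ (b - 1) - u i ^ b) * Real.exp (-u i) +
          (u i ^ b * Real.exp (-u i)) * S u) * regVand g ε u) else 0)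
    (G := fun u => (∏ j ∈ K, u j) *
      (∏ j ∈ ({i}ᶜ : Finset (Fin (n + 1))), lagWeight a (u j)) *
        ((u i ^ b * Real.exp (-u i)) * regVand g ε u))
    (C := A) (M := m + (1 + ⌈2 * g⌉₊ * (n + 1 - 1))) ?_ ?_ ?_ ?_ ?_ ?_
  · rw [hmain]
    simp
  · refine Measurable.stronglyMeasurable ?_
    refine Measurable.ite (measurableSet_lt measurable_const (measurable_pi_apply i)) ?_
      measurable_const
    refine ((Finset.measurable_prod _ fun j _ => measurable_pi_apply j).mul
      (Finset.measurable_prod _ fun j _ => (measurable_lagWeight a).comp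
      (measurable_pi_apply j))).mul (Measurable.mul ?_ (continuous_regVand hg).measurable)
    have := measurable_regVandLogDeriv (g := g) (ε := ε) i
    fun_prop
  · intro u
    split_ifs with hu
    · refine key u _ ((abs_add_le _ _).trans ?_)
      have h1 := abs_deriv_rpow_mul_exp_le hb hu
      have h2 := abs_regVandLogDeriv_le hg hε hε1 i u
      rw [abs_mul (u i ^ b * _)]
      have h3 := mul_le_mul (hφ _ hu) h2 (abs_nonneg _) (expWeight_nonneg _ _)
      push_cast at h3
      rw [hA]
      linarith
    · rw [norm_zero]
      exact mul_nonneg (by linarith) (Finset.prod_nonneg fun _ _ => expWeight_nonneg _ _)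
  · intro u hu
    simp [hu.not_gt]
  · intro u hu
    refine key u _ ((hφ _ hu).trans ?_)
    exact le_mul_of_one_le_left (expWeight_nonneg _ _) hA1
  · intro u
    simp only [hcK, hcW, Function.update_self]
    refine continuous_const.mul (Continuous.mul ?_ ((continuous_regVand hg).comp
      (continuous_const.update i continuous_id)))
    exact (continuous_id.rpow_const fun _ => Or.inr hb0).mul (by fun_prop)
  · intro u hu
    simp only [hcK, hcW, Function.update_self, if_pos hu]
    have h1 := hasDerivAt_rpow_mul_exp (b := b) hu
    have h2 := hasDerivAt_regVand_update (g := g) hε u i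
    convert! (h1.mul h2).const_mul ((∏ j ∈ K, u j) *
      ∏ j ∈ ({i}ᶜ : Finset (Fin (n + 1))), lagWeight a (u j)) using 1
    simp only [Function.update_eq_self, hS, regVandLogDeriv]
    ring

end LaguerreIBP

/-! ### Aomoto's recursion. -/

section LaguerreRecurrence

variable {g ε a : ℝ} {n : ℕ}

theorem integral_lag_comp_perm (hg : 0 ≤ g) (hε : 0 ≤ ε) (σ : Equiv.Perm (Fin n))
    (f : (Fin n → ℝ) → ℝ) :
    ∫ u : Fin n → ℝ, (∏ j, lagWeight a (u j)) * regVand g ε u * f (fun j => u (σ j)) =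
      ∫ u : Fin n → ℝ, (∏ j, lagWeight a (u j)) * regVand g ε u * f u := by
  have h := integral_pi_comp_equiv (μ := volume) σ
    (fun u : Fin n → ℝ => (∏ j, lagWeight a (u j)) * regVand g ε u * f u)
  refine Eq.trans (integral_congr_ae (ae_of_all _ fun u => ?_)) h
  simp only
  rw [regVand_comp_perm hg hε, Equiv.prod_comp σ fun j => lagWeight a (u j)]

theorem abs_prod_mul_ratio_le (hg : 0 ≤ g) (hε : 0 < ε) (hε1 : ε ≤ 1) (K : Finset (Fin n))
    (i l : Fin n) (u : Fin n → ℝ) :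
    |(∏ j ∈ K, u j) * (u i * (2 * g * ((u i - u l) / ((u i - u l) ^ 2 + ε))))| ≤
      2 * g * (1 / ε) * ∏ j, (1 + |u j|) ^ 2 := by
  rw [abs_mul, abs_mul, abs_mul, abs_of_nonneg (show 0 ≤ 2 * g by linarith)]
  have h1 := prod_abs_le_prod_one_add K u
  have h2 : |u i| ≤ ∏ j, (1 + |u j|) := by linarith [one_add_abs_le_prod i u]
  have h3 := abs_div_sq_add_le (x := u i - u l) hε hε1
  have h0 : 0 ≤ ∏ j, (1 + |u j|) := by positivity
  calc _ ≤ (∏ j, (1 + |u j|)) * ((∏ j, (1 + |u j|)) * (2 * g * (1 / ε))) := by gcongr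
    _ = _ := by rw [Finset.prod_pow]; ring

/-- For `l ∈ K` the product `u_i ∏_K u_j` is unchanged when `i` and `l` are exchanged, while the
ratio changes sign. -/
theorem integral_ratio_mem (hg : 0 ≤ g) (hε : 0 < ε)
    {K : Finset (Fin n)} {i l : Fin n} (hi : i ∉ K) (hl : l ∈ K) :
    ∫ u : Fin n → ℝ, (∏ j, lagWeight a (u j)) * regVand g ε u *
      ((∏ j ∈ K, u j) * (u i * (2 * g * ((u i - u l) / ((u i - u l) ^ 2 + ε))))) = 0 := by
  have h := integral_lag_comp_perm (a := a) hg hε.le (Equiv.swap i l)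
    (fun u => (∏ j ∈ K, u j) * (u i * (2 * g * ((u i - u l) / ((u i - u l) ^ 2 + ε)))))
  have hneg : ∀ u : Fin n → ℝ, (fun u : Fin n → ℝ => (∏ j ∈ K, u j) *
        (u i * (2 * g * ((u i - u l) / ((u i - u l) ^ 2 + ε)))))
        (fun j => u (Equiv.swap i l j)) =
      - ((∏ j ∈ K, u j) * (u i * (2 * g * ((u i - u l) / ((u i - u l) ^ 2 + ε))))) := by
    intro u
    simp only [Equiv.swap_apply_left, Equiv.swap_apply_right]
    have h1 : (∏ j ∈ K, u (Equiv.swap i l j)) * u l = (∏ j ∈ K, u j) * u i := by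
      have h2 : ∏ j ∈ insert i K, u (Equiv.swap i l j) = ∏ j ∈ insert i K, u j := by
        refine Equiv.Perm.prod_comp _ _ (fun j => u j) fun x hx => ?_
        by_contra hx'
        refine hx (Equiv.swap_apply_of_ne_of_ne ?_ ?_)
        · rintro rfl; simp at hx'
        · rintro rfl; simp [hl] at hx'
      rw [Finset.prod_insert hi, Finset.prod_insert hi, Equiv.swap_apply_left] at h2
      linarith
    rw [← mul_assoc, h1, ← neg_sub (u i) (u l), neg_sq]
    ring
  simp_rw [hneg, mul_neg, integral_neg] at h
  linarith

/-- Averaging over the exchange of `i` and `l` replaces `u_i (u_i - u_l)` by half of `(u_i - u_l)²`,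
and this half turns `2 g` into `g`. -/
theorem integral_ratio_not_mem (hg : 0 ≤ g) (hε : 0 < ε) (hε1 : ε ≤ 1) (ha : 0 ≤ a)
    {K : Finset (Fin n)} {i l : Fin n} (hi : i ∉ K) (hl : l ∉ K) :
    ∫ u : Fin n → ℝ, (∏ j, lagWeight a (u j)) * regVand g ε u *
      ((∏ j ∈ K, u j) * (u i * (2 * g * ((u i - u l) / ((u i - u l) ^ 2 + ε))))) =
    g * ∫ u : Fin n → ℝ, (∏ j, lagWeight a (u j)) * regVand g ε u *
      ((∏ j ∈ K, u j) * ((u i - u l) ^ 2 / ((u i - u l) ^ 2 + ε))) := by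
  set f : (Fin n → ℝ) → ℝ := fun u =>
    (∏ j ∈ K, u j) * (u i * (2 * g * ((u i - u l) / ((u i - u l) ^ 2 + ε)))) with hf
  have h := integral_lag_comp_perm (a := a) hg hε.le (Equiv.swap i l) f
  have hprod : ∀ u : Fin n → ℝ, ∏ j ∈ K, u (Equiv.swap i l j) = ∏ j ∈ K, u j := fun u =>
    Finset.prod_congr rfl fun j hj => by
      rw [Equiv.swap_apply_of_ne_of_ne (ne_of_mem_of_not_mem hj hi)
        (ne_of_mem_of_not_mem hj hl)]
  have hfm : Measurable f := by rw [hf]; fun_prop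
  have hfi := integrable_lag_mul (a := a) hg hε.le hε1 ha hfm
    (abs_prod_mul_ratio_le hg hε hε1 K i l)
  have hfi' : Integrable fun u : Fin n → ℝ => (∏ j, lagWeight a (u j)) * regVand g ε u *
      f (fun j => u (Equiv.swap i l j)) := by
    refine integrable_lag_mul hg hε.le hε1 ha (by rw [hf]; fun_prop)
      (C := 2 * g * (1 / ε)) (p := 2) fun u => ?_
    have := abs_prod_mul_ratio_le hg hε hε1 K i l (fun j => u (Equiv.swap i l j))
    rwa [Equiv.prod_comp (Equiv.swap i l) fun j => (1 + |u j|) ^ 2] at this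
  have hsum := integral_add hfi hfi'
  rw [h] at hsum
  have : ∫ u : Fin n → ℝ, ((∏ j, lagWeight a (u j)) * regVand g ε u * f u +
      (∏ j, lagWeight a (u j)) * regVand g ε u * f (fun j => u (Equiv.swap i l j))) =
      2 * (g * ∫ u : Fin n → ℝ, (∏ j, lagWeight a (u j)) * regVand g ε u *
      ((∏ j ∈ K, u j) * ((u i - u l) ^ 2 / ((u i - u l) ^ 2 + ε)))) := by
    rw [← integral_const_mul, ← integral_const_mul]
    refine integral_congr_ae (ae_of_all _ fun u => ?_)
    simp only [hf, Equiv.swap_apply_left, Equiv.swap_apply_right, hprod]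
    rw [← neg_sub (u i) (u l), neg_sq]
    ring
  linarith

theorem regVand_zero_eq_zero (hg : 0 < g) {u : Fin n → ℝ} {i l : Fin n} (hil : i ≠ l)
    (h : u i = u l) : regVand g 0 u = 0 := by
  have hz : ((u i - u l) ^ 2 + 0) ^ g = 0 := by simp [h, hg.ne']
  have hz' : ((u l - u i) ^ 2 + 0) ^ g = 0 := by simp [h, hg.ne']
  unfold regVand pairProd
  rcases lt_or_gt_of_ne hil with h | h
  · exact Finset.prod_eq_zero (Finset.mem_univ i)
      (Finset.prod_eq_zero (Finset.mem_Ioi.2 h) hz)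
  · exact Finset.prod_eq_zero (Finset.mem_univ l)
      (Finset.prod_eq_zero (Finset.mem_Ioi.2 h) hz')

/-- The ratio tends to `1` off the diagonal `u i = u l`. On the diagonal it is zero, but there the
limiting Vandermonde product vanishes as well, since `g > 0`. -/
theorem tendsto_integral_ratio (hg : 0 < g) (ha : 0 ≤ a) (K : Finset (Fin n)) {i l : Fin n}
    (hil : i ≠ l) :
    Tendsto (fun ε => ∫ u : Fin n → ℝ, (∏ j, lagWeight a (u j)) * regVand g ε u *
      ((∏ j ∈ K, u j) * ((u i - u l) ^ 2 / ((u i - u l) ^ 2 + ε))))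
      (nhdsWithin 0 (Set.Ioc 0 1)) (nhds (lagIntegral g 0 a K)) := by
  have hmeas : ∀ ε, Measurable fun u : Fin n → ℝ => (∏ j, lagWeight a (u j)) * regVand g ε u *
      ((∏ j ∈ K, u j) * ((u i - u l) ^ 2 / ((u i - u l) ^ 2 + ε))) := by
    intro ε
    have hm := measurable_lagIntegrand (a := a) (ε := ε) hg.le (∅ : Finset (Fin n))
    simp only [Finset.prod_empty, one_mul] at hm
    exact hm.mul (by fun_prop)
  refine tendsto_integral_filter_of_dominated_convergence
    (fun u => ∏ j, expWeight (⌈a⌉₊ + (1 + ⌈2 * g⌉₊ * (n - 1))) (u j))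
    (Eventually.of_forall fun ε => (hmeas ε).aestronglyMeasurable) ?_
    (Integrable.fintype_prod fun _ => integrable_expWeight _) (ae_of_all _ fun u => ?_)
  · filter_upwards [self_mem_nhdsWithin] with ε hε
    refine ae_of_all _ fun u => ?_
    have h := lagIntegrand_le hg.le hε.1.le hε.2 (fun j => lagWeight_nonneg a (u j))
      (fun j => lagWeight_le ha _) K
    refine le_trans ?_ h
    have hε0 := hε.1
    have hle : (u i - u l) ^ 2 / ((u i - u l) ^ 2 + ε) ≤ 1 := by
      rw [div_le_one (by positivity)]; linarith
    have h0 : 0 ≤ (u i - u l) ^ 2 / ((u i - u l) ^ 2 + ε) := by positivity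
    rw [Real.norm_eq_abs, show (∏ j, lagWeight a (u j)) * regVand g ε u *
      ((∏ j ∈ K, u j) * ((u i - u l) ^ 2 / ((u i - u l) ^ 2 + ε))) =
      (∏ j ∈ K, u j) * (∏ j, lagWeight a (u j)) * regVand g ε u *
      ((u i - u l) ^ 2 / ((u i - u l) ^ 2 + ε)) by ring, abs_mul _ (_ / _), abs_of_nonneg h0]
    exact mul_le_of_le_one_right (abs_nonneg _) hle
  · have hV := ((continuous_regVand_eps hg.le u).tendsto 0).mono_left
      (nhdsWithin_le_nhds (s := Set.Ioc 0 1))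
    by_cases h : u i = u l
    · simp only [h, sub_self, ne_eq, OfNat.ofNat_ne_zero, not_false_eq_true, zero_pow, zero_div,
        mul_zero, regVand_zero_eq_zero hg hil h]
      exact tendsto_const_nhds
    · have hne : (u i - u l) ^ 2 ≠ 0 := pow_ne_zero _ (sub_ne_zero.2 h)
      have hr : Tendsto (fun ε : ℝ => (u i - u l) ^ 2 / ((u i - u l) ^ 2 + ε))
          (nhdsWithin 0 (Set.Ioc 0 1)) (nhds ((u i - u l) ^ 2 / ((u i - u l) ^ 2 + 0))) :=
        (tendsto_const_nhds.div (tendsto_const_nhds.add tendsto_id) (by simpa using hne)).mono_left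
          nhdsWithin_le_nhds
      rw [add_zero, div_self hne] at hr
      convert! (hV.const_mul (∏ j, lagWeight a (u j))).mul (hr.const_mul (∏ j ∈ K, u j)) using 2
      ring

/-- Integration by parts with `b = a + 1`: the weight yields `a + 1` and the factor `-u_i`, and each
of the `n - |K|` other indices outside `K` yields `g` in the limit `ε → 0`. Indices in `K`
contribute nothing. -/
theorem lagIntegral_insert (hg : 0 < g) (ha : 0 ≤ a) {K : Finset (Fin (n + 1))}
    {i : Fin (n + 1)} (hi : i ∉ K) :
    lagIntegral g 0 a (insert i K) =
      (a + 1 + g * (n - K.card : ℝ)) * lagIntegral g 0 a K := by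
  set Rl : Fin (n + 1) → ℝ → ℝ := fun l ε =>
    ∫ u : Fin (n + 1) → ℝ, (∏ j, lagWeight a (u j)) * regVand g ε u *
      ((∏ j ∈ K, u j) * ((u i - u l) ^ 2 / ((u i - u l) ^ 2 + ε))) with hRl
  have hreg : ∀ ε ∈ Set.Ioc (0 : ℝ) 1, (a + 1) * lagIntegral g ε a K -
      lagIntegral g ε a (insert i K) +
      ∑ l ∈ ({i}ᶜ : Finset (Fin (n + 1))), (if l ∈ K then 0 else g * Rl l ε) = 0 := by
    rintro ε ⟨hε, hε1⟩
    have h := integral_laguerre_deriv hg.le hε hε1 ha (b := a + 1) (Or.inr (by linarith)) i K hi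
    rw [Real.zero_rpow (by linarith)] at h
    simp only [zero_mul, mul_zero, integral_zero, neg_zero] at h
    have hI : ∀ L : Finset (Fin (n + 1)), Integrable fun u : Fin (n + 1) → ℝ =>
        (∏ j, lagWeight a (u j)) * regVand g ε u * ∏ j ∈ L, u j := fun L =>
      integrable_lag_mul hg.le hε.le hε1 ha (by fun_prop) (C := 1) (p := 1) fun u => by
        simpa using prod_abs_le_prod_one_add L u
    have hL : ∀ L : Finset (Fin (n + 1)), lagIntegral g ε a L = ∫ u : Fin (n + 1) → ℝ,
        (∏ j, lagWeight a (u j)) * regVand g ε u * ∏ j ∈ L, u j := fun L =>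
      integral_congr_ae (ae_of_all _ fun u => by simp only; ring)
    have hT : ∀ l : Fin (n + 1), Integrable fun u : Fin (n + 1) → ℝ =>
        (∏ j, lagWeight a (u j)) * regVand g ε u *
        ((∏ j ∈ K, u j) * (u i * (2 * g * ((u i - u l) / ((u i - u l) ^ 2 + ε))))) := fun l =>
      integrable_lag_mul hg.le hε.le hε1 ha (by fun_prop)
        (abs_prod_mul_ratio_le hg.le hε hε1 K i l)
    have hTv : ∀ l ∈ ({i}ᶜ : Finset (Fin (n + 1))), (if l ∈ K then 0 else g * Rl l ε) =
        ∫ u : Fin (n + 1) → ℝ, (∏ j, lagWeight a (u j)) * regVand g ε u *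
        ((∏ j ∈ K, u j) * (u i * (2 * g * ((u i - u l) / ((u i - u l) ^ 2 + ε))))) := by
      intro l _
      split_ifs with hl
      · exact (integral_ratio_mem hg.le hε hi hl).symm
      · exact (integral_ratio_not_mem hg.le hε hε1 ha hi hl).symm
    have hI2 : Integrable fun u : Fin (n + 1) → ℝ =>
        (a + 1) * ((∏ j, lagWeight a (u j)) * regVand g ε u * ∏ j ∈ K, u j) -
        (∏ j, lagWeight a (u j)) * regVand g ε u * ∏ j ∈ insert i K, u j :=
      ((hI K).const_mul _).sub (hI _)
    rw [Finset.sum_congr rfl hTv, ← integral_finsetSum _ fun l _ => hT l, hL, hL,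
      ← integral_const_mul, ← integral_sub ((hI K).const_mul _) (hI _),
      ← integral_add hI2 (integrable_finsetSum _ fun l _ => hT l),
      ← h]
    refine integral_congr_ae (ae_of_all _ fun u => ?_)
    simp only
    rw [Finset.prod_insert hi, ← Finset.prod_mul_prod_compl {i} fun j => lagWeight a (u j),
      Finset.prod_singleton, ← Finset.mul_sum, ← Finset.mul_sum, ← Finset.mul_sum,
      ← regVandLogDeriv]
    split_ifs with hu
    · rw [lagWeight, if_pos hu, add_sub_cancel_right, Real.rpow_add_one hu.ne']
      ring
    · rw [lagWeight, if_neg hu]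
      ring
  have hlim : Tendsto (fun ε => (a + 1) * lagIntegral g ε a K -
      lagIntegral g ε a (insert i K) +
      ∑ l ∈ ({i}ᶜ : Finset (Fin (n + 1))), (if l ∈ K then 0 else g * Rl l ε))
      (nhdsWithin 0 (Set.Ioc 0 1)) (nhds ((a + 1) * lagIntegral g 0 a K -
      lagIntegral g 0 a (insert i K) +
      ∑ l ∈ ({i}ᶜ : Finset (Fin (n + 1))), (if l ∈ K then 0 else g * lagIntegral g 0 a K))) := by
    refine (((tendsto_lagIntegral hg.le ha K).const_mul _).sub
      (tendsto_lagIntegral hg.le ha _)).add (tendsto_finsetSum _ fun l hl => ?_)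
    split_ifs with hlK
    · exact tendsto_const_nhds
    · exact (tendsto_integral_ratio hg ha K (by
        rintro rfl; simp at hl)).const_mul g
  have hne : (nhdsWithin (0 : ℝ) (Set.Ioc 0 1)).NeBot :=
    left_nhdsWithin_Ioc_neBot zero_lt_one
  have hzero := tendsto_nhds_unique hlim
    (tendsto_const_nhds.congr' (f₁ := fun _ => (0 : ℝ)) (by
      filter_upwards [self_mem_nhdsWithin] with ε hε
      exact (hreg ε hε).symm))
  have hcard : ∑ l ∈ ({i}ᶜ : Finset (Fin (n + 1))),
      (if l ∈ K then 0 else g * lagIntegral g 0 a K) =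
      (n - K.card : ℝ) * (g * lagIntegral g 0 a K) := by
    simp_rw [← ite_not (_ ∈ K)]
    rw [← Finset.sum_filter, Finset.sum_const, nsmul_eq_mul]
    congr 1
    have h1 : ({i}ᶜ : Finset (Fin (n + 1))).filter (fun l => l ∉ K) = (insert i K)ᶜ := by
      ext; simp
    rw [h1, Finset.card_compl, Finset.card_insert_of_notMem hi, Fintype.card_fin]
    have h2 : (insert i K).card ≤ n + 1 := by simpa using Finset.card_le_univ (insert i K)
    rw [Finset.card_insert_of_notMem hi] at h2
    rw [Nat.add_sub_add_right, Nat.cast_sub (by omega)]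
  rw [hcard] at hzero
  linarith

theorem lagIntegral_eq_prod_mul (hg : 0 < g) (ha : 0 ≤ a) (K : Finset (Fin (n + 1))) :
    lagIntegral g 0 a K =
      (∏ m ∈ Finset.range K.card, (a + 1 + g * (n - m : ℝ))) *
        lagIntegral g 0 a (∅ : Finset (Fin (n + 1))) := by
  induction K using Finset.induction_on with
  | empty => simp
  | insert i K hi ih =>
    rw [lagIntegral_insert hg ha hi, ih, Finset.card_insert_of_notMem hi,
      Finset.prod_range_succ]
    ring

/-- Inserting all indices one after another multiplies the weight of every variable by `u_j`, that
is, raises `a` by one. -/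
theorem lagIntegral_add_one (hg : 0 < g) (ha : 0 ≤ a) :
    lagIntegral g 0 (a + 1) (∅ : Finset (Fin n)) =
      (∏ m ∈ Finset.range n, (a + 1 + g * m)) *
        lagIntegral g 0 a (∅ : Finset (Fin n)) := by
  cases n with
  | zero => simp [lagIntegral]
  | succ n =>
    have h := lagIntegral_eq_prod_mul hg ha (Finset.univ : Finset (Fin (n + 1)))
    rw [Finset.card_univ, Fintype.card_fin] at h
    rw [← Finset.prod_range_reflect]
    convert! h using 1
    · unfold lagIntegral
      refine integral_congr_ae (ae_of_all _ fun u => ?_)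
      simp only [Finset.prod_empty, one_mul, ← Finset.prod_mul_distrib, mul_lagWeight]
    · congr 1
      refine Finset.prod_congr rfl fun m hm => ?_
      have := Finset.mem_range.1 hm
      rw [Nat.add_sub_cancel, Nat.cast_sub (by omega)]

end LaguerreRecurrence

theorem pairProd_const {A : Type*} [CommMonoid A] (n : ℕ) (c : A) :
    pairProd (fun _ _ : Fin n => c) = c ^ n.choose 2 := by
  unfold pairProd
  simp only [Finset.prod_const, Fin.card_Ioi]
  rw [Finset.prod_pow_eq_pow_sum, Fin.sum_univ_eq_sum_range fun j => n - 1 - j,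
    Finset.sum_range_reflect fun j => j, Finset.sum_range_id, Nat.choose_two_right]

/-! ### The boundary relation at exponent zero. -/

section LaguerreBoundary

variable {g ε a : ℝ} {n : ℕ}

theorem pairProd_cons {A : Type*} [CommMonoid A] (F : Fin (n + 1) → Fin (n + 1) → A) :
    pairProd F = (∏ k : Fin n, F 0 k.succ) * pairProd fun j k : Fin n => F j.succ k.succ := by
  unfold pairProd
  rw [Fin.prod_univ_succ]
  simp

theorem regVand_insertNth_zero (r : Fin n → ℝ) :
    regVand g ε (Fin.insertNth 0 0 r : Fin (n + 1) → ℝ) =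
      (∏ k, ((r k) ^ 2 + ε) ^ g) * regVand g ε r := by
  unfold regVand
  rw [pairProd_cons]
  simp

theorem integral_logDeriv_eq_zero (hg : 0 ≤ g) (hε : 0 < ε) (hε1 : ε ≤ 1) (ha : 0 ≤ a)
    (i : Fin n) :
    ∫ u : Fin n → ℝ, (∏ j, lagWeight a (u j)) * regVand g ε u * regVandLogDeriv g ε i u = 0 := by
  unfold regVandLogDeriv
  simp_rw [Finset.mul_sum]
  rw [integral_finsetSum]
  · refine Finset.sum_eq_zero fun l _ => ?_
    have h := integral_lag_comp_perm (a := a) hg hε.le (Equiv.swap i l)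
      (fun u => 2 * g * ((u i - u l) / ((u i - u l) ^ 2 + ε)))
    have hneg : ∀ u : Fin n → ℝ,
        2 * g * ((u l - u i) / ((u l - u i) ^ 2 + ε)) =
        -(2 * g * ((u i - u l) / ((u i - u l) ^ 2 + ε))) := fun u => by
      rw [← neg_sub (u i) (u l), neg_sq]; ring
    simp only [Equiv.swap_apply_left, Equiv.swap_apply_right] at h
    simp_rw [hneg, mul_neg, integral_neg] at h
    linarith
  · intro l _
    refine integrable_lag_mul hg hε.le hε1 ha (by fun_prop) (C := 2 * g * (1 / ε)) (p := 0)
      fun u => ?_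
    rw [abs_mul, abs_of_nonneg (by positivity)]
    simpa using mul_le_mul_of_nonneg_left (abs_div_sq_add_le (x := u i - u l) hε hε1)
      (show 0 ≤ 2 * g by linarith)

/-- For `a = b = 0` the derivative of `e^{-u_0}` reproduces the integrand up to sign, and the
logarithmic derivative integrates to zero by antisymmetry. What remains is the value at `u_0 = 0`,
where each other variable acquires a factor `(r_k² + ε)^g`. -/
theorem lagIntegral_zero_eq_boundary (hg : 0 ≤ g) (hε : 0 < ε) (hε1 : ε ≤ 1) :
    lagIntegral g ε 0 (∅ : Finset (Fin (n + 1))) =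
      ∫ r : Fin n → ℝ, (∏ j, lagWeight 0 (r j) * ((r j) ^ 2 + ε) ^ g) * regVand g ε r := by
  have h := integral_laguerre_deriv hg hε hε1 le_rfl (b := 0) (Or.inl rfl) (0 : Fin (n + 1)) ∅
    (by simp)
  have h1 : ∀ r : Fin n → ℝ, ∏ j ∈ ({0}ᶜ : Finset (Fin (n + 1))),
      lagWeight 0 ((Fin.insertNth 0 0 r : Fin (n + 1) → ℝ) j) = ∏ j, lagWeight 0 (r j) := by
    intro r
    rw [← Fin.image_succ_univ, Finset.prod_image fun _ _ _ _ h => Fin.succ_injective _ h]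
    simp
  simp only [h1, regVand_insertNth_zero, Finset.prod_empty, one_mul, Real.rpow_zero] at h
  have h2 := integral_logDeriv_eq_zero (a := 0) hg hε hε1 le_rfl (0 : Fin (n + 1))
  have hI : Integrable fun u : Fin (n + 1) → ℝ =>
      (∏ j, lagWeight 0 (u j)) * regVand g ε u * regVandLogDeriv g ε 0 u :=
    integrable_lag_mul hg hε.le hε1 le_rfl (measurable_regVandLogDeriv 0) (p := 0) fun u => by
      simpa using abs_regVandLogDeriv_le hg hε hε1 0 u
  have hI' : Integrable fun u : Fin (n + 1) → ℝ =>
      (∏ j, lagWeight 0 (u j)) * regVand g ε u * 1 :=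
    integrable_lag_mul hg hε.le hε1 le_rfl measurable_const (C := 1) (p := 0) fun u => by simp
  have h3 := integral_sub hI' hI
  rw [h2, sub_zero] at h3
  have h4 : lagIntegral g ε 0 (∅ : Finset (Fin (n + 1))) =
      ∫ u : Fin (n + 1) → ℝ, (∏ j, lagWeight 0 (u j)) * regVand g ε u * 1 :=
    integral_congr_ae (ae_of_all _ fun u => by simp)
  rw [h4, ← h3, ← neg_inj, ← integral_neg]
  refine Eq.trans (integral_congr_ae (ae_of_all _ fun u => ?_)) (h.trans ?_)
  · simp only
    rw [← Finset.prod_mul_prod_compl {0} fun j => lagWeight 0 (u j), Finset.prod_singleton]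
    split_ifs with hu
    · rw [lagWeight, if_pos hu, Real.rpow_zero]; ring
    · rw [lagWeight, if_neg hu]; ring
  · rw [neg_inj]
    refine integral_congr_ae (ae_of_all _ fun u => ?_)
    simp only
    rw [Finset.prod_mul_distrib]; ring

/-- In the limit `ε → 0` the boundary factors become `r_k^{2g}` and merge with the weight: one
variable is traded for the exponent `2 g`. -/
theorem lagIntegral_zero_succ (hg : 0 < g) :
    lagIntegral g 0 0 (∅ : Finset (Fin (n + 1))) =
      lagIntegral g 0 (2 * g) (∅ : Finset (Fin n)) := by
  have h1 := tendsto_lagIntegral (n := n + 1) hg.le le_rfl (∅ : Finset (Fin (n + 1))) (a := 0)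
  have h2 : Tendsto (fun ε => ∫ r : Fin n → ℝ,
      (∏ j, lagWeight 0 (r j) * ((r j) ^ 2 + ε) ^ g) * regVand g ε r)
      (nhdsWithin 0 (Set.Ioc 0 1)) (nhds (∫ r : Fin n → ℝ,
      (∏ j, lagWeight 0 (r j) * ((r j) ^ 2 + 0) ^ g) * regVand g 0 r)) := by
    have hcont : ∀ x : ℝ, Continuous fun ε : ℝ => (x ^ 2 + ε) ^ g := fun x =>
      Continuous.rpow_const (by fun_prop) fun _ => Or.inr hg.le
    refine tendsto_integral_filter_of_dominated_convergence
      (fun u => ∏ j, expWeight (⌈2 * g⌉₊ + (1 + ⌈2 * g⌉₊ * (n - 1))) (u j))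
      (Eventually.of_forall fun ε => ?_) ?_
      (Integrable.fintype_prod fun _ => integrable_expWeight _) (ae_of_all _ fun u => ?_)
    · refine (Measurable.mul (Finset.measurable_prod _ fun j _ => ?_)
        (continuous_regVand hg.le).measurable).aestronglyMeasurable
      have := (measurable_lagWeight 0).comp (measurable_pi_apply (X := fun _ : Fin n => ℝ) j)
      exact this.mul (by fun_prop)
    · filter_upwards [self_mem_nhdsWithin] with ε hε
      refine ae_of_all _ fun u => ?_
      have h := lagIntegrand_le (u := u) (w := fun j => lagWeight 0 (u j) * ((u j) ^ 2 + ε) ^ g)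
        (m := ⌈2 * g⌉₊) hg.le hε.1.le hε.2 (fun j => mul_nonneg (lagWeight_nonneg _ _)
          (Real.rpow_nonneg (by have := hε.1; positivity) _)) (fun j => ?_) ∅
      · rw [Finset.prod_empty, one_mul] at h
        exact h
      · have h1 := sq_sub_add_rpow_le hg.le hε.1.le hε.2 (u j) 0
        simp only [sub_zero, abs_zero, add_zero, one_pow, mul_one] at h1
        have h2 := lagWeight_le le_rfl (u j)
        rw [Nat.ceil_zero] at h2
        have h3 := expWeight_mul_pow 0 ⌈2 * g⌉₊ (u j)
        rw [zero_add] at h3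
        rw [← h3]
        exact mul_le_mul h2 h1 (Real.rpow_nonneg (by have := hε.1; positivity) _)
          (expWeight_nonneg _ _)
    · refine Tendsto.mono_left (Continuous.tendsto ?_ 0) nhdsWithin_le_nhds
      exact (continuous_finsetProd _ fun j _ => continuous_const.mul (hcont _)).mul
        (continuous_regVand_eps hg.le u)
  have hne : (nhdsWithin (0 : ℝ) (Set.Ioc 0 1)).NeBot :=
    left_nhdsWithin_Ioc_neBot zero_lt_one
  rw [tendsto_nhds_unique (h1.congr' (by
    filter_upwards [self_mem_nhdsWithin] with ε hε
    exact lagIntegral_zero_eq_boundary hg.le hε.1 hε.2)) h2]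
  refine integral_congr_ae (ae_of_all _ fun u => ?_)
  simp only [Finset.prod_empty, one_mul]
  congr 1
  refine Finset.prod_congr rfl fun j _ => ?_
  unfold lagWeight
  split_ifs with h
  · rw [add_zero, ← Real.rpow_natCast, ← Real.rpow_mul h.le, Real.rpow_zero]
    push_cast; ring
  · simp

end LaguerreBoundary

/-! ### The Gaussian limit of the Laguerre integral. -/

section LaguerreLimit

/-- For `s ≥ 0` this is `y ≤ sinh y` at `y = log (1 + s)`; for `s ≤ 0` it comes from the first two
terms of the logarithmic series. The denominator `1 + |s|` makes the bound strong enough to dominate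
the rescaled weight uniformly by `e^{-|y|}`. -/
theorem log_one_add_sub_le {s : ℝ} (hs : -1 < s) :
    Real.log (1 + s) - s ≤ -(s ^ 2 / (2 * (1 + |s|))) := by
  rcases le_total 0 s with h | h
  · rw [abs_of_nonneg h]
    have h1 : 0 < 1 + s := by linarith
    have h2 := Real.self_le_sinh_iff.2 (Real.log_nonneg (by linarith : 1 ≤ 1 + s))
    rw [Real.sinh_eq, Real.exp_neg, Real.exp_log h1] at h2
    have h3 : s - s ^ 2 / (2 * (1 + s)) = ((1 + s) - (1 + s)⁻¹) / 2 := by field_simp; ring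
    linarith
  · have h0 : |(-s)| < 1 := by rw [abs_neg, abs_of_nonpos h]; linarith
    have h1 := Real.hasSum_pow_div_log_of_abs_lt_one h0
    have h2 := sum_le_hasSum (Finset.range 2) (fun i _ => by
      have : 0 ≤ -s := by linarith
      positivity) h1
    simp only [Finset.sum_range_succ, Finset.sum_range_zero] at h2
    norm_num at h2
    have h3 : s ^ 2 / (2 * (1 + |s|)) ≤ s ^ 2 / 2 := by
      apply div_le_div_of_nonneg_left (sq_nonneg _) (by norm_num)
      linarith [abs_nonneg s]
    linarith

/-- The Laguerre weight, centred at its maximum and rescaled. -/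
noncomputable def scaledLagWeight (a y : ℝ) : ℝ :=
  lagWeight a (a + Real.sqrt (2 * a) * y) / (a ^ a * Real.exp (-a))

variable {a : ℝ}

theorem add_sqrt_mul_eq (ha : 0 < a) (y : ℝ) :
    a + Real.sqrt (2 * a) * y = a * (1 + Real.sqrt (2 / a) * y) := by
  have : Real.sqrt (2 * a) = a * Real.sqrt (2 / a) := by
    rw [show 2 * a = a ^ 2 * (2 / a) by field_simp, Real.sqrt_mul (by positivity),
      Real.sqrt_sq ha.le]
  rw [this]; ring

theorem scaledLagWeight_eq (ha : 0 < a) {y : ℝ} (hy : -1 < Real.sqrt (2 / a) * y) :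
    scaledLagWeight a y =
      Real.exp (a * (Real.log (1 + Real.sqrt (2 / a) * y) - Real.sqrt (2 / a) * y)) := by
  set s := Real.sqrt (2 / a) * y with hs
  have h1 : 0 < 1 + s := by linarith
  unfold scaledLagWeight lagWeight
  rw [add_sqrt_mul_eq ha, ← hs, if_pos (by positivity), Real.mul_rpow ha.le h1.le,
    div_eq_iff (by positivity), Real.rpow_def_of_pos h1, mul_comm (Real.exp _),
    mul_assoc, mul_assoc, ← Real.exp_add, ← Real.exp_add]
  congr 2
  ring

theorem scaledLagWeight_nonneg (ha : 0 < a) (y : ℝ) : 0 ≤ scaledLagWeight a y :=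
  div_nonneg (lagWeight_nonneg _ _) (by positivity)

theorem scaledLagWeight_le (ha : 2 ≤ a) (y : ℝ) :
    scaledLagWeight a y ≤ Real.exp 1 * expWeight 0 y := by
  have ha0 : 0 < a := by linarith
  rcases lt_or_ge (-1) (Real.sqrt (2 / a) * y) with h | h
  · rw [scaledLagWeight_eq ha0 h]
    set s := Real.sqrt (2 / a) * y with hs
    unfold expWeight
    rw [pow_zero, mul_one, ← Real.exp_add]
    refine Real.exp_le_exp.2 ?_
    have h1 := mul_le_mul_of_nonneg_left (log_one_add_sub_le h) ha0.le
    have hs2 : a * s ^ 2 = 2 * y ^ 2 := by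
      rw [hs, mul_pow, Real.sq_sqrt (by positivity)]; field_simp
    -- This is where `a ≥ 2` enters.
    have hsy : |s| ≤ |y| := by
      rw [hs, abs_mul, abs_of_nonneg (Real.sqrt_nonneg _)]
      refine mul_le_of_le_one_left (abs_nonneg _) ?_
      exact Real.sqrt_le_one.2 ((div_le_one ha0).2 ha)
    have h2 : a * -(s ^ 2 / (2 * (1 + |s|))) = - (y ^ 2 / (1 + |s|)) := by
      rw [mul_neg, ← mul_div_assoc, hs2, mul_div_mul_left _ _ two_ne_zero]
    have h3 : y ^ 2 / (1 + |y|) ≤ y ^ 2 / (1 + |s|) := by gcongr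
    have h4 : |y| - 1 ≤ y ^ 2 / (1 + |y|) := by
      rw [le_div_iff₀ (by positivity), ← sq_abs y]; nlinarith
    linarith
  · have : scaledLagWeight a y = 0 := by
      unfold scaledLagWeight lagWeight
      rw [add_sqrt_mul_eq ha0, if_neg (by nlinarith), zero_div]
    rw [this]
    exact mul_nonneg (Real.exp_pos _).le (expWeight_nonneg _ _)

theorem tendsto_scaledLagWeight (y : ℝ) :
    Tendsto (fun a => scaledLagWeight a y) atTop (nhds (Real.exp (-y ^ 2))) := by
  have hs0 : Tendsto (fun a : ℝ => Real.sqrt (2 / a) * y) atTop (nhds 0) := by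
    have h1 : Tendsto (fun a : ℝ => 2 / a) atTop (nhds 0) := tendsto_const_nhds.div_atTop tendsto_id
    have h2 := (Real.continuous_sqrt.tendsto 0).comp h1
    rw [Real.sqrt_zero] at h2
    simpa using h2.mul_const y
  have habs : Tendsto (fun a : ℝ => |Real.sqrt (2 / a) * y|) atTop (nhds 0) := by
    simpa using hs0.abs
  have hlim : Tendsto (fun a : ℝ => a * (Real.log (1 + Real.sqrt (2 / a) * y) -
      Real.sqrt (2 / a) * y)) atTop (nhds (-y ^ 2)) := by
    have hb : Tendsto (fun a : ℝ => 2 * y ^ 2 * (|Real.sqrt (2 / a) * y| /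
        (1 - |Real.sqrt (2 / a) * y|))) atTop (nhds 0) := by
      have h1 : Tendsto (fun a : ℝ => 1 - |Real.sqrt (2 / a) * y|) atTop (nhds (1 - 0)) :=
        tendsto_const_nhds.sub habs
      simpa using (habs.div h1 (by norm_num)).const_mul (2 * y ^ 2)
    rw [tendsto_iff_norm_sub_tendsto_zero]
    refine squeeze_zero' (Eventually.of_forall fun _ => norm_nonneg _) ?_ hb
    filter_upwards [eventually_gt_atTop 0, habs.eventually (gt_mem_nhds one_pos)] with a ha has
    set s := Real.sqrt (2 / a) * y with hs
    have h := Real.abs_log_sub_add_sum_range_le (x := -s) (by rwa [abs_neg]) 2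
    simp only [Finset.sum_range_succ, Finset.sum_range_zero, abs_neg] at h
    norm_num at h
    have hs2 : a * s ^ 2 = 2 * y ^ 2 := by
      rw [hs, mul_pow, Real.sq_sqrt (by positivity)]; field_simp
    have h5 : a * (Real.log (1 + s) - s) - -y ^ 2 = a * (-s + s ^ 2 / 2 + Real.log (1 + s)) := by
      linear_combination (-1 / 2) * hs2
    rw [Real.norm_eq_abs, h5, abs_mul, abs_of_pos ha]
    refine (mul_le_mul_of_nonneg_left h ha.le).trans (le_of_eq ?_)
    rw [← hs2, ← sq_abs s]; ring
  refine (Real.continuous_exp.tendsto _ |>.comp hlim).congr' ?_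
  filter_upwards [eventually_gt_atTop 0, hs0.eventually (lt_mem_nhds (by norm_num : (-1 : ℝ) < 0))]
    with a ha has
  exact (scaledLagWeight_eq ha has).symm

/-- The Mehta integral with exponent `2 g`. -/
noncomputable def gaussVandIntegral (g : ℝ) (n : ℕ) : ℝ :=
  ∫ u : Fin n → ℝ, (∏ j, Real.exp (-(u j) ^ 2)) * regVand g 0 u

variable {g : ℝ} {n : ℕ}

theorem regVand_affine (ha : 0 ≤ a) (b : ℝ) (y : Fin n → ℝ) :
    regVand g 0 (fun j => b + Real.sqrt (2 * a) * y j) =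
      ((2 * a) ^ g) ^ n.choose 2 * regVand g 0 y := by
  unfold regVand
  rw [← pairProd_const, ← pairProd_mul]
  refine pairProd_congr fun j k _ => ?_
  rw [← Real.mul_rpow (by positivity) (by positivity)]
  congr 1
  rw [show b + Real.sqrt (2 * a) * y j - (b + Real.sqrt (2 * a) * y k) =
    Real.sqrt (2 * a) * (y j - y k) by ring, mul_pow, Real.sq_sqrt (by positivity)]
  ring

/-- The substitution `u = a + √(2a) y` recentres `x^a e^{-x}` at its maximum `x = a`, in the scale
in which it tends to `e^{-y²}`. Each variable contributes a Jacobian `√(2a)` and each pair a factor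
`(2a)^g`. -/
theorem lagIntegral_eq_scaled (ha : 0 < a) :
    lagIntegral g 0 a (∅ : Finset (Fin n)) =
      (Real.sqrt (2 * a) * (a ^ a * Real.exp (-a))) ^ n * ((2 * a) ^ g) ^ n.choose 2 *
        ∫ y : Fin n → ℝ, (∏ j, scaledLagWeight a (y j)) * regVand g 0 y := by
  set F : (Fin n → ℝ) → ℝ := fun u => (∏ j, lagWeight a (u j)) * regVand g 0 u with hF
  have h0 : lagIntegral g 0 a (∅ : Finset (Fin n)) = ∫ u, F u := by
    simp [lagIntegral, hF]
  have hs : 0 < Real.sqrt (2 * a) := by positivity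
  have h1 : ∫ y : Fin n → ℝ, F ((fun _ => a) + Real.sqrt (2 * a) • y) =
      |((Real.sqrt (2 * a)) ^ n)⁻¹| * ∫ u, F u := by
    have h2 := Measure.integral_comp_smul (volume : Measure (Fin n → ℝ))
      (fun u => F ((fun _ => a) + u)) (Real.sqrt (2 * a))
    rw [h2, integral_add_left_eq_self F, Module.finrank_fin_fun, smul_eq_mul]
  rw [abs_of_pos (by positivity)] at h1
  have h3 : ∫ u, F u = (Real.sqrt (2 * a)) ^ n *
      ∫ y : Fin n → ℝ, F ((fun _ => a) + Real.sqrt (2 * a) • y) := by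
    rw [h1]; field_simp
  rw [h0, h3, mul_pow, mul_assoc, mul_assoc]
  congr 1
  rw [← mul_assoc, ← integral_const_mul]
  refine integral_congr_ae (ae_of_all _ fun y => ?_)
  have h4 := regVand_affine (g := g) ha.le a y
  simp only [hF, Pi.add_apply, Pi.smul_apply, smul_eq_mul]
  rw [show ((fun _ => a) + Real.sqrt (2 * a) • y : Fin n → ℝ) =
    fun j => a + Real.sqrt (2 * a) * y j from rfl, h4]
  unfold scaledLagWeight
  rw [Finset.prod_div_distrib, Finset.prod_const, Finset.card_univ, Fintype.card_fin]
  field_simp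

theorem tendsto_integral_scaledLagWeight (hg : 0 ≤ g) :
    Tendsto (fun a => ∫ y : Fin n → ℝ, (∏ j, scaledLagWeight a (y j)) * regVand g 0 y) atTop
      (nhds (gaussVandIntegral g n)) := by
  refine tendsto_integral_filter_of_dominated_convergence
    (fun u => ∏ j, Real.exp 1 * expWeight (⌈2 * g⌉₊ * (n - 1)) (u j))
    (Eventually.of_forall fun a => ?_) ?_
    (Integrable.fintype_prod fun _ => (integrable_expWeight _).const_mul _)
    (ae_of_all _ fun u => ?_)
  · refine (Measurable.mul (Finset.measurable_prod _ fun j _ => ?_)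
      (continuous_regVand hg).measurable).aestronglyMeasurable
    unfold scaledLagWeight
    exact ((measurable_lagWeight a).comp (by fun_prop)).div_const _
  · filter_upwards [eventually_ge_atTop 2] with a ha
    refine ae_of_all _ fun u => ?_
    have h1 : ∏ j, scaledLagWeight a (u j) ≤ ∏ j, Real.exp 1 * expWeight 0 (u j) :=
      Finset.prod_le_prod (fun j _ => scaledLagWeight_nonneg (by linarith) _)
        fun j _ => scaledLagWeight_le ha _
    have h2 : 0 ≤ ∏ j, scaledLagWeight a (u j) :=
      Finset.prod_nonneg fun j _ => scaledLagWeight_nonneg (by linarith) _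
    rw [Real.norm_of_nonneg (mul_nonneg h2 (regVand_nonneg le_rfl u))]
    refine (mul_le_mul h1 (regVand_le hg le_rfl zero_le_one u) (regVand_nonneg le_rfl u)
      (h2.trans h1)).trans (le_of_eq ?_)
    rw [← Finset.prod_mul_distrib]
    refine Finset.prod_congr rfl fun j _ => ?_
    rw [mul_assoc, expWeight_mul_pow, zero_add]
  · exact (tendsto_finsetProd _ fun j _ => tendsto_scaledLagWeight (u j)).mul_const _

theorem lagIntegral_one (ha : 0 < a) :
    lagIntegral g 0 a (∅ : Finset (Fin 1)) = Real.Gamma (a + 1) := by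
  unfold lagIntegral
  have h1 : ∀ u : Fin 1 → ℝ, regVand g 0 u = 1 := fun u => by
    simp [regVand, pairProd]
  simp only [h1, Finset.prod_empty, one_mul, mul_one]
  rw [integral_fintype_prod_volume_eq_pow (lagWeight a), Fintype.card_fin, pow_one,
    Real.Gamma_eq_integral (by linarith), ← integral_indicator measurableSet_Ioi]
  refine integral_congr_ae (ae_of_all _ fun x => ?_)
  simp only [lagWeight, Set.indicator, Set.mem_Ioi, add_sub_cancel_right]
  split_ifs <;> ring

theorem gaussVandIntegral_one : gaussVandIntegral g 1 = Real.sqrt Real.pi := by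
  unfold gaussVandIntegral
  have h1 : ∀ u : Fin 1 → ℝ, regVand g 0 u = 1 := fun u => by
    simp [regVand, pairProd]
  simp only [h1, mul_one]
  rw [integral_fintype_prod_volume_eq_pow (fun x => Real.exp (-x ^ 2)), Fintype.card_fin, pow_one]
  simpa using integral_gaussian 1

/-- `Γ(a+1)` is the same integral with one variable. Dividing by its power cancels the prefactors
`√(2a) a^a e^{-a}` and makes Stirling's formula unnecessary. -/
theorem tendsto_lagIntegral_div (hg : 0 ≤ g) :
    Tendsto (fun a => lagIntegral g 0 a (∅ : Finset (Fin n)) /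
        (Real.Gamma (a + 1) ^ n * ((2 * a) ^ g) ^ n.choose 2)) atTop
      (nhds (gaussVandIntegral g n / Real.sqrt Real.pi ^ n)) := by
  have hn := tendsto_integral_scaledLagWeight (n := n) hg
  have h1 := tendsto_integral_scaledLagWeight (n := 1) hg
  rw [gaussVandIntegral_one] at h1
  have hpi : Real.sqrt Real.pi ≠ 0 := by positivity
  refine (hn.div (h1.pow n) (pow_ne_zero _ hpi)).congr' ?_
  filter_upwards [eventually_gt_atTop 0] with a ha
  have h2 := lagIntegral_eq_scaled (g := g) (n := 1) ha
  rw [lagIntegral_one ha, pow_one, Nat.choose_eq_zero_of_lt (by norm_num : 1 < 2), pow_zero,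
    mul_one] at h2
  have h3 : Real.sqrt (2 * a) * (a ^ a * Real.exp (-a)) ≠ 0 := by positivity
  have h4 : ((2 * a) ^ g) ^ n.choose 2 ≠ 0 := by positivity
  simp only [Pi.div_apply]
  rw [lagIntegral_eq_scaled ha, h2, mul_pow _ (∫ _, _)]
  field_simp

end LaguerreLimit

/-! ### The closed form of the Mehta integral. -/

section MehtaClosedForm

theorem prod_range_add_mul_Gamma {s : ℝ} (hs : 0 < s) (N : ℕ) :
    (∏ k ∈ Finset.range N, (s + k)) * Real.Gamma s = Real.Gamma (s + N) := by
  induction N with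
  | zero => simp
  | succ N ih =>
    rw [Finset.prod_range_succ, Nat.cast_succ, ← add_assoc,
      Real.Gamma_add_one (by positivity), ← ih]
    ring

/-- Euler's limit formula for `Γ(s)`, inverted. -/
theorem tendsto_Gamma_ratio {s : ℝ} (hs : 0 < s) :
    Tendsto (fun N : ℕ => Real.Gamma (N + 1 + s) / (Real.Gamma (N + 1) * (N : ℝ) ^ s)) atTop
      (nhds 1) := by
  have h := (Real.GammaSeq_tendsto_Gamma s).inv₀ (Real.Gamma_pos_of_pos hs).ne'
  have h2 := h.mul_const (Real.Gamma s)
  rw [inv_mul_cancel₀ (Real.Gamma_pos_of_pos hs).ne'] at h2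
  refine h2.congr fun N => ?_
  have h3 := prod_range_add_mul_Gamma hs (N + 1)
  rw [Real.GammaSeq, inv_div, Real.Gamma_nat_eq_factorial,
    show (N : ℝ) + 1 + s = s + ((N + 1 : ℕ) : ℝ) by push_cast; ring, ← h3]
  ring

variable {g : ℝ} {n : ℕ}

theorem lagIntegral_add_nat (hg : 0 < g) {a : ℝ} (ha : 0 ≤ a) (N : ℕ) :
    lagIntegral g 0 (a + N) (∅ : Finset (Fin n)) =
      (∏ m ∈ Finset.range n, ∏ k ∈ Finset.range N, (a + g * m + 1 + k)) *
        lagIntegral g 0 a (∅ : Finset (Fin n)) := by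
  induction N with
  | zero => simp
  | succ N ih =>
    simp_rw [Finset.prod_range_succ _ N]
    rw [Finset.prod_mul_distrib, Nat.cast_succ, ← add_assoc,
      lagIntegral_add_one hg (by positivity), ih, ← mul_assoc]
    congr 1
    rw [mul_comm]
    congr 1
    exact Finset.prod_congr rfl fun m _ => by ring

/-- Raising the exponent from `0` to `N` in `n + 1` variables gives `p_0 ⋯ p_n`; raising it from
`2g` to `N + 2g` in `n` variables gives `p_2 ⋯ p_{n+1}`. The two bottom values agree by the boundary
relation, and in the quotient only `p_0`, `p_1` and `p_{n+1}` survive. -/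
theorem lagIntegral_nat_succ (hg : 0 < g) (N : ℕ) :
    lagIntegral g 0 N (∅ : Finset (Fin (n + 1))) =
      Real.Gamma (N + 1) * (Real.Gamma (N + 1 + g) / Real.Gamma (1 + g)) *
        (Real.Gamma (1 + (n + 1) * g) / Real.Gamma (N + 1 + (n + 1) * g)) *
        lagIntegral g 0 (N + 2 * g) (∅ : Finset (Fin n)) := by
  set p : ℕ → ℝ := fun m => ∏ k ∈ Finset.range N, (g * m + 1 + k) with hp
  have hpG : ∀ m : ℕ, p m * Real.Gamma (1 + m * g) = Real.Gamma (N + 1 + m * g) := fun m => by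
    have := prod_range_add_mul_Gamma (s := g * m + 1) (by positivity) N
    rw [hp, show (1 : ℝ) + m * g = g * m + 1 by ring, this]
    congr 1; ring
  have hpos : ∀ m : ℕ, 0 < p m := fun m => Finset.prod_pos fun k _ => by positivity
  have hGpos : ∀ m : ℕ, 0 < Real.Gamma (1 + m * g) := fun m =>
    Real.Gamma_pos_of_pos (by positivity)
  have h1 := lagIntegral_add_nat (n := n + 1) hg le_rfl N
  have h2 := lagIntegral_add_nat (n := n) hg (a := 2 * g) (by positivity) N
  rw [zero_add, lagIntegral_zero_succ hg] at h1
  have h3 : ∏ m ∈ Finset.range (n + 1), ∏ k ∈ Finset.range N, (0 + g * m + 1 + (k : ℝ)) =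
      ∏ m ∈ Finset.range (n + 1), p m := by simp [hp]
  have h4 : ∏ m ∈ Finset.range n, ∏ k ∈ Finset.range N, (2 * g + g * m + 1 + (k : ℝ)) =
      ∏ m ∈ Finset.range n, p (m + 2) := by
    refine Finset.prod_congr rfl fun m _ => Finset.prod_congr rfl fun k _ => ?_
    push_cast; ring
  have h5 : (∏ m ∈ Finset.range (n + 1), p m) * p (n + 1) =
      (∏ m ∈ Finset.range n, p (m + 2)) * p 1 * p 0 := by
    rw [← Finset.prod_range_succ, Finset.prod_range_succ', Finset.prod_range_succ']
  have g0 := hpG 0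
  have g1 := hpG 1
  have gn := hpG (n + 1)
  have gp1 := hGpos 1
  have gpn := hGpos (n + 1)
  push_cast at g0 g1 gn gp1 gpn
  simp only [zero_mul, add_zero, Real.Gamma_one, mul_one, one_mul] at g0 g1 gp1
  rw [add_comm (N : ℝ) (2 * g), h1, h2, h3, h4, ← g0, ← g1, ← gn]
  have := hpos (n + 1)
  field_simp
  linear_combination lagIntegral g 0 (2 * g) (∅ : Finset (Fin n)) * h5

/-- Both sides of the relation between `n + 1` and `n` variables are divided by their
normalizations. All quotients of Gamma functions and powers of `N` tend to `1`, apart from the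
constants displayed. -/
theorem gaussVandIntegral_succ (hg : 0 < g) :
    gaussVandIntegral g (n + 1) / Real.sqrt Real.pi ^ (n + 1) =
      Real.Gamma (1 + (n + 1) * g) / Real.Gamma (1 + g) * ((2 : ℝ) ^ g)⁻¹ ^ n *
        (gaussVandIntegral g n / Real.sqrt Real.pi ^ n) := by
  have hcast : Tendsto (fun N : ℕ => (N : ℝ)) atTop atTop := tendsto_natCast_atTop_atTop
  have hL := (tendsto_lagIntegral_div (n := n + 1) hg.le).comp hcast
  have hshift : Tendsto (fun N : ℕ => (N : ℝ) + 2 * g) atTop atTop :=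
    tendsto_atTop_add_const_right _ _ hcast
  have hR := (tendsto_lagIntegral_div (n := n) hg.le).comp hshift
  have hρ1 := tendsto_Gamma_ratio hg
  have hρn := tendsto_Gamma_ratio (s := (n + 1) * g) (by positivity)
  have hρ2 := tendsto_Gamma_ratio (s := 2 * g) (by positivity)
  have hY : Tendsto (fun N : ℕ => (2 * ((N : ℝ) + 2 * g)) ^ g / (2 * (N : ℝ)) ^ g) atTop
      (nhds 1) := by
    have h1 : Tendsto (fun N : ℕ => 1 + 2 * g / (N : ℝ)) atTop (nhds (1 + 0)) :=
      tendsto_const_nhds.add (tendsto_const_nhds.div_atTop hcast)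
    have h2 := h1.rpow_const (p := g) (Or.inr hg.le)
    rw [add_zero, Real.one_rpow] at h2
    refine h2.congr' ?_
    filter_upwards [eventually_gt_atTop 0] with N hN
    have hN' : (0 : ℝ) < N := by exact_mod_cast hN
    rw [← Real.div_rpow (by positivity) (by positivity)]
    congr 1
    field_simp
  have hall := ((((hR.const_mul (Real.Gamma (1 + (n + 1) * g) / Real.Gamma (1 + g) *
    ((2 : ℝ) ^ g)⁻¹ ^ n)).mul hρ1).mul (hρn.inv₀ one_ne_zero)).mul (hρ2.pow n)).mul
    (hY.pow (n.choose 2))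
  simp only [one_pow, inv_one, mul_one] at hall
  refine tendsto_nhds_unique hL (hall.congr' ?_)
  filter_upwards [eventually_gt_atTop 0] with N hN
  have hN' : (0 : ℝ) < N := by exact_mod_cast hN
  simp only [Function.comp_apply]
  rw [lagIntegral_nat_succ hg, Nat.choose_succ_succ n 1, Nat.choose_one_right]
  have e1 : (N : ℝ) ^ (2 * g) = ((N : ℝ) ^ g) ^ 2 := by
    rw [mul_comm, Real.rpow_mul hN'.le]; norm_num
  have e2 : (N : ℝ) ^ ((n + 1) * g) = ((N : ℝ) ^ g) ^ (n + 1) := by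
    rw [mul_comm, Real.rpow_mul hN'.le]; norm_cast
  have e3 : (2 * (N : ℝ)) ^ g = 2 ^ g * (N : ℝ) ^ g := Real.mul_rpow (by norm_num) hN'.le
  rw [e1, e2, e3, show (N : ℝ) + 2 * g + 1 = N + 1 + 2 * g by ring]
  have p1 : 0 < Real.Gamma (N + 1) := Real.Gamma_pos_of_pos (by positivity)
  have p2 : 0 < Real.Gamma (N + 1 + g) := Real.Gamma_pos_of_pos (by positivity)
  have p3 : 0 < Real.Gamma (N + 1 + 2 * g) := Real.Gamma_pos_of_pos (by positivity)
  have p4 : 0 < Real.Gamma (N + 1 + (n + 1) * g) := Real.Gamma_pos_of_pos (by positivity)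
  have p5 : 0 < Real.Gamma (1 + g) := Real.Gamma_pos_of_pos (by positivity)
  have p6 : 0 < (N : ℝ) ^ g := by positivity
  have p7 : 0 < (2 : ℝ) ^ g := by positivity
  have p8 : 0 < (2 * ((N : ℝ) + 2 * g)) ^ g := by positivity
  generalize (2 * ((N : ℝ) + 2 * g)) ^ g = Y at *
  generalize (N : ℝ) ^ g = X at *
  generalize (2 : ℝ) ^ g = Z at *
  generalize Real.Gamma (N + 1) = A at *
  generalize Real.Gamma (N + 1 + g) = B at *
  generalize Real.Gamma (N + 1 + 2 * g) = C at *
  generalize Real.Gamma (N + 1 + (n + 1) * g) = D at *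
  generalize Real.Gamma (1 + g) = E at *
  simp only [div_pow, mul_pow, inv_pow, pow_add, pow_one]
  field_simp
  ring

theorem gaussVandIntegral_eq (hg : 0 < g) (n : ℕ) :
    gaussVandIntegral g n = Real.sqrt Real.pi ^ n * ((2 : ℝ) ^ g)⁻¹ ^ n.choose 2 *
      ∏ j ∈ Finset.Icc 1 n, Real.Gamma (1 + j * g) / Real.Gamma (1 + g) := by
  have hpi : Real.sqrt Real.pi ≠ 0 := by positivity
  suffices h : gaussVandIntegral g n / Real.sqrt Real.pi ^ n = ((2 : ℝ) ^ g)⁻¹ ^ n.choose 2 *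
      ∏ j ∈ Finset.Icc 1 n, Real.Gamma (1 + j * g) / Real.Gamma (1 + g) by
    rw [div_eq_iff (pow_ne_zero _ hpi)] at h
    rw [h]; ring
  induction n with
  | zero => simp [gaussVandIntegral, regVand, pairProd, Measure.real, volume_pi]
  | succ n ih =>
    rw [gaussVandIntegral_succ hg, ih, Finset.prod_Icc_succ_top (by omega),
      Nat.choose_succ_succ n 1, Nat.choose_one_right, pow_add]
    push_cast
    ring

theorem mehtaIntegrand_eq (n β : ℕ) (u : Fin n → ℝ) :
    mehtaIntegrand n β u = (∏ j, Real.exp (-(u j) ^ 2)) * regVand (2 / (β : ℝ)) 0 u := by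
  rw [regVand_zero, mehtaIntegrand]
  congr 2
  ring

theorem exp_neg_sq_le_expWeight (x : ℝ) : Real.exp (-x ^ 2) ≤ Real.exp 1 * expWeight 0 x := by
  rw [expWeight, pow_zero, mul_one, ← Real.exp_add, Real.exp_le_exp]
  nlinarith [sq_abs x, sq_nonneg (|x| - 1), abs_nonneg x]

theorem integrable_mehtaIntegrand (n β : ℕ) : Integrable (mehtaIntegrand n β) := by
  have hg : (0 : ℝ) ≤ 2 / (β : ℝ) := by positivity
  have hfun : mehtaIntegrand n β = fun u =>
      (∏ j, Real.exp (-(u j) ^ 2)) * regVand (2 / (β : ℝ)) 0 u :=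
    funext (mehtaIntegrand_eq n β)
  rw [hfun]
  refine integrable_of_le_expWeight (Continuous.aestronglyMeasurable ?_) (Real.exp 1 ^ n)
    (⌈2 * (2 / (β : ℝ))⌉₊ * (n - 1)) fun u => ?_
  · exact (by fun_prop : Continuous fun u : Fin n → ℝ => ∏ j, Real.exp (-(u j) ^ 2)).mul
      (continuous_regVand hg)
  · rw [Real.norm_of_nonneg (mul_nonneg (by positivity) (regVand_nonneg le_rfl u))]
    have h1 : ∏ j, Real.exp (-(u j) ^ 2) ≤ ∏ j, Real.exp 1 * expWeight 0 (u j) :=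
      Finset.prod_le_prod (fun _ _ => by positivity) fun j _ => exp_neg_sq_le_expWeight _
    refine (mul_le_mul h1 (regVand_le hg le_rfl zero_le_one u) (regVand_nonneg le_rfl u)
      ((by positivity : (0 : ℝ) ≤ ∏ j, Real.exp (-(u j) ^ 2)).trans h1)).trans (le_of_eq ?_)
    rw [Finset.prod_mul_distrib, Finset.prod_const, Finset.card_univ, Fintype.card_fin, mul_assoc,
      ← Finset.prod_mul_distrib]
    simp_rw [expWeight_mul_pow, zero_add]

theorem mehtaIntegral_eq_gaussVandIntegral (n β : ℕ) :
    mehtaIntegral n β = gaussVandIntegral (2 / (β : ℝ)) n :=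
  integral_congr_ae (ae_of_all _ (mehtaIntegrand_eq n β))

theorem mehtaIntegral_eq (n : ℕ) {β : ℕ} (hβ : 0 < β) :
    mehtaIntegral n β =
      Real.pi ^ ((n : ℝ) / 2) / (2 : ℝ) ^ ((n : ℝ) * ((n : ℝ) - 1) / (β : ℝ)) *
        ∏ j ∈ Finset.Icc 2 n,
          Real.Gamma (1 + 2 * (j : ℝ) / (β : ℝ)) / Real.Gamma (1 + 2 / (β : ℝ)) := by
  have hβ' : (0 : ℝ) < β := by exact_mod_cast hβ
  rw [mehtaIntegral_eq_gaussVandIntegral, gaussVandIntegral_eq (by positivity)]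
  have h1 : Real.sqrt Real.pi ^ n = Real.pi ^ ((n : ℝ) / 2) := by
    rw [Real.sqrt_eq_rpow, ← Real.rpow_natCast, ← Real.rpow_mul Real.pi_pos.le]
    congr 1; ring
  have h2 : ((2 : ℝ) ^ (2 / (β : ℝ)))⁻¹ ^ n.choose 2 =
      ((2 : ℝ) ^ ((n : ℝ) * ((n : ℝ) - 1) / (β : ℝ)))⁻¹ := by
    rw [inv_pow, ← Real.rpow_natCast, ← Real.rpow_mul (by norm_num), Nat.cast_choose_two]
    congr 2
    field_simp
  have h3 : ∏ j ∈ Finset.Icc 1 n,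
      Real.Gamma (1 + j * (2 / (β : ℝ))) / Real.Gamma (1 + 2 / (β : ℝ)) =
      ∏ j ∈ Finset.Icc 2 n,
        Real.Gamma (1 + 2 * (j : ℝ) / (β : ℝ)) / Real.Gamma (1 + 2 / (β : ℝ)) := by
    rcases Nat.eq_zero_or_pos n with rfl | hn
    · simp
    -- The factor `j = 1` equals `1`, so the product may start at `2`.
    · rw [← Finset.mul_prod_Ioc_eq_prod_Icc hn]
      rw [Nat.cast_one, one_mul, div_self (Real.Gamma_pos_of_pos (by positivity)).ne', one_mul]
      refine Finset.prod_congr (by ext; simp [Nat.succ_le_iff]) fun j _ => ?_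
      congr 2; ring
  rw [h1, h2, h3]
  rfl

end MehtaClosedForm

/-! ### Contour deformation: the homotopy and its kernel. -/

/-- The linear homotopy from the real line to the curve `γ`. -/
noncomputable def lineHomotopy (γ : ℝ → ℂ) (s t : ℝ) : ℂ := t + s * (γ t - t)

/-- The derivative of `lineHomotopy γ s` with respect to the curve parameter. -/
noncomputable def lineHomotopyDeriv (γ : ℝ → ℂ) (s t : ℝ) : ℂ := 1 + s * (deriv γ t - 1)

/-- The kernel `(z_b - z_a + ε) ^ κ` for `a ≤ b` on the curve `lineHomotopy γ s`, made symmetric. -/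
noncomputable def contourKernel (γ : ℝ → ℂ) (κ ε s a b : ℝ) : ℂ :=
  (lineHomotopy γ s (max a b) - lineHomotopy γ s (min a b) + ε) ^ (κ : ℂ)

/-- The logarithmic derivative of `contourKernel` with respect to the point with parameter `a`. -/
noncomputable def contourKernelLog (γ : ℝ → ℂ) (κ ε s a b : ℝ) : ℂ :=
  if b < a then κ / (lineHomotopy γ s a - lineHomotopy γ s b + ε)
  else if a < b then -(κ / (lineHomotopy γ s b - lineHomotopy γ s a + ε)) else 0

/-- The hypotheses under which the real line is deformed into `γ` in an integral of `g`. -/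
structure IsDeformation (g : ℂ → ℂ) (γ : ℝ → ℂ) (T : ℝ) : Prop where
  contDiff : ContDiff ℝ 1 γ
  nonneg : 0 ≤ T
  eq_ofReal : ∀ t : ℝ, T ≤ |t| → γ t = t
  sub_mem : ∀ s t : ℝ, s < t → γ t - γ s ∈ Complex.slitPlane
  analyticAt : ∀ s ∈ Set.Icc (0 : ℝ) 1, ∀ t : ℝ, AnalyticAt ℂ g (lineHomotopy γ s t)

theorem add_ofReal_mem_slitPlane {z : ℂ} (hz : z ∈ Complex.slitPlane) {r : ℝ} (hr : 0 ≤ r) :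
    z + r ∈ Complex.slitPlane := by
  rw [Complex.mem_slitPlane_iff] at hz ⊢
  simp only [Complex.add_re, Complex.ofReal_re, Complex.add_im, Complex.ofReal_im, add_zero]
  rcases hz with h | h
  · exact Or.inl (by linarith)
  · exact Or.inr h

theorem ofReal_mul_mem_slitPlane {z : ℂ} (hz : z ∈ Complex.slitPlane) {r : ℝ} (hr : 0 < r) :
    r * z ∈ Complex.slitPlane := by
  rw [Complex.mem_slitPlane_iff] at hz ⊢
  simp only [Complex.re_ofReal_mul, Complex.im_ofReal_mul]
  rcases hz with h | h
  · exact Or.inl (by positivity)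
  · exact Or.inr (mul_ne_zero hr.ne' h)

namespace IsDeformation

variable {g : ℂ → ℂ} {γ : ℝ → ℂ} {T κ ε s : ℝ}

theorem hasDerivAt (h : IsDeformation g γ T) (t : ℝ) : HasDerivAt γ (deriv γ t) t :=
  (h.contDiff.differentiable one_ne_zero t).hasDerivAt

/-- The difference is `s (γ b - γ a) + (1 - s)(b - a)`, and the slit plane is stable under positive
multiples and under adding nonnegative reals. -/
theorem lineHomotopy_sub_mem (h : IsDeformation g γ T) (hs : s ∈ Set.Icc (0 : ℝ) 1) {a b : ℝ}
    (hab : a < b) : lineHomotopy γ s b - lineHomotopy γ s a ∈ Complex.slitPlane := by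
  have h1 : lineHomotopy γ s b - lineHomotopy γ s a =
      s * (γ b - γ a) + (((1 - s) * (b - a) : ℝ) : ℂ) := by
    unfold lineHomotopy; push_cast; ring
  rw [h1]
  have h0 : 0 ≤ (1 - s) * (b - a) := mul_nonneg (by linarith [hs.2]) (by linarith)
  rcases eq_or_lt_of_le hs.1 with hs0 | hs0
  · subst hs0
    simp only [Complex.ofReal_zero, zero_mul, sub_zero, one_mul, zero_add]
    exact Complex.ofReal_mem_slitPlane.2 (by linarith)
  · exact add_ofReal_mem_slitPlane (ofReal_mul_mem_slitPlane (h.sub_mem a b hab) hs0) h0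

theorem base_mem (h : IsDeformation g γ T) (hε : 0 < ε) (hs : s ∈ Set.Icc (0 : ℝ) 1) {a b : ℝ}
    (hab : a ≤ b) : lineHomotopy γ s b - lineHomotopy γ s a + ε ∈ Complex.slitPlane := by
  rcases hab.eq_or_lt with rfl | hab
  · simp [hε]
  · exact add_ofReal_mem_slitPlane (h.lineHomotopy_sub_mem hs hab) hε.le

theorem hasDerivAt_lineHomotopy (h : IsDeformation g γ T) (s t : ℝ) :
    HasDerivAt (fun t => lineHomotopy γ s t) (lineHomotopyDeriv γ s t) t := by
  have h1 := (hasDerivAt_id t).ofReal_comp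
  convert! h1.add (((h.hasDerivAt t).sub h1).const_mul (s : ℂ)) using 1

theorem hasDerivAt_lineHomotopy_fst (s t : ℝ) :
    HasDerivAt (fun s => lineHomotopy γ s t) (γ t - t) s := by
  have h1 := (hasDerivAt_id s).ofReal_comp
  simpa [lineHomotopy] using (h1.mul_const (γ t - t)).const_add (t : ℂ)

theorem hasDerivAt_cpow_comp {f : ℝ → ℂ} {f' : ℂ} {x κ : ℝ} (hf : HasDerivAt f f' x)
    (hx : f x ∈ Complex.slitPlane) :
    HasDerivAt (fun y => f y ^ (κ : ℂ)) (f x ^ (κ : ℂ) * (κ / f x * f')) x := by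
  have h1 := ((hasDerivAt_id (f x)).cpow_const (c := (κ : ℂ)) hx).comp x hf
  convert! h1 using 1
  simp only [id]
  rw [Complex.cpow_sub _ _ (Complex.slitPlane_ne_zero hx), Complex.cpow_one]
  ring

theorem contourKernel_comm (a b : ℝ) : contourKernel γ κ ε s a b = contourKernel γ κ ε s b a := by
  unfold contourKernel; rw [max_comm, min_comm]

theorem contourKernelLog_swap (a b : ℝ) :
    contourKernelLog γ κ ε s b a = - contourKernelLog γ κ ε s a b := by
  unfold contourKernelLog
  rcases lt_trichotomy a b with h | h | h
  · simp [h, h.not_gt]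
  · simp [h]
  · simp [h, h.not_gt]

theorem hasDerivAt_contourKernel_fst (h : IsDeformation g γ T) (hε : 0 < ε)
    (hs : s ∈ Set.Icc (0 : ℝ) 1) (a b : ℝ) :
    HasDerivAt (fun s => contourKernel γ κ ε s a b)
      (contourKernel γ κ ε s a b *
        (contourKernelLog γ κ ε s a b * ((γ a - a) - (γ b - b)))) s := by
  have key : ∀ {a b : ℝ}, a < b → HasDerivAt (fun s => contourKernel γ κ ε s a b)
      (contourKernel γ κ ε s a b *
        (contourKernelLog γ κ ε s a b * ((γ a - a) - (γ b - b)))) s := by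
    intro a b hab
    have h1 := ((hasDerivAt_lineHomotopy_fst (γ := γ) s b).sub
      (hasDerivAt_lineHomotopy_fst (γ := γ) s a)).add_const (ε : ℂ)
    have h2 := hasDerivAt_cpow_comp (κ := κ) h1 (h.base_mem hε hs hab.le)
    unfold contourKernel contourKernelLog
    simp only [max_eq_right hab.le, min_eq_left hab.le, if_neg hab.not_gt, if_pos hab]
    convert! h2 using 1
    simp only [Pi.sub_apply]
    ring
  rcases lt_trichotomy a b with hab | rfl | hab
  · exact key hab
  · simp only [sub_self, mul_zero]
    unfold contourKernel
    simp only [max_self, min_self, sub_self, zero_add]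
    exact hasDerivAt_const _ _
  · have h1 := key hab
    simp_rw [contourKernel_comm b a] at h1
    rw [contourKernelLog_swap] at h1
    convert! h1 using 2
    ring

/-- At `a = b` the roles of `max` and `min` are exchanged and the kernel has in general a corner;
continuity there is all that is used. -/
theorem hasDerivAt_contourKernel_snd (h : IsDeformation g γ T) (hε : 0 < ε)
    (hs : s ∈ Set.Icc (0 : ℝ) 1) {a b : ℝ} (hab : a ≠ b) :
    HasDerivAt (fun x => contourKernel γ κ ε s x b)
      (contourKernel γ κ ε s a b *
        (contourKernelLog γ κ ε s a b * lineHomotopyDeriv γ s a)) a := by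
  have h0 := h.hasDerivAt_lineHomotopy s a
  rcases lt_or_gt_of_ne hab with hab | hab
  · have h1 := (h0.const_sub (lineHomotopy γ s b)).add_const (ε : ℂ)
    have h2 := hasDerivAt_cpow_comp (κ := κ) h1 (h.base_mem hε hs hab.le)
    have h3 : (fun x => contourKernel γ κ ε s x b) =ᶠ[nhds a]
        fun x => (lineHomotopy γ s b - lineHomotopy γ s x + ε) ^ (κ : ℂ) := by
      filter_upwards [gt_mem_nhds hab] with x hx
      simp only [contourKernel, max_eq_right hx.le, min_eq_left hx.le]
    refine HasDerivAt.congr_of_eventuallyEq ?_ h3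
    convert! h2 using 1
    simp only [contourKernel, contourKernelLog, max_eq_right hab.le, min_eq_left hab.le,
      if_neg hab.not_gt, if_pos hab]
    ring
  · have h1 := (h0.sub_const (lineHomotopy γ s b)).add_const (ε : ℂ)
    have h2 := hasDerivAt_cpow_comp (κ := κ) h1 (h.base_mem hε hs hab.le)
    have h3 : (fun x => contourKernel γ κ ε s x b) =ᶠ[nhds a]
        fun x => (lineHomotopy γ s x - lineHomotopy γ s b + ε) ^ (κ : ℂ) := by
      filter_upwards [lt_mem_nhds hab] with x hx
      simp only [contourKernel, max_eq_left hx.le, min_eq_right hx.le]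
    refine HasDerivAt.congr_of_eventuallyEq ?_ h3
    convert! h2 using 1
    simp only [contourKernel, contourKernelLog, max_eq_left hab.le, min_eq_right hab.le,
      if_pos hab]

theorem continuous_deriv (h : IsDeformation g γ T) : Continuous (deriv γ) :=
  h.contDiff.continuous_deriv le_rfl

end IsDeformation

/-! ### The continuity equation for the integrand along the homotopy. -/

/-- The density `g(z) dz` pulled back to the curve `lineHomotopy γ s`. -/
noncomputable def contourDensity (g : ℂ → ℂ) (γ : ℝ → ℂ) (s t : ℝ) : ℂ :=
  g (lineHomotopy γ s t) * lineHomotopyDeriv γ s t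

/-- The derivative of `contourDensity` in `s`, and of `g(z_t) (γ t - t)` in `t`. -/
noncomputable def contourDensityDeriv (g : ℂ → ℂ) (γ : ℝ → ℂ) (s t : ℝ) : ℂ :=
  deriv g (lineHomotopy γ s t) * lineHomotopyDeriv γ s t * (γ t - t) +
    g (lineHomotopy γ s t) * (deriv γ t - 1)

/-- The integrand on the curve `lineHomotopy γ s`. -/
noncomputable def contourIntegrand (g : ℂ → ℂ) (γ : ℝ → ℂ) (κ ε s : ℝ) {d : ℕ} (t : Fin d → ℝ) :
    ℂ :=
  (∏ j, contourDensity g γ s (t j)) * pairProd fun j k => contourKernel γ κ ε s (t j) (t k)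

/-- The vector field whose divergence is the `s`-derivative of `contourIntegrand`. -/
noncomputable def contourFlux (g : ℂ → ℂ) (γ : ℝ → ℂ) (κ ε s : ℝ) {d : ℕ} (i : Fin d)
    (t : Fin d → ℝ) : ℂ :=
  (g (lineHomotopy γ s (t i)) * (γ (t i) - t i)) *
    (∏ j ∈ ({i}ᶜ : Finset (Fin d)), contourDensity g γ s (t j)) *
    pairProd fun j k => contourKernel γ κ ε s (t j) (t k)

/-- The derivative of `contourFlux` in the `i`-th variable. -/
noncomputable def contourFluxDeriv (g : ℂ → ℂ) (γ : ℝ → ℂ) (κ ε s : ℝ) {d : ℕ} (i : Fin d)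
    (t : Fin d → ℝ) : ℂ :=
  (contourDensityDeriv g γ s (t i) *
      ∏ j ∈ ({i}ᶜ : Finset (Fin d)), contourDensity g γ s (t j)) *
      (pairProd fun j k => contourKernel γ κ ε s (t j) (t k)) +
    ((g (lineHomotopy γ s (t i)) * (γ (t i) - t i)) *
      ∏ j ∈ ({i}ᶜ : Finset (Fin d)), contourDensity g γ s (t j)) *
      ((pairProd fun j k => contourKernel γ κ ε s (t j) (t k)) *
        ∑ k ∈ ({i}ᶜ : Finset (Fin d)),
          contourKernelLog γ κ ε s (t i) (t k) * lineHomotopyDeriv γ s (t i))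

namespace IsDeformation

variable {g : ℂ → ℂ} {γ : ℝ → ℂ} {T κ ε s : ℝ} {d : ℕ}

theorem hasDerivAt_contourDensity (h : IsDeformation g γ T) (hs : s ∈ Set.Icc (0 : ℝ) 1) (t : ℝ) :
    HasDerivAt (fun s => contourDensity g γ s t) (contourDensityDeriv g γ s t) s := by
  have h1 := (h.analyticAt s hs t).differentiableAt.hasDerivAt.comp s
    (hasDerivAt_lineHomotopy_fst (γ := γ) s t)
  have h2 : HasDerivAt (fun s => lineHomotopyDeriv γ s t) (deriv γ t - 1) s := by
    have h1 := (hasDerivAt_id s).ofReal_comp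
    simpa [lineHomotopyDeriv] using (h1.mul_const (deriv γ t - 1)).const_add (1 : ℂ)
  convert! h1.mul h2 using 1
  simp only [contourDensityDeriv, Function.comp_apply]
  ring

theorem hasDerivAt_flux_density (h : IsDeformation g γ T) (hs : s ∈ Set.Icc (0 : ℝ) 1) (t : ℝ) :
    HasDerivAt (fun t => g (lineHomotopy γ s t) * (γ t - t)) (contourDensityDeriv g γ s t) t := by
  have h1 := (h.analyticAt s hs t).differentiableAt.hasDerivAt.comp t
    (h.hasDerivAt_lineHomotopy s t)
  have h2 := (h.hasDerivAt t).sub (hasDerivAt_id t).ofReal_comp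
  convert! h1.mul h2 using 1

/-- The change of the integrand with `s` is a divergence. For the densities this is the closedness
of `g dz`: the same expression is the `s`-derivative of the density and the `t`-derivative of
`g(z)(γ(t) - t)`. For the kernel, `sum_pair_mul_sub_eq` moves the pair terms to single variables. -/
theorem hasDerivAt_contourIntegrand (h : IsDeformation g γ T) (hε : 0 < ε)
    (hs : s ∈ Set.Icc (0 : ℝ) 1) (t : Fin d → ℝ) :
    HasDerivAt (fun s => contourIntegrand g γ κ ε s t)
      (∑ i, contourFluxDeriv g γ κ ε s i t) s := by
  have h1 := HasDerivAt.fun_finsetProd (u := Finset.univ)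
    fun j _ => h.hasDerivAt_contourDensity hs (t j)
  have h2 := hasDerivAt_pairProd (x := s)
    (F := fun j k s => contourKernel γ κ ε s (t j) (t k))
    fun j k _ => h.hasDerivAt_contourKernel_fst (κ := κ) hε hs (t j) (t k)
  rw [sum_pair_mul_sub_eq (fun j k => contourKernelLog γ κ ε s (t j) (t k))
    (fun j k => contourKernelLog_swap (t j) (t k)) fun j => γ (t j) - t j] at h2
  convert! h1.mul h2 using 1
  unfold contourFluxDeriv
  rw [Finset.sum_add_distrib]
  congr 1
  · rw [Finset.sum_mul]
    refine Finset.sum_congr rfl fun i _ => ?_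
    rw [← Finset.compl_singleton, smul_eq_mul]
    ring
  · rw [Finset.mul_sum, Finset.mul_sum]
    refine Finset.sum_congr rfl fun i _ => ?_
    rw [← Finset.prod_mul_prod_compl {i} fun j => contourDensity g γ s (t j),
      Finset.prod_singleton, ← Finset.sum_mul]
    simp only [contourDensity]
    ring

theorem hasDerivAt_contourFlux (h : IsDeformation g γ T) (hε : 0 < ε)
    (hs : s ∈ Set.Icc (0 : ℝ) 1) (i : Fin d) {t : Fin d → ℝ} (ht : ∀ k, k ≠ i → t i ≠ t k) :
    HasDerivAt (fun x => contourFlux g γ κ ε s i (Function.update t i x))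
      (contourFluxDeriv g γ κ ε s i t) (t i) := by
  have hc : ∀ x : ℝ, ∏ j ∈ ({i}ᶜ : Finset (Fin d)),
      contourDensity g γ s (Function.update t i x j) =
      ∏ j ∈ ({i}ᶜ : Finset (Fin d)), contourDensity g γ s (t j) := fun x =>
    Finset.prod_congr rfl fun j hj => by
      rw [Function.update_of_ne (by simpa using hj)]
  have h1 := h.hasDerivAt_flux_density hs (t i)
  have h2 := hasDerivAt_pairProd_update (ω := contourKernel γ κ ε s) contourKernel_comm t i
    (q := fun k => contourKernelLog γ κ ε s (t i) (t k) * lineHomotopyDeriv γ s (t i))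
    fun k hk => h.hasDerivAt_contourKernel_snd hε hs (ht k hk)
  unfold contourFlux
  simp only [hc, Function.update_self]
  convert! (h1.mul_const (∏ j ∈ ({i}ᶜ : Finset (Fin d)), contourDensity g γ s (t j))).mul h2 using 1
  simp only [contourFluxDeriv, Function.update_eq_self]

end IsDeformation

/-! ### Measurability and boundedness on cubes. -/

/-- Measurable functions that are bounded on `K`. -/
def BddMeas {X : Type*} [MeasurableSpace X] (K : Set X) (f : X → ℂ) : Prop :=
  Measurable f ∧ ∃ C : ℝ, ∀ x ∈ K, ‖f x‖ ≤ C

namespace BddMeas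

variable {X : Type*} [MeasurableSpace X] {K : Set X} {f f' : X → ℂ}

theorem const (c : ℂ) : BddMeas K fun _ => c := ⟨measurable_const, ‖c‖, fun _ _ => le_rfl⟩

theorem add (hf : BddMeas K f) (hf' : BddMeas K f') : BddMeas K fun x => f x + f' x := by
  obtain ⟨hm, C, hC⟩ := hf
  obtain ⟨hm', C', hC'⟩ := hf'
  exact ⟨hm.add hm', C + C', fun x hx =>
    (norm_add_le _ _).trans (add_le_add (hC x hx) (hC' x hx))⟩

theorem mul (hf : BddMeas K f) (hf' : BddMeas K f') : BddMeas K fun x => f x * f' x := by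
  obtain ⟨hm, C, hC⟩ := hf
  obtain ⟨hm', C', hC'⟩ := hf'
  refine ⟨hm.mul hm', C * C', fun x hx => ?_⟩
  rw [norm_mul]
  exact mul_le_mul (hC x hx) (hC' x hx) (norm_nonneg _) ((norm_nonneg _).trans (hC x hx))

theorem sum {ι : Type*} (s : Finset ι) {F : ι → X → ℂ} (h : ∀ i ∈ s, BddMeas K (F i)) :
    BddMeas K fun x => ∑ i ∈ s, F i x := by
  classical
  induction s using Finset.induction_on with
  | empty => simpa using const 0
  | insert i s hi ih =>
    simp_rw [Finset.sum_insert hi]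
    exact (h i (Finset.mem_insert_self i s)).add
      (ih fun j hj => h j (Finset.mem_insert_of_mem hj))

theorem prod {ι : Type*} (s : Finset ι) {F : ι → X → ℂ} (h : ∀ i ∈ s, BddMeas K (F i)) :
    BddMeas K fun x => ∏ i ∈ s, F i x := by
  classical
  induction s using Finset.induction_on with
  | empty => simpa using const 1
  | insert i s hi ih =>
    simp_rw [Finset.prod_insert hi]
    exact (h i (Finset.mem_insert_self i s)).mul
      (ih fun j hj => h j (Finset.mem_insert_of_mem hj))

theorem comp {Y : Type*} [MeasurableSpace Y] {L : Set Y} (hf : BddMeas K f) {φ : Y → X}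
    (hφ : Measurable φ) (hL : ∀ y ∈ L, φ y ∈ K) : BddMeas L fun y => f (φ y) :=
  ⟨hf.1.comp hφ, hf.2.choose, fun y hy => hf.2.choose_spec _ (hL y hy)⟩

theorem integrable (hf : BddMeas K f) {μ : Measure X} [IsFiniteMeasure μ]
    (hK : ∀ᵐ x ∂μ, x ∈ K) : Integrable f μ := by
  obtain ⟨hm, C, hC⟩ := hf
  exact Integrable.of_bound hm.aestronglyMeasurable C (hK.mono hC)

end BddMeas

/-- The projection of the real line to the unit interval. -/
noncomputable def clampUnit (s : ℝ) : ℝ := (Set.projIcc (0 : ℝ) 1 zero_le_one s : ℝ)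

theorem clampUnit_mem (s : ℝ) : clampUnit s ∈ Set.Icc (0 : ℝ) 1 :=
  (Set.projIcc (0 : ℝ) 1 zero_le_one s).2

theorem clampUnit_of_mem {s : ℝ} (hs : s ∈ Set.Icc (0 : ℝ) 1) : clampUnit s = s := by
  rw [clampUnit, Set.projIcc_of_mem zero_le_one hs]

theorem continuous_clampUnit : Continuous clampUnit :=
  continuous_subtype_val.comp continuous_projIcc

/-- The points whose second component lies in the cube `[-R, R]^d`. -/
def cubeStrip (d : ℕ) (R : ℝ) : Set (ℝ × (Fin d → ℝ)) :=
  {p | ∀ j, p.2 j ∈ Set.Icc (-R) R}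

section Bounds

variable {d : ℕ} {R : ℝ}

/-- The analytic data are available for `s ∈ [0, 1]` only. After clamping `s` they are continuous
for all real `s`, so measurability and bounds on cubes follow from continuity and compactness. -/
theorem bddMeas_of_continuous₁ {F : ℝ → ℝ → ℂ}
    (hF : Continuous fun p : ℝ × ℝ => F (clampUnit p.1) p.2) (j : Fin d) :
    BddMeas (cubeStrip d R) fun p => F (clampUnit p.1) (p.2 j) := by
  have h1 : Continuous fun p : ℝ × (Fin d → ℝ) => (p.1, p.2 j) := by fun_prop
  refine ⟨(hF.comp h1).measurable, ?_⟩
  obtain ⟨C, hC⟩ := ((isCompact_Icc (a := (0 : ℝ)) (b := 1)).prod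
    (isCompact_Icc (a := -R) (b := R))).exists_bound_of_continuousOn hF.continuousOn
  refine ⟨C, fun p hp => ?_⟩
  have := hC (clampUnit p.1, p.2 j) ⟨clampUnit_mem _, hp j⟩
  simpa only [clampUnit_of_mem (clampUnit_mem p.1)] using this

theorem exists_bound_of_continuous₂ {F : ℝ → ℝ → ℝ → ℂ}
    (hF : Continuous fun p : ℝ × ℝ × ℝ => F (clampUnit p.1) p.2.1 p.2.2) (R : ℝ) :
    ∃ C : ℝ, ∀ s : ℝ, ∀ a ∈ Set.Icc (-R) R, ∀ b ∈ Set.Icc (-R) R,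
      ‖F (clampUnit s) a b‖ ≤ C := by
  obtain ⟨C, hC⟩ := ((isCompact_Icc (a := (0 : ℝ)) (b := 1)).prod
    ((isCompact_Icc (a := -R) (b := R)).prod
      (isCompact_Icc (a := -R) (b := R)))).exists_bound_of_continuousOn hF.continuousOn
  refine ⟨C, fun s a ha b hb => ?_⟩
  have := hC (clampUnit s, a, b) ⟨clampUnit_mem _, ha, hb⟩
  simpa only [clampUnit_of_mem (clampUnit_mem s)] using this

theorem bddMeas_of_continuous₂ {F : ℝ → ℝ → ℝ → ℂ}
    (hF : Continuous fun p : ℝ × ℝ × ℝ => F (clampUnit p.1) p.2.1 p.2.2) (j k : Fin d) :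
    BddMeas (cubeStrip d R) fun p => F (clampUnit p.1) (p.2 j) (p.2 k) := by
  have h1 : Continuous fun p : ℝ × (Fin d → ℝ) => (p.1, p.2 j, p.2 k) := by fun_prop
  refine ⟨(hF.comp h1).measurable, ?_⟩
  obtain ⟨C, hC⟩ := exists_bound_of_continuous₂ hF R
  exact ⟨C, fun p hp => hC _ _ (hp j) _ (hp k)⟩

end Bounds

namespace IsDeformation

variable {g : ℂ → ℂ} {γ : ℝ → ℂ} {T κ ε s R : ℝ} {d : ℕ}

theorem continuous_lineHomotopy_clamp (h : IsDeformation g γ T) :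
    Continuous fun p : ℝ × ℝ => lineHomotopy γ (clampUnit p.1) p.2 := by
  have h1 := h.contDiff.continuous
  have h2 := continuous_clampUnit
  unfold lineHomotopy
  fun_prop

theorem continuous_lineHomotopyDeriv_clamp (h : IsDeformation g γ T) :
    Continuous fun p : ℝ × ℝ => lineHomotopyDeriv γ (clampUnit p.1) p.2 := by
  have h1 := h.continuous_deriv
  have h2 := continuous_clampUnit
  unfold lineHomotopyDeriv
  fun_prop

theorem continuous_comp_clamp (h : IsDeformation g γ T) :
    Continuous fun p : ℝ × ℝ => g (lineHomotopy γ (clampUnit p.1) p.2) :=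
  continuous_iff_continuousAt.2 fun p =>
    ContinuousAt.comp (f := fun p : ℝ × ℝ => lineHomotopy γ (clampUnit p.1) p.2)
      (h.analyticAt _ (clampUnit_mem p.1) p.2).continuousAt
      h.continuous_lineHomotopy_clamp.continuousAt

theorem continuous_deriv_comp_clamp (h : IsDeformation g γ T) :
    Continuous fun p : ℝ × ℝ => deriv g (lineHomotopy γ (clampUnit p.1) p.2) :=
  continuous_iff_continuousAt.2 fun p =>
    ContinuousAt.comp (f := fun p : ℝ × ℝ => lineHomotopy γ (clampUnit p.1) p.2)
      (h.analyticAt _ (clampUnit_mem p.1) p.2).deriv.continuousAt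
      h.continuous_lineHomotopy_clamp.continuousAt

theorem continuous_contourDensity_clamp (h : IsDeformation g γ T) :
    Continuous fun p : ℝ × ℝ => contourDensity g γ (clampUnit p.1) p.2 :=
  h.continuous_comp_clamp.mul h.continuous_lineHomotopyDeriv_clamp

theorem continuous_contourDensityDeriv_clamp (h : IsDeformation g γ T) :
    Continuous fun p : ℝ × ℝ => contourDensityDeriv g γ (clampUnit p.1) p.2 := by
  have h1 := h.contDiff.continuous
  have h2 := h.continuous_deriv
  exact ((h.continuous_deriv_comp_clamp.mul h.continuous_lineHomotopyDeriv_clamp).mul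
    (by fun_prop)).add (h.continuous_comp_clamp.mul (by fun_prop))

theorem continuous_base_clamp (h : IsDeformation g γ T) :
    Continuous fun p : ℝ × ℝ × ℝ => lineHomotopy γ (clampUnit p.1) (max p.2.1 p.2.2) -
      lineHomotopy γ (clampUnit p.1) (min p.2.1 p.2.2) + (ε : ℂ) := by
  have h1 := h.contDiff.continuous
  have h2 := continuous_clampUnit
  unfold lineHomotopy
  fun_prop

theorem continuous_contourKernel_clamp (h : IsDeformation g γ T) (hε : 0 < ε) :
    Continuous fun p : ℝ × ℝ × ℝ => contourKernel γ κ ε (clampUnit p.1) p.2.1 p.2.2 :=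
  Continuous.cpow h.continuous_base_clamp continuous_const fun p =>
    h.base_mem hε (clampUnit_mem p.1) min_le_max

theorem bddMeas_contourKernelLog (h : IsDeformation g γ T) (hε : 0 < ε) (j k : Fin d) :
    BddMeas (cubeStrip d R) fun p =>
      contourKernelLog γ κ ε (clampUnit p.1) (p.2 j) (p.2 k) := by
  have hc := h.continuous_lineHomotopy_clamp
  have h1 : ∀ j : Fin d, Measurable fun p : ℝ × (Fin d → ℝ) =>
      lineHomotopy γ (clampUnit p.1) (p.2 j) := fun j =>
    (hc.comp (by fun_prop : Continuous fun p : ℝ × (Fin d → ℝ) => (p.1, p.2 j))).measurable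
  have h2 := h1 j
  have h3 := h1 k
  refine ⟨?_, ?_⟩
  · unfold contourKernelLog
    refine Measurable.ite (measurableSet_lt (by fun_prop) (by fun_prop)) (by fun_prop)
      (Measurable.ite (measurableSet_lt (by fun_prop) (by fun_prop)) (by fun_prop)
        measurable_const)
  · have hinv : Continuous fun p : ℝ × ℝ × ℝ => (κ : ℂ) /
        (lineHomotopy γ (clampUnit p.1) (max p.2.1 p.2.2) -
        lineHomotopy γ (clampUnit p.1) (min p.2.1 p.2.2) + (ε : ℂ)) :=
      continuous_const.div h.continuous_base_clamp fun p =>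
        Complex.slitPlane_ne_zero (h.base_mem hε (clampUnit_mem p.1) min_le_max)
    obtain ⟨C, hC⟩ := exists_bound_of_continuous₂ (F := fun s a b => (κ : ℂ) /
        (lineHomotopy γ s (max a b) - lineHomotopy γ s (min a b) + (ε : ℂ))) hinv R
    refine ⟨C, fun p hp => ?_⟩
    have := hC p.1 _ (hp j) _ (hp k)
    simp only [contourKernelLog]
    split_ifs with h4 h5
    · rwa [max_eq_left h4.le, min_eq_right h4.le] at this
    · rw [max_eq_right h5.le, min_eq_left h5.le] at this
      rwa [norm_neg]
    · rw [norm_zero]; exact (norm_nonneg _).trans this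

theorem bddMeas_contourIntegrand (h : IsDeformation g γ T) (hε : 0 < ε) :
    BddMeas (cubeStrip d R) fun p => contourIntegrand g γ κ ε (clampUnit p.1) p.2 :=
  (BddMeas.prod _ fun j _ => bddMeas_of_continuous₁ h.continuous_contourDensity_clamp j).mul
    (BddMeas.prod _ fun j _ => BddMeas.prod _ fun k _ =>
      bddMeas_of_continuous₂ (h.continuous_contourKernel_clamp hε) j k)

theorem bddMeas_contourFluxDeriv (h : IsDeformation g γ T) (hε : 0 < ε) (i : Fin d) :
    BddMeas (cubeStrip d R) fun p => contourFluxDeriv g γ κ ε (clampUnit p.1) i p.2 := by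
  have hA : BddMeas (cubeStrip d R) fun p => ∏ j ∈ ({i}ᶜ : Finset (Fin d)),
      contourDensity g γ (clampUnit p.1) (p.2 j) :=
    BddMeas.prod _ fun j _ => bddMeas_of_continuous₁ h.continuous_contourDensity_clamp j
  have hW : BddMeas (cubeStrip d R) fun p => pairProd fun j k =>
      contourKernel γ κ ε (clampUnit p.1) (p.2 j) (p.2 k) :=
    BddMeas.prod _ fun j _ => BddMeas.prod _ fun k _ =>
      bddMeas_of_continuous₂ (h.continuous_contourKernel_clamp hε) j k
  have hB : BddMeas (cubeStrip d R) fun p =>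
      g (lineHomotopy γ (clampUnit p.1) (p.2 i)) * (γ (p.2 i) - p.2 i) := by
    have h1 := h.contDiff.continuous
    exact bddMeas_of_continuous₁ (F := fun s t => g (lineHomotopy γ s t) * (γ t - t))
      (h.continuous_comp_clamp.mul (by fun_prop)) i
  exact (((bddMeas_of_continuous₁ h.continuous_contourDensityDeriv_clamp i).mul hA).mul hW).add
    ((hB.mul hA).mul (hW.mul (BddMeas.sum _ fun k _ =>
      (h.bddMeas_contourKernelLog hε i k).mul
        (bddMeas_of_continuous₁ h.continuous_lineHomotopyDeriv_clamp i))))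

end IsDeformation

/-! ### Invariance of the integral over cubes. -/

/-- Lebesgue measure on the cube `(-R, R]^d`. -/
noncomputable def cubeMeasure (d : ℕ) (R : ℝ) : Measure (Fin d → ℝ) :=
  Measure.pi fun _ => (volume : Measure ℝ).restrict (Set.Ioc (-R) R)

theorem cubeMeasure_eq (d : ℕ) (R : ℝ) :
    cubeMeasure d R = volume.restrict (Set.univ.pi fun _ => Set.Ioc (-R) R) :=
  (Measure.restrict_pi_pi _ _).symm

instance (d : ℕ) (R : ℝ) : IsFiniteMeasure (cubeMeasure d R) := by
  unfold cubeMeasure; infer_instance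

theorem ae_cubeMeasure (d : ℕ) (R : ℝ) : ∀ᵐ t ∂cubeMeasure d R, ∀ j, t j ∈ Set.Icc (-R) R := by
  rw [cubeMeasure_eq]
  filter_upwards [ae_restrict_mem (MeasurableSet.univ_pi fun _ => measurableSet_Ioc)] with t ht j
  exact Set.Ioc_subset_Icc_self (ht j (Set.mem_univ j))

namespace IsDeformation

variable {g : ℂ → ℂ} {γ : ℝ → ℂ} {T κ ε s R : ℝ} {d : ℕ}

theorem integrable_contourFluxDeriv (h : IsDeformation g γ T) (hε : 0 < ε)
    (hs : s ∈ Set.Icc (0 : ℝ) 1) (i : Fin d) :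
    Integrable (contourFluxDeriv g γ κ ε s i) (cubeMeasure d R) := by
  have h1 := (h.bddMeas_contourFluxDeriv (κ := κ) (R := R) hε i).comp
    (φ := fun t : Fin d → ℝ => (s, t)) (L := {t : Fin d → ℝ | ∀ j, t j ∈ Set.Icc (-R) R}) (by fun_prop)
    fun t ht => ht
  simp only [clampUnit_of_mem hs] at h1
  exact h1.integrable (ae_cubeMeasure d R)

theorem integrable_contourIntegrand_cube (h : IsDeformation g γ T) (hε : 0 < ε)
    (hs : s ∈ Set.Icc (0 : ℝ) 1) :
    Integrable (contourIntegrand g γ κ ε s) (cubeMeasure d R) := by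
  have h1 := (h.bddMeas_contourIntegrand (κ := κ) (R := R) hε).comp
    (φ := fun t : Fin d → ℝ => (s, t)) (L := {t : Fin d → ℝ | ∀ j, t j ∈ Set.Icc (-R) R}) (by fun_prop)
    fun t ht => ht
  simp only [clampUnit_of_mem hs] at h1
  exact h1.integrable (ae_cubeMeasure d R)

/-- The flux is continuous in the variable `i` and differentiable off the finitely many values where
it meets another variable. It vanishes at both ends, because `γ(t) = t` there. -/
theorem integral_contourFluxDeriv_eq_zero (h : IsDeformation g γ T) (hε : 0 < ε)
    (hs : s ∈ Set.Icc (0 : ℝ) 1) (hR : T ≤ R) (i : Fin (d + 1)) :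
    ∫ t, contourFluxDeriv g γ κ ε s i t ∂cubeMeasure (d + 1) R = 0 := by
  have hR0 : 0 ≤ R := h.nonneg.trans hR
  refine integral_pi_eq_zero_of_forall_insertNth i (h.integrable_contourFluxDeriv hε hs i)
    fun r => ?_
  rw [← intervalIntegral.integral_of_le (by linarith)]
  have hup : ∀ x y : ℝ, Function.update (i.insertNth x r : Fin (d + 1) → ℝ) i y
      = i.insertNth y r := fun x y => Fin.update_insertNth _ _ _ _
  have hcontIns : Continuous fun x : ℝ => (i.insertNth x r : Fin (d + 1) → ℝ) := by
    rw [← funext fun x => hup 0 x]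
    exact continuous_const.update i continuous_id
  -- The other coordinates `r` are arbitrary and need not lie in the cube, so the bounds are taken
  -- on a larger cube that contains them.
  obtain ⟨R', hRR', hr⟩ : ∃ R', R ≤ R' ∧ ∀ j, |r j| ≤ R' := by
    refine ⟨R + ∑ j, |r j|, ?_, fun j => ?_⟩
    · exact le_add_of_nonneg_right (Finset.sum_nonneg fun j _ => abs_nonneg (r j))
    linarith [Finset.single_le_sum (fun j _ => abs_nonneg (r j)) (Finset.mem_univ j)]
  have hbdd := (h.bddMeas_contourFluxDeriv (κ := κ) (R := R') hε i).comp
    (φ := fun x : ℝ => (s, (i.insertNth x r : Fin (d + 1) → ℝ))) (L := Set.Icc (-R) R)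
    (by have := hcontIns.measurable; fun_prop) (fun x hx j => by
      simp only
      rcases Fin.eq_self_or_eq_succAbove i j with rfl | ⟨k, rfl⟩
      · rw [Fin.insertNth_apply_same]
        exact ⟨by linarith [hx.1], by linarith [hx.2]⟩
      · rw [Fin.insertNth_apply_succAbove]
        exact abs_le.1 (hr k))
  simp only [clampUnit_of_mem hs] at hbdd
  have hint : IntervalIntegrable (fun x => contourFluxDeriv g γ κ ε s i
      (i.insertNth x r : Fin (d + 1) → ℝ)) volume (-R) R := by
    rw [intervalIntegrable_iff_integrableOn_Ioc_of_le (by linarith)]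
    exact hbdd.integrable (by
      filter_upwards [ae_restrict_mem measurableSet_Ioc] with x hx
      exact Set.Ioc_subset_Icc_self hx)
  have hflux : Continuous fun x => contourFlux g γ κ ε s i
      (i.insertNth x r : Fin (d + 1) → ℝ) := by
    have hcoord : ∀ j, Continuous fun x : ℝ => (i.insertNth x r : Fin (d + 1) → ℝ) j := fun j =>
      (continuous_apply j).comp hcontIns
    have h0 := h.contDiff.continuous
    have e1 : Continuous fun t => contourDensity g γ s t := by
      have := h.continuous_contourDensity_clamp.comp (by fun_prop : Continuous fun t : ℝ => (s, t))
      simpa only [Function.comp_def, clampUnit_of_mem hs] using this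
    have e2 : Continuous fun t => g (lineHomotopy γ s t) := by
      have := h.continuous_comp_clamp.comp (by fun_prop : Continuous fun t : ℝ => (s, t))
      simpa only [Function.comp_def, clampUnit_of_mem hs] using this
    have e3 : Continuous fun p : ℝ × ℝ => contourKernel γ κ ε s p.1 p.2 := by
      have := (h.continuous_contourKernel_clamp (κ := κ) hε).comp
        (by fun_prop : Continuous fun p : ℝ × ℝ => (s, p.1, p.2))
      simpa only [Function.comp_def, clampUnit_of_mem hs] using this
    unfold contourFlux pairProd
    refine (((e2.comp (hcoord i)).mul ((h0.comp (hcoord i)).sub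
      (Complex.continuous_ofReal.comp (hcoord i)))).mul
      (continuous_finsetProd _ fun j _ => e1.comp (hcoord j))).mul
      (continuous_finsetProd _ fun j _ => continuous_finsetProd _ fun k _ => ?_)
    exact e3.comp ((hcoord j).prodMk (hcoord k))
  have hend : ∀ x : ℝ, |x| = R → contourFlux g γ κ ε s i
      (i.insertNth x r : Fin (d + 1) → ℝ) = 0 := by
    intro x hx
    unfold contourFlux
    rw [Fin.insertNth_apply_same, h.eq_ofReal x (by rw [hx]; exact hR)]
    simp
  rw [integral_eq_of_hasDerivAt_off_countable (fun x => contourFlux g γ κ ε s i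
      (i.insertNth x r : Fin (d + 1) → ℝ)) _ (Set.countable_range r) hflux.continuousOn
      (fun x hx => ?_) hint, hend R (abs_of_nonneg hR0), hend (-R) (by rw [abs_neg, abs_of_nonneg hR0]),
      sub_zero]
  have h1 := h.hasDerivAt_contourFlux (κ := κ) hε hs i (t := i.insertNth x r) fun k hk => by
    rcases Fin.eq_self_or_eq_succAbove i k with rfl | ⟨k, rfl⟩
    · exact absurd rfl hk
    · rw [Fin.insertNth_apply_same, Fin.insertNth_apply_succAbove]
      rintro rfl
      exact hx.2 ⟨k, rfl⟩
  simp only [hup, Fin.insertNth_apply_same] at h1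
  exact h1

/-- The difference of the two integrals is the integral over `s` of the total divergence; Fubini and
the vanishing of each flux integral finish the argument. -/
theorem integral_contourIntegrand_cube (h : IsDeformation g γ T) (hε : 0 < ε) (hR : T ≤ R) :
    ∫ t, contourIntegrand g γ κ ε 1 t ∂cubeMeasure d R =
      ∫ t, contourIntegrand g γ κ ε 0 t ∂cubeMeasure d R := by
  have h01 : (0 : ℝ) ∈ Set.Icc (0 : ℝ) 1 := by simp
  have h11 : (1 : ℝ) ∈ Set.Icc (0 : ℝ) 1 := by simp
  rw [← sub_eq_zero, ← integral_sub (h.integrable_contourIntegrand_cube hε h11)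
    (h.integrable_contourIntegrand_cube hε h01)]
  set Θ : ℝ → (Fin d → ℝ) → ℂ := fun s t =>
    ∑ i, contourFluxDeriv g γ κ ε (clampUnit s) i t with hΘ
  have hΘb : BddMeas (cubeStrip d R) fun p => Θ p.1 p.2 :=
    BddMeas.sum _ fun i _ => h.bddMeas_contourFluxDeriv hε i
  have hftc : ∀ᵐ t ∂cubeMeasure d R, contourIntegrand g γ κ ε 1 t - contourIntegrand g γ κ ε 0 t =
      ∫ s in Set.Ioc (0 : ℝ) 1, Θ s t := by
    filter_upwards [ae_cubeMeasure d R] with t ht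
    rw [← intervalIntegral.integral_of_le zero_le_one]
    refine (intervalIntegral.integral_eq_sub_of_hasDerivAt (f := fun s =>
      contourIntegrand g γ κ ε s t) (fun s hs => ?_) ?_).symm
    · rw [Set.uIcc_of_le zero_le_one] at hs
      simp only [hΘ, clampUnit_of_mem hs]
      exact h.hasDerivAt_contourIntegrand hε hs t
    · rw [intervalIntegrable_iff_integrableOn_Ioc_of_le zero_le_one]
      exact (hΘb.comp (φ := fun s : ℝ => (s, t)) (L := Set.univ) (by fun_prop)
        fun s _ => ht).integrable (by simp)
  rw [integral_congr_ae hftc, integral_integral_swap]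
  · have hz : ∀ s, ∫ t, Θ s t ∂cubeMeasure d R = 0 := by
      intro s
      simp only [hΘ]
      rw [integral_finsetSum _ fun i _ => h.integrable_contourFluxDeriv hε (clampUnit_mem s) i]
      refine Finset.sum_eq_zero fun i _ => ?_
      cases d with
      | zero => exact i.elim0
      | succ d => exact h.integral_contourFluxDeriv_eq_zero hε (clampUnit_mem s) hR i
    simp [hz]
  · refine (hΘb.comp (φ := fun p : (Fin d → ℝ) × ℝ => (p.2, p.1))
      (L := {p : (Fin d → ℝ) × ℝ | ∀ j, p.1 j ∈ Set.Icc (-R) R}) (by fun_prop) fun p hp => hp).integrable ?_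
    have := Measure.quasiMeasurePreserving_fst (μ := cubeMeasure d R)
      (ν := volume.restrict (Set.Ioc (0 : ℝ) 1))
    exact this.ae (ae_cubeMeasure d R)

end IsDeformation

/-! ### Removing the cube and the regularization. -/

theorem lineHomotopy_zero (γ : ℝ → ℂ) (t : ℝ) : lineHomotopy γ 0 t = t := by
  simp [lineHomotopy]

theorem lineHomotopy_one (γ : ℝ → ℂ) (t : ℝ) : lineHomotopy γ 1 t = γ t := by
  simp [lineHomotopy]

theorem contourDensity_zero (g : ℂ → ℂ) (γ : ℝ → ℂ) (t : ℝ) : contourDensity g γ 0 t = g t := by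
  simp [contourDensity, lineHomotopy_zero, lineHomotopyDeriv]

theorem contourDensity_one (g : ℂ → ℂ) (γ : ℝ → ℂ) (t : ℝ) :
    contourDensity g γ 1 t = g (γ t) * deriv γ t := by
  simp [contourDensity, lineHomotopy_one, lineHomotopyDeriv]

theorem contourIntegrand_zero (g : ℂ → ℂ) (γ : ℝ → ℂ) (κ : ℝ) {d : ℕ} (t : Fin d → ℝ) :
    contourIntegrand g γ κ 0 0 t = (∏ j, g (t j)) * (absVandermondePow κ t : ℂ) := by
  unfold contourIntegrand
  congr 1
  · exact Finset.prod_congr rfl fun j _ => contourDensity_zero g γ (t j)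
  · unfold absVandermondePow pairProd
    push_cast
    refine Finset.prod_congr rfl fun j _ => Finset.prod_congr rfl fun k _ => ?_
    rw [contourKernel, lineHomotopy_zero, lineHomotopy_zero, Complex.ofReal_zero, add_zero,
      ← Complex.ofReal_sub, ← Complex.ofReal_cpow (by simp), max_sub_min_eq_abs', Complex.ofReal_cpow (abs_nonneg _)]

namespace IsDeformation

variable {g : ℂ → ℂ} {γ : ℝ → ℂ} {T κ ε s R : ℝ} {d : ℕ}

theorem exists_norm_lineHomotopy_le (h : IsDeformation g γ T) :
    ∃ C : ℝ, 1 ≤ C ∧ ∀ s ∈ Set.Icc (0 : ℝ) 1, ∀ t : ℝ,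
      ‖lineHomotopy γ s t‖ ≤ C * (1 + |t|) := by
  have hc : Continuous fun t : ℝ => γ t - t := by
    have := h.contDiff.continuous
    fun_prop
  obtain ⟨C, hC⟩ := (isCompact_Icc (a := -T) (b := T)).exists_bound_of_continuousOn hc.continuousOn
  have hb : ∀ t : ℝ, ‖γ t - t‖ ≤ max C 0 := fun t => by
    rcases le_total |t| T with ht | ht
    · exact (hC t (abs_le.1 ht)).trans (le_max_left _ _)
    · simp [h.eq_ofReal t ht]
  refine ⟨1 + max C 0, by linarith [le_max_right C 0], fun s hs t => ?_⟩
  have h1 : ‖lineHomotopy γ s t‖ ≤ |t| + |s| * ‖γ t - t‖ := by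
    unfold lineHomotopy
    refine (norm_add_le _ _).trans ?_
    simp
  rw [abs_of_nonneg hs.1] at h1
  have h2 : s * ‖γ t - t‖ ≤ 1 * max C 0 := mul_le_mul hs.2 (hb t) (norm_nonneg _) zero_le_one
  nlinarith [abs_nonneg t, le_max_right C 0]

theorem exists_norm_contourKernel_le (h : IsDeformation g γ T) (hκ : 0 ≤ κ) :
    ∃ c : ℝ, 0 ≤ c ∧ ∀ s ∈ Set.Icc (0 : ℝ) 1, ∀ ε ∈ Set.Icc (0 : ℝ) 1, ∀ a b : ℝ,
      ‖contourKernel γ κ ε s a b‖ ≤ (c * (1 + |a|) ^ κ) * (c * (1 + |b|) ^ κ) := by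
  obtain ⟨C, hC1, hC⟩ := h.exists_norm_lineHomotopy_le
  refine ⟨(3 * C) ^ κ, by positivity, fun s hs ε hε a b => ?_⟩
  have ha := abs_nonneg a
  have hb := abs_nonneg b
  have hbase : ‖lineHomotopy γ s (max a b) - lineHomotopy γ s (min a b) + ε‖ ≤
      (3 * C * (1 + |a|)) * (3 * C * (1 + |b|)) := by
    have h1 : ‖lineHomotopy γ s (max a b) - lineHomotopy γ s (min a b) + ε‖ ≤
        ‖lineHomotopy γ s (max a b)‖ + ‖lineHomotopy γ s (min a b)‖ + 1 := by
      refine (norm_add_le _ _).trans (add_le_add (norm_sub_le _ _) ?_)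
      rw [Complex.norm_real, Real.norm_of_nonneg hε.1]
      exact hε.2
    have h2 : ‖lineHomotopy γ s (max a b)‖ + ‖lineHomotopy γ s (min a b)‖ ≤
        C * (1 + |a|) + C * (1 + |b|) := by
      rcases le_total a b with hab | hab
      · rw [max_eq_right hab, min_eq_left hab, add_comm]
        exact add_le_add (hC s hs a) (hC s hs b)
      · rw [max_eq_left hab, min_eq_right hab]
        exact add_le_add (hC s hs a) (hC s hs b)
    have h3 : C * (1 + |a|) + C * (1 + |b|) + 1 ≤ 3 * C * ((1 + |a|) * (1 + |b|)) := by
      have : 0 ≤ C * (|a| * |b|) := by positivity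
      nlinarith [mul_nonneg (by linarith : 0 ≤ C) ha, mul_nonneg (by linarith : 0 ≤ C) hb]
    have h4 : 3 * C * ((1 + |a|) * (1 + |b|)) ≤
        (3 * C) * (3 * C * ((1 + |a|) * (1 + |b|))) :=
      le_mul_of_one_le_left (by positivity) (by linarith)
    linarith
  rw [contourKernel, Complex.norm_cpow_real]
  refine (Real.rpow_le_rpow (norm_nonneg _) hbase hκ).trans (le_of_eq ?_)
  rw [Real.mul_rpow (x := 3 * C * (1 + |a|)) (by positivity) (by positivity),
    Real.mul_rpow (x := 3 * C) (y := 1 + |a|) (by positivity) (by positivity),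
    Real.mul_rpow (x := 3 * C) (y := 1 + |b|) (by positivity) (by positivity)]

theorem measurable_contourIntegrand (h : IsDeformation g γ T) (hs : s ∈ Set.Icc (0 : ℝ) 1) :
    Measurable fun t : Fin d → ℝ => contourIntegrand g γ κ ε s t := by
  have e1 : Continuous fun t => contourDensity g γ s t := by
    have := h.continuous_contourDensity_clamp.comp (by fun_prop : Continuous fun t : ℝ => (s, t))
    simpa only [Function.comp_def, clampUnit_of_mem hs] using this
  have e2 : Continuous fun t => lineHomotopy γ s t := by
    have := h.continuous_lineHomotopy_clamp.comp (by fun_prop : Continuous fun t : ℝ => (s, t))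
    simpa only [Function.comp_def, clampUnit_of_mem hs] using this
  unfold contourIntegrand pairProd contourKernel
  refine (Finset.measurable_prod _ fun j _ => e1.measurable.comp (measurable_pi_apply j)).mul
    (Finset.measurable_prod _ fun j _ => Finset.measurable_prod _ fun k _ => ?_)
  refine Measurable.pow_const ?_ _
  exact (by fun_prop : Continuous fun t : Fin d → ℝ =>
    lineHomotopy γ s (max (t j) (t k)) - lineHomotopy γ s (min (t j) (t k)) + (ε : ℂ)).measurable

theorem exists_norm_contourIntegrand_le (h : IsDeformation g γ T) (hκ : 0 ≤ κ) :
    ∃ c : ℝ, 0 ≤ c ∧ ∀ s ∈ Set.Icc (0 : ℝ) 1, ∀ ε ∈ Set.Icc (0 : ℝ) 1, ∀ t : Fin d → ℝ,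
      ‖contourIntegrand g γ κ ε s t‖ ≤
        c * ∏ j, (‖contourDensity g γ s (t j)‖ * ((1 + |t j|) ^ κ) ^ (d - 1)) := by
  obtain ⟨c, hc0, hc⟩ := h.exists_norm_contourKernel_le hκ
  refine ⟨(c ^ (d - 1)) ^ d, by positivity, fun s hs ε hε t => ?_⟩
  unfold contourIntegrand
  rw [norm_mul, norm_prod]
  have h1 := norm_pairProd_le (F := fun j k => contourKernel γ κ ε s (t j) (t k))
    (p := fun j => c * (1 + |t j|) ^ κ) fun j k _ => hc s hs ε hε _ _
  refine (mul_le_mul_of_nonneg_left h1 (by positivity)).trans (le_of_eq ?_)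
  simp_rw [mul_pow]
  rw [Finset.prod_mul_distrib, Finset.prod_mul_distrib, Finset.prod_const, Finset.card_univ,
    Fintype.card_fin]
  ring

theorem deriv_eq_one (h : IsDeformation g γ T) {t : ℝ} (ht : T < |t|) : deriv γ t = 1 := by
  have h1 : γ =ᶠ[nhds t] fun t : ℝ => (t : ℂ) := by
    filter_upwards [continuous_abs.continuousAt.eventually (lt_mem_nhds ht)] with x hx
    exact h.eq_ofReal x hx.le
  rw [h1.deriv_eq]
  simpa using (hasDerivAt_id t).ofReal_comp.deriv

/-- Outside a compact interval the contour is the real line, and on the interval the density is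
continuous. -/
theorem integrable_density_one (h : IsDeformation g γ T) {m : ℕ} (hκ : 0 ≤ κ)
    (hint : Integrable fun t : ℝ => ‖g t‖ * ((1 + |t|) ^ κ) ^ m) :
    Integrable fun t : ℝ => ‖contourDensity g γ 1 t‖ * ((1 + |t|) ^ κ) ^ m := by
  have e1 : Continuous fun t => contourDensity g γ 1 t := by
    have := h.continuous_contourDensity_clamp.comp
      (by fun_prop : Continuous fun t : ℝ => ((1 : ℝ), t))
    simpa only [Function.comp_def, clampUnit_of_mem (Set.right_mem_Icc.2 zero_le_one)] using this
  have e2 : Continuous fun t : ℝ => ‖contourDensity g γ 1 t‖ * ((1 + |t|) ^ κ) ^ m :=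
    e1.norm.mul ((Continuous.rpow_const (by fun_prop) fun _ => Or.inr hκ).pow m)
  rw [← integrableOn_univ, ← Set.union_compl_self (Set.Icc (-T) T)]
  refine (e2.continuousOn.integrableOn_compact isCompact_Icc).union ?_
  refine (hint.integrableOn (s := (Set.Icc (-T) T)ᶜ)).congr_fun (fun t ht => ?_)
    measurableSet_Icc.compl
  have ht' : T < |t| := by
    by_contra hcon
    exact ht (abs_le.1 (not_lt.1 hcon))
  simp only [contourDensity_one, h.eq_ofReal t ht'.le, h.deriv_eq_one ht', mul_one]

theorem tendsto_contourKernel (h : IsDeformation g γ T) (hκ : 0 < κ)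
    (hs : s ∈ Set.Icc (0 : ℝ) 1) (a b : ℝ) :
    Tendsto (fun ε => contourKernel γ κ ε s a b) (nhdsWithin 0 (Set.Ioc 0 1))
      (nhds (contourKernel γ κ 0 s a b)) := by
  have key : ∀ {a b : ℝ}, a < b → Tendsto (fun ε => contourKernel γ κ ε s a b)
      (nhdsWithin 0 (Set.Ioc 0 1)) (nhds (contourKernel γ κ 0 s a b)) := by
    intro a b hab
    have h1 := h.lineHomotopy_sub_mem hs hab
    unfold contourKernel
    rw [max_eq_right hab.le, min_eq_left hab.le]
    have h2 : ContinuousAt (fun ε : ℝ => (lineHomotopy γ s b - lineHomotopy γ s a + (ε : ℂ)) ^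
        (κ : ℂ)) 0 := by
      refine ContinuousAt.cpow (by fun_prop) continuousAt_const ?_
      simpa using h1
    exact h2.tendsto.mono_left nhdsWithin_le_nhds
  rcases lt_trichotomy a b with hab | rfl | hab
  · exact key hab
  · unfold contourKernel
    simp only [max_self, min_self, sub_self, zero_add, Complex.ofReal_zero]
    have h1 : Tendsto (fun ε : ℝ => ((ε ^ κ : ℝ) : ℂ)) (nhdsWithin 0 (Set.Ioc 0 1))
        (nhds (((0 : ℝ) ^ κ : ℝ) : ℂ)) :=
      ((Complex.continuous_ofReal.tendsto _).comp
        (Real.continuousAt_rpow_const 0 κ (Or.inr hκ.le)).tendsto).mono_left nhdsWithin_le_nhds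
    rw [Complex.ofReal_cpow le_rfl, Complex.ofReal_zero] at h1
    refine h1.congr' ?_
    filter_upwards [self_mem_nhdsWithin] with ε hε
    rw [Complex.ofReal_cpow hε.1.le]
  · have := key hab
    simp_rw [contourKernel_comm b a] at this
    exact this

theorem integrable_density (h : IsDeformation g γ T) (hκ : 0 ≤ κ) {m : ℕ}
    (hint : Integrable fun t : ℝ => ‖g t‖ * ((1 + |t|) ^ κ) ^ m) (hs : s = 0 ∨ s = 1) :
    Integrable fun t : ℝ => ‖contourDensity g γ s t‖ * ((1 + |t|) ^ κ) ^ m := by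
  rcases hs with rfl | rfl
  · simpa only [contourDensity_zero] using hint
  · exact h.integrable_density_one hκ hint

theorem integrable_contourIntegrand (h : IsDeformation g γ T) (hκ : 0 ≤ κ)
    (hint : Integrable fun t : ℝ => ‖g t‖ * ((1 + |t|) ^ κ) ^ (d - 1)) (hs : s = 0 ∨ s = 1)
    (hε : ε ∈ Set.Icc (0 : ℝ) 1) :
    Integrable fun t : Fin d → ℝ => contourIntegrand g γ κ ε s t := by
  have hs' : s ∈ Set.Icc (0 : ℝ) 1 := by rcases hs with rfl | rfl <;> simp
  obtain ⟨c, _, hc⟩ := h.exists_norm_contourIntegrand_le (d := d) hκ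
  exact Integrable.of_norm_le_prod (fun _ => h.integrable_density hκ hint hs) c
    (h.measurable_contourIntegrand hs').aestronglyMeasurable
    (ae_of_all _ fun t => hc s hs' ε hε t)

theorem tendsto_integral_contourIntegrand (h : IsDeformation g γ T) (hκ : 0 < κ)
    (hint : Integrable fun t : ℝ => ‖g t‖ * ((1 + |t|) ^ κ) ^ (d - 1)) (hs : s = 0 ∨ s = 1) :
    Tendsto (fun ε => ∫ t : Fin d → ℝ, contourIntegrand g γ κ ε s t)
      (nhdsWithin 0 (Set.Ioc 0 1)) (nhds (∫ t : Fin d → ℝ, contourIntegrand g γ κ 0 s t)) := by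
  have hs' : s ∈ Set.Icc (0 : ℝ) 1 := by rcases hs with rfl | rfl <;> simp
  obtain ⟨c, _, hc⟩ := h.exists_norm_contourIntegrand_le (d := d) hκ.le
  refine tendsto_integral_filter_of_dominated_convergence _
    (Eventually.of_forall fun ε => (h.measurable_contourIntegrand hs').aestronglyMeasurable) ?_
    ((Integrable.fintype_prod fun _ : Fin d => h.integrable_density hκ.le hint hs).const_mul c)
    (ae_of_all _ fun t => ?_)
  · filter_upwards [self_mem_nhdsWithin] with ε hε
    exact ae_of_all _ fun t => hc s hs' ε (Set.Ioc_subset_Icc_self hε) t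
  · unfold contourIntegrand pairProd
    exact (tendsto_finsetProd _ fun j _ => tendsto_finsetProd _ fun k _ =>
      h.tendsto_contourKernel hκ hs' _ _).const_mul _

/-- Cubes exhaust the space. Convergence is needed at the two ends `s = 0, 1` only, since the
intermediate contours occur only on cubes. -/
theorem integral_contourIntegrand_eq_of_pos (h : IsDeformation g γ T) (hκ : 0 < κ)
    (hint : Integrable fun t : ℝ => ‖g t‖ * ((1 + |t|) ^ κ) ^ (d - 1)) (hε : ε ∈ Set.Ioc (0 : ℝ) 1) :
    ∫ t : Fin d → ℝ, contourIntegrand g γ κ ε 1 t =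
      ∫ t : Fin d → ℝ, contourIntegrand g γ κ ε 0 t := by
  have key : ∀ s : ℝ, s = 0 ∨ s = 1 → Tendsto (fun n : ℕ =>
      ∫ t, contourIntegrand g γ κ ε s t ∂cubeMeasure d n) atTop
      (nhds (∫ t : Fin d → ℝ, contourIntegrand g γ κ ε s t)) := by
    intro s hs
    have hI := h.integrable_contourIntegrand hκ.le hint hs (Set.Ioc_subset_Icc_self hε)
    have hU : ⋃ n : ℕ, (Set.univ.pi fun _ : Fin d => Set.Ioc (-(n : ℝ)) n) = Set.univ := by
      refine Set.eq_univ_of_forall fun t => Set.mem_iUnion.2 ?_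
      obtain ⟨n, hn⟩ := exists_nat_gt (∑ j, |t j|)
      refine ⟨n, fun j _ => ?_⟩
      have : |t j| < n :=
        (Finset.single_le_sum (fun j _ => abs_nonneg (t j)) (Finset.mem_univ j)).trans_lt hn
      exact ⟨(abs_lt.1 this).1, (abs_lt.1 this).2.le⟩
    have := tendsto_setIntegral_of_monotone (μ := volume)
      (s := fun n : ℕ => Set.univ.pi fun _ : Fin d => Set.Ioc (-(n : ℝ)) n)
      (f := fun t => contourIntegrand g γ κ ε s t)
      (fun n => MeasurableSet.univ_pi fun _ => measurableSet_Ioc)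
      (fun m n hmn => Set.pi_mono fun j _ => Set.Ioc_subset_Ioc
        (neg_le_neg (by exact_mod_cast hmn)) (by exact_mod_cast hmn))
      (by rw [hU]; exact hI.integrableOn)
    rw [hU, setIntegral_univ] at this
    simp only [cubeMeasure_eq]
    exact this
  refine tendsto_nhds_unique (key 1 (Or.inr rfl)) ((key 0 (Or.inl rfl)).congr' ?_)
  filter_upwards [eventually_ge_atTop ⌈T⌉₊] with n hn
  exact (h.integral_contourIntegrand_cube hε.1 (Nat.ceil_le.1 hn)).symm

theorem integral_eq_contour (h : IsDeformation g γ T) (hκ : 0 < κ)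
    (hint : Integrable fun t : ℝ => ‖g t‖ * ((1 + |t|) ^ κ) ^ (d - 1)) :
    ∫ t : Fin d → ℝ, (∏ j, g (t j)) * (absVandermondePow κ t : ℂ) =
      ∫ t : Fin d → ℝ, contourIntegrand g γ κ 0 1 t := by
  have hne : (nhdsWithin (0 : ℝ) (Set.Ioc 0 1)).NeBot := left_nhdsWithin_Ioc_neBot zero_lt_one
  simp_rw [← contourIntegrand_zero g γ κ]
  refine tendsto_nhds_unique (h.tendsto_integral_contourIntegrand hκ hint (Or.inl rfl))
    ((h.tendsto_integral_contourIntegrand hκ hint (Or.inr rfl)).congr' ?_)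
  filter_upwards [self_mem_nhdsWithin] with ε hε
  exact h.integral_contourIntegrand_eq_of_pos hκ hint hε

end IsDeformation

/-! ### Straightening a contour near a point. -/

section Straighten

variable {γ : ℝ → ℂ} {T : ℝ}

theorem exists_smooth_cutoff : ∃ (χ : ℝ → ℝ) (L : ℝ), ContDiff ℝ 1 χ ∧ 0 ≤ L ∧
    (∀ x, |deriv χ x| ≤ L) ∧ (∀ x, |χ x| ≤ 1) ∧ (∀ x, |x| ≤ 1 → χ x = 1) ∧
    ∀ x, 2 ≤ |x| → χ x = 0 := by
  let b : ContDiffBump (0 : ℝ) := ⟨1, 2, one_pos, one_lt_two⟩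
  have hb : ContDiff ℝ 1 b := b.contDiff
  obtain ⟨L, hL⟩ := (hb.continuous_deriv le_rfl).bounded_above_of_compact_support
    b.hasCompactSupport.deriv
  refine ⟨b, L, hb, (norm_nonneg _).trans (hL 0), hL, fun x => ?_, fun x hx => ?_, fun x hx => ?_⟩
  · rw [abs_of_nonneg b.nonneg]; exact b.le_one
  · exact b.one_of_mem_closedBall (by simpa using hx)
  · exact b.zero_of_le_dist (by simpa using hx)

/-- For parameters in a bounded range, one near `t₀` and the other not, the differences form a
compact subset of the slit plane. For the remaining ones the far point is real and so remote that
the real part of the difference is at least `1`. -/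
theorem exists_ball_sub_subset_slitPlane (hγ : Continuous γ) (hT : 0 ≤ T)
    (heq : ∀ t : ℝ, T ≤ |t| → γ t = t)
    (hsub : ∀ s t : ℝ, s < t → γ t - γ s ∈ Complex.slitPlane) (t₀ : ℝ) {r₀ : ℝ} (hr₀ : 0 < r₀) :
    ∃ η > 0, ∀ s t : ℝ, s < t →
      ((|t - t₀| ≤ r₀ / 2 ∧ r₀ ≤ |s - t₀|) ∨ (|s - t₀| ≤ r₀ / 2 ∧ r₀ ≤ |t - t₀|)) →
      Metric.ball (γ t - γ s) η ⊆ Complex.slitPlane := by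
  obtain ⟨M, hM⟩ := (isCompact_Icc (a := t₀ - r₀ / 2) (b := t₀ + r₀ / 2)).exists_bound_of_continuousOn
    hγ.continuousOn
  have hM0 : 0 ≤ M := (norm_nonneg _).trans (hM t₀ ⟨by linarith, by linarith⟩)
  set T' := T + M + 1 with hT'
  have hre : ∀ z : ℂ, 1 ≤ z.re → Metric.ball z 1 ⊆ Complex.slitPlane := by
    intro z hz w hw
    rw [Complex.mem_slitPlane_iff]
    left
    have h1 := (Complex.abs_re_le_norm (w - z)).trans_lt (mem_ball_iff_norm.1 hw)
    have := (abs_lt.1 h1).1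
    rw [Complex.sub_re] at this
    linarith
  have hcont : Continuous fun p : ℝ × ℝ => γ p.2 - γ p.1 := by fun_prop
  have hK1 : IsCompact ((fun p : ℝ × ℝ => γ p.2 - γ p.1) ''
      (Set.Icc (-T') (t₀ - r₀) ×ˢ Set.Icc (t₀ - r₀ / 2) (t₀ + r₀ / 2))) :=
    (isCompact_Icc.prod isCompact_Icc).image hcont
  have hK2 : IsCompact ((fun p : ℝ × ℝ => γ p.2 - γ p.1) ''
      (Set.Icc (t₀ - r₀ / 2) (t₀ + r₀ / 2) ×ˢ Set.Icc (t₀ + r₀) T')) :=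
    (isCompact_Icc.prod isCompact_Icc).image hcont
  obtain ⟨δ₁, hδ₁, h₁⟩ := hK1.exists_thickening_subset_open Complex.isOpen_slitPlane (by
    rintro _ ⟨p, hp, rfl⟩
    exact hsub _ _ (by linarith [hp.1.2, hp.2.1]))
  obtain ⟨δ₂, hδ₂, h₂⟩ := hK2.exists_thickening_subset_open Complex.isOpen_slitPlane (by
    rintro _ ⟨p, hp, rfl⟩
    exact hsub _ _ (by linarith [hp.1.2, hp.2.1]))
  refine ⟨min 1 (min δ₁ δ₂), by positivity, fun s t hst h => ?_⟩
  rcases h with ⟨h1, h2⟩ | ⟨h1, h2⟩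
  · have ht := abs_le.1 h1
    have hs : s ≤ t₀ - r₀ := by
      rcases le_abs.1 h2 with h | h <;> linarith
    rcases le_or_gt (-T') s with h3 | h3
    · refine Set.Subset.trans ?_ h₁
      refine (Metric.ball_subset_ball ((min_le_right _ _).trans (min_le_left _ _))).trans ?_
      have hmem : (s, t) ∈ Set.Icc (-T') (t₀ - r₀) ×ˢ Set.Icc (t₀ - r₀ / 2) (t₀ + r₀ / 2) :=
        ⟨⟨h3, hs⟩, by linarith, by linarith⟩
      exact Metric.ball_subset_thickening
        (Set.mem_image_of_mem (fun p : ℝ × ℝ => γ p.2 - γ p.1) hmem) _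
    · refine (Metric.ball_subset_ball (min_le_left _ _)).trans (hre _ ?_)
      have h4 := (Complex.abs_re_le_norm _).trans (hM t ⟨by linarith, by linarith⟩)
      rw [heq s (by rw [abs_of_neg (by linarith)]; linarith), Complex.sub_re, Complex.ofReal_re]
      linarith [(abs_le.1 h4).1]
  · have hs := abs_le.1 h1
    have ht : t₀ + r₀ ≤ t := by
      rcases le_abs.1 h2 with h | h <;> linarith
    rcases le_or_gt t T' with h3 | h3
    · refine Set.Subset.trans ?_ h₂
      refine (Metric.ball_subset_ball ((min_le_right _ _).trans (min_le_right _ _))).trans ?_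
      have hmem : (s, t) ∈ Set.Icc (t₀ - r₀ / 2) (t₀ + r₀ / 2) ×ˢ Set.Icc (t₀ + r₀) T' :=
        ⟨⟨by linarith, by linarith⟩, ht, h3⟩
      exact Metric.ball_subset_thickening
        (Set.mem_image_of_mem (fun p : ℝ × ℝ => γ p.2 - γ p.1) hmem) _
    · refine (Metric.ball_subset_ball (min_le_left _ _)).trans (hre _ ?_)
      have h4 := (Complex.abs_re_le_norm _).trans (hM s ⟨by linarith, by linarith⟩)
      rw [heq t (by rw [abs_of_pos (by linarith)]; linarith), Complex.sub_re, Complex.ofReal_re]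
      linarith [(abs_le.1 h4).2]

theorem norm_sub_le_of_deriv_bound_near {D : ℝ → ℂ} (hD : Differentiable ℝ D) {t₀ r ν : ℝ}
    (hb : ∀ t, |t - t₀| ≤ r → ‖deriv D t‖ ≤ ν) {s t : ℝ} (hs : |s - t₀| ≤ r) (ht : |t - t₀| ≤ r) :
    ‖D t - D s‖ ≤ ν * |t - s| := by
  have hc : Convex ℝ (Metric.closedBall t₀ r) := convex_closedBall t₀ r
  have := hc.norm_image_sub_le_of_norm_deriv_le (f := D) (C := ν) (fun x _ => hD x)
    (fun x hx => hb x (by simpa [Real.dist_eq] using hx)) (x := s) (y := t)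
    (by simpa [Real.dist_eq] using hs) (by simpa [Real.dist_eq] using ht)
  simpa using this

/-- The curve is replaced by its tangent line within a cutoff of scale `r`. Near `t₀` the perturbed
difference quotients remain in a ball around `deriv γ t₀` inside the slit plane. If one parameter is
near and the other far, a uniform ball is available, and otherwise nothing changes. The error bound
is relative to `|t - t₀|`, as needed to keep the descent of `Re f` up to the saddle. -/
theorem exists_straighten (hγ : ContDiff ℝ 1 γ) (hT : 0 ≤ T)
    (heq : ∀ t : ℝ, T ≤ |t| → γ t = t)
    (hsub : ∀ s t : ℝ, s < t → γ t - γ s ∈ Complex.slitPlane) {t₀ : ℝ}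
    (ht₀ : deriv γ t₀ ∈ Complex.slitPlane) {ρ : ℝ} (hρ : 0 < ρ) :
    ∃ (γ' : ℝ → ℂ) (r : ℝ), 0 < r ∧ ContDiff ℝ 1 γ' ∧
      (∀ t, ρ ≤ |t - t₀| → γ' t = γ t) ∧
      (∀ t, |t - t₀| ≤ r → γ' t = γ t₀ + deriv γ t₀ * ((t - t₀ : ℝ) : ℂ)) ∧
      (∀ s t : ℝ, s < t → γ' t - γ' s ∈ Complex.slitPlane) ∧
      ∀ t, ‖γ' t - γ t‖ ≤ ρ * |t - t₀| := by
  obtain ⟨χ, L, hχ, hL0, hL, hχ1, hχone, hχzero⟩ := exists_smooth_cutoff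
  set v := deriv γ t₀ with hv
  have hγd : Differentiable ℝ γ := hγ.differentiable one_ne_zero
  have hγc : Continuous (deriv γ) := hγ.continuous_deriv le_rfl
  obtain ⟨ν₀, hν₀, hball⟩ := Metric.isOpen_iff.1 Complex.isOpen_slitPlane v ht₀
  set ν := ν₀ / 3 with hνdef
  have hν : 0 < ν := by positivity
  have hnear : ∀ c > 0, ∃ r > 0, ∀ t, |t - t₀| ≤ r → ‖v - deriv γ t‖ ≤ c := by
    intro c hc
    obtain ⟨δ, hδ, h⟩ := Metric.continuousAt_iff.1 hγc.continuousAt c hc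
    refine ⟨δ / 2, by positivity, fun t ht => ?_⟩
    have := h (show dist t t₀ < δ by rw [Real.dist_eq]; linarith)
    rw [dist_eq_norm] at this
    rw [← norm_neg, neg_sub]
    exact this.le
  obtain ⟨r₀, hr₀, hr₀b⟩ := hnear ν hν
  obtain ⟨η, hη, hηb⟩ := exists_ball_sub_subset_slitPlane hγ.continuous hT heq hsub t₀ hr₀
  -- The derivative of the perturbation is at most `(L / r)(2 r ν₁) + ν₁ = (2L + 1) ν₁`; the scale
  -- `r` cancels, so `ν₁` can be fixed before `r`.
  set ν₁ := min ν ρ / (2 * L + 1) with hν₁def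
  have hν₁ : 0 < ν₁ := by positivity
  have hν₁K : (2 * L + 1) * ν₁ = min ν ρ := by rw [hν₁def]; field_simp
  obtain ⟨r₁, hr₁, hr₁b⟩ := hnear ν₁ hν₁
  set r := min (min (r₁ / 2) (r₀ / 4)) (min (ρ / 2) (η / (2 * ν₁ + 1) / 2)) with hrdef
  have hr : 0 < r := by positivity
  have hr1 : 2 * r ≤ r₁ := by
    have := (min_le_left (min (r₁ / 2) (r₀ / 4)) (min (ρ / 2) (η / (2 * ν₁ + 1) / 2))).trans
      (min_le_left _ _)
    linarith
  have hr2 : 2 * r ≤ r₀ / 2 := by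
    have := (min_le_left (min (r₁ / 2) (r₀ / 4)) (min (ρ / 2) (η / (2 * ν₁ + 1) / 2))).trans
      (min_le_right _ _)
    linarith
  have hr3 : 2 * r ≤ ρ := by
    have := (min_le_right (min (r₁ / 2) (r₀ / 4)) (min (ρ / 2) (η / (2 * ν₁ + 1) / 2))).trans
      (min_le_left _ _)
    linarith
  have hr4 : ν₁ * (2 * r) < η := by
    have h1 := (min_le_right (min (r₁ / 2) (r₀ / 4)) (min (ρ / 2) (η / (2 * ν₁ + 1) / 2))).trans
      (min_le_right _ _)
    have h2 : 2 * r ≤ η / (2 * ν₁ + 1) := by linarith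
    rw [le_div_iff₀ (by positivity)] at h2
    nlinarith
  set D : ℝ → ℂ := fun t => γ t₀ + v * ((t - t₀ : ℝ) : ℂ) - γ t with hD
  have hDc : ContDiff ℝ 1 D := by
    have h1 : ContDiff ℝ 1 fun t : ℝ => ((t - t₀ : ℝ) : ℂ) :=
      Complex.ofRealCLM.contDiff.comp (contDiff_id.sub contDiff_const)
    exact (contDiff_const.add (contDiff_const.mul h1)).sub hγ
  have hDd : ∀ t, HasDerivAt D (v - deriv γ t) t := by
    intro t
    have h1 := (((hasDerivAt_id t).sub_const t₀).ofReal_comp).const_mul v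
    have h2 := (h1.const_add (γ t₀)).sub (hγd t).hasDerivAt
    convert! h2 using 1
    simp
  have hD0 : D t₀ = 0 := by simp [hD]
  have hDb : ∀ t, |t - t₀| ≤ r₁ → ‖D t‖ ≤ ν₁ * |t - t₀| := by
    intro t ht
    have := norm_sub_le_of_deriv_bound_near (D := D) (fun t => (hDd t).differentiableAt)
      (r := r₁) (ν := ν₁) (fun t ht => by rw [(hDd t).deriv]; exact hr₁b t ht)
      (s := t₀) (by simpa using hr₁.le) ht
    rwa [hD0, sub_zero] at this
  set e : ℝ → ℂ := fun t => ((χ ((t - t₀) / r) : ℝ) : ℂ) * D t with he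
  have hec : ContDiff ℝ 1 e := by
    have h1 : ContDiff ℝ 1 fun t : ℝ => χ ((t - t₀) / r) :=
      hχ.comp ((contDiff_id.sub contDiff_const).div_const r)
    exact (Complex.ofRealCLM.contDiff.comp h1).mul hDc
  have he0 : ∀ t, 2 * r ≤ |t - t₀| → e t = 0 := by
    intro t ht
    have : χ ((t - t₀) / r) = 0 := hχzero _ (by
      rw [abs_div, abs_of_pos hr, le_div_iff₀ hr]; exact ht)
    simp [he, this]
  have heb : ∀ t, ‖e t‖ ≤ ν₁ * |t - t₀| := by
    intro t
    rcases le_total (2 * r) |t - t₀| with h | h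
    · rw [he0 t h, norm_zero]; positivity
    · have h1 : ‖e t‖ ≤ 1 * ‖D t‖ := by
        simp only [he, norm_mul, Complex.norm_real]
        exact mul_le_mul_of_nonneg_right (hχ1 _) (norm_nonneg _)
      rw [one_mul] at h1
      exact h1.trans (hDb t (h.trans hr1))
  have hed : ∀ t, ‖deriv e t‖ ≤ min ν ρ := by
    intro t
    rcases lt_or_ge (2 * r) |t - t₀| with h | h
    · have h1 : e =ᶠ[nhds t] fun _ => 0 := by
        have hcont : Continuous fun x : ℝ => |x - t₀| := by fun_prop
        filter_upwards [hcont.continuousAt.eventually (lt_mem_nhds h)] with x hx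
        exact he0 x hx.le
      rw [h1.deriv_eq, deriv_const, norm_zero]
      positivity
    · have h1 : HasDerivAt (fun t => χ ((t - t₀) / r)) (deriv χ ((t - t₀) / r) * (1 / r)) t :=
        ((hχ.differentiable one_ne_zero _).hasDerivAt).comp t
          (((hasDerivAt_id t).sub_const t₀).div_const r)
      have h2 : HasDerivAt e _ t := h1.ofReal_comp.mul (hDd t)
      rw [h2.deriv, ← hν₁K]
      refine (norm_add_le _ _).trans ?_
      rw [norm_mul, norm_mul, Complex.norm_real, Complex.norm_real, norm_mul, Real.norm_eq_abs,
        Real.norm_eq_abs, Real.norm_eq_abs, abs_of_pos (by positivity : 0 < 1 / r)]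
      have h3 : ‖D t‖ ≤ ν₁ * (2 * r) := (hDb t (h.trans hr1)).trans (by gcongr)
      have h4 := hr₁b t (h.trans hr1)
      have h5 : |deriv χ ((t - t₀) / r)| * (1 / r) * ‖D t‖ ≤ L * (1 / r) * (ν₁ * (2 * r)) := by
        gcongr
        exact hL _
      have h6 : |χ ((t - t₀) / r)| * ‖v - deriv γ t‖ ≤ 1 * ν₁ := by
        gcongr
        exact hχ1 _
      have h7 : L * (1 / r) * (ν₁ * (2 * r)) = 2 * L * ν₁ := by field_simp
      linarith
  have hel : ∀ s t, ‖e t - e s‖ ≤ ν * |t - s| := by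
    intro s t
    have := norm_sub_le_of_deriv_bound_near (D := e) (hec.differentiable one_ne_zero) (t₀ := t₀)
      (r := max |s - t₀| |t - t₀|) (fun x _ => (hed x).trans (min_le_left _ _))
      (le_max_left _ _) (le_max_right _ _)
    exact this
  refine ⟨fun t => γ t + e t, r, hr, hγ.add hec, fun t ht => ?_, fun t ht => ?_,
    fun s t hst => ?_, fun t => ?_⟩
  · change γ t + e t = γ t
    rw [he0 t (hr3.trans ht), add_zero]
  · have : χ ((t - t₀) / r) = 1 := hχone _ (by
      rw [abs_div, abs_of_pos hr, div_le_one hr]; exact ht)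
    simp [he, this, hD]
  · change γ t + e t - (γ s + e s) ∈ _
    have hsplit : γ t + e t - (γ s + e s) = (γ t - γ s) + (e t - e s) := by ring
    rw [hsplit]
    by_cases hboth : |s - t₀| ≤ r₀ ∧ |t - t₀| ≤ r₀
    · have h1 := norm_sub_le_of_deriv_bound_near (D := D) (fun t => (hDd t).differentiableAt)
        (fun t ht => by rw [(hDd t).deriv]; exact hr₀b t ht) hboth.1 hboth.2
      have h2 := hel s t
      rw [abs_of_pos (by linarith)] at h1 h2
      have hts : 0 < t - s := by linarith
      -- Relative to the tangent direction, the quotient is off by a part from the curve and a part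
      -- from the perturbation, each at most `ν = ν₀ / 3`.
      set w : ℂ := ((t - s : ℝ) : ℂ)⁻¹ * (e t - e s - (D t - D s)) with hw
      have hne : ((t - s : ℝ) : ℂ) ≠ 0 := by exact_mod_cast hts.ne'
      have h3 : (γ t - γ s) + (e t - e s) = ((t - s : ℝ) : ℂ) * (v + w) := by
        rw [hw, mul_add, mul_inv_cancel_left₀ hne]
        simp only [hD]; push_cast; ring
      rw [h3]
      refine ofReal_mul_mem_slitPlane (hball ?_) hts
      rw [mem_ball_iff_norm, add_sub_cancel_left, hw, norm_mul, norm_inv, Complex.norm_real,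
        Real.norm_of_nonneg hts.le, inv_mul_lt_iff₀ hts]
      refine (norm_sub_le _ _).trans_lt ?_
      have : ν₀ = 3 * ν := by rw [hνdef]; ring
      rw [this]
      nlinarith
    · by_cases hs : 2 * r ≤ |s - t₀|
      · by_cases ht : 2 * r ≤ |t - t₀|
        · rw [he0 s hs, he0 t ht, sub_zero, add_zero]
          exact hsub s t hst
        · push Not at ht hboth
          have hs' : r₀ ≤ |s - t₀| := by
            by_contra hcon
            have := hboth (not_le.1 hcon).le
            linarith
          refine hηb s t hst (Or.inl ⟨by linarith, hs'⟩) ?_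
          rw [he0 s hs, sub_zero, mem_ball_iff_norm, add_sub_cancel_left]
          refine (heb t).trans_lt (lt_of_le_of_lt ?_ hr4)
          gcongr
      · push Not at hs hboth
        have ht' := hboth (by linarith)
        refine hηb s t hst (Or.inr ⟨by linarith, ht'.le⟩) ?_
        rw [he0 t (by linarith), zero_sub, mem_ball_iff_norm, add_sub_cancel_left, norm_neg]
        refine (heb s).trans_lt (lt_of_le_of_lt ?_ hr4)
        gcongr
  · change ‖γ t + e t - γ t‖ ≤ _
    rw [add_sub_cancel_left]
    refine (heb t).trans ?_
    have : ν₁ ≤ ρ := by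
      have h1 : ν₁ ≤ (2 * L + 1) * ν₁ := le_mul_of_one_le_left hν₁.le (by linarith)
      rw [hν₁K] at h1
      exact h1.trans (min_le_right _ _)
    gcongr

end Straighten

/-! ### Taylor expansion at a simple saddle point. -/

section Taylor

theorem AnalyticAt.exists_norm_sub_taylor_le {F : ℂ → ℂ} {u₀ : ℂ} (hF : AnalyticAt ℂ F u₀) (n : ℕ) :
    ∃ C r : ℝ, 0 ≤ C ∧ 0 < r ∧ ∀ w : ℂ, ‖w‖ ≤ r →
      ‖F (u₀ + w) - ∑ k ∈ Finset.range n, iteratedDeriv k F u₀ / (k.factorial : ℂ) * w ^ k‖ ≤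
        C * ‖w‖ ^ n := by
  obtain ⟨C, hC, h⟩ := (hF.hasFPowerSeriesAt.isBigO_sub_partialSum_pow n).exists_nonneg
  obtain ⟨r, hr, hb⟩ := Metric.eventually_nhds_iff.1 h.bound
  refine ⟨C, r / 2, hC, by positivity, fun w hw => ?_⟩
  have := hb (show dist w 0 < r by rw [dist_zero_right]; linarith)
  rw [norm_pow, norm_norm] at this
  convert! this using 3
  rw [FormalMultilinearSeries.partialSum]
  refine Finset.sum_congr rfl fun k _ => ?_
  rw [FormalMultilinearSeries.apply_eq_pow_smul_coeff, smul_eq_mul, mul_comm]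
  simp [FormalMultilinearSeries.coeff_ofScalars]

variable {f : ℂ → ℂ} {u₀ : ℂ} {R φ θ : ℝ}

/-- `2 θ + φ` is an odd multiple of `π`, whichever representative of the angle is taken. -/
theorem IsSimpleSaddle.deriv2_mul_exp_sq (hf : IsSimpleSaddle f u₀ R φ θ) :
    iteratedDeriv 2 f u₀ * Complex.exp (Complex.I * θ) ^ 2 = -R := by
  obtain ⟨m, hm⟩ := hf.angle_eq
  rw [hf.deriv2_eq, ← Complex.exp_nat_mul, mul_assoc, ← Complex.exp_add, hm]
  have : Complex.I * (φ : ℂ) + ((2 : ℕ) : ℂ) * (Complex.I * (((Real.pi - φ) / 2 + m * Real.pi : ℝ) : ℂ))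
      = Real.pi * Complex.I + m * (2 * Real.pi * Complex.I) := by
    push_cast; ring
  rw [this, Complex.exp_add, Complex.exp_pi_mul_I, Complex.exp_int_mul_two_pi_mul_I]
  ring

theorem IsSimpleSaddle.exists_taylor (hf : IsSimpleSaddle f u₀ R φ θ) :
    ∃ (b : ℂ) (C r : ℝ), 0 ≤ C ∧ 0 < r ∧ ∀ y : ℂ, ‖y‖ ≤ r →
      ‖f (u₀ + Complex.exp (Complex.I * θ) * y) - f u₀ + R / 2 * y ^ 2 - b * y ^ 3‖ ≤
        C * ‖y‖ ^ 4 := by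
  obtain ⟨C, r, hC, hr, h⟩ := hf.analyticAt.exists_norm_sub_taylor_le 4
  refine ⟨iteratedDeriv 3 f u₀ / 6 * Complex.exp (Complex.I * θ) ^ 3, C, r, hC, hr, fun y hy => ?_⟩
  have hn : ‖Complex.exp (Complex.I * θ) * y‖ = ‖y‖ := by
    rw [norm_mul, mul_comm Complex.I, Complex.norm_exp_ofReal_mul_I, one_mul]
  have := h (Complex.exp (Complex.I * θ) * y) (by rwa [hn])
  rw [hn] at this
  convert! this using 2
  simp only [Finset.sum_range_succ, Finset.sum_range_zero, iteratedDeriv_zero, iteratedDeriv_one,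
    hf.deriv_eq_zero, Nat.factorial]
  push_cast
  linear_combination (y ^ 2 / 2) * hf.deriv2_mul_exp_sq

/-- Along every path that is sufficiently tangent to the direction of steepest descent, the real
part of `f` decreases near a simple saddle point. -/
theorem IsSimpleSaddle.exists_descent (hf : IsSimpleSaddle f u₀ R φ θ) {c : ℝ} (hc : 0 < c) :
    ∃ ρ : ℝ, 0 < ρ ∧ ∀ (x : ℝ) (u : ℂ), x ≠ 0 → |x| ≤ ρ →
      ‖u - (u₀ + c * Complex.exp (Complex.I * θ) * x)‖ ≤ ρ * |x| → (f u).re < (f u₀).re := by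
  obtain ⟨b, C, r, hC, hr, h⟩ := hf.exists_taylor
  have hR := hf.pos
  set B := ‖b‖ + C * 1 with hB
  -- The entries ensure, in this order: `Re y² ≥ (c|x|)² / 2` despite the deviation of the path;
  -- `‖y‖ ≤ 1`; `y` lies in the disc of the Taylor bound; the cubic and quartic terms are beaten by
  -- the quadratic one.
  set ρ := min (min (c / 8) (1 / (c + 1))) (min (r / (2 * c + 1)) (R / (16 * (B + 1) * (2 * c))))
    with hρ
  have hBp : 0 ≤ B := by positivity
  have hρ0 : 0 < ρ := by positivity
  have h1 : ρ ≤ c / 8 := (min_le_left _ _).trans (min_le_left _ _)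
  have h2 : ρ ≤ 1 / (c + 1) := (min_le_left _ _).trans (min_le_right _ _)
  have h3 : ρ ≤ r / (2 * c + 1) := (min_le_right _ _).trans (min_le_left _ _)
  have h4 : ρ ≤ R / (16 * (B + 1) * (2 * c)) := (min_le_right _ _).trans (min_le_right _ _)
  rw [le_div_iff₀ (by positivity)] at h2 h3 h4
  refine ⟨ρ, hρ0, fun x u hx0 hx hu => ?_⟩
  set e := Complex.exp (Complex.I * θ) with he
  have hen : ‖e‖ = 1 := by rw [he, mul_comm Complex.I, Complex.norm_exp_ofReal_mul_I]
  have he0 : e ≠ 0 := Complex.exp_ne_zero _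
  set q := (u - (u₀ + c * e * x)) / e with hq
  have hqn : ‖q‖ ≤ ρ * |x| := by rw [hq, norm_div, hen, div_one]; exact hu
  set y : ℂ := c * x + q with hy
  have huy : u = u₀ + e * y := by rw [hy, hq]; field_simp; ring
  have hxp : 0 < |x| := abs_pos.2 hx0
  have hcx : ‖(c * x : ℂ)‖ = c * |x| := by
    rw [norm_mul, Complex.norm_real, Complex.norm_real, Real.norm_of_nonneg hc.le, Real.norm_eq_abs]
  have hq2 : ‖q‖ ≤ c / 8 * |x| := hqn.trans (by gcongr)
  have hyn : ‖y‖ ≤ 2 * c * |x| := (norm_add_le _ _).trans (by rw [hcx]; nlinarith)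
  have hyr : ‖y‖ ≤ r := hyn.trans (by nlinarith)
  have hy1 : ‖y‖ ≤ 1 := by
    refine (norm_add_le _ _).trans ?_
    rw [hcx]
    nlinarith [mul_le_mul_of_nonneg_left hx hc.le, abs_nonneg x]
  have ht := h y hyr
  rw [← huy] at ht
  have hre := (Complex.abs_re_le_norm _).trans ht
  have hy2 : (y ^ 2).re ≥ (c * |x|) ^ 2 / 2 := by
    have h5 : y ^ 2 = ((c * x : ℝ) : ℂ) ^ 2 + (2 * (c * x) * q + q ^ 2) := by
      rw [hy]; push_cast; ring
    have h6 : ‖2 * (c * x) * q + q ^ 2‖ ≤ (c * |x|) ^ 2 / 2 := by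
      refine (norm_add_le _ _).trans ?_
      rw [norm_mul, norm_mul, hcx, norm_pow, Complex.norm_ofNat]
      have : 0 ≤ c * |x| := by positivity
      nlinarith [norm_nonneg q]
    have h7 := (abs_le.1 ((Complex.abs_re_le_norm _).trans h6)).1
    rw [h5, Complex.add_re, ← Complex.ofReal_pow, Complex.ofReal_re, mul_pow, ← sq_abs x,
      ← mul_pow]
    linarith
  have hb3 : (b * y ^ 3).re ≤ ‖b‖ * ‖y‖ ^ 3 := by
    refine (Complex.re_le_norm _).trans ?_
    rw [norm_mul, norm_pow]
  have h8 := (abs_le.1 hre).2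
  simp only [Complex.sub_re, Complex.add_re] at h8
  have h9 : ((R : ℂ) / 2 * y ^ 2).re = R / 2 * (y ^ 2).re := by
    rw [show (R : ℂ) / 2 = ((R / 2 : ℝ) : ℂ) by push_cast; rfl, Complex.re_ofReal_mul]
  rw [h9] at h8
  have h10 : C * ‖y‖ ^ 4 + ‖b‖ * ‖y‖ ^ 3 ≤ B * ‖y‖ ^ 3 := by
    rw [hB]
    have : C * ‖y‖ ^ 4 ≤ C * ‖y‖ ^ 3 :=
      mul_le_mul_of_nonneg_left (pow_le_pow_of_le_one (norm_nonneg _) hy1 (by norm_num)) hC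
    linarith
  have h11 : B * ‖y‖ ^ 3 < R / 2 * ((c * |x|) ^ 2 / 2) := by
    have h12 : B * ‖y‖ ≤ R / 16 := by
      calc B * ‖y‖ ≤ (B + 1) * (2 * c * |x|) := by gcongr; linarith
        _ ≤ (B + 1) * (2 * c * ρ) := by gcongr
        _ ≤ R / 16 := by linarith
    have h13 : ‖y‖ ^ 2 ≤ (9 / 8 * (c * |x|)) ^ 2 := by
      gcongr
      exact (norm_add_le _ _).trans (by rw [hcx]; linarith)
    have h14 : 0 < (c * |x|) ^ 2 := by positivity
    calc B * ‖y‖ ^ 3 = B * ‖y‖ * ‖y‖ ^ 2 := by ring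
      _ ≤ R / 16 * (9 / 8 * (c * |x|)) ^ 2 := by gcongr
      _ < _ := by nlinarith
  have h15 : R / 2 * ((c * |x|) ^ 2 / 2) ≤ R / 2 * (y ^ 2).re := by gcongr
  linarith

/-- The logarithm of the integrand at a simple saddle point in the scaled variable. -/
theorem IsSimpleSaddle.exists_scaled_taylor (hf : IsSimpleSaddle f u₀ R φ θ) {h : ℂ → ℂ}
    (hh : AnalyticAt ℂ h u₀) :
    ∃ (a b : ℂ) (C r : ℝ), 0 ≤ C ∧ 0 < r ∧ ∀ σ x : ℝ, 0 < σ → |σ * x| ≤ r →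
      ‖(2 / (R * σ ^ 2) * (f (u₀ + Complex.exp (Complex.I * θ) * (σ * x : ℝ)) - f u₀) + x ^ 2 +
        (h (u₀ + Complex.exp (Complex.I * θ) * (σ * x : ℝ)) - h u₀)) - σ * (a * x ^ 3 + b * x)‖ ≤
          C * σ ^ 2 * (1 + |x|) ^ 4 ∧
      ‖2 / (R * σ ^ 2) * (f (u₀ + Complex.exp (Complex.I * θ) * (σ * x : ℝ)) - f u₀) + x ^ 2 +
        (h (u₀ + Complex.exp (Complex.I * θ) * (σ * x : ℝ)) - h u₀)‖ ≤ x ^ 2 / 4 + C := by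
  obtain ⟨a, C₁, r₁, hC₁, hr₁, h₁⟩ := hf.exists_taylor
  obtain ⟨C₂, r₂, hC₂, hr₂, h₂⟩ := hh.exists_norm_sub_taylor_le 2
  have hR := hf.pos
  set e := Complex.exp (Complex.I * θ) with he
  have hen : ‖e‖ = 1 := by rw [he, mul_comm Complex.I, Complex.norm_exp_ofReal_mul_I]
  set b := deriv h u₀ * e with hb
  set K := 2 / R * (‖a‖ + C₁) with hK
  have hK0 : 0 ≤ K := by positivity
  -- The last entry makes the cubic and quartic contributions together at most `x² / 4`, which a
  -- Gaussian weight can absorb.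
  set r := min (min r₁ r₂) (min 1 (1 / (4 * (K + 1)))) with hr
  have hr0 : 0 < r := by positivity
  refine ⟨2 / R * a, b, 2 / R * C₁ + C₂ + ‖b‖, r, by positivity, hr0, fun σ x hσ hx => ?_⟩
  have hx1 : |σ * x| ≤ r₁ := hx.trans ((min_le_left _ _).trans (min_le_left _ _))
  have hx2 : |σ * x| ≤ r₂ := hx.trans ((min_le_left _ _).trans (min_le_right _ _))
  have hx3 : |σ * x| ≤ 1 := hx.trans ((min_le_right _ _).trans (min_le_left _ _))
  have hx4 : |σ * x| ≤ 1 / (4 * (K + 1)) := hx.trans ((min_le_right _ _).trans (min_le_right _ _))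
  have hyn : ‖((σ * x : ℝ) : ℂ)‖ = |σ * x| := by rw [Complex.norm_real, Real.norm_eq_abs]
  have hf1 := h₁ ((σ * x : ℝ) : ℂ) (by rwa [hyn])
  have hh1 := h₂ (e * ((σ * x : ℝ) : ℂ)) (by rwa [norm_mul, hen, one_mul, hyn])
  rw [norm_mul, hen, one_mul] at hh1
  rw [hyn] at hf1 hh1
  simp only [Finset.sum_range_succ, Finset.sum_range_zero, iteratedDeriv_zero, iteratedDeriv_one,
    Nat.factorial, pow_zero, pow_one, zero_add, Nat.cast_one, mul_one, div_one] at hh1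
  set A := f (u₀ + e * ((σ * x : ℝ) : ℂ)) - f u₀ with hA
  set H := h (u₀ + e * ((σ * x : ℝ) : ℂ)) with hH
  set rf := A + R / 2 * ((σ * x : ℝ) : ℂ) ^ 2 - a * ((σ * x : ℝ) : ℂ) ^ 3 with hrf
  set rh := H - (h u₀ + deriv h u₀ * (e * ((σ * x : ℝ) : ℂ))) with hrh
  have hσc : (σ : ℂ) ≠ 0 := by exact_mod_cast hσ.ne'
  have hRc : (R : ℂ) ≠ 0 := by exact_mod_cast hR.ne'
  -- The factor `2 / (R σ²)` stands for `N`; with it the quadratic Taylor term is exactly `-x²` and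
  -- cancels.
  have hz : 2 / (R * σ ^ 2) * A + x ^ 2 + (H - h u₀) =
      σ * (2 / R * a * x ^ 3 + b * x) + (2 / (R * σ ^ 2) * rf + rh) := by
    rw [hrf, hrh, hb]; push_cast; field_simp; ring
  have hcoef : ‖(2 / (R * σ ^ 2) : ℂ)‖ = 2 / (R * σ ^ 2) := by
    rw [norm_div, norm_mul, norm_pow, Complex.norm_real, Complex.norm_real, Complex.norm_ofNat,
      Real.norm_of_nonneg hR.le, Real.norm_of_nonneg hσ.le]
  have habs : |σ * x| = σ * |x| := by rw [abs_mul, abs_of_pos hσ]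
  have hx0 : 0 ≤ |x| := abs_nonneg x
  have hrf2 : ‖2 / (R * σ ^ 2) * rf‖ ≤ 2 / R * C₁ * σ ^ 2 * |x| ^ 4 := by
    rw [norm_mul, hcoef]
    calc 2 / (R * σ ^ 2) * ‖rf‖ ≤ 2 / (R * σ ^ 2) * (C₁ * |σ * x| ^ 4) := by gcongr
      _ = _ := by rw [habs]; field_simp
  have hrh2 : ‖rh‖ ≤ C₂ * σ ^ 2 * |x| ^ 2 := by
    calc ‖rh‖ ≤ C₂ * |σ * x| ^ 2 := hh1
      _ = _ := by rw [habs]; ring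
  rw [hz]
  constructor
  · rw [add_sub_cancel_left]
    have h4 : |x| ^ 4 ≤ (1 + |x|) ^ 4 := by gcongr; linarith
    have h2 : |x| ^ 2 ≤ (1 + |x|) ^ 4 :=
      (pow_le_pow_left₀ hx0 (by linarith) 2).trans (pow_le_pow_right₀ (by linarith) (by norm_num))
    calc _ ≤ 2 / R * C₁ * σ ^ 2 * |x| ^ 4 + C₂ * σ ^ 2 * |x| ^ 2 :=
          (norm_add_le _ _).trans (add_le_add hrf2 hrh2)
      _ ≤ 2 / R * C₁ * σ ^ 2 * (1 + |x|) ^ 4 + C₂ * σ ^ 2 * (1 + |x|) ^ 4 := by gcongr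
      _ ≤ (2 / R * C₁ + C₂ + ‖b‖) * σ ^ 2 * (1 + |x|) ^ 4 := by
        have : 0 ≤ ‖b‖ * (σ ^ 2 * (1 + |x|) ^ 4) := by positivity
        linarith
  · have h3 : ‖(σ : ℂ) * (2 / R * a * x ^ 3 + b * x)‖ ≤
        2 / R * ‖a‖ * |σ * x| * x ^ 2 + ‖b‖ := by
      rw [mul_add]
      refine (norm_add_le _ _).trans (add_le_add (le_of_eq ?_) ?_)
      · simp only [norm_mul, norm_div, norm_pow, Complex.norm_real, Complex.norm_ofNat,
          Real.norm_eq_abs, abs_of_pos hR, abs_of_pos hσ, habs]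
        rw [← sq_abs x]; ring
      · calc ‖(σ : ℂ) * (b * x)‖ = ‖b‖ * |σ * x| := by
              rw [norm_mul, norm_mul, Complex.norm_real, Complex.norm_real, Real.norm_eq_abs,
                Real.norm_eq_abs, abs_of_pos hσ, habs]; ring
          _ ≤ ‖b‖ * 1 := by gcongr
          _ = ‖b‖ := mul_one _
    have h4 : 2 / R * C₁ * σ ^ 2 * |x| ^ 4 ≤ 2 / R * C₁ * |σ * x| * x ^ 2 := by
      have : σ ^ 2 * |x| ^ 4 = |σ * x| * |σ * x| * x ^ 2 := by rw [habs, ← sq_abs x]; ring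
      calc 2 / R * C₁ * σ ^ 2 * |x| ^ 4 = 2 / R * C₁ * (|σ * x| * |σ * x| * x ^ 2) := by
            rw [← this]; ring
        _ ≤ 2 / R * C₁ * (|σ * x| * 1 * x ^ 2) := by gcongr
        _ = _ := by ring
    have h5 : C₂ * σ ^ 2 * |x| ^ 2 ≤ C₂ := by
      calc C₂ * σ ^ 2 * |x| ^ 2 = C₂ * |σ * x| ^ 2 := by rw [habs]; ring
        _ ≤ C₂ * 1 ^ 2 := by gcongr
        _ = C₂ := by ring
    have h6 : K * |σ * x| ≤ 1 / 4 := by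
      rw [le_div_iff₀ (by positivity)] at hx4
      nlinarith [abs_nonneg (σ * x)]
    have h7 : K * |σ * x| * x ^ 2 ≤ 1 / 4 * x ^ 2 := by gcongr
    have h8 : K * |σ * x| * x ^ 2 =
        2 / R * ‖a‖ * |σ * x| * x ^ 2 + 2 / R * C₁ * |σ * x| * x ^ 2 := by rw [hK]; ring
    have h9 : 0 ≤ 2 / R * C₁ := by positivity
    calc _ ≤ (2 / R * ‖a‖ * |σ * x| * x ^ 2 + ‖b‖) +
          (2 / R * C₁ * σ ^ 2 * |x| ^ 4 + C₂ * σ ^ 2 * |x| ^ 2) :=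
          (norm_add_le _ _).trans (add_le_add h3 ((norm_add_le _ _).trans (add_le_add hrf2 hrh2)))
      _ ≤ _ := by linarith

theorem exists_log_add_taylor {Δ : ℂ} (hΔ : Δ ∈ Complex.slitPlane) :
    ∃ C r : ℝ, 0 ≤ C ∧ 0 < r ∧ ∀ y : ℂ, ‖y‖ ≤ r → Δ + y ∈ Complex.slitPlane ∧
      ‖Complex.log (Δ + y) - Complex.log Δ - y / Δ‖ ≤ C * ‖y‖ ^ 2 := by
  have hlog : AnalyticAt ℂ Complex.log Δ := analyticAt_clog hΔ
  obtain ⟨C, r, hC, hr, h⟩ := hlog.exists_norm_sub_taylor_le 2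
  obtain ⟨r', hr', hb⟩ := Metric.isOpen_iff.1 Complex.isOpen_slitPlane Δ hΔ
  refine ⟨C, min r (r' / 2), hC, by positivity, fun y hy => ⟨hb ?_, ?_⟩⟩
  · rw [mem_ball_iff_norm, add_sub_cancel_left]
    have := hy.trans (min_le_right _ _)
    linarith
  · convert! h y (hy.trans (min_le_left _ _)) using 2
    simp only [Finset.sum_range_succ, Finset.sum_range_zero, iteratedDeriv_zero, iteratedDeriv_one,
      Nat.factorial, (Complex.hasDerivAt_log hΔ).deriv]
    simp
    ring

end Taylor

/-! ### Perturbed Gaussian integrals. -/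

section GaussPerturbation

variable {d : ℕ}

theorem exp_neg_half_sq_le_expWeight (x : ℝ) :
    Real.exp (-x ^ 2 / 2) ≤ Real.exp 1 * expWeight 0 x := by
  rw [expWeight, pow_zero, mul_one, ← Real.exp_add, Real.exp_le_exp]
  nlinarith [sq_abs x, sq_nonneg (|x| - 1), abs_nonneg x]

theorem integrable_prod_exp_neg_half_sq (M : ℕ) :
    Integrable fun x : Fin d → ℝ => ∏ i, (Real.exp (-(x i) ^ 2 / 2) * (1 + |x i|) ^ M) := by
  refine integrable_of_le_expWeight (by fun_prop) (∏ _i : Fin d, Real.exp 1) M fun x => ?_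
  rw [← Finset.prod_mul_distrib, Real.norm_of_nonneg (by positivity)]
  refine Finset.prod_le_prod (fun i _ => by positivity) fun i _ => ?_
  calc _ ≤ Real.exp 1 * expWeight 0 (x i) * (1 + |x i|) ^ M := by
        gcongr; exact exp_neg_half_sq_le_expWeight _
    _ = _ := by rw [mul_assoc, expWeight_mul_pow, zero_add]

/-- A Gaussian integral against an even weight does not see a perturbation that is odd to first
order. -/
theorem exists_norm_integral_gauss_sub_le {V : (Fin d → ℝ) → ℝ} {ℓ : (Fin d → ℝ) → ℂ} {M : ℕ}
    {C : ℝ} (hVm : Measurable V) (hV0 : ∀ x, 0 ≤ V x) (hV : ∀ x, V x ≤ ∏ i, (1 + |x i|) ^ M)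
    (hVe : ∀ x, V (-x) = V x) (hℓm : Measurable ℓ) (hℓ : ∀ x, ‖ℓ x‖ ≤ C * ∏ i, (1 + |x i|) ^ M)
    (hℓo : ∀ x, ℓ (-x) = -ℓ x) (hC : 0 ≤ C) :
    ∃ C' : ℝ, 0 ≤ C' ∧ ∀ (σ : ℝ) (E : (Fin d → ℝ) → ℂ),
      (∀ x, ‖E x - 1 - σ * ℓ x‖ ≤
        C * σ ^ 2 * ∏ i, (Real.exp ((x i) ^ 2 / 2) * (1 + |x i|) ^ M)) →
      Integrable (fun x => (((∏ i, Real.exp (-(x i) ^ 2)) * V x : ℝ) : ℂ) * E x) →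
      ‖(∫ x, (((∏ i, Real.exp (-(x i) ^ 2)) * V x : ℝ) : ℂ) * E x) -
        ∫ x, (((∏ i, Real.exp (-(x i) ^ 2)) * V x : ℝ) : ℂ)‖ ≤ C' * σ ^ 2 := by
  set G : (Fin d → ℝ) → ℝ := fun x => (∏ i, Real.exp (-(x i) ^ 2)) * V x with hG
  have hGm : Measurable G := by fun_prop
  have hG0 : ∀ x, 0 ≤ G x := fun x => mul_nonneg (by positivity) (hV0 x)
  have hGle : ∀ x, G x ≤ ∏ i, (Real.exp (-(x i) ^ 2) * (1 + |x i|) ^ M) := fun x => by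
    rw [Finset.prod_mul_distrib]
    exact mul_le_mul_of_nonneg_left (hV x) (by positivity)
  -- One power `M` is for the weight `V` and one for the error; half of the Gaussian is given up to
  -- the factor `e^{x²/2}` of the error.
  have hWint := integrable_prod_exp_neg_half_sq (d := d) (M + M)
  set W : (Fin d → ℝ) → ℝ := fun x => ∏ i, (Real.exp (-(x i) ^ 2 / 2) * (1 + |x i|) ^ (M + M))
    with hW
  have hW0 : ∀ x, 0 ≤ W x := fun x => by rw [hW]; positivity
  have hGW : ∀ x, G x * ∏ i, (1 + |x i|) ^ M ≤ W x := fun x => by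
    refine (mul_le_mul_of_nonneg_right (hGle x) (by positivity)).trans ?_
    rw [← Finset.prod_mul_distrib]
    refine Finset.prod_le_prod (fun i _ => by positivity) fun i _ => ?_
    rw [mul_assoc, ← pow_add]
    gcongr
    nlinarith [sq_nonneg (x i)]
  have hGi : Integrable fun x => ((G x : ℝ) : ℂ) := by
    refine Integrable.ofReal (hWint.mono' hGm.aestronglyMeasurable (ae_of_all _ fun x => ?_))
    change ‖G x‖ ≤ W x
    rw [Real.norm_of_nonneg (hG0 x)]
    refine le_trans ?_ (hGW x)
    exact le_mul_of_one_le_right (hG0 x)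
      (one_le_prod_of_forall_one_le fun i _ => one_le_pow₀ (le_add_of_nonneg_right (abs_nonneg (x i))))
  have hGℓ : Integrable fun x => ((G x : ℝ) : ℂ) * ℓ x := by
    refine (hWint.const_mul C).mono'
      ((Complex.measurable_ofReal.comp hGm).mul hℓm).aestronglyMeasurable (ae_of_all _ fun x => ?_)
    rw [norm_mul, Complex.norm_real, Real.norm_of_nonneg (hG0 x)]
    calc G x * ‖ℓ x‖ ≤ G x * (C * ∏ i, (1 + |x i|) ^ M) :=
          mul_le_mul_of_nonneg_left (hℓ x) (hG0 x)
      _ = C * (G x * ∏ i, (1 + |x i|) ^ M) := by ring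
      _ ≤ _ := mul_le_mul_of_nonneg_left (hGW x) hC
  have hzero : ∫ x, ((G x : ℝ) : ℂ) * ℓ x = 0 := by
    have h1 := integral_neg_eq_self (fun x => ((G x : ℝ) : ℂ) * ℓ x) (volume : Measure (Fin d → ℝ))
    have h2 : ∀ x, ((G (-x) : ℝ) : ℂ) * ℓ (-x) = -(((G x : ℝ) : ℂ) * ℓ x) := fun x => by
      rw [hℓo]
      simp only [hG, hVe, Pi.neg_apply, neg_sq]
      ring
    simp_rw [h2, integral_neg] at h1
    exact self_eq_neg.1 h1.symm
  refine ⟨C * ∫ x, W x, mul_nonneg hC (integral_nonneg hW0), fun σ E hE hint => ?_⟩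
  have h1 : (∫ x, ((G x : ℝ) : ℂ) * E x) - ∫ x, ((G x : ℝ) : ℂ) =
      ∫ x, ((G x : ℝ) : ℂ) * (E x - 1 - σ * ℓ x) := by
    have h2 : (fun x => ((G x : ℝ) : ℂ) * (E x - 1 - σ * ℓ x)) =
        fun x => ((G x : ℝ) : ℂ) * E x - (G x : ℂ) - σ * (((G x : ℝ) : ℂ) * ℓ x) := by
      funext x; ring
    have h3 : Integrable fun x => ((G x : ℝ) : ℂ) * E x - (G x : ℂ) := hint.sub hGi
    rw [h2, integral_sub h3 (hGℓ.const_mul _), integral_sub hint hGi, integral_const_mul, hzero,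
      mul_zero, sub_zero]
  rw [h1]
  have h4 : ∀ x, ‖((G x : ℝ) : ℂ) * (E x - 1 - σ * ℓ x)‖ ≤ C * σ ^ 2 * W x := fun x => by
    rw [norm_mul, Complex.norm_real, Real.norm_of_nonneg (hG0 x)]
    calc G x * ‖E x - 1 - σ * ℓ x‖
        ≤ (∏ i, (Real.exp (-(x i) ^ 2) * (1 + |x i|) ^ M)) *
          (C * σ ^ 2 * ∏ i, (Real.exp ((x i) ^ 2 / 2) * (1 + |x i|) ^ M)) :=
          mul_le_mul (hGle x) (hE x) (norm_nonneg _) (by positivity)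
      _ = C * σ ^ 2 * W x := by
        rw [mul_left_comm, ← Finset.prod_mul_distrib]
        congr 1
        refine Finset.prod_congr rfl fun i _ => ?_
        rw [mul_mul_mul_comm, ← Real.exp_add, ← pow_add]
        ring_nf
  refine (norm_integral_le_of_norm_le (hWint.const_mul _) (ae_of_all _ h4)).trans ?_
  rw [integral_const_mul]
  exact le_of_eq (by ring)

end GaussPerturbation

/-! ### Interaction within two groups of variables. -/

section TypedVandermonde

/-- The product of `|x_j - x_k| ^ κ` over all pairs of distinct indices. -/
noncomputable def offDiagVand {ι : Type*} [Fintype ι] [DecidableEq ι] (κ : ℝ) (x : ι → ℝ) : ℝ :=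
  ∏ j, ∏ k ∈ ({j}ᶜ : Finset ι), |x k - x j| ^ (κ / 2)

/-- The product of `|x_j - x_k| ^ κ` over the pairs of indices of the same type. -/
noncomputable def typedVandermonde {d : ℕ} (κ : ℝ) (s : Fin d → Bool) (x : Fin d → ℝ) : ℝ :=
  pairProd fun j k => if s j = s k then |x j - x k| ^ κ else 1

variable {κ : ℝ} {d : ℕ}

/-- The form over ordered pairs makes no reference to an order of the indices and is therefore
usable for variables indexed by a subtype. -/
theorem absVandermondePow_eq_offDiagVand (hκ : 0 ≤ κ) (x : Fin d → ℝ) :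
    absVandermondePow κ x = offDiagVand κ x := by
  rw [offDiagVand, ← pairProd_mul_swap fun k j => |x k - x j| ^ (κ / 2)]
  refine pairProd_congr fun j k _ => ?_
  rw [abs_sub_comm (x k), ← Real.rpow_add_of_nonneg (abs_nonneg _) (by positivity) (by positivity),
    add_halves]

theorem prod_compl_singleton_ite {ι A : Type*} [Fintype ι] [DecidableEq ι] [CommMonoid A]
    (p : ι → Prop) [DecidablePred p] (F : ι → A) (j : {i // p i}) :
    ∏ k ∈ ({(j : ι)}ᶜ : Finset ι), (if p k then F k else 1) =
      ∏ k ∈ ({j}ᶜ : Finset {i // p i}), F k := by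
  have h1 : ∀ (κ' : Type _) [Fintype κ'] [DecidableEq κ'] (a : κ') (H : κ' → A),
      ∏ k ∈ ({a}ᶜ : Finset κ'), H k = ∏ k, if k = a then 1 else H k := by
    intro κ' _ _ a H
    rw [← Finset.prod_mul_prod_compl ({a} : Finset κ') fun k => if k = a then 1 else H k]
    rw [Finset.prod_singleton, if_pos rfl, one_mul]
    refine Finset.prod_congr rfl fun k hk => ?_
    rw [if_neg (by simpa using hk)]
  rw [h1, h1, ← Fintype.prod_subtype_mul_prod_subtype p]
  have h2 : ∏ i : {i // ¬ p i}, (if (i : ι) = j then 1 else if p i then F i else 1) = 1 :=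
    Finset.prod_eq_one fun i _ => by rw [if_neg i.2, ite_self]
  rw [h2, mul_one]
  refine Finset.prod_congr rfl fun i _ => ?_
  rw [if_pos i.2]
  simp only [Subtype.ext_iff]

theorem typedVandermonde_eq (hκ : 0 ≤ κ) (s : Fin d → Bool) (x : Fin d → ℝ) :
    typedVandermonde κ s x = offDiagVand κ (fun i : {i // s i = true} => x i) *
      offDiagVand κ (fun i : {i // ¬ s i = true} => x i) := by
  have h1 : typedVandermonde κ s x = ∏ j, ∏ k ∈ ({j}ᶜ : Finset (Fin d)),
      if s k = s j then |x k - x j| ^ (κ / 2) else 1 := by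
    rw [← pairProd_mul_swap fun k j => if s k = s j then |x k - x j| ^ (κ / 2) else 1]
    refine pairProd_congr fun j k _ => ?_
    simp only [eq_comm (a := s k)]
    split_ifs
    · rw [abs_sub_comm (x k), ← Real.rpow_add_of_nonneg (abs_nonneg _) (by positivity)
        (by positivity), add_halves]
    · rw [one_mul]
  rw [h1, ← Fintype.prod_subtype_mul_prod_subtype fun i => s i = true]
  unfold offDiagVand
  congr 1
  · refine Finset.prod_congr rfl fun j _ => ?_
    rw [← prod_compl_singleton_ite (fun i => s i = true) (fun k => |x k - x j| ^ (κ / 2))]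
    refine Finset.prod_congr rfl fun k _ => ?_
    rw [j.2]
  · refine Finset.prod_congr rfl fun j _ => ?_
    rw [← prod_compl_singleton_ite (fun i => ¬ s i = true) (fun k => |x k - x j| ^ (κ / 2))]
    refine Finset.prod_congr rfl fun k _ => ?_
    have hj := j.2
    simp only [Bool.not_eq_true] at hj ⊢
    rw [hj]

theorem integral_gauss_offDiagVand {ι : Type*} [Fintype ι] [DecidableEq ι] {n β : ℕ}
    (hn : Fintype.card ι = n) :
    ∫ x : ι → ℝ, (∏ i, Real.exp (-(x i) ^ 2)) * offDiagVand (4 / (β : ℝ)) x =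
      mehtaIntegral n β := by
  obtain ⟨e⟩ : Nonempty (Fin n ≃ ι) := ⟨(Fintype.equivFinOfCardEq hn).symm⟩
  have h := integral_pi_comp_equiv (μ := volume) e (mehtaIntegrand n β)
  rw [mehtaIntegral, volume_pi, volume_pi, ← h]
  refine integral_congr_ae (ae_of_all _ fun x => ?_)
  simp only [mehtaIntegrand]
  rw [absVandermondePow_eq_offDiagVand (by positivity)]
  congr 1
  · rw [e.prod_comp fun i => Real.exp (-(x i) ^ 2)]
  · exact (prod_offDiag_comp_equiv e fun k j => |x k - x j| ^ (4 / (β : ℝ) / 2)).symm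

/-- Variables of different type do not interact, so the integral splits by Fubini over the two index
sets. -/
theorem integral_gauss_typedVandermonde (β : ℕ) (s : Fin d → Bool) {n m : ℕ}
    (hn : Fintype.card {i // s i = true} = n) (hm : Fintype.card {i // ¬ s i = true} = m) :
    ∫ x, (∏ i, Real.exp (-(x i) ^ 2)) * typedVandermonde (4 / (β : ℝ)) s x =
      mehtaIntegral n β * mehtaIntegral m β := by
  rw [← integral_gauss_offDiagVand hn, ← integral_gauss_offDiagVand hm, ← integral_prod_mul,
    ← Measure.volume_eq_prod]
  rw [← (volume_preserving_piEquivPiSubtypeProd (fun _ : Fin d => ℝ)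
    (fun i => s i = true)).integral_comp']
  refine integral_congr_ae (ae_of_all _ fun x => ?_)
  simp only [MeasurableEquiv.piEquivPiSubtypeProd, MeasurableEquiv.coe_mk,
    Equiv.piEquivPiSubtypeProd_apply]
  rw [typedVandermonde_eq (by positivity),
    ← Fintype.prod_subtype_mul_prod_subtype fun i => s i = true]
  ring

theorem measurable_typedVandermonde (κ : ℝ) (s : Fin d → Bool) :
    Measurable (typedVandermonde κ s) := by
  unfold typedVandermonde pairProd
  refine Finset.measurable_prod _ fun j _ => Finset.measurable_prod _ fun k _ => ?_
  dsimp only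
  split_ifs <;> fun_prop

theorem typedVandermonde_nonneg (κ : ℝ) (s : Fin d → Bool) (x : Fin d → ℝ) :
    0 ≤ typedVandermonde κ s x := by
  unfold typedVandermonde pairProd
  refine Finset.prod_nonneg fun j _ => Finset.prod_nonneg fun k _ => ?_
  dsimp only
  split_ifs <;> positivity

theorem typedVandermonde_neg (κ : ℝ) (s : Fin d → Bool) (x : Fin d → ℝ) :
    typedVandermonde κ s (-x) = typedVandermonde κ s x := by
  refine pairProd_congr fun j k _ => ?_
  rw [Pi.neg_apply, Pi.neg_apply, ← neg_sub', abs_neg]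

theorem typedVandermonde_le (hκ : 0 ≤ κ) (s : Fin d → Bool) (x : Fin d → ℝ) :
    typedVandermonde κ s x ≤ ∏ i, (1 + |x i|) ^ (⌈κ⌉₊ * (d - 1)) := by
  refine (le_abs_self _).trans ?_
  rw [← Real.norm_eq_abs]
  simp_rw [pow_mul]
  refine norm_pairProd_le fun j k _ => ?_
  have h1 : ∀ y : ℝ, 1 ≤ 1 + |y| := fun y => by linarith [abs_nonneg y]
  have h2 : 1 ≤ (1 + |x j|) * (1 + |x k|) := one_le_mul_of_one_le_of_one_le (h1 _) (h1 _)
  rw [← mul_pow]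
  split_ifs
  · rw [Real.norm_of_nonneg (by positivity)]
    calc |x j - x k| ^ κ ≤ ((1 + |x j|) * (1 + |x k|)) ^ κ := by
          refine Real.rpow_le_rpow (abs_nonneg _) ?_ hκ
          nlinarith [abs_sub (x j) (x k), abs_nonneg (x j), abs_nonneg (x k)]
      _ ≤ ((1 + |x j|) * (1 + |x k|)) ^ (⌈κ⌉₊ : ℝ) := Real.rpow_le_rpow_of_exponent_le h2 (Nat.le_ceil _)
      _ = _ := Real.rpow_natCast _ _
  · rw [norm_one]
    exact one_le_pow₀ h2

end TypedVandermonde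

/-! ### The integrand near a choice of saddle points. -/

section LocalForm

variable {d : ℕ}

/-- Two simple saddle points with common `|f''| = R`, in the order `false`, `true`. -/
structure IsSaddlePair (f h : ℂ → ℂ) (u : Bool → ℂ) (R : ℝ) (θ : Bool → ℝ) : Prop where
  saddle : ∀ b, ∃ φ, IsSimpleSaddle f (u b) R φ (θ b)
  analyticAt : ∀ b, AnalyticAt ℂ h (u b)
  re_lt : (u false).re < (u true).re

/-- The curve `γ` passes through the points `u b` along straight segments in the directions
`exp (i θ b)`. -/
structure IsStraightAt (γ : ℝ → ℂ) (u : Bool → ℂ) (θ τ c : Bool → ℝ) (r : ℝ) : Prop where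
  r_pos : 0 < r
  c_pos : ∀ b, 0 < c b
  lt : τ false + r < τ true - r
  eq : ∀ b t, |t - τ b| ≤ r →
    γ t = u b + c b * Complex.exp (Complex.I * θ b) * ((t - τ b : ℝ) : ℂ)

/-- The point with scaled coordinates `x` near the saddle points selected by `s`. -/
noncomputable def scaledPoint (τ c : Bool → ℝ) (σ : ℝ) (s : Fin d → Bool) (x : Fin d → ℝ) :
    Fin d → ℝ := fun i => τ (s i) + σ / c (s i) * x i

/-- The non-quadratic part of the exponent near a saddle point in the scaled variable. -/
noncomputable def saddleRemainder (f h : ℂ → ℂ) (u : ℂ) (R θ σ x : ℝ) : ℂ :=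
  2 / (R * σ ^ 2) * (f (u + Complex.exp (Complex.I * θ) * (σ * x : ℝ)) - f u) + x ^ 2 +
    (h (u + Complex.exp (Complex.I * θ) * (σ * x : ℝ)) - h u)

/-- The logarithm of the leading constant of the integrand near the saddle points selected
by `s`. -/
noncomputable def logAmplitude (f h : ℂ → ℂ) (N : ℕ) (u : Bool → ℂ) (θ : Bool → ℝ) (κ σ : ℝ)
    (s : Fin d → Bool) : ℂ :=
  ∑ i, (Real.log σ + Complex.I * θ (s i) + N * phaseN f h N (u (s i))) +
    ∑ j, ∑ k ∈ Finset.Ioi j, κ * (if s j = s k then (Real.log σ : ℂ) + Complex.I * θ (s j)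
      else Complex.log (u true - u false))

/-- The relative position of two points near different saddle points. -/
noncomputable def crossShift (θ : Bool → ℝ) (σ : ℝ) (b b' : Bool) (x y : ℝ) : ℂ :=
  (if b then 1 else -1) * (Complex.exp (Complex.I * θ b) * (σ * x : ℝ) -
    Complex.exp (Complex.I * θ b') * (σ * y : ℝ))

/-- The non-quadratic part of the exponent of the integrand in scaled variables. -/
noncomputable def totalRemainder (f h : ℂ → ℂ) (u : Bool → ℂ) (R : ℝ) (θ : Bool → ℝ) (κ σ : ℝ)
    (s : Fin d → Bool) (x : Fin d → ℝ) : ℂ :=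
  ∑ i, saddleRemainder f h (u (s i)) R (θ (s i)) σ (x i) +
    ∑ j, ∑ k ∈ Finset.Ioi j, if s j = s k then 0 else
      κ * (Complex.log (u true - u false + crossShift θ σ (s j) (s k) (x j) (x k)) -
        Complex.log (u true - u false))

theorem exp_sum_pair (F : Fin d → Fin d → ℂ) :
    Complex.exp (∑ j, ∑ k ∈ Finset.Ioi j, F j k) = pairProd fun j k => Complex.exp (F j k) := by
  simp_rw [Complex.exp_sum, pairProd]

variable {f h : ℂ → ℂ} {γ : ℝ → ℂ} {u : Bool → ℂ} {θ τ c : Bool → ℝ} {R r ρ κ σ : ℝ} {N : ℕ}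

theorem IsSaddlePair.R_pos (hu : IsSaddlePair f h u R θ) : 0 < R :=
  (hu.saddle true).choose_spec.pos

theorem IsSaddlePair.log_exp (hu : IsSaddlePair f h u R θ) (b : Bool) :
    Complex.log (Complex.exp (Complex.I * θ b)) = Complex.I * θ b := by
  have h1 := (hu.saddle b).choose_spec.angle_mem
  exact Complex.log_exp (by simpa using h1.1) (by simpa using h1.2)

theorem IsSaddlePair.sub_mem (hu : IsSaddlePair f h u R θ) :
    u true - u false ∈ Complex.slitPlane := by
  rw [Complex.mem_slitPlane_iff]
  left
  rw [Complex.sub_re]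
  linarith [hu.re_lt]

theorem IsStraightAt.eq_scaled (hγ : IsStraightAt γ u θ τ c r) {b : Bool} {x : ℝ}
    (hx : |σ * x| ≤ r * c b) :
    γ (τ b + σ / c b * x) = u b + Complex.exp (Complex.I * θ b) * (σ * x : ℝ) := by
  have hc := hγ.c_pos b
  have hcc : (c b : ℂ) ≠ 0 := by exact_mod_cast hc.ne'
  rw [hγ.eq b]
  · push_cast; field_simp; ring
  · rw [add_sub_cancel_left, div_mul_eq_mul_div, abs_div, abs_of_pos hc]
    exact (div_le_iff₀ hc).2 hx

theorem IsStraightAt.deriv_eq_scaled (hγ : IsStraightAt γ u θ τ c r) {b : Bool} {x : ℝ}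
    (hx : |σ * x| < r * c b) :
    deriv γ (τ b + σ / c b * x) = c b * Complex.exp (Complex.I * θ b) := by
  have hc := hγ.c_pos b
  have hlt : |τ b + σ / c b * x - τ b| < r := by
    rw [add_sub_cancel_left, div_mul_eq_mul_div, abs_div, abs_of_pos hc]
    exact (div_lt_iff₀ hc).2 hx
  have h1 : γ =ᶠ[nhds (τ b + σ / c b * x)] fun t : ℝ =>
      u b + c b * Complex.exp (Complex.I * θ b) * ((t - τ b : ℝ) : ℂ) := by
    have hcont : Continuous fun t : ℝ => |t - τ b| := by fun_prop
    filter_upwards [hcont.continuousAt.eventually (gt_mem_nhds hlt)] with t ht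
    exact hγ.eq b t ht.le
  rw [h1.deriv_eq]
  have h2 := (((((hasDerivAt_id (τ b + σ / c b * x)).sub_const (τ b)).ofReal_comp).const_mul
    (c b * Complex.exp (Complex.I * θ b) : ℂ)).const_add (u b)).deriv
  simpa using h2

theorem IsStraightAt.lt_of_scaled (hγ : IsStraightAt γ u θ τ c r) {x y : ℝ}
    (hx : |σ * x| ≤ r * c false) (hy : |σ * y| ≤ r * c true) :
    τ false + σ / c false * x < τ true + σ / c true * y := by
  have h1 := hγ.c_pos false
  have h2 := hγ.c_pos true
  have h3 : σ / c false * x ≤ r := by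
    rw [div_mul_eq_mul_div, div_le_iff₀ h1]
    exact (le_abs_self _).trans hx
  have h4 : -r ≤ σ / c true * y := by
    rw [div_mul_eq_mul_div, le_div_iff₀ h2]
    linarith [neg_abs_le (σ * y)]
  linarith [hγ.lt]

theorem contourKernel_zero_one (a b : ℝ) :
    contourKernel γ κ 0 1 a b = (γ (max a b) - γ (min a b)) ^ (κ : ℂ) := by
  rw [contourKernel, lineHomotopy_one, lineHomotopy_one, Complex.ofReal_zero, add_zero]

/-- On a straight segment an ordered difference is a positive real times `e^{iθ}`. As `θ ∈ (-π, π]`,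
the principal logarithm splits exactly, and the power has no error term; this is the purpose of
straightening. -/
theorem contourKernel_same (hu : IsSaddlePair f h u R θ) (hγ : IsStraightAt γ u θ τ c r)
    (hκ : 0 < κ) (hσ : 0 < σ) (b : Bool) {x y : ℝ} (hx : |σ * x| ≤ r * c b)
    (hy : |σ * y| ≤ r * c b) :
    contourKernel γ κ 0 1 (τ b + σ / c b * x) (τ b + σ / c b * y) =
      Complex.exp (κ * (Real.log σ + Complex.I * θ b)) * ((|x - y| ^ κ : ℝ) : ℂ) := by
  wlog hxy : y ≤ x generalizing x y
  · rw [IsDeformation.contourKernel_comm, this hy hx (le_of_not_ge hxy), abs_sub_comm]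
  have hc := hγ.c_pos b
  have hle : τ b + σ / c b * y ≤ τ b + σ / c b * x := by gcongr
  rw [contourKernel_zero_one, max_eq_left hle, min_eq_right hle, hγ.eq_scaled hx,
    hγ.eq_scaled hy]
  rcases eq_or_lt_of_le hxy with rfl | hlt
  · have hκc : (κ : ℂ) ≠ 0 := by exact_mod_cast hκ.ne'
    simp [hκ.ne', hκc]
  have hpos : 0 < σ * (x - y) := mul_pos hσ (by linarith)
  have h1 : u b + Complex.exp (Complex.I * θ b) * (σ * x : ℝ) -
      (u b + Complex.exp (Complex.I * θ b) * (σ * y : ℝ)) =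
      ((σ * (x - y) : ℝ) : ℂ) * Complex.exp (Complex.I * θ b) := by push_cast; ring
  have hne : ((σ * (x - y) : ℝ) : ℂ) * Complex.exp (Complex.I * θ b) ≠ 0 :=
    mul_ne_zero (by exact_mod_cast hpos.ne') (Complex.exp_ne_zero _)
  rw [h1, Complex.cpow_def_of_ne_zero hne, Complex.log_ofReal_mul hpos (Complex.exp_ne_zero _),
    hu.log_exp, abs_of_pos (by linarith), Real.rpow_def_of_pos (by linarith),
    Complex.ofReal_exp, ← Complex.exp_add, Real.log_mul hσ.ne' (by linarith)]
  congr 1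
  push_cast
  ring

/-- A point near `u false` always has the smaller parameter, whatever its index. The base is
therefore `u true - u false` plus a small shift, with the sign that `crossShift` records. -/
theorem contourKernel_cross (hγ : IsStraightAt γ u θ τ c r) {b b' : Bool} (hb : b ≠ b') {x y : ℝ}
    (hx : |σ * x| ≤ r * c b) (hy : |σ * y| ≤ r * c b')
    (hs : u true - u false + crossShift θ σ b b' x y ≠ 0) :
    contourKernel γ κ 0 1 (τ b + σ / c b * x) (τ b' + σ / c b' * y) =
      Complex.exp (κ * Complex.log (u true - u false)) *
        Complex.exp (κ * (Complex.log (u true - u false + crossShift θ σ b b' x y) -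
          Complex.log (u true - u false))) := by
  rw [← Complex.exp_add, ← mul_add, add_sub_cancel, mul_comm (κ : ℂ), ← Complex.cpow_def_of_ne_zero hs,
    contourKernel_zero_one]
  congr 1
  cases b <;> cases b' <;> first | exact absurd rfl hb | skip
  · have := hγ.lt_of_scaled hx hy
    rw [max_eq_right this.le, min_eq_left this.le, hγ.eq_scaled hx, hγ.eq_scaled hy,
      crossShift]
    simp only [Bool.false_eq_true, if_false]
    ring
  · have := hγ.lt_of_scaled hy hx
    rw [max_eq_left this.le, min_eq_right this.le, hγ.eq_scaled hx, hγ.eq_scaled hy,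
      crossShift]
    simp only [if_true]
    ring

theorem mul_phaseN (hN : N ≠ 0) (z : ℂ) : (N : ℂ) * phaseN f h N z = N * f z + h z := by
  have : (N : ℂ) ≠ 0 := by exact_mod_cast hN
  rw [phaseN]; field_simp

theorem contourDensity_scaled (hγ : IsStraightAt γ u θ τ c r) (hσ : 0 < σ)
    (hN0 : N ≠ 0) (hN : (N : ℂ) = 2 / (R * σ ^ 2)) {g : ℂ → ℂ} (b : Bool)
    {x : ℝ} (hx : |σ * x| < r * c b)
    (hg : ∀ t, g (γ t) = Complex.exp (N * phaseN f h N (γ t))) :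
    ((σ / c b : ℝ) : ℂ) * contourDensity g γ 1 (τ b + σ / c b * x) =
      Complex.exp (Real.log σ + Complex.I * θ b + N * phaseN f h N (u b)) *
        ((Real.exp (-x ^ 2) : ℝ) : ℂ) * Complex.exp (saddleRemainder f h (u b) R (θ b) σ x) := by
  have hc := hγ.c_pos b
  have hcc : (c b : ℂ) ≠ 0 := by exact_mod_cast hc.ne'
  rw [contourDensity_one, hγ.deriv_eq_scaled hx, hg, hγ.eq_scaled hx.le, mul_phaseN hN0,
    mul_phaseN hN0]
  have h1 : ((σ / c b : ℝ) : ℂ) * (Complex.exp (N * f (u b + Complex.exp (Complex.I * θ b) *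
      (σ * x : ℝ)) + h (u b + Complex.exp (Complex.I * θ b) * (σ * x : ℝ))) *
      (c b * Complex.exp (Complex.I * θ b))) = Complex.exp (Real.log σ) *
      Complex.exp (Complex.I * θ b) * Complex.exp (N * f (u b + Complex.exp (Complex.I * θ b) *
      (σ * x : ℝ)) + h (u b + Complex.exp (Complex.I * θ b) * (σ * x : ℝ))) := by
    rw [← Complex.ofReal_exp, Real.exp_log hσ]
    push_cast
    field_simp
  rw [h1, Complex.ofReal_exp, ← Complex.exp_add, ← Complex.exp_add, ← Complex.exp_add,
    ← Complex.exp_add]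
  congr 1
  rw [saddleRemainder, ← hN]
  push_cast
  ring

/-- An exact factorization of the integrand and the Jacobian: constant amplitude, Gaussian,
interaction within groups, and one exponential that collects everything of higher order. -/
theorem prod_mul_contourIntegrand_scaled (hu : IsSaddlePair f h u R θ)
    (hγ : IsStraightAt γ u θ τ c r) (hκ : 0 < κ) (hσ : 0 < σ) (hN0 : N ≠ 0)
    (hN : (N : ℂ) = 2 / (R * σ ^ 2)) {g : ℂ → ℂ}
    (hg : ∀ t, g (γ t) = Complex.exp (N * phaseN f h N (γ t))) (s : Fin d → Bool)
    {x : Fin d → ℝ} (hx : ∀ i, |σ * x i| < r * c (s i))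
    (hs : ∀ j k, s j ≠ s k →
      u true - u false + crossShift θ σ (s j) (s k) (x j) (x k) ≠ 0) :
    ((∏ i, (σ / c (s i)) : ℝ) : ℂ) * contourIntegrand g γ κ 0 1 (scaledPoint τ c σ s x) =
      Complex.exp (logAmplitude f h N u θ κ σ s) *
        ((((∏ i, Real.exp (-(x i) ^ 2)) * typedVandermonde κ s x : ℝ) : ℂ) *
          Complex.exp (totalRemainder f h u R θ κ σ s x)) := by
  have hK : (pairProd fun j k => contourKernel γ κ 0 1 (scaledPoint τ c σ s x j)
      (scaledPoint τ c σ s x k)) = (pairProd fun j k => Complex.exp (κ * (if s j = s k then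
        (Real.log σ : ℂ) + Complex.I * θ (s j) else Complex.log (u true - u false)))) *
      (((typedVandermonde κ s x : ℝ) : ℂ) * pairProd fun j k => Complex.exp (if s j = s k then 0 else
      κ * (Complex.log (u true - u false + crossShift θ σ (s j) (s k) (x j) (x k)) -
        Complex.log (u true - u false)))) := by
    have h1 : ((typedVandermonde κ s x : ℝ) : ℂ) = pairProd fun j k =>
        (((if s j = s k then |x j - x k| ^ κ else 1 : ℝ)) : ℂ) :=
      map_pairProd Complex.ofRealHom _
    rw [h1, ← pairProd_mul, ← pairProd_mul]
    refine pairProd_congr fun j k _ => ?_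
    simp only [scaledPoint]
    by_cases hjk : s j = s k
    · simp only [if_pos hjk, Complex.exp_zero, mul_one]
      have := contourKernel_same hu hγ hκ hσ (s k) (by rw [← hjk]; exact (hx j).le) (hx k).le
      rw [hjk]
      exact this
    · simp only [if_neg hjk, Complex.ofReal_one, one_mul]
      exact contourKernel_cross hγ hjk (hx j).le (hx k).le (hs j k hjk)
  rw [contourIntegrand, hK, logAmplitude, totalRemainder, Complex.exp_add, Complex.exp_add,
    exp_sum_pair, exp_sum_pair, Complex.exp_sum, Complex.exp_sum, Complex.ofReal_prod, ← mul_assoc,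
    ← Finset.prod_mul_distrib]
  have hD : ∏ i, (((σ / c (s i) : ℝ) : ℂ) * contourDensity g γ 1 (scaledPoint τ c σ s x i)) =
      (∏ i, Complex.exp (Real.log σ + Complex.I * θ (s i) + N * phaseN f h N (u (s i)))) *
        (∏ i, ((Real.exp (-(x i) ^ 2) : ℝ) : ℂ)) *
        ∏ i, Complex.exp (saddleRemainder f h (u (s i)) R (θ (s i)) σ (x i)) := by
    rw [← Finset.prod_mul_distrib, ← Finset.prod_mul_distrib]
    exact Finset.prod_congr rfl fun i _ => contourDensity_scaled hγ hσ hN0 hN (s i) (hx i) hg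
  rw [hD]
  push_cast
  ring

end LocalForm

/-! ### Bounds for the remainder in scaled variables. -/

section LocalBounds

variable {d : ℕ} {f h : ℂ → ℂ} {u : Bool → ℂ} {θ : Bool → ℝ} {R κ σ : ℝ}

theorem norm_sum_pair_le {F : Fin d → Fin d → ℂ} {B : ℝ} (hB : 0 ≤ B)
    (hF : ∀ j k, ‖F j k‖ ≤ B) : ‖∑ j, ∑ k ∈ Finset.Ioi j, F j k‖ ≤ d * (d * B) := by
  have h1 : ∀ j : Fin d, ‖∑ k ∈ Finset.Ioi j, F j k‖ ≤ d * B := fun j => by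
    refine (norm_sum_le_of_le _ fun k _ => hF j k).trans ?_
    rw [Finset.sum_const, nsmul_eq_mul]
    gcongr
    simpa using Finset.card_le_univ (Finset.Ioi j)
  refine (norm_sum_le_of_le _ fun j _ => h1 j).trans ?_
  simp

theorem norm_exp_I_mul (t : ℝ) : ‖Complex.exp (Complex.I * t)‖ = 1 := by
  rw [mul_comm, Complex.norm_exp_ofReal_mul_I]

theorem crossShift_eq (b b' : Bool) (x y : ℝ) :
    crossShift θ σ b b' x y = σ * crossShift θ 1 b b' x y := by
  simp only [crossShift]; push_cast; ring

theorem norm_crossShift_le (b b' : Bool) (x y : ℝ) :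
    ‖crossShift θ σ b b' x y‖ ≤ |σ * x| + |σ * y| := by
  have h1 : ‖(if b then 1 else -1 : ℂ)‖ = 1 := by split_ifs <;> simp
  rw [crossShift, norm_mul, h1, one_mul]
  refine (norm_sub_le _ _).trans (le_of_eq ?_)
  rw [norm_mul, norm_mul, norm_exp_I_mul, norm_exp_I_mul, Complex.norm_real, Complex.norm_real,
    one_mul, one_mul, Real.norm_eq_abs, Real.norm_eq_abs]

theorem IsSaddlePair.exists_saddleRemainder_le (hu : IsSaddlePair f h u R θ) :
    ∃ (a b : Bool → ℂ) (C ρ : ℝ), 0 ≤ C ∧ 0 < ρ ∧ ∀ (i : Bool) (σ x : ℝ), 0 < σ → |σ * x| ≤ ρ →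
      ‖saddleRemainder f h (u i) R (θ i) σ x - σ * (a i * x ^ 3 + b i * x)‖ ≤
        C * σ ^ 2 * (1 + |x|) ^ 4 ∧
      ‖saddleRemainder f h (u i) R (θ i) σ x‖ ≤ x ^ 2 / 4 + C := by
  choose φ hφ using hu.saddle
  choose a b C ρ hC hρ H using fun i => (hφ i).exists_scaled_taylor (hu.analyticAt i)
  refine ⟨a, b, max (C true) (C false), min (ρ true) (ρ false), le_max_of_le_left (hC _),
    lt_min (hρ _) (hρ _), fun i σ x hσ hx => ?_⟩
  have hCi : C i ≤ max (C true) (C false) := by cases i <;> simp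
  have hρi : min (ρ true) (ρ false) ≤ ρ i := by cases i <;> simp
  obtain ⟨h1, h2⟩ := H i σ x hσ (hx.trans hρi)
  exact ⟨h1.trans (by gcongr), h2.trans (by gcongr)⟩

/-- The first order term `ℓ` collects the cubic terms of `f`, the linear terms of `h` and the linear
terms of `log` for pairs at different saddles; all are odd in `x`. The crude second bound lets the
Gaussian dominate the exponential of the remainder. The radius is chosen before `d` and `s`, so all
selections of saddles share one cutoff. -/
theorem IsSaddlePair.exists_totalRemainder_le (hu : IsSaddlePair f h u R θ) (hκ : 0 ≤ κ) :
    ∃ ρ : ℝ, 0 < ρ ∧ ∀ (d : ℕ) (s : Fin d → Bool), ∃ (ℓ : (Fin d → ℝ) → ℂ) (C : ℝ), 0 ≤ C ∧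
      Measurable ℓ ∧ (∀ x, ℓ (-x) = -ℓ x) ∧ (∀ x, ‖ℓ x‖ ≤ C * (∏ i, (1 + |x i|)) ^ 4) ∧
      ∀ (σ : ℝ) (x : Fin d → ℝ), 0 < σ → (∀ i, |σ * x i| ≤ ρ) →
        (∀ j k, u true - u false + crossShift θ σ (s j) (s k) (x j) (x k) ≠ 0) ∧
        ‖totalRemainder f h u R θ κ σ s x - σ * ℓ x‖ ≤ C * σ ^ 2 * (∏ i, (1 + |x i|)) ^ 4 ∧
        ‖totalRemainder f h u R θ κ σ s x‖ ≤ ∑ i, (x i) ^ 2 / 4 + C := by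
  obtain ⟨a, b, C₁, ρ₁, hC₁, hρ₁, H₁⟩ := hu.exists_saddleRemainder_le
  obtain ⟨C₂, r, hC₂, hr, H₂⟩ := exists_log_add_taylor hu.sub_mem
  set Δ := u true - u false with hΔ
  have hΔ0 : Δ ≠ 0 := Complex.slitPlane_ne_zero hu.sub_mem
  -- Half of `r`, because a shift involves two displacements.
  refine ⟨min ρ₁ (r / 2), by positivity, fun d s => ?_⟩
  set A := ‖a true‖ + ‖a false‖ + ‖b true‖ + ‖b false‖ with hA
  set L := κ * ‖Δ‖⁻¹ with hL
  have hL0 : 0 ≤ L := by positivity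
  have hA0 : 0 ≤ A := by positivity
  have haA : ∀ i, ‖a i‖ + ‖b i‖ ≤ A := fun i => by
    cases i <;> simp only [hA] <;>
      linarith [norm_nonneg (a true), norm_nonneg (a false), norm_nonneg (b true),
        norm_nonneg (b false)]
  set C := d * A + d * (d * (2 * L)) + d * C₁ + d * (d * (4 * κ * C₂)) +
    d * (d * (L * r + κ * C₂ * r ^ 2)) with hC
  set ℓ₁ : (Fin d → ℝ) → ℂ := fun x => ∑ i, (a (s i) * (x i : ℂ) ^ 3 + b (s i) * (x i : ℂ)) with hℓ₁
  set ℓ₂ : (Fin d → ℝ) → Fin d → Fin d → ℂ := fun x j k =>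
    if s j = s k then 0 else κ * (crossShift θ 1 (s j) (s k) (x j) (x k) / Δ) with hℓ₂
  have hP1 : ∀ (x : Fin d → ℝ) i, 1 + |x i| ≤ ∏ i, (1 + |x i|) := fun x i => one_add_abs_le_prod i x
  have hP0 : ∀ (x : Fin d → ℝ), 1 ≤ ∏ i, (1 + |x i|) := fun x =>
    one_le_prod_of_forall_one_le fun i _ => by linarith [abs_nonneg (x i)]
  refine ⟨fun x => ℓ₁ x + ∑ j, ∑ k ∈ Finset.Ioi j, ℓ₂ x j k, C, by positivity, ?_, fun x => ?_,
    fun x => ?_, fun σ x hσ hx => ⟨fun j k => ?_, ?_, ?_⟩⟩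
  · refine Measurable.add (by fun_prop) (Finset.measurable_sum _ fun j _ =>
      Finset.measurable_sum _ fun k _ => ?_)
    simp only [hℓ₂]
    split_ifs
    · fun_prop
    · unfold crossShift; fun_prop
  · have h1 : ℓ₁ (-x) = -ℓ₁ x := by
      simp only [hℓ₁, Pi.neg_apply, Complex.ofReal_neg, ← Finset.sum_neg_distrib]
      exact Finset.sum_congr rfl fun i _ => by ring
    have h2 : ∀ j k, ℓ₂ (-x) j k = -ℓ₂ x j k := fun j k => by
      simp only [hℓ₂, Pi.neg_apply, crossShift]
      split_ifs
      all_goals (push_cast; ring1)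
    simp only [h1, h2, Finset.sum_neg_distrib]
    ring
  · have h1 : ‖ℓ₁ x‖ ≤ d * (A * (∏ i, (1 + |x i|)) ^ 4) := by
      refine (norm_sum_le_of_le _ fun i _ => (?_ : _ ≤ A * (∏ i, (1 + |x i|)) ^ 4)).trans
        (by simp)
      have hxi := hP1 x i
      have h3 : |x i| ^ 3 ≤ (∏ i, (1 + |x i|)) ^ 4 :=
        (pow_le_pow_left₀ (abs_nonneg _) (by linarith) 3).trans
          (pow_le_pow_right₀ (hP0 x) (by norm_num))
      have h4 : |x i| ≤ (∏ i, (1 + |x i|)) ^ 4 :=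
        (show |x i| ≤ _ by linarith).trans (le_self_pow₀ (hP0 x) (by norm_num))
      calc _ ≤ ‖a (s i)‖ * |x i| ^ 3 + ‖b (s i)‖ * |x i| := by
            refine (norm_add_le _ _).trans (le_of_eq ?_)
            rw [norm_mul, norm_mul, norm_pow, Complex.norm_real, Real.norm_eq_abs]
        _ ≤ ‖a (s i)‖ * (∏ i, (1 + |x i|)) ^ 4 + ‖b (s i)‖ * (∏ i, (1 + |x i|)) ^ 4 := by gcongr
        _ ≤ A * (∏ i, (1 + |x i|)) ^ 4 := by rw [← add_mul]; gcongr; exact haA _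
    have h2 : ‖∑ j, ∑ k ∈ Finset.Ioi j, ℓ₂ x j k‖ ≤
        d * (d * (2 * L * (∏ i, (1 + |x i|)) ^ 4)) := by
      refine norm_sum_pair_le (by positivity) fun j k => ?_
      simp only [hℓ₂]
      split_ifs
      · rw [norm_zero]; positivity
      · have h3 := norm_crossShift_le (θ := θ) (σ := 1) (s j) (s k) (x j) (x k)
        rw [one_mul, one_mul] at h3
        have h4 : |x j| + |x k| ≤ 2 * (∏ i, (1 + |x i|)) ^ 4 := by
          have := le_self_pow₀ (hP0 x) (show 4 ≠ 0 by norm_num)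
          linarith [hP1 x j, hP1 x k]
        rw [norm_mul, norm_div, Complex.norm_real, Real.norm_of_nonneg hκ]
        calc κ * (‖crossShift θ 1 (s j) (s k) (x j) (x k)‖ / ‖Δ‖)
            ≤ κ * (2 * (∏ i, (1 + |x i|)) ^ 4 / ‖Δ‖) := by gcongr; linarith
          _ = 2 * L * (∏ i, (1 + |x i|)) ^ 4 := by rw [hL]; ring
    refine (norm_add_le _ _).trans ((add_le_add h1 h2).trans ?_)
    calc _ = (d * A + d * (d * (2 * L))) * (∏ i, (1 + |x i|)) ^ 4 := by ring
      _ ≤ _ := by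
        gcongr
        rw [hC]
        have : 0 ≤ d * C₁ + d * (d * (4 * κ * C₂)) + d * (d * (L * r + κ * C₂ * r ^ 2)) := by
          positivity
        linarith
  · refine Complex.slitPlane_ne_zero (H₂ _ ?_).1
    refine (norm_crossShift_le _ _ _ _).trans ?_
    linarith [(hx j).trans (min_le_right _ _), (hx k).trans (min_le_right _ _)]
  · have h1 : ‖(∑ i, saddleRemainder f h (u (s i)) R (θ (s i)) σ (x i)) - σ * ℓ₁ x‖ ≤
        d * (C₁ * σ ^ 2 * (∏ i, (1 + |x i|)) ^ 4) := by
      rw [hℓ₁, Finset.mul_sum, ← Finset.sum_sub_distrib]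
      refine (norm_sum_le_of_le _ fun i _ =>
        (?_ : _ ≤ C₁ * σ ^ 2 * (∏ i, (1 + |x i|)) ^ 4)).trans (by simp)
      refine (H₁ (s i) σ (x i) hσ ((hx i).trans (min_le_left _ _))).1.trans ?_
      gcongr
      exact hP1 x i
    have h2 : ‖(∑ j, ∑ k ∈ Finset.Ioi j, if s j = s k then 0 else
        κ * (Complex.log (Δ + crossShift θ σ (s j) (s k) (x j) (x k)) - Complex.log Δ)) -
        σ * ∑ j, ∑ k ∈ Finset.Ioi j, ℓ₂ x j k‖ ≤
        d * (d * (4 * κ * C₂ * σ ^ 2 * (∏ i, (1 + |x i|)) ^ 4)) := by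
      rw [Finset.mul_sum]
      simp_rw [Finset.mul_sum]
      rw [← Finset.sum_sub_distrib]
      simp_rw [← Finset.sum_sub_distrib]
      refine norm_sum_pair_le (by positivity) fun j k => ?_
      simp only [hℓ₂]
      split_ifs
      · rw [mul_zero, sub_zero, norm_zero]; positivity
      · have h3 := norm_crossShift_le (θ := θ) (σ := σ) (s j) (s k) (x j) (x k)
        have h4 : |σ * x j| + |σ * x k| ≤ 2 * σ * ∏ i, (1 + |x i|) := by
          rw [abs_mul, abs_mul, abs_of_pos hσ]
          nlinarith [hP1 x j, hP1 x k]
        have h5 : ‖crossShift θ σ (s j) (s k) (x j) (x k)‖ ≤ r := by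
          linarith [(hx j).trans (min_le_right _ _), (hx k).trans (min_le_right _ _)]
        have h6 : (κ : ℂ) * (Complex.log (Δ + crossShift θ σ (s j) (s k) (x j) (x k)) - Complex.log Δ) -
            σ * (κ * (crossShift θ 1 (s j) (s k) (x j) (x k) / Δ)) =
            κ * (Complex.log (Δ + crossShift θ σ (s j) (s k) (x j) (x k)) - Complex.log Δ -
              crossShift θ σ (s j) (s k) (x j) (x k) / Δ) := by
          rw [crossShift_eq (σ := σ)]; ring
        rw [h6, norm_mul, Complex.norm_real, Real.norm_of_nonneg hκ]
        have h7 : (∏ i, (1 + |x i|)) ^ 2 ≤ (∏ i, (1 + |x i|)) ^ 4 :=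
          pow_le_pow_right₀ (hP0 x) (by norm_num)
        calc _ ≤ κ * (C₂ * ‖crossShift θ σ (s j) (s k) (x j) (x k)‖ ^ 2) :=
              mul_le_mul_of_nonneg_left (H₂ _ h5).2 hκ
          _ ≤ κ * (C₂ * (2 * σ * ∏ i, (1 + |x i|)) ^ 2) := by gcongr; linarith
          _ = 4 * κ * C₂ * σ ^ 2 * (∏ i, (1 + |x i|)) ^ 2 := by ring
          _ ≤ _ := by gcongr
    have h3 : totalRemainder f h u R θ κ σ s x -
        σ * (ℓ₁ x + ∑ j, ∑ k ∈ Finset.Ioi j, ℓ₂ x j k) =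
        ((∑ i, saddleRemainder f h (u (s i)) R (θ (s i)) σ (x i)) - σ * ℓ₁ x) +
        ((∑ j, ∑ k ∈ Finset.Ioi j, if s j = s k then 0 else
        κ * (Complex.log (Δ + crossShift θ σ (s j) (s k) (x j) (x k)) - Complex.log Δ)) -
        σ * ∑ j, ∑ k ∈ Finset.Ioi j, ℓ₂ x j k) := by
      rw [totalRemainder]; ring
    rw [h3]
    refine (norm_add_le _ _).trans ((add_le_add h1 h2).trans ?_)
    calc _ = (d * C₁ + d * (d * (4 * κ * C₂))) * (σ ^ 2 * (∏ i, (1 + |x i|)) ^ 4) := by ring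
      _ ≤ C * (σ ^ 2 * (∏ i, (1 + |x i|)) ^ 4) := by
        gcongr
        rw [hC]
        have : 0 ≤ d * A + d * (d * (2 * L)) + d * (d * (L * r + κ * C₂ * r ^ 2)) := by
          positivity
        linarith
      _ = _ := by ring
  · have h1 : ‖∑ i, saddleRemainder f h (u (s i)) R (θ (s i)) σ (x i)‖ ≤
        ∑ i, (x i) ^ 2 / 4 + d * C₁ := by
      refine (norm_sum_le_of_le _ fun i _ =>
        (H₁ (s i) σ (x i) hσ ((hx i).trans (min_le_left _ _))).2).trans ?_
      rw [Finset.sum_add_distrib]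
      simp
    have h2 : ‖∑ j, ∑ k ∈ Finset.Ioi j, if s j = s k then 0 else
        κ * (Complex.log (Δ + crossShift θ σ (s j) (s k) (x j) (x k)) - Complex.log Δ)‖ ≤
        d * (d * (L * r + κ * C₂ * r ^ 2)) := by
      refine norm_sum_pair_le (by positivity) fun j k => ?_
      split_ifs
      · rw [norm_zero]; positivity
      · have h3 := norm_crossShift_le (θ := θ) (σ := σ) (s j) (s k) (x j) (x k)
        have h5 : ‖crossShift θ σ (s j) (s k) (x j) (x k)‖ ≤ r := by
          linarith [(hx j).trans (min_le_right _ _), (hx k).trans (min_le_right _ _)]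
        rw [norm_mul, Complex.norm_real, Real.norm_of_nonneg hκ]
        set y := crossShift θ σ (s j) (s k) (x j) (x k) with hy
        have h6 : Complex.log (Δ + y) - Complex.log Δ =
            (Complex.log (Δ + y) - Complex.log Δ - y / Δ) + y / Δ := by ring
        calc κ * ‖Complex.log (Δ + y) - Complex.log Δ‖
            ≤ κ * (C₂ * ‖y‖ ^ 2 + ‖y‖ / ‖Δ‖) := by
              rw [h6]
              gcongr
              refine (norm_add_le _ _).trans (add_le_add (H₂ _ h5).2 (norm_div _ _).le)
          _ ≤ κ * (C₂ * r ^ 2 + r / ‖Δ‖) := by gcongr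
          _ = _ := by rw [hL]; ring
    rw [totalRemainder]
    refine (norm_add_le _ _).trans ((add_le_add h1 h2).trans ?_)
    rw [hC]
    have : 0 ≤ d * A + d * (d * (2 * L)) + d * (d * (4 * κ * C₂)) := by positivity
    linarith

/-- Inside the box, `|e^Z - 1 - Z| ≤ |Z|² e^{|Z|}` with `|Z| = O(σ p⁴)`. Outside, some `|x_i|`
exceeds `ρ / σ`, whence `1 ≤ σ² p² / ρ²`. The cutoff thus costs only `O(σ²)` with a polynomial
weight and needs no separate tail estimate. -/
theorem norm_indicator_exp_sub_le {E Z ℓ : ℂ} {C σ ρ : ℝ} {x : Fin d → ℝ} (hC : 0 ≤ C)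
    (hσ : 0 < σ) (hσ1 : σ ≤ 1) (hρ : 0 < ρ) (hℓ : ‖ℓ‖ ≤ C * (∏ i, (1 + |x i|)) ^ 4)
    (hbox : (∀ i, |σ * x i| ≤ ρ) → E = Complex.exp Z ∧
      ‖Z - σ * ℓ‖ ≤ C * σ ^ 2 * (∏ i, (1 + |x i|)) ^ 4 ∧ ‖Z‖ ≤ ∑ i, (x i) ^ 2 / 4 + C)
    (hout : (¬ ∀ i, |σ * x i| ≤ ρ) → E = 0) :
    ‖E - 1 - σ * ℓ‖ ≤ (4 * C ^ 2 * Real.exp C + C + (1 + C) / ρ ^ 2) * σ ^ 2 *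
      ∏ i, (Real.exp ((x i) ^ 2 / 2) * (1 + |x i|) ^ 8) := by
  set p := ∏ i, (1 + |x i|) with hp
  have hp1 : 1 ≤ p := one_le_prod_of_forall_one_le fun i _ => by linarith [abs_nonneg (x i)]
  have hexp : ∏ i, (Real.exp ((x i) ^ 2 / 2) * (1 + |x i|) ^ 8) =
      Real.exp (∑ i, (x i) ^ 2 / 2) * p ^ 8 := by
    rw [Finset.prod_mul_distrib, Finset.prod_pow, Real.exp_sum]
  have hQ : 0 ≤ ∑ i, (x i) ^ 2 / 4 := Finset.sum_nonneg fun i _ => by positivity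
  have hQ2 : ∑ i, (x i) ^ 2 / 4 ≤ ∑ i, (x i) ^ 2 / 2 :=
    Finset.sum_le_sum fun i _ => by linarith [sq_nonneg (x i)]
  have h48 : p ^ 4 ≤ p ^ 8 := pow_le_pow_right₀ hp1 (by norm_num)
  have he1 : 1 ≤ Real.exp (∑ i, (x i) ^ 2 / 2) := Real.one_le_exp (hQ.trans hQ2)
  rw [hexp]
  by_cases hx : ∀ i, |σ * x i| ≤ ρ
  · obtain ⟨rfl, h1, h2⟩ := hbox hx
    have h3 := Complex.norm_exp_sub_sum_le_norm_mul_exp Z 2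
    simp only [Finset.sum_range_succ, Finset.sum_range_zero, Nat.factorial, pow_zero, pow_one,
      zero_add, Nat.cast_one, mul_one, div_one] at h3
    have h4 : ‖Z‖ ≤ 2 * C * σ * p ^ 4 := by
      have h5 : Z = (Z - σ * ℓ) + σ * ℓ := by ring
      calc ‖Z‖ ≤ C * σ ^ 2 * p ^ 4 + σ * (C * p ^ 4) := by
            rw [h5]
            refine (norm_add_le _ _).trans (add_le_add h1 ?_)
            rw [norm_mul, Complex.norm_real, Real.norm_of_nonneg hσ.le]
            gcongr
        _ ≤ C * (σ * 1) * p ^ 4 + σ * (C * p ^ 4) := by rw [sq]; gcongr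
        _ = _ := by ring
    have h6 : Real.exp ‖Z‖ ≤ Real.exp C * Real.exp (∑ i, (x i) ^ 2 / 2) := by
      rw [← Real.exp_add, Real.exp_le_exp]; linarith
    calc ‖Complex.exp Z - 1 - σ * ℓ‖ = ‖(Complex.exp Z - (1 + Z)) + (Z - σ * ℓ)‖ := by congr 1; ring
      _ ≤ ‖Z‖ ^ 2 * Real.exp ‖Z‖ + C * σ ^ 2 * p ^ 4 := (norm_add_le _ _).trans (add_le_add h3 h1)
      _ ≤ (2 * C * σ * p ^ 4) ^ 2 * (Real.exp C * Real.exp (∑ i, (x i) ^ 2 / 2)) +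
          C * σ ^ 2 * (1 * p ^ 8) := by gcongr; rw [one_mul]; exact h48
      _ ≤ (2 * C * σ * p ^ 4) ^ 2 * (Real.exp C * Real.exp (∑ i, (x i) ^ 2 / 2)) +
          C * σ ^ 2 * (Real.exp (∑ i, (x i) ^ 2 / 2) * p ^ 8) := by gcongr
      _ = (4 * C ^ 2 * Real.exp C + C) * σ ^ 2 * (Real.exp (∑ i, (x i) ^ 2 / 2) * p ^ 8) := by ring
      _ ≤ _ := by
        rw [mul_assoc _ (σ ^ 2), mul_assoc _ (σ ^ 2)]
        exact mul_le_mul_of_nonneg_right (le_add_of_nonneg_right (by positivity)) (by positivity)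
  · rw [hout hx]
    push Not at hx
    obtain ⟨i, hi⟩ := hx
    have h1 : |x i| ≤ p := by linarith [one_add_abs_le_prod i x]
    have h2 : ρ ≤ σ * p := by
      rw [abs_mul, abs_of_pos hσ] at hi
      nlinarith
    have h3 : 1 ≤ σ ^ 2 * p ^ 2 / ρ ^ 2 := by
      rw [le_div_iff₀ (by positivity), one_mul, ← mul_pow]
      gcongr
    calc ‖0 - 1 - σ * ℓ‖ ≤ 1 + 1 * (C * p ^ 4) := by
          rw [zero_sub]
          refine (norm_sub_le _ _).trans ?_
          rw [norm_neg, norm_one, norm_mul, Complex.norm_real, Real.norm_of_nonneg hσ.le]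
          gcongr
      _ ≤ p ^ 4 + C * p ^ 4 := by rw [one_mul]; gcongr; exact one_le_pow₀ hp1
      _ = (1 + C) * p ^ 4 * 1 := by ring
      _ ≤ (1 + C) * p ^ 4 * (σ ^ 2 * p ^ 2 / ρ ^ 2) := by gcongr
      _ = (1 + C) / ρ ^ 2 * σ ^ 2 * (1 * p ^ 6) := by ring
      _ ≤ (1 + C) / ρ ^ 2 * σ ^ 2 * (Real.exp (∑ i, (x i) ^ 2 / 2) * p ^ 8) := by
        gcongr
        norm_num
      _ ≤ _ := by gcongr; exact le_add_of_nonneg_left (by positivity)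

end LocalBounds

/-! ### The contribution of one choice of saddle points. -/

section LocalIntegral

variable {d : ℕ}

theorem integral_eq_scaled (a b : Fin d → ℝ) (ha : ∀ i, 0 < a i) (F : (Fin d → ℝ) → ℂ) :
    ∫ t, F t = ((∏ i, a i : ℝ) : ℂ) * ∫ x : Fin d → ℝ, F fun i => b i + a i * x i := by
  have hpos : 0 < ∏ i, a i := Finset.prod_pos fun i _ => ha i
  have hdet : (Matrix.diagonal a).det = ∏ i, a i := Matrix.det_diagonal
  have hemb : MeasurableEmbedding fun x : Fin d → ℝ => (fun i => a i * x i : Fin d → ℝ) :=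
    (MeasurableEquiv.piCongrRight fun i =>
      (Homeomorph.mulLeft₀ (a i) (ha i).ne').toMeasurableEquiv).measurableEmbedding
  have h1 := Real.smul_map_diagonal_volume_pi (D := a) (by rw [hdet]; exact hpos.ne')
  have h2 : ⇑(Matrix.toLin' (Matrix.diagonal a)) = fun x : Fin d → ℝ => (fun i => a i * x i) := by
    funext x i
    simp [Matrix.toLin'_apply, Matrix.mulVec_diagonal]
  rw [h2, hdet, abs_of_pos hpos] at h1
  rw [← integral_add_left_eq_self F b]
  conv_lhs => rw [← h1]
  rw [integral_smul_measure, hemb.integral_map, ENNReal.toReal_ofReal hpos.le, Complex.real_smul]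
  rfl

theorem integrable_scaled (a b : Fin d → ℝ) (ha : ∀ i, 0 < a i) {F : (Fin d → ℝ) → ℂ}
    (hF : Integrable F) : Integrable fun x : Fin d → ℝ => F fun i => b i + a i * x i := by
  have hpos : 0 < ∏ i, a i := Finset.prod_pos fun i _ => ha i
  have hdet : (Matrix.diagonal a).det = ∏ i, a i := Matrix.det_diagonal
  have hemb : MeasurableEmbedding fun x : Fin d → ℝ => (fun i => a i * x i : Fin d → ℝ) :=
    (MeasurableEquiv.piCongrRight fun i =>
      (Homeomorph.mulLeft₀ (a i) (ha i).ne').toMeasurableEquiv).measurableEmbedding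
  have h1 := Real.smul_map_diagonal_volume_pi (D := a) (by rw [hdet]; exact hpos.ne')
  have h2 : ⇑(Matrix.toLin' (Matrix.diagonal a)) = fun x : Fin d → ℝ => (fun i => a i * x i) := by
    funext x i
    simp [Matrix.toLin'_apply, Matrix.mulVec_diagonal]
  rw [h2, hdet, abs_of_pos hpos] at h1
  have h3 : Integrable fun t => F (b + t) := hF.comp_add_left b
  rw [← h1, integrable_smul_measure (by simpa using hpos) ENNReal.ofReal_ne_top,
    hemb.integrable_map_iff] at h3
  exact h3

/-- The cutoff to the part of the contour near the saddle point `b`. -/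
noncomputable def nearSaddle (τ c : Bool → ℝ) (ρ : ℝ) (b : Bool) : ℝ → ℂ :=
  (Metric.closedBall (τ b) (ρ / c b)).indicator 1

variable {f h : ℂ → ℂ} {γ : ℝ → ℂ} {u : Bool → ℂ} {θ τ c : Bool → ℝ} {R r ρ κ σ : ℝ}

theorem measurable_nearSaddle (b : Bool) : Measurable (nearSaddle τ c ρ b) :=
  measurable_one.indicator measurableSet_closedBall

theorem norm_nearSaddle_le_one (b : Bool) (t : ℝ) : ‖nearSaddle τ c ρ b t‖ ≤ 1 := by
  classical
  rw [nearSaddle, Set.indicator_apply]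
  split_ifs <;> simp

theorem integrable_prod_nearSaddle_mul (s : Fin d → Bool) {F : (Fin d → ℝ) → ℂ}
    (hF : Integrable F) : Integrable fun t => (∏ i, nearSaddle τ c ρ (s i) (t i)) * F t := by
  refine hF.bdd_mul (c := 1) (Measurable.aestronglyMeasurable ?_) (ae_of_all _ fun t => ?_)
  · exact Finset.measurable_prod _ fun i _ => (measurable_nearSaddle _).comp (measurable_pi_apply i)
  · rw [norm_prod]
    exact Finset.prod_le_one (fun _ _ => norm_nonneg _) fun i _ => norm_nearSaddle_le_one _ _

theorem nearSaddle_scaledPoint (hc : ∀ b, 0 < c b) (s : Fin d → Bool) (x : Fin d → ℝ)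
    (i : Fin d) : nearSaddle τ c ρ (s i) (scaledPoint τ c σ s x i) =
      if |σ * x i| ≤ ρ then 1 else 0 := by
  have h := hc (s i)
  classical
  rw [nearSaddle, Set.indicator_apply]
  have : scaledPoint τ c σ s x i ∈ Metric.closedBall (τ (s i)) (ρ / c (s i)) ↔ |σ * x i| ≤ ρ := by
    rw [Metric.mem_closedBall, Real.dist_eq, scaledPoint, add_sub_cancel_left, div_mul_eq_mul_div,
      abs_div, abs_of_pos h, div_le_div_iff_of_pos_right h]
  simp only [this, Pi.one_apply]

/-- After rescaling each variable around its saddle, the integrand is the amplitude times a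
perturbed Gaussian to which `exists_norm_integral_gauss_sub_le` applies. The error is measured
relative to the amplitude. -/
theorem exists_local_asymptotics {β : ℕ} (hβ : 0 < β) (hu : IsSaddlePair f h u R θ)
    (hγ : IsStraightAt γ u θ τ c r) :
    ∃ ρ : ℝ, 0 < ρ ∧ (∀ b, ρ < r * c b) ∧ ∀ (d : ℕ) (s : Fin d → Bool), ∃ C : ℝ, 0 ≤ C ∧
      ∀ (N : ℕ) (σ : ℝ) (g : ℂ → ℂ), 0 < σ → σ ≤ 1 → N ≠ 0 → (N : ℂ) = 2 / (R * σ ^ 2) →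
        (∀ t, g (γ t) = Complex.exp (N * phaseN f h N (γ t))) →
        Integrable (fun t : Fin d → ℝ => contourIntegrand g γ (4 / (β : ℝ)) 0 1 t) →
        ‖(∫ t : Fin d → ℝ, (∏ i, nearSaddle τ c ρ (s i) (t i)) *
            contourIntegrand g γ (4 / (β : ℝ)) 0 1 t) -
          Complex.exp (logAmplitude f h N u θ (4 / (β : ℝ)) σ s) *
            ((∫ x : Fin d → ℝ, (∏ i, Real.exp (-(x i) ^ 2)) *
              typedVandermonde (4 / (β : ℝ)) s x : ℝ) : ℂ)‖ ≤
          C * σ ^ 2 * ‖Complex.exp (logAmplitude f h N u θ (4 / (β : ℝ)) σ s)‖ := by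
  set κ : ℝ := 4 / (β : ℝ) with hκdef
  have hκ : 0 < κ := by positivity
  obtain ⟨ρ₀, hρ₀, H⟩ := hu.exists_totalRemainder_le hκ.le
  have hr := hγ.r_pos
  have hc := hγ.c_pos
  have hct := hc true
  have hcf := hc false
  -- Halving makes the cutoff strictly smaller than the straight segments, so that the derivative of
  -- `γ` is known on the closed cutoff.
  set ρ := min ρ₀ (min (r * c true) (r * c false) / 2) with hρ
  have hρ0 : 0 < ρ := by positivity
  have hρr : ∀ b, ρ < r * c b := fun b => by
    have h1 : ρ ≤ min (r * c true) (r * c false) / 2 := min_le_right _ _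
    have h2 : min (r * c true) (r * c false) ≤ r * c b := by cases b <;> simp
    have h3 : 0 < min (r * c true) (r * c false) := by positivity
    linarith
  refine ⟨ρ, hρ0, hρr, fun d s => ?_⟩
  obtain ⟨ℓ, C₁, hC₁, hℓm, hℓo, hℓ, HZ⟩ := H d s
  set C₂ := 4 * C₁ ^ 2 * Real.exp C₁ + C₁ + (1 + C₁) / ρ ^ 2 with hC₂
  set M := 8 + ⌈κ⌉₊ * (d - 1) with hM
  have hx1 : ∀ y : ℝ, 1 ≤ 1 + |y| := fun y => by linarith [abs_nonneg y]
  have hVM : ∀ x, typedVandermonde κ s x ≤ ∏ i, (1 + |x i|) ^ M := fun x => by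
    refine (typedVandermonde_le hκ.le s x).trans
      (Finset.prod_le_prod (fun i _ => by positivity) fun i _ => ?_)
    exact pow_le_pow_right₀ (hx1 _) (by omega)
  have hC₂0 : 0 ≤ C₂ := by positivity
  have hC12 : C₁ ≤ C₂ := by
    have : 0 ≤ 4 * C₁ ^ 2 * Real.exp C₁ + (1 + C₁) / ρ ^ 2 := by positivity
    rw [hC₂]; linarith
  have hℓM : ∀ x, ‖ℓ x‖ ≤ C₂ * ∏ i, (1 + |x i|) ^ M := fun x => by
    refine (hℓ x).trans ?_
    rw [Finset.prod_pow]
    refine mul_le_mul hC12 (pow_le_pow_right₀ ?_ (by omega)) (by positivity) hC₂0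
    exact one_le_prod_of_forall_one_le fun i _ => hx1 _
  obtain ⟨C, hC, HC⟩ := exists_norm_integral_gauss_sub_le (measurable_typedVandermonde κ s)
    (typedVandermonde_nonneg κ s) hVM (typedVandermonde_neg κ s) hℓm hℓM hℓo hC₂0
  refine ⟨C, hC, fun N σ g hσ hσ1 hN0 hN hg hint => ?_⟩
  have ha : ∀ i, 0 < σ / c (s i) := fun i => div_pos hσ (hc _)
  have hint' := integrable_prod_nearSaddle_mul (τ := τ) (c := c) (ρ := ρ) s hint
  set E : (Fin d → ℝ) → ℂ := fun x => (∏ i, (if |σ * x i| ≤ ρ then 1 else 0 : ℂ)) *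
    Complex.exp (totalRemainder f h u R θ κ σ s x) with hE
  have hpt : ∀ x : Fin d → ℝ, ((∏ i, (σ / c (s i)) : ℝ) : ℂ) *
      ((∏ i, nearSaddle τ c ρ (s i) (scaledPoint τ c σ s x i)) *
        contourIntegrand g γ κ 0 1 (scaledPoint τ c σ s x)) =
      Complex.exp (logAmplitude f h N u θ κ σ s) *
        ((((∏ i, Real.exp (-(x i) ^ 2)) * typedVandermonde κ s x : ℝ) : ℂ) * E x) := by
    intro x
    simp only [hE, nearSaddle_scaledPoint hc]
    by_cases hx : ∀ i, |σ * x i| ≤ ρ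
    · rw [mul_left_comm, prod_mul_contourIntegrand_scaled hu hγ hκ hσ hN0 hN hg s
        (fun i => (hx i).trans_lt (hρr _))
        (fun j k _ => (HZ σ x hσ fun i => (hx i).trans (min_le_left _ _)).1 j k)]
      ring
    · push Not at hx
      obtain ⟨i, hi⟩ := hx
      have : ∏ i, (if |σ * x i| ≤ ρ then 1 else 0 : ℂ) = 0 :=
        Finset.prod_eq_zero (Finset.mem_univ i) (if_neg (not_le.2 hi))
      rw [this]
      ring
  have hA : Complex.exp (logAmplitude f h N u θ κ σ s) ≠ 0 := Complex.exp_ne_zero _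
  -- Integrability is carried back from the contour integrand, dividing by the nonzero amplitude.
  have hEi : Integrable fun x =>
      (((∏ i, Real.exp (-(x i) ^ 2)) * typedVandermonde κ s x : ℝ) : ℂ) * E x := by
    have h1 := (integrable_scaled (fun i => σ / c (s i)) (fun i => τ (s i)) ha hint').const_mul
      ((Complex.exp (logAmplitude f h N u θ κ σ s))⁻¹ * ((∏ i, (σ / c (s i)) : ℝ) : ℂ))
    refine h1.congr (ae_of_all _ fun x => ?_)
    refine (mul_assoc _ _ _).trans ((congrArg (fun z =>
      (Complex.exp (logAmplitude f h N u θ κ σ s))⁻¹ * z) (hpt x)).trans ?_)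
    exact inv_mul_cancel_left₀ hA _
  have hEb : ∀ x, ‖E x - 1 - σ * ℓ x‖ ≤
      C₂ * σ ^ 2 * ∏ i, (Real.exp ((x i) ^ 2 / 2) * (1 + |x i|) ^ M) := fun x => by
    refine (norm_indicator_exp_sub_le (Z := totalRemainder f h u R θ κ σ s x) hC₁ hσ hσ1 hρ0 (hℓ x)
      (fun hx => ?_) (fun hx => ?_)).trans ?_
    · refine ⟨?_, (HZ σ x hσ fun i => (hx i).trans (min_le_left _ _)).2⟩
      have : ∏ i, (if |σ * x i| ≤ ρ then 1 else 0 : ℂ) = 1 :=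
        Finset.prod_eq_one fun i _ => if_pos (hx i)
      simp only [hE, this, one_mul]
    · push Not at hx
      obtain ⟨i, hi⟩ := hx
      have : ∏ i, (if |σ * x i| ≤ ρ then 1 else 0 : ℂ) = 0 :=
        Finset.prod_eq_zero (Finset.mem_univ i) (if_neg (not_le.2 hi))
      simp only [hE, this, zero_mul]
    · refine mul_le_mul_of_nonneg_left
        (Finset.prod_le_prod (fun i _ => by positivity) fun i _ => ?_) (by positivity)
      exact mul_le_mul_of_nonneg_left (pow_le_pow_right₀ (hx1 _) (by omega)) (by positivity)
  have hfin := HC σ E hEb hEi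
  rw [integral_eq_scaled (fun i => σ / c (s i)) (fun i => τ (s i)) ha, ← integral_const_mul]
  have h3 : (fun x : Fin d → ℝ => ((∏ i, (σ / c (s i)) : ℝ) : ℂ) *
      ((∏ i, nearSaddle τ c ρ (s i) (τ (s i) + σ / c (s i) * x i)) *
        contourIntegrand g γ κ 0 1 fun i => τ (s i) + σ / c (s i) * x i)) =
      fun x => Complex.exp (logAmplitude f h N u θ κ σ s) *
        ((((∏ i, Real.exp (-(x i) ^ 2)) * typedVandermonde κ s x : ℝ) : ℂ) * E x) := funext hpt
  rw [h3, integral_const_mul, ← integral_complex_ofReal, ← mul_sub, norm_mul, mul_comm]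
  gcongr

end LocalIntegral

/-! ### The part away from the saddle points. -/

section Tail

variable {d : ℕ}

theorem norm_one_sub_prod_le {χ : Fin d → ℂ} (hχ : ∀ i, χ i = 0 ∨ χ i = 1) :
    ‖1 - ∏ i, χ i‖ ≤ ∑ i, ‖1 - χ i‖ := by
  by_cases h : ∀ i, χ i = 1
  · simp [h]
  · push Not at h
    obtain ⟨i, hi⟩ := h
    have hi0 := (hχ i).resolve_right hi
    rw [Finset.prod_eq_zero (Finset.mem_univ i) hi0, sub_zero, norm_one]
    calc (1 : ℝ) = ‖1 - χ i‖ := by simp [hi0]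
      _ ≤ _ := Finset.single_le_sum (f := fun i => ‖1 - χ i‖) (fun _ _ => norm_nonneg _)
        (Finset.mem_univ i)

/-- If `∏ χ ≠ 1`, at least one variable lies outside the cutoff. Summing over it gives one small
one-dimensional integral and `d - 1` ordinary ones. -/
theorem norm_integral_one_sub_prod_mul_le {A : (Fin d → ℝ) → ℂ} {w : ℝ → ℝ} {χ : ℝ → ℂ} {c : ℝ}
    (hχm : Measurable χ) (hχ : ∀ t, χ t = 0 ∨ χ t = 1) (hw : Integrable w)
    (hc : 0 ≤ c) (hA : ∀ t, ‖A t‖ ≤ c * ∏ j, w (t j)) :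
    ‖∫ t : Fin d → ℝ, (1 - ∏ i, χ (t i)) * A t‖ ≤
      c * (d * ((∫ t, w t * ‖1 - χ t‖) * (∫ t, w t) ^ (d - 1))) := by
  have hwr : Integrable fun t => w t * ‖1 - χ t‖ := by
    refine hw.mul_bdd (c := 1) (measurable_const.sub hχm).norm.aestronglyMeasurable
      (ae_of_all _ fun t => ?_)
    rcases hχ t with h | h <;> simp [h]
  set W : Fin d → Fin d → ℝ → ℝ := fun i j t => if j = i then w t * ‖1 - χ t‖ else w t with hW
  have hWi : ∀ i j, Integrable (W i j) := fun i j => by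
    simp only [hW]; split_ifs <;> assumption
  have hI : ∀ i, Integrable fun t : Fin d → ℝ => ∏ j, W i j (t j) := fun i =>
    Integrable.fintype_prod (hWi i)
  have hb : ∀ t : Fin d → ℝ, ‖(1 - ∏ i, χ (t i)) * A t‖ ≤ c * ∑ i, ∏ j, W i j (t j) := fun t => by
    rw [norm_mul]
    have h1 : ∀ i, ∏ j, W i j (t j) = ‖1 - χ (t i)‖ * ∏ j, w (t j) := fun i => by
      have : ∀ j, W i j (t j) = w (t j) * if j = i then ‖1 - χ (t j)‖ else 1 := fun j => by
        simp only [hW]; split_ifs <;> simp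
      simp_rw [this, Finset.prod_mul_distrib, Finset.prod_ite_eq']
      simp [mul_comm]
    simp_rw [h1, ← Finset.sum_mul]
    calc _ ≤ (∑ i, ‖1 - χ (t i)‖) * (c * ∏ j, w (t j)) :=
          mul_le_mul (norm_one_sub_prod_le fun i => hχ (t i)) (hA t) (norm_nonneg _)
            (Finset.sum_nonneg fun _ _ => norm_nonneg _)
      _ = _ := by ring
  refine (norm_integral_le_of_norm_le ((integrable_finsetSum _ fun i _ => hI i).const_mul c)
    (ae_of_all _ hb)).trans ?_
  rw [integral_const_mul, integral_finsetSum _ fun i _ => hI i]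
  refine mul_le_mul_of_nonneg_left (le_of_eq ?_) hc
  have h2 : ∀ i, ∫ t : Fin d → ℝ, ∏ j, W i j (t j) =
      (∫ t, w t * ‖1 - χ t‖) * (∫ t, w t) ^ (d - 1) := fun i => by
    rw [integral_fintype_prod_volume_eq_prod, ← Finset.mul_prod_erase _ _ (Finset.mem_univ i)]
    congr 1
    · simp [hW]
    · rw [Finset.prod_congr rfl (g := fun _ => ∫ t, w t) fun j hj => by
        simp [hW, Finset.ne_of_mem_erase hj]]
      simp
  rw [Finset.sum_congr rfl fun i _ => h2 i]
  simp

end Tail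

/-! ### Summation over all choices of saddle points. -/

section ContourAsymptotics

variable {d : ℕ} {f h : ℂ → ℂ} {γ : ℝ → ℂ} {u : Bool → ℂ} {θ τ c : Bool → ℝ} {R r ρ m T : ℝ}

/-- The choice of saddle points that places exactly the points with index in `S` near `u true`. -/
def selection (S : Finset (Fin d)) (i : Fin d) : Bool := decide (i ∈ S)

theorem prod_nearSaddle_add (t : Fin d → ℝ) :
    ∏ i, (nearSaddle τ c ρ true (t i) + nearSaddle τ c ρ false (t i)) =
      ∑ S : Finset (Fin d), ∏ i, nearSaddle τ c ρ (selection S i) (t i) := by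
  rw [Finset.prod_add, Finset.powerset_univ]
  refine Finset.sum_congr rfl fun S _ => ?_
  have h1 : ∀ i, nearSaddle τ c ρ (selection S i) (t i) =
      if i ∈ S then nearSaddle τ c ρ true (t i) else nearSaddle τ c ρ false (t i) := fun i => by
    by_cases hi : i ∈ S <;> simp [selection, hi]
  simp_rw [h1]
  rw [Finset.prod_ite]
  congr 1 <;> refine Finset.prod_congr ?_ fun _ _ => rfl <;> ext i <;> simp

/-- The two cutoff intervals are disjoint, so the sum of their indicators is again an indicator. -/
theorem IsStraightAt.nearSaddle_add (hγ : IsStraightAt γ u θ τ c r) (hρ : ∀ b, ρ < r * c b)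
    (t : ℝ) : nearSaddle τ c ρ true t + nearSaddle τ c ρ false t = 0 ∧ (∀ b, ρ / c b < |t - τ b|) ∨
      nearSaddle τ c ρ true t + nearSaddle τ c ρ false t = 1 := by
  classical
  have h1 : ∀ b, nearSaddle τ c ρ b t = if |t - τ b| ≤ ρ / c b then 1 else 0 := fun b => by
    rw [nearSaddle, Set.indicator_apply]
    simp only [Metric.mem_closedBall, Real.dist_eq, Pi.one_apply]
  have h2 : ∀ b, ρ / c b < r := fun b => (div_lt_iff₀ (hγ.c_pos b)).2 (hρ b)
  rw [h1, h1]
  by_cases ht : |t - τ true| ≤ ρ / c true <;> by_cases hf : |t - τ false| ≤ ρ / c false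
  · have := (abs_le.1 ht).1
    have := (abs_le.1 hf).2
    linarith [h2 true, h2 false, hγ.lt]
  · right; simp [ht, hf]
  · right; simp [ht, hf]
  · left
    refine ⟨by simp [ht, hf], fun b => ?_⟩
    cases b
    · exact not_le.1 hf
    · exact not_le.1 ht

/-- `N f_N = (N - N₁) f + N₁ f_{N₁}`. Growth in `N` is thus controlled by `|e^f|` alone, and the
single density at `N₁` supplies all integrability. -/
theorem contourDensity_eq_pow_mul {g : ℕ → ℂ → ℂ} {N N₁ : ℕ} (hN₁ : N₁ ≠ 0) (hN : N₁ ≤ N)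
    (hg : ∀ N, N₁ ≤ N → ∀ t, g N (γ t) = Complex.exp (N * phaseN f h N (γ t))) (t : ℝ) :
    contourDensity (g N) γ 1 t =
      Complex.exp (f (γ t)) ^ (N - N₁) * contourDensity (g N₁) γ 1 t := by
  rw [contourDensity_one, contourDensity_one, hg N hN, hg N₁ le_rfl, mul_phaseN (by omega),
    mul_phaseN hN₁, ← Complex.exp_nat_mul, ← mul_assoc, ← Complex.exp_add]
  congr 2
  rw [Nat.cast_sub hN]
  ring

/-- The product of the cutoffs expands into subsets of variables near `u true`, each treated by the
local asymptotics. Its complement has at least one variable where `|e^f| ≤ q e^m`, which gains the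
factor `q^{N - N₁}`. -/
theorem exists_contour_asymptotics {β : ℕ} (hβ : 0 < β) (hu : IsSaddlePair f h u R θ)
    (hγ : IsStraightAt γ u θ τ c r) {g : ℕ → ℂ → ℂ} {N₁ : ℕ} (hN₁ : N₁ ≠ 0)
    (hdef : ∀ N, N₁ ≤ N → IsDeformation (g N) γ T)
    (hg : ∀ N, N₁ ≤ N → ∀ t, g N (γ t) = Complex.exp (N * phaseN f h N (γ t)))
    (hint : ∀ N, N₁ ≤ N →
      Integrable fun t : ℝ => ‖g N t‖ * ((1 + |t|) ^ (4 / (β : ℝ))) ^ (d - 1))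
    (hmax : ∀ t, ‖Complex.exp (f (γ t))‖ ≤ Real.exp m)
    (hout : ∀ δ > 0, ∃ q, 0 ≤ q ∧ q < 1 ∧ ∀ t, (∀ b, δ < |t - τ b|) →
      ‖Complex.exp (f (γ t))‖ ≤ q * Real.exp m) :
    ∃ C q : ℝ, 0 ≤ C ∧ 0 ≤ q ∧ q < 1 ∧ ∀ᶠ N : ℕ in atTop,
      ‖(∫ t : Fin d → ℝ, contourIntegrand (g N) γ (4 / (β : ℝ)) 0 1 t) -
        ∑ S : Finset (Fin d),
          Complex.exp (logAmplitude f h N u θ (4 / (β : ℝ)) (Real.sqrt (2 / (N * R))) (selection S)) *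
            ((∫ x : Fin d → ℝ, (∏ i, Real.exp (-(x i) ^ 2)) *
              typedVandermonde (4 / (β : ℝ)) (selection S) x : ℝ) : ℂ)‖ ≤
      C / N * ∑ S : Finset (Fin d), ‖Complex.exp (logAmplitude f h N u θ (4 / (β : ℝ))
        (Real.sqrt (2 / (N * R))) (selection S))‖ + C * q ^ (N - N₁) * (Real.exp m) ^ (d * (N - N₁)) := by
  set κ : ℝ := 4 / (β : ℝ) with hκdef
  have hκ : 0 < κ := by positivity
  have hR := hu.R_pos
  obtain ⟨ρ, hρ, hρr, hloc⟩ := exists_local_asymptotics hβ hu hγ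
  choose C hC hlocS using fun S : Finset (Fin d) => hloc d (selection S)
  obtain ⟨cK, hcK, hbound⟩ := (hdef N₁ le_rfl).exists_norm_contourIntegrand_le (d := d) hκ.le
  set δ := min (ρ / c true) (ρ / c false) with hδ
  have hδ0 : 0 < δ := lt_min (div_pos hρ (hγ.c_pos _)) (div_pos hρ (hγ.c_pos _))
  obtain ⟨q, hq0, hq1, hq⟩ := hout δ hδ0
  set χ : ℝ → ℂ := fun t => nearSaddle τ c ρ true t + nearSaddle τ c ρ false t with hχ
  have hχm : Measurable χ := (measurable_nearSaddle _).add (measurable_nearSaddle _)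
  have hχ01 : ∀ t, χ t = 0 ∨ χ t = 1 := fun t => (hγ.nearSaddle_add hρr t).imp And.left id
  set w : ℕ → ℝ → ℝ := fun N t => ‖contourDensity (g N) γ 1 t‖ * ((1 + |t|) ^ κ) ^ (d - 1) with hw
  have hw0 : ∀ N t, 0 ≤ w N t := fun N t => by simp only [hw]; positivity
  have hwi : ∀ N, N₁ ≤ N → Integrable (w N) := fun N hN =>
    (hdef N hN).integrable_density_one hκ.le (hint N hN)
  have hwN : ∀ N, N₁ ≤ N → ∀ t, w N t = ‖Complex.exp (f (γ t))‖ ^ (N - N₁) * w N₁ t :=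
    fun N hN t => by
      simp only [hw]
      rw [contourDensity_eq_pow_mul hN₁ hN hg, norm_mul, norm_pow, mul_assoc]
  set μ := Real.exp m with hμ
  set I₁ := ∫ t, w N₁ t with hI₁
  have hI₁0 : 0 ≤ I₁ := integral_nonneg (hw0 N₁)
  set K := cK * (d * I₁ ^ d) with hK
  have htail : ∀ N, N₁ ≤ N → ‖∫ t : Fin d → ℝ, (1 - ∏ i, χ (t i)) * contourIntegrand (g N) γ κ 0 1 t‖ ≤
      K * q ^ (N - N₁) * μ ^ (d * (N - N₁)) := by
    intro N hN
    have hA : ∀ t : Fin d → ℝ, ‖contourIntegrand (g N) γ κ 0 1 t‖ ≤ cK * ∏ j, w N (t j) := by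
      intro t
      have h1 := hbound 1 ⟨zero_le_one, le_rfl⟩ 0 ⟨le_rfl, zero_le_one⟩ t
      have h2 : contourIntegrand (g N) γ κ 0 1 t = (∏ j, Complex.exp (f (γ (t j))) ^ (N - N₁)) *
          contourIntegrand (g N₁) γ κ 0 1 t := by
        rw [contourIntegrand, contourIntegrand, ← mul_assoc, ← Finset.prod_mul_distrib]
        simp_rw [contourDensity_eq_pow_mul hN₁ hN hg]
      rw [h2, norm_mul, norm_prod]
      simp_rw [hwN N hN, Finset.prod_mul_distrib, norm_pow]
      calc _ ≤ (∏ j, ‖Complex.exp (f (γ (t j)))‖ ^ (N - N₁)) * (cK * ∏ j, w N₁ (t j)) := by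
            gcongr
        _ = _ := by ring
    refine (norm_integral_one_sub_prod_mul_le hχm hχ01 (hwi N hN) hcK hA).trans ?_
    have h3 : ∫ t, w N t ≤ μ ^ (N - N₁) * I₁ := by
      rw [hI₁, ← integral_const_mul]
      refine integral_mono (hwi N hN) ((hwi N₁ le_rfl).const_mul _) fun t => ?_
      dsimp only
      rw [hwN N hN]
      exact mul_le_mul_of_nonneg_right (pow_le_pow_left₀ (norm_nonneg _) (hmax t) _) (hw0 _ _)
    have h4 : ∫ t, w N t * ‖1 - χ t‖ ≤ (q * μ) ^ (N - N₁) * I₁ := by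
      rw [hI₁, ← integral_const_mul]
      refine integral_mono_of_nonneg (ae_of_all _ fun t => mul_nonneg (hw0 _ _) (norm_nonneg _))
        ((hwi N₁ le_rfl).const_mul _) (ae_of_all _ fun t => ?_)
      dsimp only
      rw [hwN N hN]
      rcases hγ.nearSaddle_add hρr t with ⟨h5, h6⟩ | h5
      · have h7 : χ t = 0 := h5
        rw [h7, sub_zero, norm_one, mul_one]
        refine mul_le_mul_of_nonneg_right (pow_le_pow_left₀ (norm_nonneg _) (hq t fun b => ?_) _)
          (hw0 _ _)
        refine lt_of_le_of_lt ?_ (h6 b)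
        cases b
        · exact min_le_right _ _
        · exact min_le_left _ _
      · have h7 : χ t = 1 := h5
        rw [h7, sub_self, norm_zero, mul_zero]
        exact mul_nonneg (by positivity) (hw0 _ _)
    have h5 : 0 ≤ ∫ t, w N t := integral_nonneg (hw0 N)
    -- For `d = 0` the truncated exponent satisfies `d - 1 + 1 ≠ d`, but both sides carry the factor
    -- `d`.
    rcases Nat.eq_zero_or_pos d with hd | hd
    · rw [hK]; simp [hd]
    calc cK * (d * ((∫ t, w N t * ‖1 - χ t‖) * (∫ t, w N t) ^ (d - 1)))
        ≤ cK * (d * (((q * μ) ^ (N - N₁) * I₁) * (μ ^ (N - N₁) * I₁) ^ (d - 1))) := by gcongr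
      _ = cK * (d * (I₁ ^ (d - 1 + 1))) * q ^ (N - N₁) * (μ ^ (N - N₁)) ^ (d - 1 + 1) := by ring
      _ = _ := by rw [Nat.sub_add_cancel hd, hK, ← pow_mul, mul_comm (N - N₁)]
  refine ⟨(∑ S, C S) * (2 / R) + K, q,
    add_nonneg (mul_nonneg (Finset.sum_nonneg fun S _ => hC S) (by positivity)) (by positivity),
    hq0, hq1, ?_⟩
  filter_upwards [eventually_ge_atTop N₁, eventually_ge_atTop ⌈2 / R⌉₊] with N hN hNR
  have hN0 : N ≠ 0 := by omega
  have hNp : (0 : ℝ) < N := by exact_mod_cast Nat.pos_of_ne_zero hN0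
  -- This choice makes `N = 2 / (R σ²)`, so `σ²` is of order `1 / N`.
  set σ := Real.sqrt (2 / (N * R)) with hσdef
  have hσ : 0 < σ := Real.sqrt_pos.2 (by positivity)
  have hσ2 : σ ^ 2 = 2 / (N * R) := Real.sq_sqrt (by positivity)
  have hσ1 : σ ≤ 1 := by
    rw [hσdef, Real.sqrt_le_iff, one_pow, div_le_one (by positivity)]
    refine ⟨zero_le_one, ?_⟩
    have := (Nat.ceil_le.1 hNR)
    rwa [div_le_iff₀ hR] at this
  have hNσ : (N : ℂ) = 2 / (R * σ ^ 2) := by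
    have h1 : (N : ℝ) = 2 / (R * σ ^ 2) := by rw [hσ2]; field_simp
    exact_mod_cast congrArg (fun x : ℝ => (x : ℂ)) h1
  have hWi : Integrable fun t : Fin d → ℝ => contourIntegrand (g N) γ κ 0 1 t :=
    (hdef N hN).integrable_contourIntegrand hκ.le (hint N hN) (Or.inr rfl) ⟨le_rfl, zero_le_one⟩
  have hsplit : ∫ t : Fin d → ℝ, contourIntegrand (g N) γ κ 0 1 t =
      (∑ S : Finset (Fin d), ∫ t : Fin d → ℝ, (∏ i, nearSaddle τ c ρ (selection S i) (t i)) *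
        contourIntegrand (g N) γ κ 0 1 t) +
      ∫ t : Fin d → ℝ, (1 - ∏ i, χ (t i)) * contourIntegrand (g N) γ κ 0 1 t := by
    have hi : ∀ S : Finset (Fin d), Integrable fun t : Fin d → ℝ =>
        (∏ i, nearSaddle τ c ρ (selection S i) (t i)) * contourIntegrand (g N) γ κ 0 1 t :=
      fun S => integrable_prod_nearSaddle_mul _ hWi
    have h1 : ∀ t : Fin d → ℝ, (1 - ∏ i, χ (t i)) * contourIntegrand (g N) γ κ 0 1 t =
        contourIntegrand (g N) γ κ 0 1 t - ∑ S : Finset (Fin d),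
          (∏ i, nearSaddle τ c ρ (selection S i) (t i)) * contourIntegrand (g N) γ κ 0 1 t := by
      intro t
      simp only [hχ]
      rw [prod_nearSaddle_add, sub_mul, one_mul, Finset.sum_mul]
    simp_rw [h1]
    rw [integral_sub hWi (integrable_finsetSum _ fun S _ => hi S),
      integral_finsetSum _ fun S _ => hi S]
    ring
  have hloc1 : ∀ S : Finset (Fin d), _ := fun S => hlocS S N σ (g N) hσ hσ1 hN0 hNσ (hg N hN) hWi
  rw [hsplit, add_sub_right_comm, ← Finset.sum_sub_distrib]
  refine (norm_add_le _ _).trans (add_le_add ?_ ?_)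
  · refine (norm_sum_le_of_le _ fun S _ => hloc1 S).trans ?_
    rw [Finset.mul_sum]
    refine Finset.sum_le_sum fun S _ => mul_le_mul_of_nonneg_right ?_ (norm_nonneg _)
    have hCS : C S ≤ ∑ S, C S := Finset.single_le_sum (fun S _ => hC S) (Finset.mem_univ S)
    calc C S * σ ^ 2 ≤ (∑ S, C S) * (2 / (N * R)) := by rw [hσ2]; gcongr
      _ = ((∑ S, C S) * (2 / R)) / N := by field_simp
      _ ≤ _ := by gcongr; exact le_add_of_nonneg_right (by positivity)
  · refine (htail N hN).trans ?_
    have : 0 ≤ (∑ S, C S) * (2 / R) :=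
      mul_nonneg (Finset.sum_nonneg fun S _ => hC S) (by positivity)
    gcongr
    linarith

end ContourAsymptotics

/-! ### The amplitude as a function of the number of points at each saddle. -/

section Amplitude

variable {d : ℕ}

theorem sum_pair_eq_of_symm (F : Fin d → Fin d → ℂ) (hF : ∀ j k, F k j = F j k) :
    ∑ j, ∑ k ∈ Finset.Ioi j, F j k = ((∑ j, ∑ k, F j k) - ∑ j, F j j) / 2 := by
  have h1 := Finset.sum_sum_Ioi_add_eq_sum_sum_off_diag fun j k => F j k
  have h2 : ∀ j, ∑ k ∈ ({j}ᶜ : Finset (Fin d)), F k j = (∑ k, F j k) - F j j := fun j => by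
    rw [← Finset.sum_add_sum_compl {j} fun k => F j k, Finset.sum_singleton, add_sub_cancel_left]
    exact Finset.sum_congr rfl fun k _ => hF j k
  simp_rw [h2, hF, ← two_mul, ← Finset.mul_sum] at h1
  rw [Finset.sum_sub_distrib] at h1
  rw [← h1]
  ring

theorem sum_selection (S : Finset (Fin d)) (a : Bool → ℂ) :
    ∑ i, a (selection S i) = S.card * a true + (d - S.card) * a false := by
  have h1 : ∀ i, a (selection S i) = a false + if i ∈ S then a true - a false else 0 := fun i => by
    by_cases hi : i ∈ S <;> simp [selection, hi]
  simp_rw [h1, Finset.sum_add_distrib, ← Finset.sum_filter]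
  simp
  ring

theorem sum_pair_selection (S : Finset (Fin d)) (a : Bool → ℂ) (b : ℂ) :
    ∑ j, ∑ k ∈ Finset.Ioi j, (if selection S j = selection S k then a (selection S j) else b) =
      S.card * (S.card - 1) / 2 * a true +
        (d - S.card) * (d - S.card - 1) / 2 * a false + S.card * (d - S.card) * b := by
  rw [sum_pair_eq_of_symm]
  · have h1 : ∀ j, ∑ k, (if selection S j = selection S k then a (selection S j) else b) =
        (fun s : Bool => if s then S.card * a true + (d - S.card) * b
          else S.card * b + (d - S.card) * a false) (selection S j) := fun j => by
      have := sum_selection S fun s => if selection S j = s then a (selection S j) else b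
      rw [this]
      cases selection S j <;> simp
    simp_rw [h1]
    rw [sum_selection S fun s : Bool => if s then S.card * a true + (d - S.card) * b
          else S.card * b + (d - S.card) * a false]
    simp only [if_true, sum_selection]
    simp
    ring
  · intro j k
    by_cases hjk : selection S j = selection S k
    · rw [if_pos hjk, if_pos hjk.symm, hjk]
    · rw [if_neg hjk, if_neg (Ne.symm hjk)]

/-- Counting points and pairs gives a quadratic polynomial in `|S|`, expanded here around the
balanced value `e`. The coefficient of the square contains `(2/e) log σ`, the source of the
suppression of unbalanced selections. -/
theorem logAmplitude_selection (f h : ℂ → ℂ) (N : ℕ) (u : Bool → ℂ) (θ : Bool → ℝ) (σ : ℝ) {e : ℕ}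
    (he : 0 < e) (S : Finset (Fin (2 * e))) :
    logAmplitude f h N u θ (4 / ((2 * e : ℕ) : ℝ)) σ (selection S) =
      (Real.log σ * (2 * (2 * e - 1)) + Complex.I * ((2 * e - 1) * (θ true + θ false)) +
        e * (N * phaseN f h N (u true) + N * phaseN f h N (u false)) +
        2 * e * Complex.log (u true - u false)) +
      (S.card - e : ℂ) ^ 2 * (2 / e * Real.log σ + Complex.I * ((θ true + θ false) / e) -
        2 / e * Complex.log (u true - u false)) +
      (S.card - e : ℂ) * (N * phaseN f h N (u true) - N * phaseN f h N (u false) +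
        Complex.I * ((3 - 1 / e) * (θ true - θ false))) := by
  have hec : (e : ℂ) ≠ 0 := by exact_mod_cast he.ne'
  rw [logAmplitude, sum_selection S fun b =>
    (Real.log σ + Complex.I * θ b + N * phaseN f h N (u b) : ℂ)]
  simp_rw [← Finset.mul_sum]
  rw [sum_pair_selection S fun b => (Real.log σ + Complex.I * θ b : ℂ)]
  push_cast
  field_simp
  ring

end Amplitude

/-! ### Binomials, Mehta integrals and Gamma quotients. -/

section Combinatorics

theorem sum_range_two_mul_succ {A : Type*} [AddCommMonoid A] (F : ℕ → A) (e : ℕ) :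
    ∑ n ∈ Finset.range (2 * e + 1), F n =
      F e + ∑ k ∈ Finset.Icc 1 e, (F (e + k) + F (e - k)) := by
  have h1 : ∑ k ∈ Finset.Icc 1 e, F (e + k) = ∑ i ∈ Finset.range e, F (e + 1 + i) := by
    rw [← Finset.Ico_add_one_right_eq_Icc, Finset.sum_Ico_eq_sum_range]
    exact Finset.sum_congr (by simp) fun i _ => by rw [add_assoc]
  have h2 : ∑ k ∈ Finset.Icc 1 e, F (e - k) = ∑ i ∈ Finset.range e, F i := by
    rw [← Finset.Ico_add_one_right_eq_Icc, Finset.sum_Ico_eq_sum_range, ← Finset.sum_range_reflect]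
    refine Finset.sum_congr (by simp) fun i hi => ?_
    congr 1
    have := Finset.mem_range.1 hi
    omega
  rw [Finset.sum_add_distrib, h1, h2, show 2 * e + 1 = (e + 1) + e by ring, Finset.sum_range_add,
    Finset.sum_range_succ]
  abel

/-- The product of Gamma functions in the closed form of the Mehta integral. -/
noncomputable def gammaProd (g : ℝ) (n : ℕ) : ℝ :=
  ∏ j ∈ Finset.Icc 1 n, Real.Gamma (1 + j * g) / Real.Gamma (1 + g)

theorem gammaProd_pos {g : ℝ} (hg : 0 < g) (n : ℕ) : 0 < gammaProd g n :=
  Finset.prod_pos fun j _ => div_pos (Real.Gamma_pos_of_pos (by positivity))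
    (Real.Gamma_pos_of_pos (by positivity))

theorem gammaProd_succ (g : ℝ) (n : ℕ) :
    gammaProd g (n + 1) = gammaProd g n * (Real.Gamma (1 + (n + 1 : ℕ) * g) / Real.Gamma (1 + g)) := by
  rw [gammaProd, gammaProd, Finset.prod_Icc_succ_top (by omega)]

/-- The ratio of Gamma products in the coefficient of the `k`-th oscillatory term. -/
theorem prod_Gamma_ratio_eq {e : ℕ} (he : 0 < e) {k : ℕ} (hk : k ≤ e) :
    ((2 * e).choose (e + k) : ℝ) * gammaProd (1 / e) (e + k) * gammaProd (1 / e) (e - k) =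
      ((2 * e).choose e : ℝ) * gammaProd (1 / e) e ^ 2 *
        ∏ j ∈ Finset.Icc 1 k, Real.Gamma (1 + j / e) / Real.Gamma (1 + ((j : ℝ) - k) / e) := by
  have hep : (0 : ℝ) < e := by exact_mod_cast he
  have hprod : ∀ k : ℕ, ∏ j ∈ Finset.Icc 1 k, Real.Gamma (1 + ((j : ℝ) - k) / e) =
      ∏ i ∈ Finset.range k, Real.Gamma (1 - i / e) := fun k => by
    rw [← Finset.Ico_add_one_right_eq_Icc, Finset.prod_Ico_eq_prod_range,
      ← Finset.prod_range_reflect]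
    refine Finset.prod_congr (by simp) fun i hi => ?_
    have h1 := Finset.mem_range.1 hi
    congr 1
    have h2 : ((1 + (k + 1 - 1 - 1 - i) : ℕ) : ℝ) = k - i := by
      rw [show 1 + (k + 1 - 1 - 1 - i) = k - i by omega, Nat.cast_sub (by omega)]
    rw [h2]; ring
  have hnum : ∀ k : ℕ, ∏ j ∈ Finset.Icc 1 k, Real.Gamma (1 + (j : ℝ) / e) =
      ∏ i ∈ Finset.range k, Real.Gamma (1 + (i + 1) / e) := fun k => by
    rw [← Finset.Ico_add_one_right_eq_Icc, Finset.prod_Ico_eq_prod_range]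
    refine Finset.prod_congr (by simp) fun i _ => ?_
    push_cast
    ring_nf
  rw [Finset.prod_div_distrib, hprod, hnum, ← Finset.prod_div_distrib]
  -- Increasing `k` moves one Gamma factor between the products of lengths `e + k` and `e - k`. The
  -- quotient of consecutive binomials is cancelled by the factors that the functional equation of
  -- Gamma extracts.
  induction k with
  | zero => simp; ring
  | succ k ih =>
    have ih' := ih (by omega)
    rw [Finset.prod_range_succ, ← mul_assoc, ← ih']
    -- Writing `m = e - (k + 1)` avoids truncated subtraction and shows that the Gamma function at
    -- `1 - k/e = (m + 1)/e` is nonzero.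
    obtain ⟨m, rfl⟩ : ∃ m, e = k + 1 + m := ⟨e - (k + 1), by omega⟩
    set e := k + 1 + m with he'
    have h1 : e - k = m + 1 := by omega
    have h2 : e - (k + 1) = m := by omega
    rw [h1, h2, ← add_assoc, gammaProd_succ, gammaProd_succ]
    have hc : ((2 * e).choose (e + k + 1) : ℝ) * (e + k + 1) = (2 * e).choose (e + k) * (m + 1) := by
      have := Nat.choose_succ_right_eq (2 * e) (e + k)
      rw [show 2 * e - (e + k) = m + 1 by omega] at this
      exact_mod_cast this
    have hG1 : Real.Gamma (1 + (e + k + 1 : ℕ) * (1 / (e : ℝ))) =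
        ((e + k + 1) / e) * Real.Gamma (1 + (k + 1) / e) := by
      rw [show 1 + (e + k + 1 : ℕ) * (1 / (e : ℝ)) = (1 + (k + 1) / e) + 1 by
        push_cast; field_simp; ring, Real.Gamma_add_one (by positivity)]
      congr 1
      field_simp
      ring
    have hG2 : Real.Gamma (1 + (m + 1 : ℕ) * (1 / (e : ℝ))) =
        ((m + 1) / e) * Real.Gamma (1 - k / e) := by
      have h3 : (e : ℝ) = k + 1 + m := by rw [he']; push_cast; ring
      have h4 : 1 - (k : ℝ) / e = (m + 1) / e := by
        field_simp; rw [h3]; ring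
      rw [h4, show 1 + (m + 1 : ℕ) * (1 / (e : ℝ)) = (m + 1) / e + 1 by push_cast; ring,
        Real.Gamma_add_one (by positivity)]
    have hGk : Real.Gamma (1 - (k : ℝ) / e) ≠ 0 := by
      have h3 : (e : ℝ) = k + 1 + m := by rw [he']; push_cast; ring
      have h4 : 1 - (k : ℝ) / e = (m + 1) / e := by
        field_simp; rw [h3]; ring
      rw [h4]
      exact (Real.Gamma_pos_of_pos (by positivity)).ne'
    rw [hG1, hG2]
    have hne : (e : ℝ) ≠ 0 := hep.ne'
    have hG0 : Real.Gamma (1 + 1 / (e : ℝ)) ≠ 0 := (Real.Gamma_pos_of_pos (by positivity)).ne'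
    generalize Real.Gamma (1 + (k + 1) / e) = A
    generalize Real.Gamma (1 - k / e) = B at hGk
    generalize Real.Gamma (1 + 1 / (e : ℝ)) = D at hG0
    generalize gammaProd (1 / e) (e + k) = G₁
    generalize gammaProd (1 / e) m = G₂
    field_simp
    linear_combination (G₁ * A * G₂) * hc

theorem mehtaIntegral_eq_gammaProd (n : ℕ) {e : ℕ} (he : 0 < e) :
    mehtaIntegral n (2 * e) = Real.sqrt Real.pi ^ n *
      (2 : ℝ) ^ (-((n : ℝ) * (n - 1) / (2 * e))) * gammaProd (1 / e) n := by
  have hep : (0 : ℝ) < e := by exact_mod_cast he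
  have hg : (2 : ℝ) / ((2 * e : ℕ) : ℝ) = 1 / e := by push_cast; field_simp
  rw [mehtaIntegral_eq_gaussVandIntegral, hg, gaussVandIntegral_eq (by positivity), gammaProd]
  congr 2
  rw [← Real.rpow_neg zero_le_two, ← Real.rpow_natCast, ← Real.rpow_mul zero_le_two,
    Nat.cast_choose_two]
  congr 1
  field_simp

/-- The exponents of `2` for `e + k` and `e - k` add up to the balanced value and an excess `k² /
e`, since `(e+k)(e+k-1) + (e-k)(e-k-1) = 2e(e-1) + 2k²`. The Gamma products are compared by
`prod_Gamma_ratio_eq`. -/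
theorem choose_mul_mehtaIntegral_eq {e : ℕ} (he : 0 < e) {k : ℕ} (hk : k ≤ e) :
    ((2 * e).choose (e + k) : ℝ) * (mehtaIntegral (e + k) (2 * e) * mehtaIntegral (e - k) (2 * e)) =
      ((2 * e).choose e : ℝ) * mehtaIntegral e (2 * e) ^ 2 * ((2 : ℝ) ^ (-((k : ℝ) ^ 2 / e)) *
        ∏ j ∈ Finset.Icc 1 k, Real.Gamma (1 + j / e) / Real.Gamma (1 + ((j : ℝ) - k) / e)) := by
  have hep : (0 : ℝ) < e := by exact_mod_cast he
  simp only [mehtaIntegral_eq_gammaProd _ he]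
  have h1 : Real.sqrt Real.pi ^ (e + k) * Real.sqrt Real.pi ^ (e - k) = (Real.sqrt Real.pi ^ e) ^ 2 := by
    rw [← pow_add, ← pow_mul]; congr 1; omega
  have h2 : (2 : ℝ) ^ (-(((e + k : ℕ) : ℝ) * ((e + k : ℕ) - 1) / (2 * e))) *
      (2 : ℝ) ^ (-(((e - k : ℕ) : ℝ) * ((e - k : ℕ) - 1) / (2 * e))) =
      ((2 : ℝ) ^ (-((e : ℝ) * (e - 1) / (2 * e)))) ^ 2 * (2 : ℝ) ^ (-((k : ℝ) ^ 2 / e)) := by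
    rw [← Real.rpow_natCast ((2 : ℝ) ^ _), ← Real.rpow_mul zero_le_two, ← Real.rpow_add two_pos,
      ← Real.rpow_add two_pos, Nat.cast_sub hk]
    congr 1
    push_cast
    field_simp
    ring
  calc _ = (Real.sqrt Real.pi ^ (e + k) * Real.sqrt Real.pi ^ (e - k)) *
        ((2 : ℝ) ^ (-(((e + k : ℕ) : ℝ) * ((e + k : ℕ) - 1) / (2 * e))) *
          (2 : ℝ) ^ (-(((e - k : ℕ) : ℝ) * ((e - k : ℕ) - 1) / (2 * e)))) *
        (((2 * e).choose (e + k) : ℝ) * gammaProd (1 / e) (e + k) * gammaProd (1 / e) (e - k)) := by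
        ring
    _ = _ := by rw [h1, h2, prod_Gamma_ratio_eq he hk]; ring

theorem mehtaIntegral_pos (n : ℕ) {e : ℕ} (he : 0 < e) : 0 < mehtaIntegral n (2 * e) := by
  have hep : (0 : ℝ) < e := by exact_mod_cast he
  rw [mehtaIntegral_eq_gammaProd n he]
  have := gammaProd_pos (g := 1 / e) (by positivity) n
  have := Real.pi_pos
  positivity

end Combinatorics

/-! ### The sum over selections in closed form. -/

section Expansion

/-- The `k`-th summand of `oscillatoryFactor`. -/
noncomputable def oscillatoryTerm (β N : ℕ) (R : ℝ) (um up fm fp : ℂ) (θm θp : ℝ) (k : ℕ) : ℂ :=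
  ((∏ j ∈ Finset.Icc 1 k, Real.Gamma (1 + 2 * (j : ℝ) / (β : ℝ)) /
      Real.Gamma (1 + 2 * ((j : ℝ) - (k : ℝ)) / (β : ℝ)) : ℝ) : ℂ) *
    (Complex.exp (Complex.I * (2 * (k : ℂ) ^ 2 * ((θp : ℂ) + (θm : ℂ)) / (β : ℂ))) /
      ((up - um) ^ (4 * (k : ℂ) ^ 2 / (β : ℂ)) *
        ((((N : ℝ) * R) ^ (2 * (k : ℝ) ^ 2 / (β : ℝ)) : ℝ) : ℂ))) *
    Complex.cos (-Complex.I * (k : ℂ) * (N : ℂ) * (fp - fm) +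
      (k : ℂ) * ((θp : ℂ) - (θm : ℂ)) * (3 - 2 / (β : ℂ)))

theorem oscillatoryFactor_eq (β N : ℕ) (R : ℝ) (um up fm fp : ℂ) (θm θp : ℝ) :
    oscillatoryFactor β N R um up fm fp θm θp =
      1 + 2 * ∑ k ∈ Finset.Icc 1 ⌊Real.sqrt ((β : ℝ) / 2)⌋₊,
        oscillatoryTerm β N R um up fm fp θm θp k := rfl

theorem norm_cos_le_exp (z : ℂ) : ‖Complex.cos z‖ ≤ Real.exp |z.im| := by
  rw [Complex.cos, norm_div, Complex.norm_ofNat, div_le_iff₀ two_pos]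
  refine (norm_add_le _ _).trans ?_
  rw [Complex.norm_exp, Complex.norm_exp]
  have h1 : Real.exp (z * Complex.I).re ≤ Real.exp |z.im| := by
    rw [Real.exp_le_exp, Complex.mul_I_re]; exact neg_le_abs _
  have h2 : Real.exp (-z * Complex.I).re ≤ Real.exp |z.im| := by
    rw [Real.exp_le_exp, Complex.mul_I_re, Complex.neg_im, neg_neg]; exact le_abs_self _
  linarith

/-- The part of the prefactor that does not depend on the Mehta integrals. -/
noncomputable def saddleScale (e N : ℕ) (R : ℝ) (um up fm fp : ℂ) (θm θp : ℝ) : ℂ :=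
  (up - um) ^ (2 * e) * (2 / ((N : ℂ) * (R : ℂ))) ^ (2 * e - 1) *
    Complex.exp (((2 * e : ℕ) : ℂ) * (N : ℂ) * (fp + fm) / 2) *
    Complex.exp (Complex.I * (((2 * e : ℕ) : ℂ) - 1) * ((θp : ℂ) + (θm : ℂ)))

theorem bulkPrefactor_eq (e N : ℕ) (R : ℝ) (um up fm fp : ℂ) (θm θp : ℝ) :
    bulkPrefactor (2 * e) N R um up fm fp θm θp =
      (((2 * e).choose e * mehtaIntegral e (2 * e) ^ 2 : ℝ) : ℂ) *
        saddleScale e N R um up fm fp θm θp := by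
  rw [bulkPrefactor, saddleScale, Nat.mul_div_cancel_left e two_pos]
  push_cast
  ring

variable {f h : ℂ → ℂ} {u : Bool → ℂ} {θ : Bool → ℝ} {R m : ℝ} {e N : ℕ}

/-- The amplitude of a balanced selection is `saddleScale`; it is split off as the common scale of
all terms and of the errors. -/
theorem exp_logAmplitude (hu : IsSaddlePair f h u R θ) (he : 0 < e) (hN : N ≠ 0)
    (S : Finset (Fin (2 * e))) :
    Complex.exp (logAmplitude f h N u θ (4 / ((2 * e : ℕ) : ℝ)) (Real.sqrt (2 / (N * R)))
        (selection S)) =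
      saddleScale e N R (u false) (u true) (phaseN f h N (u false)) (phaseN f h N (u true))
        (θ false) (θ true) *
      (Complex.exp ((S.card - e : ℂ) ^ 2 * (1 / e * Real.log (2 / (N * R)) +
        Complex.I * ((θ true + θ false) / e) - 2 / e * Complex.log (u true - u false))) *
      Complex.exp ((S.card - e : ℂ) * (N * phaseN f h N (u true) - N * phaseN f h N (u false) +
        Complex.I * ((3 - 1 / e) * (θ true - θ false))))) := by
  have hR := hu.R_pos
  have hNp : (0 : ℝ) < N := by exact_mod_cast Nat.pos_of_ne_zero hN
  have hΔ : u true - u false ≠ 0 := Complex.slitPlane_ne_zero hu.sub_mem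
  have hlog : Real.log (Real.sqrt (2 / (N * R))) = Real.log (2 / (N * R)) / 2 :=
    Real.log_sqrt (by positivity)
  have hpos : 0 < 2 / (N * R) := by positivity
  have h1 : (u true - u false) ^ (2 * e) = Complex.exp (2 * e * Complex.log (u true - u false)) := by
    rw [← Complex.exp_log hΔ, ← Complex.exp_nat_mul, Complex.exp_log hΔ]
    push_cast; rfl
  have h2 : (2 / ((N : ℂ) * (R : ℂ))) ^ (2 * e - 1) =
      Complex.exp ((2 * e - 1) * Real.log (2 / (N * R))) := by
    have h3 : (2 / ((N : ℂ) * (R : ℂ))) = Complex.exp (Real.log (2 / (N * R))) := by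
      rw [← Complex.ofReal_exp, Real.exp_log hpos]; push_cast; rfl
    rw [h3, ← Complex.exp_nat_mul, Nat.cast_sub (by omega)]
    push_cast; rfl
  rw [logAmplitude_selection f h N u θ _ he S, hlog, saddleScale, h1, h2, ← Complex.exp_add,
    ← Complex.exp_add, ← Complex.exp_add, ← Complex.exp_add, ← Complex.exp_add]
  congr 1
  push_cast
  ring

theorem integral_gauss_selection (S : Finset (Fin (2 * e))) :
    ∫ x : Fin (2 * e) → ℝ, (∏ i, Real.exp (-(x i) ^ 2)) *
        typedVandermonde (4 / ((2 * e : ℕ) : ℝ)) (selection S) x =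
      mehtaIntegral S.card (2 * e) * mehtaIntegral (2 * e - S.card) (2 * e) := by
  have h1 : Fintype.card {i // selection S i = true} = S.card := by
    simp [selection]
  refine integral_gauss_typedVandermonde (2 * e) (selection S) h1 ?_
  rw [Fintype.card_subtype_compl, h1, Fintype.card_fin]

/-- The linear terms for `k` and `-k` form the cosine, and the factor `2^{-k²/e}` of the Mehta
integrals turns `(2/(NR))^{k²/e}` into `(NR)^{-k²/e}`. -/
theorem oscillatoryTerm_eq (hu : IsSaddlePair f h u R θ) (he : 0 < e) (hN : N ≠ 0) (k : ℕ) :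
    (((2 : ℝ) ^ (-((k : ℝ) ^ 2 / e)) * ∏ j ∈ Finset.Icc 1 k,
        Real.Gamma (1 + j / e) / Real.Gamma (1 + ((j : ℝ) - k) / e) : ℝ) : ℂ) *
      (Complex.exp ((k : ℂ) ^ 2 * (1 / e * Real.log (2 / (N * R)) +
        Complex.I * ((θ true + θ false) / e) - 2 / e * Complex.log (u true - u false))) *
      (Complex.exp ((k : ℂ) * (N * phaseN f h N (u true) - N * phaseN f h N (u false) +
        Complex.I * ((3 - 1 / e) * (θ true - θ false)))) +
      Complex.exp (-(k : ℂ) * (N * phaseN f h N (u true) - N * phaseN f h N (u false) +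
        Complex.I * ((3 - 1 / e) * (θ true - θ false)))))) =
      2 * oscillatoryTerm (2 * e) N R (u false) (u true) (phaseN f h N (u false))
        (phaseN f h N (u true)) (θ false) (θ true) k := by
  have hR := hu.R_pos
  have hNp : (0 : ℝ) < N := by exact_mod_cast Nat.pos_of_ne_zero hN
  have hep : (0 : ℝ) < e := by exact_mod_cast he
  have hec : (e : ℂ) ≠ 0 := by exact_mod_cast he.ne'
  have hΔ : u true - u false ≠ 0 := Complex.slitPlane_ne_zero hu.sub_mem
  have h1 : ∏ j ∈ Finset.Icc 1 k, Real.Gamma (1 + 2 * (j : ℝ) / ((2 * e : ℕ) : ℝ)) /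
      Real.Gamma (1 + 2 * ((j : ℝ) - (k : ℝ)) / ((2 * e : ℕ) : ℝ)) =
      ∏ j ∈ Finset.Icc 1 k, Real.Gamma (1 + j / e) / Real.Gamma (1 + ((j : ℝ) - k) / e) := by
    refine Finset.prod_congr rfl fun j _ => ?_
    push_cast
    rw [mul_div_mul_left _ _ two_ne_zero, mul_div_mul_left _ _ two_ne_zero]
  have h2 : Complex.cos (-Complex.I * (k : ℂ) * (N : ℂ) *
      (phaseN f h N (u true) - phaseN f h N (u false)) +
      (k : ℂ) * ((θ true : ℂ) - (θ false : ℂ)) * (3 - 2 / ((2 * e : ℕ) : ℂ))) =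
      (Complex.exp ((k : ℂ) * (N * phaseN f h N (u true) - N * phaseN f h N (u false) +
        Complex.I * ((3 - 1 / e) * (θ true - θ false)))) +
      Complex.exp (-(k : ℂ) * (N * phaseN f h N (u true) - N * phaseN f h N (u false) +
        Complex.I * ((3 - 1 / e) * (θ true - θ false))))) / 2 := by
    have h3 : (2 : ℂ) / ((2 * e : ℕ) : ℂ) = 1 / e := by push_cast; field_simp
    rw [Complex.cos, h3]
    congr 3
    · linear_combination (-(k : ℂ) * N * (phaseN f h N (u true) - phaseN f h N (u false))) *
        Complex.I_mul_I
    · linear_combination ((k : ℂ) * N * (phaseN f h N (u true) - phaseN f h N (u false))) *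
        Complex.I_mul_I
  have h4 : (((2 : ℝ) ^ (-((k : ℝ) ^ 2 / e)) : ℝ) : ℂ) *
      Complex.exp ((k : ℂ) ^ 2 * (1 / e * Real.log (2 / (N * R)) +
        Complex.I * ((θ true + θ false) / e) - 2 / e * Complex.log (u true - u false))) =
      Complex.exp (Complex.I * (2 * (k : ℂ) ^ 2 * ((θ true : ℂ) + (θ false : ℂ)) /
        ((2 * e : ℕ) : ℂ))) / ((u true - u false) ^ (4 * (k : ℂ) ^ 2 / ((2 * e : ℕ) : ℂ)) *
        ((((N : ℝ) * R) ^ (2 * (k : ℝ) ^ 2 / ((2 * e : ℕ) : ℝ)) : ℝ) : ℂ)) := by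
    rw [Complex.cpow_def_of_ne_zero hΔ, Real.rpow_def_of_pos two_pos,
      Real.rpow_def_of_pos (by positivity), Complex.ofReal_exp, Complex.ofReal_exp,
      ← Complex.exp_add, ← Complex.exp_add, ← Complex.exp_sub,
      Real.log_div two_ne_zero (by positivity)]
    congr 1
    push_cast
    field_simp
    ring
  rw [oscillatoryTerm, h1, h2, ← h4]
  push_cast
  ring

/-- The summand depends only on `|S|`. The sizes are grouped as `e` and the pairs `e ± k`; at this
stage the sum over `k` still runs up to `e`. -/
theorem sum_selection_eq (hu : IsSaddlePair f h u R θ) (he : 0 < e) (hN : N ≠ 0) :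
    ∑ S : Finset (Fin (2 * e)), Complex.exp (logAmplitude f h N u θ (4 / ((2 * e : ℕ) : ℝ))
        (Real.sqrt (2 / (N * R))) (selection S)) *
        ((∫ x : Fin (2 * e) → ℝ, (∏ i, Real.exp (-(x i) ^ 2)) *
          typedVandermonde (4 / ((2 * e : ℕ) : ℝ)) (selection S) x : ℝ) : ℂ) =
      bulkPrefactor (2 * e) N R (u false) (u true) (phaseN f h N (u false)) (phaseN f h N (u true))
        (θ false) (θ true) * (1 + 2 * ∑ k ∈ Finset.Icc 1 e, oscillatoryTerm (2 * e) N R (u false)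
          (u true) (phaseN f h N (u false)) (phaseN f h N (u true)) (θ false) (θ true) k) := by
  set G : ℂ := 1 / e * Real.log (2 / (N * R)) +
        Complex.I * ((θ true + θ false) / e) - 2 / e * Complex.log (u true - u false) with hG
  set X : ℂ := N * phaseN f h N (u true) - N * phaseN f h N (u false) +
        Complex.I * ((3 - 1 / e) * (θ true - θ false)) with hX
  set B := saddleScale e N R (u false) (u true) (phaseN f h N (u false)) (phaseN f h N (u true))
        (θ false) (θ true) with hB
  set F : ℕ → ℂ := fun n => B * (Complex.exp ((n - e : ℂ) ^ 2 * G) * Complex.exp ((n - e : ℂ) * X)) *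
    ((mehtaIntegral n (2 * e) * mehtaIntegral (2 * e - n) (2 * e) : ℝ) : ℂ) with hF
  have h1 : ∀ S : Finset (Fin (2 * e)),
      Complex.exp (logAmplitude f h N u θ (4 / ((2 * e : ℕ) : ℝ))
        (Real.sqrt (2 / (N * R))) (selection S)) *
        ((∫ x : Fin (2 * e) → ℝ, (∏ i, Real.exp (-(x i) ^ 2)) *
          typedVandermonde (4 / ((2 * e : ℕ) : ℝ)) (selection S) x : ℝ) : ℂ) = F S.card := fun S => by
    rw [exp_logAmplitude hu he hN, integral_gauss_selection]
  rw [Finset.sum_congr rfl fun S _ => h1 S, ← Finset.powerset_univ, Finset.sum_powerset_apply_card,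
    Finset.card_univ, Fintype.card_fin, sum_range_two_mul_succ, bulkPrefactor_eq, ← hB, mul_add,
    mul_one]
  congr 1
  · simp only [hF, sub_self, nsmul_eq_mul, show 2 * e - e = e by omega]
    simp
    ring
  · rw [← mul_assoc, mul_comm _ (2 : ℂ), mul_assoc, mul_left_comm, Finset.mul_sum, Finset.mul_sum]
    refine Finset.sum_congr rfl fun k hk => ?_
    have hke := (Finset.mem_Icc.1 hk).2
    rw [← oscillatoryTerm_eq hu he hN k, ← hG, ← hX]
    have h2 : (2 * e).choose (e - k) = (2 * e).choose (e + k) := by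
      rw [← Nat.choose_symm (by omega : e - k ≤ 2 * e)]
      congr 1
      omega
    have h3 : 2 * e - (e + k) = e - k := by omega
    have h4 : 2 * e - (e - k) = e + k := by omega
    have h5 : ((e + k : ℕ) : ℂ) - e = k := by push_cast; ring
    have h6 : ((e - k : ℕ) : ℂ) - e = -k := by rw [Nat.cast_sub hke]; ring
    have h7 := congrArg (fun x : ℝ => (x : ℂ)) (choose_mul_mehtaIntegral_eq he hke)
    simp only [hF, nsmul_eq_mul, h2, h3, h4, h5, h6, neg_sq]
    push_cast at h7 ⊢
    linear_combination (B * Complex.exp ((k : ℂ) ^ 2 * G) * (Complex.exp (k * X) +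
      Complex.exp (-k * X))) * h7

end Expansion

/-! ### Error terms relative to the prefactor. -/

section ExpansionBounds

variable {f h : ℂ → ℂ} {u : Bool → ℂ} {θ : Bool → ℝ} {R m : ℝ} {e N : ℕ}

theorem re_mul_phaseN (hN : N ≠ 0) (z : ℂ) :
    ((N : ℂ) * phaseN f h N z).re = N * (f z).re + (h z).re := by
  rw [mul_phaseN hN, Complex.add_re, ← Complex.ofReal_natCast, Complex.re_ofReal_mul]

theorem norm_saddleScale (hN : N ≠ 0) (hR : 0 < R) (hm : ∀ b, (f (u b)).re = m) :
    ‖saddleScale e N R (u false) (u true) (phaseN f h N (u false)) (phaseN f h N (u true))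
        (θ false) (θ true)‖ =
      ‖u true - u false‖ ^ (2 * e) * (2 / (N * R)) ^ (2 * e - 1) * (Real.exp m ^ (2 * e * N) *
        Real.exp (e * ((h (u true)).re + (h (u false)).re))) := by
  have h1 : ((2 * e : ℕ) : ℂ) * (N : ℂ) * (phaseN f h N (u true) + phaseN f h N (u false)) / 2 =
      ((e : ℝ) : ℂ) * (N * phaseN f h N (u true) + N * phaseN f h N (u false)) := by
    push_cast; ring
  have h2 : Complex.I * (((2 * e : ℕ) : ℂ) - 1) * ((θ true : ℂ) + (θ false : ℂ)) =
      Complex.I * (((2 * e - 1) * (θ true + θ false) : ℝ) : ℂ) := by push_cast; ring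
  rw [saddleScale, h1, h2, norm_mul, norm_mul, norm_mul, norm_exp_I_mul, mul_one, Complex.norm_exp,
    Complex.re_ofReal_mul, Complex.add_re, re_mul_phaseN hN, re_mul_phaseN hN, hm, hm, norm_pow,
    norm_pow, norm_div, norm_mul, Complex.norm_real, Complex.norm_natCast, Complex.norm_ofNat,
    Real.norm_of_nonneg hR.le, ← Real.exp_nat_mul, ← Real.exp_add]
  congr 2
  push_cast
  ring

theorem saddleScale_ne_zero (hu : IsSaddlePair f h u R θ) (hN : N ≠ 0) (fm fp : ℂ) :
    saddleScale e N R (u false) (u true) fm fp (θ false) (θ true) ≠ 0 := by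
  have hR : (R : ℂ) ≠ 0 := by exact_mod_cast hu.R_pos.ne'
  have hNc : (N : ℂ) ≠ 0 := by exact_mod_cast hN
  have hΔ : u true - u false ≠ 0 := Complex.slitPlane_ne_zero hu.sub_mem
  have := Complex.exp_ne_zero
  rw [saddleScale]
  refine mul_ne_zero (mul_ne_zero (mul_ne_zero (pow_ne_zero _ hΔ) (pow_ne_zero _ ?_)) (this _))
    (this _)
  exact div_ne_zero two_ne_zero (mul_ne_zero hNc hR)

/-- Once `2 / (N R) ≤ 1`, the `N`-dependence of the quadratic term only decreases the modulus. In
the linear term equal heights leave only `Re h(u₊) - Re h(u₋)`, which does not depend on `N`. -/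
theorem exists_norm_exp_logAmplitude_le (hu : IsSaddlePair f h u R θ) (he : 0 < e)
    (hm : ∀ b, (f (u b)).re = m) :
    ∃ K : ℝ, 0 ≤ K ∧ ∀ N : ℕ, N ≠ 0 → 2 / R ≤ N → ∀ S : Finset (Fin (2 * e)),
      ‖Complex.exp (logAmplitude f h N u θ (4 / ((2 * e : ℕ) : ℝ)) (Real.sqrt (2 / (N * R)))
        (selection S))‖ ≤ K * ‖saddleScale e N R (u false) (u true) (phaseN f h N (u false))
          (phaseN f h N (u true)) (θ false) (θ true)‖ := by
  have hR := hu.R_pos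
  have hep : (0 : ℝ) < e := by exact_mod_cast he
  set L := |2 / (e : ℝ) * Real.log ‖u true - u false‖| with hL
  set η := |(h (u true)).re - (h (u false)).re| with hη
  refine ⟨Real.exp ((e : ℝ) ^ 2 * L) * Real.exp (e * η), by positivity, fun N hN hNR S => ?_⟩
  have hNp : (0 : ℝ) < N := by exact_mod_cast Nat.pos_of_ne_zero hN
  rw [exp_logAmplitude hu he hN, norm_mul, mul_comm]
  gcongr
  set x : ℝ := S.card - e with hx
  have hxe : |x| ≤ e := by
    have h1 : (S.card : ℝ) ≤ 2 * e := by
      have := Finset.card_le_univ S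
      rw [Fintype.card_fin] at this
      exact_mod_cast this
    rw [abs_le]
    constructor
    · have : (0 : ℝ) ≤ S.card := Nat.cast_nonneg _
      linarith
    · linarith
  have hxc : ((S.card : ℂ) - e) = (x : ℂ) := by rw [hx]; push_cast; rfl
  rw [hxc, norm_mul, Complex.norm_exp, Complex.norm_exp, ← Complex.ofReal_pow,
    Complex.re_ofReal_mul, Complex.re_ofReal_mul]
  have hlog : Real.log (2 / (N * R)) ≤ 0 := by
    refine Real.log_nonpos (by positivity) ?_
    rw [div_le_one (by positivity)]
    rwa [div_le_iff₀ hR] at hNR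
  have h1 : (1 / (e : ℂ) * Real.log (2 / (N * R)) + Complex.I * ((θ true + θ false) / e) -
      2 / e * Complex.log (u true - u false)).re =
      1 / e * Real.log (2 / (N * R)) - 2 / e * Real.log ‖u true - u false‖ := by
    have h2 : (1 / (e : ℂ) * Real.log (2 / (N * R)) + Complex.I * ((θ true + θ false) / e) -
      2 / e * Complex.log (u true - u false)) = ((1 / e * Real.log (2 / (N * R)) : ℝ) : ℂ) +
      (((θ true + θ false) / e : ℝ) : ℂ) * Complex.I -
        ((2 / e : ℝ) : ℂ) * Complex.log (u true - u false) := by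
      push_cast; ring
    rw [h2, Complex.sub_re, Complex.add_re, Complex.ofReal_re, Complex.re_ofReal_mul,
      Complex.re_ofReal_mul, Complex.log_re, Complex.I_re]
    ring
  have h3 : (N * phaseN f h N (u true) - N * phaseN f h N (u false) +
      Complex.I * ((3 - 1 / e) * (θ true - θ false))).re = (h (u true)).re - (h (u false)).re := by
    have h4 : Complex.I * ((3 - 1 / e) * (θ true - θ false)) =
        (((3 - 1 / e) * (θ true - θ false) : ℝ) : ℂ) * Complex.I := by push_cast; ring
    rw [h4, Complex.add_re, Complex.sub_re, re_mul_phaseN hN, re_mul_phaseN hN,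
      Complex.re_ofReal_mul, Complex.I_re, hm, hm]
    ring
  rw [h1, h3]
  refine mul_le_mul (Real.exp_le_exp.2 ?_) (Real.exp_le_exp.2 ?_) (Real.exp_pos _).le
    (Real.exp_pos _).le
  · have h5 : -(2 / (e : ℝ) * Real.log ‖u true - u false‖) ≤ L := neg_le_abs _
    have h6 : x ^ 2 ≤ (e : ℝ) ^ 2 := by rw [← sq_abs x]; gcongr
    have h7 : 1 / (e : ℝ) * Real.log (2 / (N * R)) ≤ 0 :=
      mul_nonpos_of_nonneg_of_nonpos (by positivity) hlog
    calc x ^ 2 * (1 / e * Real.log (2 / (N * R)) - 2 / e * Real.log ‖u true - u false‖)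
        ≤ x ^ 2 * L := by gcongr; linarith
      _ ≤ (e : ℝ) ^ 2 * L := by gcongr
  · calc x * ((h (u true)).re - (h (u false)).re) ≤ |x| * η := by
          rw [hη, ← abs_mul]; exact le_abs_self _
      _ ≤ e * η := by gcongr

/-- The term carries `(N R)^{-k²/e}` with `k²/e ≥ 1`, and the imaginary part of the argument of the
cosine is bounded, again by equal heights. This is the reason for the range of the truncated sum. -/
theorem exists_norm_oscillatoryTerm_le (hR : 0 < R) (he : 0 < e)
    (hm : ∀ b, (f (u b)).re = m) (k : ℕ) (hk : e ≤ k ^ 2) :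
    ∃ K : ℝ, 0 ≤ K ∧ ∀ N : ℕ, N ≠ 0 →
      ‖oscillatoryTerm (2 * e) N R (u false) (u true) (phaseN f h N (u false))
        (phaseN f h N (u true)) (θ false) (θ true) k‖ ≤ K / N := by
  have hep : (0 : ℝ) < e := by exact_mod_cast he
  set η := |(h (u true)).re - (h (u false)).re| with hη
  set A := ∏ j ∈ Finset.Icc 1 k, Real.Gamma (1 + 2 * (j : ℝ) / ((2 * e : ℕ) : ℝ)) /
      Real.Gamma (1 + 2 * ((j : ℝ) - (k : ℝ)) / ((2 * e : ℕ) : ℝ)) with hA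
  set D := (u true - u false) ^ (4 * (k : ℂ) ^ 2 / ((2 * e : ℕ) : ℂ)) with hD
  set s : ℝ := 2 * (k : ℝ) ^ 2 / ((2 * e : ℕ) : ℝ) with hs
  have hs1 : 1 ≤ s := by
    rw [hs]; push_cast
    rw [mul_div_mul_left _ _ two_ne_zero, one_le_div hep]
    exact_mod_cast hk
  refine ⟨‖(A : ℂ)‖ * (1 / (‖D‖ * R ^ s)) * Real.exp (k * η), by positivity, fun N hN => ?_⟩
  have hNp : (0 : ℝ) < N := by exact_mod_cast Nat.pos_of_ne_zero hN
  have hN1 : (1 : ℝ) ≤ N := by exact_mod_cast Nat.pos_of_ne_zero hN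
  have h1 : Complex.I * (2 * (k : ℂ) ^ 2 * ((θ true : ℂ) + (θ false : ℂ)) / ((2 * e : ℕ) : ℂ)) =
      Complex.I * ((2 * (k : ℝ) ^ 2 * (θ true + θ false) / ((2 * e : ℕ) : ℝ) : ℝ) : ℂ) := by
    push_cast; rfl
  have h2 : |(-Complex.I * (k : ℂ) * (N : ℂ) * (phaseN f h N (u true) - phaseN f h N (u false)) +
      (k : ℂ) * ((θ true : ℂ) - (θ false : ℂ)) * (3 - 2 / ((2 * e : ℕ) : ℂ))).im| = k * η := by
    have h3 : -Complex.I * (k : ℂ) * (N : ℂ) * (phaseN f h N (u true) - phaseN f h N (u false)) +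
      (k : ℂ) * ((θ true : ℂ) - (θ false : ℂ)) * (3 - 2 / ((2 * e : ℕ) : ℂ)) =
      ((-(k : ℝ) : ℝ) : ℂ) * (Complex.I * (N * phaseN f h N (u true) - N * phaseN f h N (u false))) +
      (((k : ℝ) * (θ true - θ false) * (3 - 2 / ((2 * e : ℕ) : ℝ)) : ℝ) : ℂ) := by
      push_cast; ring
    rw [h3, Complex.add_im, Complex.ofReal_im, Complex.im_ofReal_mul, Complex.I_mul_im,
      Complex.sub_re, re_mul_phaseN hN, re_mul_phaseN hN, hm, hm, add_zero, abs_mul, abs_neg,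
      Nat.abs_cast, hη]
    congr 2
    ring
  have h3 : (N : ℝ) * R ^ s ≤ (N * R) ^ s := by
    rw [Real.mul_rpow hNp.le hR.le]
    gcongr
    calc (N : ℝ) = (N : ℝ) ^ (1 : ℝ) := (Real.rpow_one _).symm
      _ ≤ (N : ℝ) ^ s := Real.rpow_le_rpow_of_exponent_le hN1 hs1
  have hRs : 0 < R ^ s := Real.rpow_pos_of_pos hR s
  have hD0 : 0 ≤ ‖D‖ := norm_nonneg _
  rw [oscillatoryTerm, ← hA, ← hD, h1, norm_mul, norm_mul, norm_div, norm_mul, norm_exp_I_mul,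
    Complex.norm_real ((_ : ℝ) ^ _), Real.norm_of_nonneg (by positivity)]
  refine (mul_le_mul_of_nonneg_left (norm_cos_le_exp _) (by positivity)).trans ?_
  rw [h2, show ‖(A : ℂ)‖ * (1 / (‖D‖ * R ^ s)) * Real.exp (k * η) / N =
    ‖(A : ℂ)‖ * (1 / (‖D‖ * R ^ s * N)) * Real.exp (k * η) by field_simp]
  refine mul_le_mul_of_nonneg_right ?_ (Real.exp_pos _).le
  refine mul_le_mul_of_nonneg_left ?_ (norm_nonneg _)
  rcases eq_or_lt_of_le hD0 with h4 | h4
  · rw [← h4]; simp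
  · refine one_div_le_one_div_of_le (by positivity) ?_
    calc ‖D‖ * R ^ s * N = ‖D‖ * (N * R ^ s) := by ring
      _ ≤ ‖D‖ * (N * R) ^ s := by gcongr

/-- Up to the common factor `e^{2emN}`, `saddleScale` decays only like `N^{-(2e-1)}`; a geometric
factor is smaller than this times `1 / N`. -/
theorem exists_tail_le (hu : IsSaddlePair f h u R θ) (he : 0 < e) (hm : ∀ b, (f (u b)).re = m)
    {C q : ℝ} (hC : 0 ≤ C) (hq0 : 0 ≤ q) (hq1 : q < 1) (N₁ : ℕ) :
    ∃ K : ℝ, 0 ≤ K ∧ ∀ᶠ N : ℕ in atTop,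
      C * q ^ (N - N₁) * (Real.exp m) ^ (2 * e * (N - N₁)) ≤ K / N *
        ‖saddleScale e N R (u false) (u true) (phaseN f h N (u false)) (phaseN f h N (u true))
        (θ false) (θ true)‖ := by
  have hR := hu.R_pos
  have hΔ : 0 < ‖u true - u false‖ := norm_pos_iff.2 (Complex.slitPlane_ne_zero hu.sub_mem)
  -- `q` may be zero; a positive `p` allows dividing by `p ^ N₁`.
  set p := max q (1 / 2) with hp
  have hp0 : 0 < p := lt_max_of_lt_right (by norm_num)
  have hp1 : p < 1 := max_lt hq1 (by norm_num)
  set Q := ‖u true - u false‖ ^ (2 * e) * (2 / R) ^ (2 * e - 1) *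
    Real.exp (e * ((h (u true)).re + (h (u false)).re)) with hQ
  have hQ0 : 0 < Q := by positivity
  set M := C * (p ^ N₁)⁻¹ * ((Real.exp m) ^ (2 * e * N₁))⁻¹ with hM
  refine ⟨M / Q, by positivity, ?_⟩
  have h1 := (tendsto_pow_const_mul_const_pow_of_lt_one (2 * e) hp0.le hp1).eventually
    (gt_mem_nhds one_pos)
  filter_upwards [h1, eventually_ge_atTop (max N₁ 1)] with N hN1 hN
  have hN0 : N ≠ 0 := by have := le_of_max_le_right hN; omega
  have hNp : (0 : ℝ) < N := by exact_mod_cast Nat.pos_of_ne_zero hN0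
  obtain ⟨j, rfl⟩ := Nat.exists_eq_add_of_le (le_of_max_le_left hN)
  rw [norm_saddleScale hN0 hR hm, Nat.add_sub_cancel_left]
  have h2 : q ^ j ≤ p ^ j := by gcongr; exact le_max_left _ _
  have h3 : p ^ j ≤ (p ^ N₁)⁻¹ * (((N₁ + j : ℕ) : ℝ) ^ (2 * e))⁻¹ := by
    rw [← mul_inv, ← one_div, le_div_iff₀ (by positivity)]
    calc p ^ j * (p ^ N₁ * ((N₁ + j : ℕ) : ℝ) ^ (2 * e)) = ((N₁ + j : ℕ) : ℝ) ^ (2 * e) * p ^ (N₁ + j) := by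
          rw [pow_add]; ring
      _ ≤ 1 := hN1.le
  have h4 : (Real.exp m) ^ (2 * e * (N₁ + j)) = (Real.exp m) ^ (2 * e * N₁) * (Real.exp m) ^ (2 * e * j) := by
    rw [← pow_add, ← mul_add]
  have h5 : (2 / (((N₁ + j : ℕ) : ℝ) * R)) ^ (2 * e - 1) =
      (2 / R) ^ (2 * e - 1) * (((N₁ + j : ℕ) : ℝ) * (((N₁ + j : ℕ) : ℝ) ^ (2 * e))⁻¹) := by
    rw [mul_comm _ R, ← div_div, div_pow]
    have : ((N₁ + j : ℕ) : ℝ) ^ (2 * e) = ((N₁ + j : ℕ) : ℝ) ^ (2 * e - 1) * ((N₁ + j : ℕ) : ℝ) := by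
      rw [← pow_succ]; congr 1; omega
    rw [this]
    field_simp
  rw [h5, h4]
  calc C * q ^ j * Real.exp m ^ (2 * e * j)
      ≤ C * ((p ^ N₁)⁻¹ * (((N₁ + j : ℕ) : ℝ) ^ (2 * e))⁻¹) * Real.exp m ^ (2 * e * j) := by
        gcongr; exact h2.trans h3
    _ = _ := by rw [hM, hQ]; field_simp

/-- The prefactor is nonzero, so `ε` can be defined by division. Its three parts are the relative
error of the local integrals, the tail, and the terms with `k² ≥ e` that the truncated sum omits. -/
theorem exists_expansion (hu : IsSaddlePair f h u R θ) (he : 0 < e) (hm : ∀ b, (f (u b)).re = m)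
    {I : ℕ → ℂ} {C q : ℝ} {N₁ : ℕ} (hC : 0 ≤ C) (hq0 : 0 ≤ q) (hq1 : q < 1)
    (hI : ∀ᶠ N : ℕ in atTop,
      ‖I N - ∑ S : Finset (Fin (2 * e)), Complex.exp (logAmplitude f h N u θ (4 / ((2 * e : ℕ) : ℝ))
        (Real.sqrt (2 / (N * R))) (selection S)) *
        ((∫ x : Fin (2 * e) → ℝ, (∏ i, Real.exp (-(x i) ^ 2)) *
          typedVandermonde (4 / ((2 * e : ℕ) : ℝ)) (selection S) x : ℝ) : ℂ)‖ ≤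
      C / N * ∑ S : Finset (Fin (2 * e)), ‖Complex.exp (logAmplitude f h N u θ
        (4 / ((2 * e : ℕ) : ℝ)) (Real.sqrt (2 / (N * R))) (selection S))‖ +
        C * q ^ (N - N₁) * (Real.exp m) ^ (2 * e * (N - N₁))) :
    ∃ ε : ℕ → ℂ, ε =O[atTop] (fun N : ℕ => 1 / (N : ℝ)) ∧ ∀ᶠ N : ℕ in atTop,
      I N = bulkPrefactor (2 * e) N R (u false) (u true) (phaseN f h N (u false))
          (phaseN f h N (u true)) (θ false) (θ true) *
        (oscillatoryFactor (2 * e) N R (u false) (u true) (phaseN f h N (u false))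
          (phaseN f h N (u true)) (θ false) (θ true) + ε N) := by
  have hR := hu.R_pos
  obtain ⟨K₁, hK₁, H₁⟩ := exists_norm_exp_logAmplitude_le hu he hm
  obtain ⟨K₂, hK₂, H₂⟩ := exists_tail_le hu he hm hC hq0 hq1 N₁
  -- For `β = 2e` this is the integer part of `√e`, so `k > k₀` implies `k² ≥ e`.
  set k₀ := ⌊Real.sqrt (((2 * e : ℕ) : ℝ) / 2)⌋₊ with hk₀
  have hk₀e : k₀ ≤ e := by
    refine Nat.floor_le_of_le ?_
    rw [Real.sqrt_le_iff]
    push_cast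
    refine ⟨by positivity, ?_⟩
    have : (1 : ℝ) ≤ e := by exact_mod_cast he
    nlinarith
  have hks : ∀ k, k₀ < k → e ≤ k ^ 2 := fun k hk => by
    have h1 := (Nat.floor_lt (Real.sqrt_nonneg _)).1 hk
    rw [Real.sqrt_lt' (lt_of_le_of_lt (Real.sqrt_nonneg _) h1)] at h1
    push_cast at h1
    rw [mul_div_cancel_left₀ _ two_ne_zero] at h1
    exact_mod_cast h1.le
  choose! K₃ hK₃ H₃ using fun (k : ℕ) (hk : e ≤ k ^ 2) =>
    exists_norm_oscillatoryTerm_le (f := f) (h := h) (u := u) (θ := θ) hR he hm k hk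
  set pref : ℕ → ℂ := fun N => bulkPrefactor (2 * e) N R (u false) (u true)
    (phaseN f h N (u false)) (phaseN f h N (u true)) (θ false) (θ true) with hpref
  set osc : ℕ → ℂ := fun N => oscillatoryFactor (2 * e) N R (u false) (u true)
    (phaseN f h N (u false)) (phaseN f h N (u true)) (θ false) (θ true) with hosc
  set B : ℕ → ℂ := fun N => saddleScale e N R (u false) (u true)
    (phaseN f h N (u false)) (phaseN f h N (u true)) (θ false) (θ true) with hB
  set K₀ : ℝ := (2 * e).choose e * mehtaIntegral e (2 * e) ^ 2 with hK₀
  have hK₀pos : 0 < K₀ := by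
    have h1 := mehtaIntegral_pos e he
    have h2 : (0 : ℝ) < (2 * e).choose e := by exact_mod_cast Nat.choose_pos (by omega)
    positivity
  have hprefB : ∀ N, pref N = (K₀ : ℂ) * B N := fun N => bulkPrefactor_eq e N R _ _ _ _ _ _
  have hB0 : ∀ N : ℕ, N ≠ 0 → B N ≠ 0 := fun N hN => saddleScale_ne_zero hu hN _ _
  have hpref0 : ∀ N : ℕ, N ≠ 0 → pref N ≠ 0 := fun N hN => by
    rw [hprefB]
    exact mul_ne_zero (by exact_mod_cast hK₀pos.ne') (hB0 N hN)
  set Sd := Finset.Icc 1 e \ Finset.Icc 1 k₀ with hSd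
  have hSdk : ∀ k ∈ Sd, e ≤ k ^ 2 := fun k hk => by
    rw [hSd, Finset.mem_sdiff, Finset.mem_Icc, Finset.mem_Icc] at hk
    exact hks k (by omega)
  set K := (C * ((Fintype.card (Finset (Fin (2 * e)))) * K₁) + K₂) / K₀ + 2 * ∑ k ∈ Sd, K₃ k with hK
  refine ⟨fun N => I N / pref N - osc N, ?_, ?_⟩
  · refine IsBigO.of_bound K ?_
    filter_upwards [hI, H₂, eventually_ge_atTop 1, eventually_ge_atTop ⌈2 / R⌉₊]
      with N hIN h2N hN1 hNR
    have hN0 : N ≠ 0 := by omega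
    have hNp : (0 : ℝ) < N := by exact_mod_cast hN1
    rw [sum_selection_eq hu he hN0] at hIN
    have h1 : ∑ S : Finset (Fin (2 * e)), ‖Complex.exp (logAmplitude f h N u θ
        (4 / ((2 * e : ℕ) : ℝ)) (Real.sqrt (2 / (N * R))) (selection S))‖ ≤
        (Fintype.card (Finset (Fin (2 * e)))) * K₁ * ‖B N‖ := by
      refine (Finset.sum_le_sum fun S _ => H₁ N hN0 (Nat.ceil_le.1 hNR) S).trans ?_
      rw [Finset.sum_const, Finset.card_univ, nsmul_eq_mul, mul_assoc]
    have hsd : ∑ k ∈ Finset.Icc 1 e, oscillatoryTerm (2 * e) N R (u false)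
          (u true) (phaseN f h N (u false)) (phaseN f h N (u true)) (θ false) (θ true) k =
        ∑ k ∈ Sd, oscillatoryTerm (2 * e) N R (u false)
          (u true) (phaseN f h N (u false)) (phaseN f h N (u true)) (θ false) (θ true) k +
        ∑ k ∈ Finset.Icc 1 k₀, oscillatoryTerm (2 * e) N R (u false)
          (u true) (phaseN f h N (u false)) (phaseN f h N (u true)) (θ false) (θ true) k :=
      (Finset.sum_sdiff (Finset.Icc_subset_Icc_right hk₀e)).symm
    have hsdle : ‖∑ k ∈ Sd, oscillatoryTerm (2 * e) N R (u false)
          (u true) (phaseN f h N (u false)) (phaseN f h N (u true)) (θ false) (θ true) k‖ ≤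
        (∑ k ∈ Sd, K₃ k) / N := by
      rw [Finset.sum_div]
      exact norm_sum_le_of_le _ fun k hk => H₃ k (hSdk k hk) N hN0
    set T := ∑ k ∈ Sd, oscillatoryTerm (2 * e) N R (u false)
          (u true) (phaseN f h N (u false)) (phaseN f h N (u true)) (θ false) (θ true) k with hT
    have hoscN : 1 + 2 * ∑ k ∈ Finset.Icc 1 e, oscillatoryTerm (2 * e) N R (u false)
          (u true) (phaseN f h N (u false)) (phaseN f h N (u true)) (θ false) (θ true) k =
        osc N + 2 * T := by
      rw [hsd]
      simp only [hosc, oscillatoryFactor_eq]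
      ring
    rw [hoscN] at hIN
    have hpN := hpref0 N hN0
    have h3 : I N / pref N - osc N = (I N - pref N * (osc N + 2 * T)) / pref N + 2 * T := by
      field_simp; ring
    have hBN : 0 < ‖B N‖ := norm_pos_iff.2 (hB0 N hN0)
    have hpn : ‖pref N‖ = K₀ * ‖B N‖ := by
      rw [hprefB, norm_mul, Complex.norm_real, Real.norm_of_nonneg hK₀pos.le]
    rw [h3, Real.norm_of_nonneg (by positivity)]
    refine (norm_add_le _ _).trans ?_
    rw [norm_div, norm_mul, Complex.norm_ofNat, hpn]
    have h4 : ‖I N - pref N * (osc N + 2 * T)‖ ≤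
        (C * ((Fintype.card (Finset (Fin (2 * e)))) * K₁) + K₂) / N * ‖B N‖ := by
      refine hIN.trans ((add_le_add (mul_le_mul_of_nonneg_left h1 (by positivity)) h2N).trans ?_)
      exact le_of_eq (by ring)
    calc _ ≤ (C * ((Fintype.card (Finset (Fin (2 * e)))) * K₁) + K₂) / N * ‖B N‖ / (K₀ * ‖B N‖) +
          2 * ((∑ k ∈ Sd, K₃ k) / N) := by gcongr
      _ = K * (1 / N) := by rw [hK]; field_simp
  · filter_upwards [eventually_ge_atTop 1] with N hN1
    have hpN := hpref0 N (by omega)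
    change I N = pref N * (osc N + (I N / pref N - osc N))
    field_simp
    ring

end ExpansionBounds

/-! ### Descent contours that are straight at the saddle points. -/

section StraightContour

/-- A deformation of the real line that avoids `P`, whose homotopy avoids `A`, and along which
`Re f` has its maxima `m` exactly at two saddle points, which it passes in straight segments. -/
structure IsStraightContour (f : ℂ → ℂ) (P A : Set ℂ) (γ : ℝ → ℂ) (u : Bool → ℂ)
    (θ τ c : Bool → ℝ) (r T m : ℝ) : Prop where
  contDiff : ContDiff ℝ 1 γ
  nonneg : 0 ≤ T
  eq_ofReal : ∀ t : ℝ, T ≤ |t| → γ t = t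
  sub_mem : ∀ s t : ℝ, s < t → γ t - γ s ∈ Complex.slitPlane
  avoids : ∀ t : ℝ, γ t ∉ P
  deformation : ∀ s ∈ Set.Icc (0 : ℝ) 1, ∀ t : ℝ, lineHomotopy γ s t ∉ A
  straight : IsStraightAt γ u θ τ c r
  re_eq : ∀ b, (f (u b)).re = m
  re_lt : ∀ t : ℝ, (∀ b, t ≠ τ b) → (f (γ t)).re < m
  at_infinity : ∃ c < m, ∀ t : ℝ, T ≤ |t| → (f (γ t)).re ≤ c

variable {f h : ℂ → ℂ} {P A : Set ℂ} {γ : ℝ → ℂ} {u : Bool → ℂ} {θ τ c : Bool → ℝ} {R r T m : ℝ}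

theorem IsStraightContour.re_le (hγ : IsStraightContour f P A γ u θ τ c r T m) (t : ℝ) :
    (f (γ t)).re ≤ m := by
  by_cases ht : ∀ b, t ≠ τ b
  · exact (hγ.re_lt t ht).le
  · push Not at ht
    obtain ⟨b, rfl⟩ := ht
    rw [hγ.straight.eq b _ (by simpa using hγ.straight.r_pos.le)]
    simp [hγ.re_eq]

/-- A maximum over a compact set for bounded parameters, and the separate bound near infinity. Only
`e^f` is known to be continuous along the contour, so the gap is stated for `|e^f|`. -/
theorem IsStraightContour.exists_gap (hγ : IsStraightContour f P A γ u θ τ c r T m)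
    (hf : ∀ z ∉ P, AnalyticAt ℂ (fun z => Complex.exp (f z)) z) {δ : ℝ} (hδ : 0 < δ) :
    ∃ q, 0 ≤ q ∧ q < 1 ∧ ∀ t, (∀ b, δ < |t - τ b|) →
      ‖Complex.exp (f (γ t))‖ ≤ q * Real.exp m := by
  obtain ⟨c₁, hc₁, hinf⟩ := hγ.at_infinity
  have hcont : Continuous fun t => ‖Complex.exp (f (γ t))‖ := by
    refine Continuous.norm (continuous_iff_continuousAt.2 fun t => ?_)
    exact (hf _ (hγ.avoids t)).continuousAt.comp hγ.contDiff.continuous.continuousAt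
  set K : Set ℝ := Set.Icc (-T) T ∩ {t | ∀ b, δ ≤ |t - τ b|} with hK
  have hKc : IsCompact K := by
    refine isCompact_Icc.inter_right ?_
    rw [Set.ofPred_forall]
    exact isClosed_iInter fun b => isClosed_le continuous_const (by fun_prop)
  have hlt : ∀ t ∈ K, ‖Complex.exp (f (γ t))‖ < Real.exp m := fun t ht => by
    rw [Complex.norm_exp, Real.exp_lt_exp]
    refine hγ.re_lt t fun b hb => ?_
    have := ht.2 b
    rw [hb, sub_self, abs_zero] at this
    linarith
  have hq₁ : ∃ q, 0 ≤ q ∧ q < 1 ∧ ∀ t ∈ K, ‖Complex.exp (f (γ t))‖ ≤ q * Real.exp m := by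
    rcases K.eq_empty_or_nonempty with h0 | h0
    · exact ⟨0, le_rfl, one_pos, by simp [h0]⟩
    · obtain ⟨t₀, ht₀, hmax⟩ := hKc.exists_isMaxOn h0 hcont.continuousOn
      refine ⟨‖Complex.exp (f (γ t₀))‖ / Real.exp m, by positivity,
        (div_lt_one (Real.exp_pos m)).2 (hlt t₀ ht₀), fun t ht => ?_⟩
      rw [div_mul_cancel₀ _ (Real.exp_pos m).ne']
      exact hmax ht
  obtain ⟨q₁, hq0, hq1, hq⟩ := hq₁
  refine ⟨max q₁ (Real.exp (c₁ - m)), le_max_of_le_left hq0,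
    max_lt hq1 (Real.exp_lt_one_iff.2 (by linarith)), fun t ht => ?_⟩
  rcases le_or_gt T |t| with h | h
  · calc ‖Complex.exp (f (γ t))‖ ≤ Real.exp (c₁ - m) * Real.exp m := by
          rw [← Real.exp_add, Complex.norm_exp, Real.exp_le_exp, sub_add_cancel]
          exact hinf t h
      _ ≤ _ := by gcongr; exact le_max_right _ _
  · refine (hq t ⟨abs_le.1 h.le, fun b => (ht b).le⟩).trans ?_
    gcongr
    exact le_max_left _ _

theorem exists_pos_ball_disjoint {X : Type*} [TopologicalSpace X] {K : Set X} (hK : IsCompact K)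
    {Φ : X → ℂ} (hΦ : Continuous Φ) {A : Set ℂ} (hA : A.Finite) (h : ∀ x ∈ K, Φ x ∉ A) :
    ∃ δ > 0, ∀ x ∈ K, ∀ w, ‖w - Φ x‖ < δ → w ∉ A := by
  obtain ⟨δ, hδ, hd⟩ := (hK.image hΦ).exists_thickening_subset_open hA.isClosed.isOpen_compl (by
    rintro _ ⟨x, hx, rfl⟩
    exact h x hx)
  refine ⟨δ, hδ, fun x hx w hw => hd ?_⟩
  exact Metric.ball_subset_thickening (Set.mem_image_of_mem Φ hx) _ (mem_ball_iff_norm.2 hw)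

theorem exists_norm_sub_affine_le {γ : ℝ → ℂ} {t₀ : ℝ} (hγ : DifferentiableAt ℝ γ t₀) {η : ℝ}
    (hη : 0 < η) : ∃ ρ > 0, ∀ t : ℝ, |t - t₀| ≤ ρ →
      ‖γ t - (γ t₀ + deriv γ t₀ * ((t - t₀ : ℝ) : ℂ))‖ ≤ η * |t - t₀| := by
  have h1 := hγ.hasDerivAt.isLittleO.def hη
  obtain ⟨ρ, hρ, h2⟩ := Metric.eventually_nhds_iff.1 h1
  refine ⟨ρ / 2, by positivity, fun t ht => ?_⟩
  have h3 := h2 (show dist t t₀ < ρ by rw [Real.dist_eq]; linarith)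
  rw [Real.norm_eq_abs] at h3
  convert! h3 using 2
  rw [Complex.real_smul]
  ring

/-- The contour is straightened at one saddle and then at the other. Being uniformly close, the new
curve still avoids `P` and its homotopy still avoids `A`; being tangentially close, it still
descends on both sides of each saddle by `IsSimpleSaddle.exists_descent`. -/
theorem IsDescentContour.exists_straightContour {um up : ℂ} {φm φp θm θp : ℝ}
    (hγ : IsDescentContour f h P um up θm θp γ) (hP : P.Finite) (hm : IsSimpleSaddle f um R φm θm)
    (hp : IsSimpleSaddle f up R φp θp)
    (hA : ∀ p ∈ A, p ∈ P ∧
      ∀ s ∈ Set.Icc (0 : ℝ) 1, ∀ t : ℝ, (1 - (s : ℂ)) * (t : ℂ) + (s : ℂ) * γ t ≠ p) :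
    ∃ (γ' : ℝ → ℂ) (τ c : Bool → ℝ) (r T : ℝ), IsStraightContour f P A γ'
      (fun b => if b then up else um) (fun b => if b then θp else θm) τ c r T (f up).re := by
  obtain ⟨tm, tp, htmp, hum, hup, hdm, hdp, ⟨cm, hcm, hcmd⟩, ⟨cp, hcp, hcpd⟩, hlt⟩ := hγ.passes
  obtain ⟨c₁, hc₁, hinf⟩ := hγ.at_infinity
  obtain ⟨T₀, hT₀⟩ : ∃ T₀ : ℝ, ∀ t : ℝ, T₀ ≤ |t| → γ t = t ∧ (f (t : ℂ)).re ≤ c₁ := by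
    obtain ⟨T₀, h0⟩ := (hasBasis_cobounded_norm.eventually_iff).1
      (by rwa [← Metric.cobounded_eq_cocompact] at hinf)
    exact ⟨T₀, fun t ht => h0.2 ht⟩
  have hγd : Differentiable ℝ γ := hγ.contDiff.differentiable one_ne_zero
  have hγc : Continuous γ := hγ.contDiff.continuous
  set T := |T₀| + |tm| + |tp| + 1 with hT
  have hT0 : 0 ≤ T := by positivity
  have hTT : T₀ ≤ T := by linarith [le_abs_self T₀, abs_nonneg tm, abs_nonneg tp]
  have hfar : ∀ t, T ≤ |t| → 1 ≤ |t - tm| ∧ 1 ≤ |t - tp| := fun t ht => by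
    constructor
    · linarith [abs_sub_abs_le_abs_sub t tm, abs_nonneg T₀, abs_nonneg tp]
    · linarith [abs_sub_abs_le_abs_sub t tp, abs_nonneg T₀, abs_nonneg tm]
  have hAfin : A.Finite := hP.subset fun p hp => (hA p hp).1
  obtain ⟨δ₁, hδ₁, H₁⟩ := exists_pos_ball_disjoint (isCompact_Icc (a := -T) (b := T)) hγc hP
    fun t _ => hγ.avoids t
  obtain ⟨δ₂, hδ₂, H₂⟩ := exists_pos_ball_disjoint
    ((isCompact_Icc (a := (0 : ℝ)) (b := 1)).prod (isCompact_Icc (a := -T) (b := T)))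
    (Φ := fun p : ℝ × ℝ => lineHomotopy γ p.1 p.2) (by unfold lineHomotopy; fun_prop) hAfin
    fun p hp hpA => (hA _ hpA).2 p.1 hp.1 p.2 (by unfold lineHomotopy; ring)
  obtain ⟨ρm, hρm, Hm⟩ := hm.exists_descent hcm
  obtain ⟨ρp, hρp, Hp⟩ := hp.exists_descent hcp
  obtain ⟨am, ham, Am⟩ := exists_norm_sub_affine_le (hγd tm) (half_pos hρm)
  obtain ⟨ap, hap, Ap⟩ := exists_norm_sub_affine_le (hγd tp) (half_pos hρp)
  -- The entries `1` and `(tp - tm) / 4` keep the two modifications apart and away from infinity,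
  -- `δ₁` and `δ₂` protect the avoided sets, and the rest guarantee descent: half of `ρm` or `ρp`
  -- goes to the modification and half to the deviation of `γ` from its tangent.
  set ρ := min (min (min 1 ((tp - tm) / 4)) (min (δ₁ / 2) (δ₂ / 2)))
    (min (min (ρm / 2) (ρp / 2)) (min am ap)) with hρdef
  have htt : 0 < tp - tm := by linarith
  have hρ : 0 < ρ := by positivity
  have e1 : ρ ≤ 1 := (min_le_left _ _).trans ((min_le_left _ _).trans (min_le_left _ _))
  have e2 : ρ ≤ (tp - tm) / 4 := (min_le_left _ _).trans ((min_le_left _ _).trans (min_le_right _ _))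
  have e3 : ρ ≤ δ₁ / 2 := (min_le_left _ _).trans ((min_le_right _ _).trans (min_le_left _ _))
  have e4 : ρ ≤ δ₂ / 2 := (min_le_left _ _).trans ((min_le_right _ _).trans (min_le_right _ _))
  have e5 : ρ ≤ ρm / 2 := (min_le_right _ _).trans ((min_le_left _ _).trans (min_le_left _ _))
  have e6 : ρ ≤ ρp / 2 := (min_le_right _ _).trans ((min_le_left _ _).trans (min_le_right _ _))
  have e7 : ρ ≤ am := (min_le_right _ _).trans ((min_le_right _ _).trans (min_le_left _ _))
  have e8 : ρ ≤ ap := (min_le_right _ _).trans ((min_le_right _ _).trans (min_le_right _ _))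
  obtain ⟨γ₁, r₁, hr₁, hγ₁, hoff₁, haff₁, hsub₁, hdist₁⟩ := exists_straighten hγ.contDiff hT0
    (fun t ht => (hT₀ t (hTT.trans ht)).1) hγ.sub_mem hdm hρ
  have hnear_tp : ∀ t, |t - tp| ≤ (tp - tm) / 2 → ρ ≤ |t - tm| := fun t ht => by
    have h1 := (abs_le.1 ht).1
    have h2 := le_abs_self (t - tm)
    linarith
  -- The first modification does not reach `tp`, so the second one sees the original value and
  -- tangent there.
  have hγ₁tp : γ₁ =ᶠ[nhds tp] γ := by
    filter_upwards [Metric.ball_mem_nhds tp (half_pos htt)] with t ht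
    rw [Metric.mem_ball, Real.dist_eq] at ht
    exact hoff₁ t (hnear_tp t ht.le)
  obtain ⟨γ₂, r₂, hr₂, hγ₂, hoff₂, haff₂, hsub₂, hdist₂⟩ := exists_straighten hγ₁ hT0
    (fun t ht => by rw [hoff₁ t (e1.trans (hfar t ht).1), (hT₀ t (hTT.trans ht)).1]) hsub₁
    (by rw [hγ₁tp.deriv_eq]; exact hdp) hρ
  rw [hγ₁tp.deriv_eq, hγ₁tp.eq_of_nhds] at haff₂
  have hcases : ∀ t, (|t - tm| ≤ ρ ∧ ‖γ₂ t - γ t‖ ≤ ρ * |t - tm|) ∨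
      (|t - tp| ≤ ρ ∧ ‖γ₂ t - γ t‖ ≤ ρ * |t - tp|) ∨ (ρ < |t - tm| ∧ ρ < |t - tp| ∧ γ₂ t = γ t) := by
    intro t
    rcases le_or_gt |t - tp| ρ with h1 | h1
    · right; left
      refine ⟨h1, ?_⟩
      rw [← hoff₁ t (hnear_tp t (by linarith))]
      exact hdist₂ t
    · rw [hoff₂ t h1.le]
      rcases le_or_gt |t - tm| ρ with h2 | h2
      · exact Or.inl ⟨h2, hdist₁ t⟩
      · exact Or.inr (Or.inr ⟨h2, h1, hoff₁ t h2.le⟩)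
  have hclose : ∀ t, ‖γ₂ t - γ t‖ ≤ ρ := fun t => by
    rcases hcases t with ⟨h1, h2⟩ | ⟨h1, h2⟩ | ⟨_, _, h2⟩
    · nlinarith
    · nlinarith
    · rw [h2, sub_self, norm_zero]; exact hρ.le
  have heq₂ : ∀ t, T ≤ |t| → γ₂ t = t := fun t ht => by
    rw [hoff₂ t (e1.trans (hfar t ht).2), hoff₁ t (e1.trans (hfar t ht).1),
      (hT₀ t (hTT.trans ht)).1]
  set r := min (min r₁ r₂) ((tp - tm) / 4) with hr
  have hr0 : 0 < r := by positivity
  refine ⟨γ₂, fun b => if b then tp else tm, fun b => if b then cp else cm, r, T,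
    hγ₂, hT0, heq₂, hsub₂, fun t => ?_, fun s hs t hmem => ?_, ⟨hr0, fun b => ?_, ?_, fun b t ht => ?_⟩,
    fun b => ?_, fun t ht => ?_, ⟨c₁, hc₁, fun t ht => ?_⟩⟩
  · rcases le_or_gt T |t| with h1 | h1
    · rw [heq₂ t h1, ← (hT₀ t (hTT.trans h1)).1]
      exact hγ.avoids t
    · exact H₁ t (abs_le.1 h1.le) _ ((hclose t).trans_lt (by linarith))
  · rcases le_or_gt T |t| with h1 | h1
    · refine (hA _ hmem).2 s hs t ?_
      rw [lineHomotopy, heq₂ t h1, (hT₀ t (hTT.trans h1)).1]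
      ring
    · refine H₂ (s, t) ⟨hs, abs_le.1 h1.le⟩ _ ?_ hmem
      have : lineHomotopy γ₂ s t - lineHomotopy γ s t = s * (γ₂ t - γ t) := by
        unfold lineHomotopy; ring
      rw [this, norm_mul, Complex.norm_real, Real.norm_of_nonneg hs.1]
      nlinarith [hclose t, hs.2, norm_nonneg (γ₂ t - γ t), hs.1]
  · cases b <;> simpa
  · have : r ≤ (tp - tm) / 4 := min_le_right _ _
    simp only [if_true, Bool.false_eq_true, if_false]
    linarith
  · have hr1 : r ≤ r₁ := (min_le_left _ _).trans (min_le_left _ _)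
    have hr2 : r ≤ r₂ := (min_le_left _ _).trans (min_le_right _ _)
    have hr3 : r ≤ (tp - tm) / 4 := min_le_right _ _
    cases b
    · simp only [Bool.false_eq_true, if_false] at ht ⊢
      rw [hoff₂ t, haff₁ t (ht.trans hr1), hum, hcmd]
      have h1 := (abs_le.1 ht).2
      have h2 := neg_le_abs (t - tp)
      linarith
    · simp only [if_true] at ht ⊢
      rw [haff₂ t (ht.trans hr2), hup, hcpd]
  · cases b
    · exact hγ.same_height
    · rfl
  · have htm : t ≠ tm := ht false
    have htp : t ≠ tp := ht true
    rcases hcases t with ⟨h1, h2⟩ | ⟨h1, h2⟩ | ⟨h1, h2, h3⟩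
    · rw [← hγ.same_height]
      refine Hm (t - tm) _ (sub_ne_zero.2 htm) (by linarith) ?_
      have h3 := Am t (h1.trans e7)
      rw [hum, hcmd] at h3
      have h4 : γ₂ t - (um + cm * Complex.exp (Complex.I * θm) * ((t - tm : ℝ) : ℂ)) =
        (γ₂ t - γ t) + (γ t - (um + cm * Complex.exp (Complex.I * θm) * ((t - tm : ℝ) : ℂ))) := by
        ring
      rw [h4]
      refine (norm_add_le _ _).trans ((add_le_add h2 h3).trans ?_)
      nlinarith [abs_nonneg (t - tm)]
    · refine Hp (t - tp) _ (sub_ne_zero.2 htp) (by linarith) ?_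
      have h3 := Ap t (h1.trans e8)
      rw [hup, hcpd] at h3
      have h4 : γ₂ t - (up + cp * Complex.exp (Complex.I * θp) * ((t - tp : ℝ) : ℂ)) =
        (γ₂ t - γ t) + (γ t - (up + cp * Complex.exp (Complex.I * θp) * ((t - tp : ℝ) : ℂ))) := by
        ring
      rw [h4]
      refine (norm_add_le _ _).trans ((add_le_add h2 h3).trans ?_)
      nlinarith [abs_nonneg (t - tp)]
    · rw [h3]
      exact hlt t htm htp
  · rw [heq₂ t ht]
    exact (hT₀ t (hTT.trans ht)).2

end StraightContour

/-! ### Filling in removable singularities. -/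

section RemovableExtension

/-- `g`, with its values on `P` replaced by its limits. -/
noncomputable def removableExtension (P : Set ℂ) (g : ℂ → ℂ) (z : ℂ) : ℂ :=
  open Classical in if z ∈ P then limUnder (nhdsWithin z {z}ᶜ) g else g z

variable {P : Set ℂ} {g : ℂ → ℂ} {z : ℂ}

theorem removableExtension_of_notMem (hz : z ∉ P) : removableExtension P g z = g z := if_neg hz

theorem removableExtension_of_mem (hz : z ∈ P) :
    removableExtension P g z = limUnder (nhdsWithin z {z}ᶜ) g := if_pos hz

/-- Riemann's removable singularity theorem. Finiteness of `P` isolates `z` from the other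
exceptional points. -/
theorem analyticAt_removableExtension (hP : P.Finite) (hg : ∀ w ∉ P, AnalyticAt ℂ g w)
    (hz : z ∈ P → g =O[nhdsWithin z {z}ᶜ] fun _ => (1 : ℝ)) :
    AnalyticAt ℂ (removableExtension P g) z := by
  have hs : (P \ {z})ᶜ ∈ nhds z := (hP.subset Set.sdiff_subset).isClosed.isOpen_compl.mem_nhds
    (by simp)
  by_cases hzP : z ∈ P
  · have ho : (fun w => g w - g z) =o[nhdsWithin z {z}ᶜ] fun w => (w - z)⁻¹ := by
      refine IsBoundedUnder.isLittleO_sub_self_inv ?_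
      exact (isBigO_one_iff ℝ).1 ((hz hzP).sub (isBigO_const_const (g z) one_ne_zero _))
    have hd := Complex.differentiableOn_update_limUnder_of_isLittleO hs (fun w hw =>
      (hg w fun hwP => hw.1 ⟨hwP, hw.2⟩).differentiableAt.differentiableWithinAt) ho
    refine (hd.analyticAt hs).congr ?_
    filter_upwards [hs] with w hw
    by_cases hwz : w = z
    · subst hwz
      rw [Function.update_self, removableExtension_of_mem hzP]
    · rw [Function.update_of_ne hwz, removableExtension_of_notMem fun hwP => hw ⟨hwP, hwz⟩]
  · refine (hg z hzP).congr ?_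
    filter_upwards [hs, hP.isClosed.isOpen_compl.mem_nhds hzP] with w _ hw
    rw [removableExtension_of_notMem hw]

/-- `P` meets the real line in a finite set, so the changed values are invisible to the integral. -/
theorem prod_removableExtension_ae_eq (hP : P.Finite) (g : ℂ → ℂ) (d : ℕ) :
    ∀ᵐ t : Fin d → ℝ, ∏ j, removableExtension P g (t j) = ∏ j, g (t j) := by
  have h1 : ∀ᵐ x : ℝ, (x : ℂ) ∉ P := by
    have : ((fun x : ℝ => (x : ℂ)) ⁻¹' P).Finite :=
      hP.preimage Complex.ofReal_injective.injOn
    exact measure_eq_zero_iff_ae_notMem.1 (this.measure_zero volume)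
  have h2 : ∀ᵐ t : Fin d → ℝ, ∀ j, ((t j : ℝ) : ℂ) ∉ P := ae_all_iff.2 fun j =>
    (Measure.quasiMeasurePreserving_eval (fun _ : Fin d => (volume : Measure ℝ)) j).ae h1
  filter_upwards [h2] with t ht
  exact Finset.prod_congr rfl fun j _ => removableExtension_of_notMem (ht j)

end RemovableExtension

/-! ### From the multiple integral to a one-dimensional one. -/

section RealSection

theorem absVandermondePow_cons {n : ℕ} (κ x : ℝ) (y : Fin n → ℝ) :
    absVandermondePow κ (Fin.cons x y : Fin (n + 1) → ℝ) =
      (∏ j, |x - y j| ^ κ) * absVandermondePow κ y := by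
  unfold absVandermondePow
  rw [Fin.prod_univ_succ, Fin.prod_Ioi_zero]
  simp [Fin.prod_Ioi_succ]

/-- If the integral over `ℝ^(n+1)` with the Vandermonde weight converges, then so does the one
dimensional integral of the density, at infinity, with the growth of that weight. -/
theorem exists_integrableOn_of_integrable_prod {n : ℕ} {κ : ℝ} (hκ : 0 ≤ κ) {G : ℝ → ℂ}
    (hG : ∀ t, G t ≠ 0)
    (hF : Integrable fun t : Fin (n + 1) → ℝ => (∏ j, G (t j)) * (absVandermondePow κ t : ℂ)) :
    ∃ T : ℝ, IntegrableOn (fun x => ‖G x‖ * ((1 + |x|) ^ κ) ^ n) {x | T ≤ |x|} := by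
  have hmp := (volume_preserving_piFinSuccAbove (fun _ : Fin (n + 1) => ℝ) 0).symm
  have h1 := (hmp.integrable_comp_emb
    (MeasurableEquiv.piFinSuccAbove (fun _ : Fin (n + 1) => ℝ) 0).symm.measurableEmbedding).2 hF
  have h2 := Integrable.prod_left_ae (μ := (volume : Measure ℝ))
    (ν := (volume : Measure (Fin n → ℝ))) h1
  -- Almost every section is integrable, so one can be chosen in this open box. Its coordinates lie
  -- in disjoint intervals, so their own Vandermonde factor is nonzero and can be divided out.
  set B : Set (Fin n → ℝ) := Set.pi Set.univ fun j => Set.Ioo ((j : ℕ) : ℝ) ((j : ℕ) + 1) with hB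
  have hBo : IsOpen B := isOpen_set_pi Set.finite_univ fun _ _ => isOpen_Ioo
  have hBn : B.Nonempty := Set.univ_pi_nonempty_iff.2 fun j => Set.nonempty_Ioo.2 (by linarith)
  obtain ⟨y, hyB, hy⟩ := (Measure.dense_of_ae h2).inter_open_nonempty B hBo hBn
  have hlt : ∀ i j, i < j → y i < y j := fun i j hij => by
    have h1 := (hyB i trivial).2
    have h2 := (hyB j trivial).1
    have h3 : ((i : ℕ) : ℝ) + 1 ≤ (j : ℕ) := by exact_mod_cast hij
    linarith
  have hV : absVandermondePow κ y ≠ 0 := by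
    refine Finset.prod_ne_zero_iff.2 fun i _ => Finset.prod_ne_zero_iff.2 fun j hj => ?_
    have := hlt i j (Finset.mem_Ioi.1 hj)
    exact (Real.rpow_pos_of_pos (abs_pos.2 (by linarith)) κ).ne'
  set K : ℂ := (∏ j, G (y j)) * (absVandermondePow κ y : ℂ) with hK
  have hK0 : K ≠ 0 := mul_ne_zero (Finset.prod_ne_zero_iff.2 fun _ _ => hG _)
    (by exact_mod_cast hV)
  set W : ℝ → ℝ := fun x => ∏ j, |x - y j| ^ κ with hW
  have h3 : Integrable fun x => ‖G x‖ * W x := by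
    refine ((hy.norm).const_mul ‖K‖⁻¹).congr (ae_of_all _ fun x => ?_)
    have hW0 : 0 ≤ W x := Finset.prod_nonneg fun _ _ => Real.rpow_nonneg (abs_nonneg _) _
    have h4 : (MeasurableEquiv.piFinSuccAbove (fun _ : Fin (n + 1) => ℝ) 0).symm (x, y) =
        (Fin.cons x y : Fin (n + 1) → ℝ) := by
      rw [MeasurableEquiv.piFinSuccAbove_symm_apply]
      simp [Fin.insertNthEquiv]
    simp only [Function.comp_apply, h4, Fin.prod_univ_succ, Fin.cons_zero, Fin.cons_succ,
      absVandermondePow_cons]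
    have h5 : G x * (∏ j, G (y j)) * (((∏ j, |x - y j| ^ κ) * absVandermondePow κ y : ℝ) : ℂ) =
        K * (G x * (W x : ℂ)) := by
      rw [Complex.ofReal_mul, hK, hW]
      ring
    rw [h5, norm_mul K, inv_mul_cancel_left₀ (norm_ne_zero_iff.2 hK0), norm_mul, Complex.norm_real,
      Real.norm_of_nonneg hW0]
  -- Beyond `T` every `|x - y_j|` is comparable with `1 + |x|`, which recovers the polynomial
  -- weight.
  set T : ℝ := 2 * ∑ j, |y j| + 1 with hT
  have hS : MeasurableSet {x : ℝ | T ≤ |x|} := measurableSet_le measurable_const (by fun_prop)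
  have hmeasW : Measurable W := by fun_prop
  have hyT : ∀ x, T ≤ |x| → ∀ j, (1 + |x|) / 4 ≤ |x - y j| := fun x hx j => by
    have h1 : |y j| ≤ ∑ j, |y j| :=
      Finset.single_le_sum (f := fun j => |y j|) (fun _ _ => abs_nonneg _) (Finset.mem_univ j)
    have h2 := abs_sub_abs_le_abs_sub x (y j)
    have h3 := abs_nonneg (y j)
    linarith
  refine ⟨T, ?_⟩
  have h6 : IntegrableOn (fun x => (((1 + |x|) ^ κ) ^ n / W x) * (‖G x‖ * W x))
      {x | T ≤ |x|} := by
    refine Integrable.bdd_mul (c := (4 ^ κ) ^ n) h3.integrableOn (by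
      refine Measurable.aestronglyMeasurable ?_
      fun_prop) ?_
    filter_upwards [ae_restrict_mem hS] with x hx
    have hpos : ∀ j, 0 < |x - y j| := fun j =>
      lt_of_lt_of_le (by positivity) (hyT x hx j)
    have hW0 : 0 < W x := Finset.prod_pos fun j _ => Real.rpow_pos_of_pos (hpos j) _
    rw [Real.norm_of_nonneg (by positivity), div_le_iff₀ hW0]
    calc ((1 + |x|) ^ κ) ^ n = ∏ _j : Fin n, (1 + |x|) ^ κ := by simp
      _ ≤ ∏ j : Fin n, (4 ^ κ * |x - y j| ^ κ) := by
          refine Finset.prod_le_prod (fun _ _ => by positivity) fun j _ => ?_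
          rw [← Real.mul_rpow (by norm_num) (abs_nonneg _)]
          exact Real.rpow_le_rpow (by positivity) (by linarith [hyT x hx j]) hκ
      _ = (4 ^ κ) ^ n * W x := by simp [hW, Finset.prod_mul_distrib]
  refine IntegrableOn.congr_fun h6 (fun x hx => ?_) hS
  have hW0 : W x ≠ 0 := Finset.prod_ne_zero_iff.2 fun j _ =>
    (Real.rpow_pos_of_pos (lt_of_lt_of_le (by positivity) (hyT x hx j)) _).ne'
  field_simp

end RealSection

/-! ### The extended weight on the contour and on the real line. -/

section ExtendedWeight

/-- The weight `exp (N f_N)`, extended through its removable singularities. -/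
noncomputable def extendedWeight (f h : ℂ → ℂ) (P : Set ℂ) (N : ℕ) : ℂ → ℂ :=
  removableExtension P fun z => Complex.exp (N * phaseN f h N z)

variable {f h : ℂ → ℂ} {P A : Set ℂ} {γ : ℝ → ℂ} {u : Bool → ℂ} {θ τ c : Bool → ℝ} {R r T m : ℝ}

theorem exp_mul_phaseN_eq_pow_mul {N M : ℕ} (hM : M ≠ 0) (h : M ≤ N) (f₁ h₁ : ℂ → ℂ) (z : ℂ) :
    Complex.exp (N * phaseN f₁ h₁ N z) =
      Complex.exp (f₁ z) ^ (N - M) * Complex.exp (M * phaseN f₁ h₁ M z) := by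
  rw [mul_phaseN (by lia), mul_phaseN hM, ← Complex.exp_nat_mul, ← Complex.exp_add,
    Nat.cast_sub h]
  ring_nf

theorem IsAnalyticOff.analyticAt_exp_mul_phaseN (hP : IsAnalyticOff f h P) {N : ℕ} (hN : N ≠ 0)
    {z : ℂ} (hz : z ∉ P) : AnalyticAt ℂ (fun z => Complex.exp (N * phaseN f h N z)) z := by
  refine (((hP.exp_f z hz).fun_pow N).fun_mul (hP.exp_h z hz)).congr (Eventually.of_forall fun w => ?_)
  simp only
  rw [mul_phaseN hN, ← Complex.exp_nat_mul, ← Complex.exp_add]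

theorem extendedWeight_of_notMem {N : ℕ} {z : ℂ} (hz : z ∉ P) :
    extendedWeight f h P N z = Complex.exp (N * phaseN f h N z) := removableExtension_of_notMem hz

/-- Outside `A` the singularities are removable for all large `N`, simultaneously because `P` is
finite; the homotopy never meets `A`. -/
theorem IsAnalyticOff.eventually_isDeformation (hP : IsAnalyticOff f h P)
    (hγ : IsStraightContour f P A γ u θ τ c r T m)
    (hA : ∀ p ∈ P, p ∉ A → ∀ᶠ N : ℕ in atTop,
      (fun z => Complex.exp ((N : ℂ) * phaseN f h N z)) =O[nhdsWithin p {p}ᶜ] fun _ => (1 : ℝ)) :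
    ∀ᶠ N : ℕ in atTop, IsDeformation (extendedWeight f h P N) γ T := by
  have h1 : ∀ᶠ N : ℕ in atTop, ∀ p ∈ P, p ∉ A →
      (fun z => Complex.exp ((N : ℂ) * phaseN f h N z)) =O[nhdsWithin p {p}ᶜ] fun _ => (1 : ℝ) := by
    refine (eventually_all_finite hP.finite).2 fun p hp => ?_
    by_cases hpA : p ∈ A
    · exact Eventually.of_forall fun N h => absurd hpA h
    · filter_upwards [hA p hp hpA] with N hN _ using hN
  filter_upwards [h1, eventually_ge_atTop 1] with N hN hN1
  refine ⟨hγ.contDiff, hγ.nonneg, hγ.eq_ofReal, hγ.sub_mem, fun s hs t => ?_⟩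
  exact analyticAt_removableExtension hP.finite
    (fun w hw => hP.analyticAt_exp_mul_phaseN (by lia) hw)
    fun hz => hN _ hz (hγ.deformation s hs t)

theorem IsDeformation.continuous_ofReal {g : ℂ → ℂ} (hg : IsDeformation g γ T) :
    Continuous fun t : ℝ => g t := by
  refine continuous_iff_continuousAt.2 fun t => ?_
  have h1 := (hg.analyticAt 0 (by simp) t).continuousAt
  rw [lineHomotopy_zero] at h1
  exact h1.comp (f := fun t : ℝ => (t : ℂ)) Complex.continuous_ofReal.continuousAt

/-- Far out, `e^{N f_N}` is `e^{M f_M}` times a power of `e^f`, which is bounded there; on a compact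
interval the extended weight is continuous. -/
theorem IsStraightContour.integrable_extendedWeight (hγ : IsStraightContour f P A γ u θ τ c r T m)
    {n N M : ℕ} {κ : ℝ} (hκ : 0 ≤ κ) (hM : M ≠ 0) (hMN : M ≤ N)
    (hF : Integrable fun t : Fin (n + 1) → ℝ =>
      (∏ j, Complex.exp (M * phaseN f h M (t j))) * (absVandermondePow κ t : ℂ))
    (hdef : IsDeformation (extendedWeight f h P N) γ T) :
    Integrable fun t : ℝ => ‖extendedWeight f h P N t‖ * ((1 + |t|) ^ κ) ^ n := by
  obtain ⟨T₁, hT₁⟩ := exists_integrableOn_of_integrable_prod hκ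
    (G := fun t => Complex.exp (M * phaseN f h M t)) (fun t => Complex.exp_ne_zero _) hF
  obtain ⟨c₁, hc₁, hinf⟩ := hγ.at_infinity
  have hcont : Continuous fun t : ℝ => ‖extendedWeight f h P N t‖ * ((1 + |t|) ^ κ) ^ n := by
    refine hdef.continuous_ofReal.norm.mul (Continuous.pow ?_ n)
    exact (continuous_const.add continuous_abs).rpow_const fun _ => Or.inr hκ
  set S : Set ℝ := {t | max T T₁ ≤ |t|} with hS
  have hSm : MeasurableSet S := measurableSet_le measurable_const (by fun_prop)
  have hfar : IntegrableOn (fun t : ℝ => ‖extendedWeight f h P N t‖ * ((1 + |t|) ^ κ) ^ n) S := by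
    have hST : S ⊆ {t | T₁ ≤ |t|} := fun t ht => (le_max_right T T₁).trans ht
    refine Integrable.mono' ((hT₁.mono_set hST).const_mul (Real.exp c₁ ^ (N - M))) hcont.aestronglyMeasurable ?_
    filter_upwards [ae_restrict_mem hSm] with t ht
    have htT : T ≤ |t| := (le_max_left _ _).trans ht
    have htP : (t : ℂ) ∉ P := hγ.eq_ofReal t htT ▸ hγ.avoids t
    have hle : ‖Complex.exp (f t)‖ ≤ Real.exp c₁ := by
      rw [Complex.norm_exp, Real.exp_le_exp]
      simpa [hγ.eq_ofReal t htT] using hinf t htT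
    rw [Real.norm_of_nonneg (by positivity), extendedWeight_of_notMem htP,
      exp_mul_phaseN_eq_pow_mul hM hMN, norm_mul, norm_pow, mul_assoc]
    gcongr
  have hnear : IntegrableOn (fun t : ℝ => ‖extendedWeight f h P N t‖ * ((1 + |t|) ^ κ) ^ n) Sᶜ := by
    refine (hcont.integrableOn_Icc (a := -max T T₁) (b := max T T₁)).mono_set fun t ht => ?_
    have h1 : ¬ max T T₁ ≤ |t| := ht
    exact abs_le.1 (not_le.1 h1).le
  rw [← integrableOn_univ, ← Set.union_compl_self S]
  exact hfar.union hnear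

theorem RIntegrand_ae_eq (hP : P.Finite) (f h : ℂ → ℂ) (γ : ℝ → ℂ) (N β : ℕ) :
    contourIntegrand (extendedWeight f h P N) γ (4 / (β : ℝ)) 0 0 =ᵐ[volume] RIntegrand f h N β := by
  filter_upwards [prod_removableExtension_ae_eq hP (fun z => Complex.exp (N * phaseN f h N z)) β]
    with t ht
  rw [contourIntegrand_zero, RIntegrand, extendedWeight, ht]

end ExtendedWeight

/-! ### The theorem. -/

theorem mainTheorem5 (β : ℕ) (hβ : Even β) (hβ0 : 0 < β) :
    -- the asymptotic expansion
    (∀ (f h : ℂ → ℂ) (P : Set ℂ) (um up : ℂ) (R φm φp θm θp : ℝ),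
      IsAnalyticOff f h P →
      (∃ N₀ : ℕ, 1 ≤ N₀ ∧ Integrable (RIntegrand f h N₀ β)) →
      IsSimpleSaddle f um R φm θm →
      IsSimpleSaddle f up R φp θp →
      AnalyticAt ℂ h um →
      AnalyticAt ℂ h up →
      um.re < up.re →
      (∃ γ : ℝ → ℂ, IsDescentContour f h P um up θm θp γ) →
      ∃ ε : ℕ → ℂ, ε =O[atTop] (fun N : ℕ => 1 / (N : ℝ)) ∧
        ∀ᶠ N : ℕ in atTop,
          Integrable (RIntegrand f h N β) ∧
          RIntegral f h N β =
            bulkPrefactor β N R um up (phaseN f h N um) (phaseN f h N up) θm θp *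
              (oscillatoryFactor β N R um up (phaseN f h N um) (phaseN f h N up) θm θp +
                ε N)) ∧
    -- the closed form of the Mehta type integral
    (∀ n : ℕ,
      Integrable (mehtaIntegrand n β) ∧
      mehtaIntegral n β =
        Real.pi ^ ((n : ℝ) / 2) / (2 : ℝ) ^ ((n : ℝ) * ((n : ℝ) - 1) / (β : ℝ)) *
          ∏ j ∈ Finset.Icc 2 n,
            Real.Gamma (1 + 2 * (j : ℝ) / (β : ℝ)) / Real.Gamma (1 + 2 / (β : ℝ))) := by
  obtain ⟨e, rfl⟩ : ∃ e, β = 2 * e := ⟨_, (even_iff_exists_two_mul.1 hβ).choose_spec⟩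
  refine ⟨fun f h P um up R φm φp θm θp hP hF hum hup hhm hhp hre hγ => ?_,
    fun n => ⟨integrable_mehtaIntegrand n (2 * e), mehtaIntegral_eq n hβ0⟩⟩
  have he : 0 < e := by lia
  obtain ⟨M, hM, hFM⟩ := hF
  obtain ⟨γ₀, hγ₀⟩ := hγ
  -- The singularities that persist. The deformation hypothesis keeps the homotopy away from these
  -- only; it may cross the others, which are filled in.
  set A : Set ℂ := {p | p ∈ P ∧ ¬ ∀ᶠ N : ℕ in atTop,
    (fun z => Complex.exp ((N : ℂ) * phaseN f h N z)) =O[nhdsWithin p {p}ᶜ]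
      (fun _ => (1 : ℝ))} with hA
  obtain ⟨γ, τ, c, r, T, hγ⟩ := hγ₀.exists_straightContour (A := A) hP.finite hum hup
    fun p hp => ⟨hp.1, (hγ₀.deformation p hp.1).resolve_left hp.2⟩
  have hu : IsSaddlePair f h (fun b => if b then up else um) R (fun b => if b then θp else θm) :=
    ⟨fun b => by cases b; exacts [⟨φm, hum⟩, ⟨φp, hup⟩], fun b => by cases b <;> simpa, by simpa⟩
  have hdef := hP.eventually_isDeformation hγ fun p hp hpA => by
    by_contra hcon
    exact hpA ⟨hp, hcon⟩
  obtain ⟨N₁, hN₁⟩ := eventually_atTop.1 (hdef.and (eventually_ge_atTop (M + 1)))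
  have hN₁0 : N₁ ≠ 0 := by have := (hN₁ N₁ le_rfl).2; lia
  have hκ : 0 < 4 / (((2 * e : ℕ) : ℝ)) := by positivity
  have hint : ∀ N, N₁ ≤ N → Integrable fun t : ℝ =>
      ‖extendedWeight f h P N t‖ * ((1 + |t|) ^ (4 / (((2 * e : ℕ) : ℝ)))) ^ (2 * e - 1) :=
    fun N hN => by
      obtain ⟨n, hn⟩ : ∃ n, 2 * e = n + 1 := ⟨2 * e - 1, by lia⟩
      refine hγ.integrable_extendedWeight hκ.le (by lia) (by have := (hN₁ N hN).2; lia) ?_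
        (hN₁ N hN).1 (M := M)
      rw [← show 2 * e = 2 * e - 1 + 1 by lia]
      exact hFM
  obtain ⟨C, q, hC, hq0, hq1, hI⟩ := exists_contour_asymptotics (d := 2 * e) hβ0 hu hγ.straight
    hN₁0 (fun N hN => (hN₁ N hN).1) (fun N _ t => extendedWeight_of_notMem (hγ.avoids t)) hint
    (fun t => by rw [Complex.norm_exp, Real.exp_le_exp]; exact hγ.re_le t)
    (fun δ hδ => hγ.exists_gap hP.exp_f hδ)
  obtain ⟨ε, hε, hexp⟩ := exists_expansion hu he hγ.re_eq hC hq0 hq1 hI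
  refine ⟨ε, hε, ?_⟩
  filter_upwards [hexp, eventually_ge_atTop N₁] with N hN hNN
  -- The start `s = 0` of the homotopy, with the extended weight, is the given integrand up to a
  -- null set, so both its integrability and its integral carry over.
  have hae := RIntegrand_ae_eq hP.finite f h γ N (2 * e)
  refine ⟨((hN₁ N hNN).1.integrable_contourIntegrand hκ.le (hint N hNN) (Or.inl rfl)
    (by simp)).congr hae, ?_⟩
  rw [RIntegral, ← integral_congr_ae hae]
  simp only [contourIntegrand_zero]
  rw [(hN₁ N hNN).1.integral_eq_contour hκ (hint N hNN), hN]
  rfl
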